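/- **Setting.** Let $1\le d\le 3$, let $\Omega\subset\mathbb R^d$ be a bounded polygonal/polyhedral domain (open, connected, equal to the interior of its closure, with a closure that is triangulated by the meshes below), and let $T>0$. Write $(\cdot,\cdot)$ and $\|\cdot\|$ for the inner product and norm of $L_2(\Omega)$, and $\|g\|_{L_\infty(L_2)}$ for the norm of $L_\infty(0,T;L_2(\Omega))$. Let $A\in L_\infty(\Omega;\mathbb R^{d\times d})$ be symmetric with $\alpha|v|^2\le A(x)v\cdot v\le\beta|v|^2$ for almost every $x\in\Omega$ and all $v\in\mathbb R^d$, where $0<\alpha\le\beta<\infty$. Put $a(u,v)=\int_\Omega A\nabla u\cdot\nabla v$. Let $f,\dot f\in L_\infty(0,T;L_2(\Omega))$, with $f$ identified with its continuous representative on $[0,T]$. Let $\mathcal T_H$ and $\mathcal T_h$ be conforming triangulations of $\Omega$, $\mathcal T_h$ a refinement of $\mathcal T_H$. Put $H=\max_{K\in\mathcal T_H}\operatorname{diam}K$. Assume shape regularity with parameter $\gamma>0$: $\operatorname{diam}B_K\ge\gamma\operatorname{diam}K$ for every element $K$ of either mesh, where $B_K$ is a largest ball contained in $K$. Let $V_H\subseteq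 V_h$ be the spaces of continuous functions on $\overline\Omega$ that vanish on $\partial\Omega$ and are affine on each element of $\mathcal T_H$, respectively $\mathcal T_h$. Let $\mathcal N$ be the set of interior nodes of $\mathcal T_H$, with hat functions $\varphi_x\in V_H$, $x\in\mathcal N$. Put $\mathfrak I_Hv=\sum_{x\in\mathcal N}\frac{\int_\Omega v\varphi_x}{\int_\Omega\varphi_x}\varphi_x$ and $V^{\mathrm f}=\{v\in V_h:\mathfrak I_Hv=0\}$. For $K\in\mathcal T_H$ let $\omega_0(K)=K$, and for $k\ge1$ let $\omega_k(K)$ be the union of the (closed) elements of $\mathcal T_H$ that meet $\omega_{k-1}(K)$. Let $V^{\mathrm f}(\omega_k(K))=\{w\in V^{\mathrm f}:\operatorname{supp}w\subset\omega_k(K)\}$. For $v\in V_h$ let $R^{\mathrm f}_{K,k}v\in V^{\mathrm f}(\omega_k(K))$ be given by $\int_{\omega_k(K)}A\nabla R^{\mathrm f}_{K,k}v\cdot\nabla w=\int_KA\nabla v\cdot\nabla w$ for all $w\in V^{\mathrm f}(\omega_k(K))$. Put $V^{\mathrm{ms}}_k=\{v-\sum_{K\in\mathcal T_H}R^{\mathrm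 f}_{K,k}v: v\in V_H\}$. Assume moreover, with constants $C_P$, $\nu$ and $c_0$: * the $L_2$-projection $P_H$ onto $V_H$ is $H^1$-stable: $\|\nabla P_Hv\|\le C_P\|\nabla v\|$ for all $v\in V_h$; * for all $K\in\mathcal T_H$ and $k\ge 1$, the patch $\omega_k(K)$ consists of at most $\nu k^d$ elements of $\mathcal T_H$ (this holds, for instance, for quasi-uniform meshes); * $\mathcal T_h$ is sufficiently fine relative to $\mathcal T_H$: $\operatorname{diam}K'\le c_0\operatorname{diam}K$ whenever $K'\in\mathcal T_h$, $K\in\mathcal T_H$ and $K'\subseteq K$. Let $N\ge1$, $\tau=T/N$, $t_n=n\tau$, $f_n=f(t_n)$, $\bar\partial_tU_n=(U_n-U_{n-1})/\tau$. Given $U_0\in V_h$, let $U_n\in V_h$ ($1\le n\le N$) satisfy $$(\bar\partial_tU_n,v)+a(U_n,v)=(f_n,v)\qquad\forall v\in V_h .$$ Let $U^{\mathrm{ms}}_{k,0}$ be the $L_2$-projection of $U_0$ onto $V^{\mathrm{ms}}_k$, and let $U^{\mathrm{ms}}_{k,n}\in V^{\mathrm{ms}}_k$ ($1\le n\le N$)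 satisfy $$(\bar\partial_tU^{\mathrm{ms}}_{k,n},v)+a(U^{\mathrm{ms}}_{k,n},v)=(f_n,v)\qquad\forall v\in V^{\mathrm{ms}}_k .$$ **Theorem 4.1.** There are a constant $c_0>0$ depending only on $d$ and $\gamma$, a constant $0<\mu<1$ depending only on $d$, $\gamma$, $C_P$ and an upper bound $\kappa$ for the contrast $\beta/\alpha$, and a constant $C>0$ depending only on $d,\alpha,\beta,\kappa,\gamma,C_P,\nu,T$ and an upper bound for $\operatorname{diam}\Omega$, such that in the setting above (with this $c_0$), for every $k\ge1$ and all $1\le n\le N$, $$\|U^{\mathrm{ms}}_{k,n}-U_n\|\le C\Big(1+\log\frac{t_n}{\tau}\Big)\big(H+k^{d/2}\mu^k\big)^2\Big(t_n^{-1}\|U_0\|+\|f\|_{L_\infty(L_2)}+\|\dot f\|_{L_\infty(L_2)}\Big).$$ In particular neither $C$ nor $\mu$ depends on the variations of $A$, on $H$, on the fine mesh size, on $\tau$, $N$, $k$, or on the data $U_0$, $f$. -/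

import Mathlib

open MeasureTheory

noncomputable section

namespace LOD

/-- Points of `ℝ^d` with the Euclidean norm. -/
abbrev Pt (d : ℕ) : Type := EuclideanSpace ℝ (Fin d)

/-- A bounded domain (open, connected, nonempty) that is the interior of its closure.
That it is polygonal or polyhedral is expressed by the existence of a triangulation
of it, see `Triangulation`. -/
structure IsBoundedDomain {d : ℕ} (Ω : Set (Pt d)) : Prop where
  isOpen : IsOpen Ω
  isConnected : IsConnected Ω
  isBounded : Bornology.IsBounded Ω
  interior_closure : interior (closure Ω) = Ω

/-! ### Meshes -/

/-- A conforming finite triangulation of `Ω`: a finite simplicial complex whose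
underlying space is the closure of `Ω` and all of whose simplices are faces of
`d`-dimensional ones. -/
structure Triangulation {d : ℕ} (Ω : Set (Pt d)) where
  complex : Geometry.SimplicialComplex ℝ (Pt d)
  finite_faces : complex.faces.Finite
  space_eq : complex.space = closure Ω
  pure : ∀ s ∈ complex.faces, ∃ K ∈ complex.faces, K.card = d + 1 ∧ s ⊆ K

/-- The closed simplex spanned by a finite set of vertices. -/
def hull {d : ℕ} (K : Finset (Pt d)) : Set (Pt d) := convexHull ℝ (K : Set (Pt d))

/-- `diam B_K / diam K`, where `B_K` is a largest ball contained in the simplex `K`. -/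
def shapeRatio {d : ℕ} (K : Finset (Pt d)) : ℝ :=
  sSup {δ : ℝ | ∃ c : Pt d, Metric.closedBall c (δ / 2) ⊆ hull K} / Metric.diam (hull K)

namespace Triangulation

variable {d : ℕ} {Ω : Set (Pt d)}

/-- The elements of the mesh: its `d`-dimensional simplices (given by their vertices). -/
def cells (𝒯 : Triangulation Ω) : Set (Finset (Pt d)) :=
  {K | K ∈ 𝒯.complex.faces ∧ K.card = d + 1}

/-- The largest diameter of an element. -/
def meshSize (𝒯 : Triangulation Ω) : ℝ :=
  sSup ((fun K => Metric.diam (hull K)) '' 𝒯.cells)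

/-- Every element has shape ratio at least `γ`. -/
def ShapeRegular (𝒯 : Triangulation Ω) (γ : ℝ) : Prop :=
  ∀ K ∈ 𝒯.cells, γ ≤ shapeRatio K

/-- `𝒯'` is a refinement of `𝒯`: each element of `𝒯'` lies in an element of `𝒯`. -/
def IsRefinement (𝒯' 𝒯 : Triangulation Ω) : Prop :=
  ∀ K' ∈ 𝒯'.cells, ∃ K ∈ 𝒯.cells, hull K' ⊆ hull K

/-- The elements of `𝒯'` that lie in an element `K` of `𝒯` have diameter at most
`c` times that of `K`. -/
def IsFiner (𝒯' 𝒯 : Triangulation Ω) (c : ℝ) : Prop :=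
  ∀ K ∈ 𝒯.cells, ∀ K' ∈ 𝒯'.cells, hull K' ⊆ hull K →
    Metric.diam (hull K') ≤ c * Metric.diam (hull K)

/-- The element patch `ω_k(K)`. -/
def patch (𝒯 : Triangulation Ω) : ℕ → Finset (Pt d) → Set (Pt d)
  | 0, K => hull K
  | k + 1, K => ⋃ K' ∈ {K' | K' ∈ 𝒯.cells ∧ (hull K' ∩ patch 𝒯 k K).Nonempty}, hull K'

/-- For `k ≥ 1`, a patch `ω_k(K)` consists of at most `ν k^d` elements. -/
def PatchGrowth (𝒯 : Triangulation Ω) (ν : ℝ) : Prop :=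
  ∀ K ∈ 𝒯.cells, ∀ k : ℕ, 1 ≤ k →
    (({K' | K' ∈ 𝒯.cells ∧ hull K' ⊆ 𝒯.patch k K}.ncard : ℕ) : ℝ) ≤ ν * (k : ℝ) ^ d

/-- The continuous functions on the closure of `Ω` that vanish on the boundary and are
affine on each element. They are represented by their extension by zero to `ℝ^d`. -/
def P1 (𝒯 : Triangulation Ω) : Set (Pt d → ℝ) :=
  {v | Continuous v ∧ (∀ x, x ∉ Ω → v x = 0) ∧
    ∀ K ∈ 𝒯.cells, ∃ g : Pt d →ᵃ[ℝ] ℝ, Set.EqOn v g (hull K)}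

/-- The interior nodes of the mesh. -/
def nodes (𝒯 : Triangulation Ω) : Set (Pt d) :=
  {x | x ∈ 𝒯.complex.vertices ∧ x ∈ Ω}

/-- The nodal hat function of the interior node `x`: the (unique) function in `P1` with
value `1` at `x` and `0` at all other vertices. -/
def hat (𝒯 : Triangulation Ω) (x : Pt d) : Pt d → ℝ :=
  Classical.epsilon fun φ : Pt d → ℝ =>
    φ ∈ 𝒯.P1 ∧ φ x = 1 ∧ ∀ y ∈ 𝒯.complex.vertices, y ≠ x → φ y = 0

/-- The weighted Clément interpolation operator. -/
def clement (𝒯 : Triangulation Ω) (v : Pt d → ℝ) : Pt d → ℝ := fun p =>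
  ∑ᶠ x ∈ 𝒯.nodes,
    ((∫ y in Ω, v y * 𝒯.hat x y) / (∫ y in Ω, 𝒯.hat x y)) * 𝒯.hat x p

end Triangulation

/-! ### Forms and norms

The gradients are only used for piecewise affine functions, for which the classical
gradient exists almost everywhere and is the weak gradient. -/

/-- `‖v‖_{L_2(Ω)}`, for bounded continuous `v` on a bounded set `Ω`. -/
def l2norm {d : ℕ} (Ω : Set (Pt d)) (v : Pt d → ℝ) : ℝ :=
  Real.sqrt (∫ x in Ω, (v x) ^ 2)

/-- `‖∇v‖_{L_2(Ω)}`, for piecewise affine `v`. -/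
def gradNorm {d : ℕ} (Ω : Set (Pt d)) (v : Pt d → ℝ) : ℝ :=
  Real.sqrt (∫ x in Ω, ‖gradient v x‖ ^ 2)

/-- `∫_ω A ∇u · ∇v`. -/
def form {d : ℕ} (A : Pt d → Matrix (Fin d) (Fin d) ℝ) (ω : Set (Pt d))
    (u v : Pt d → ℝ) : ℝ :=
  ∫ x in ω, ∑ i, ∑ j, A x i j * gradient u x j * gradient v x i

/-- `A` is a measurable symmetric coefficient on `Ω` with spectral bounds `α` and `β`. -/
def IsCoefficient {d : ℕ} (Ω : Set (Pt d)) (A : Pt d → Matrix (Fin d) (Fin d) ℝ)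
    (α β : ℝ) : Prop :=
  (∀ i j, AEMeasurable (fun x => A x i j) (volume.restrict Ω)) ∧
  ∀ᵐ x ∂(volume.restrict Ω), (A x).IsSymm ∧
    ∀ v : Fin d → ℝ, α * (v ⬝ᵥ v) ≤ (A x).mulVec v ⬝ᵥ v ∧
      (A x).mulVec v ⬝ᵥ v ≤ β * (v ⬝ᵥ v)

/-- `p` is the `L_2(Ω)`-orthogonal projection of `v` onto the finite element space `S`. -/
def IsL2Proj {d : ℕ} (Ω : Set (Pt d)) (S : Set (Pt d → ℝ)) (v p : Pt d → ℝ) : Prop :=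
  p ∈ S ∧ ∀ w ∈ S, ∫ x in Ω, (v x - p x) * w x = 0

/-- The `L_2`-projection onto the coarse space is stable in the `H^1_0`-norm `‖∇ · ‖`
with constant `cP`, tested on the functions of the fine space. -/
def ProjStable {d : ℕ} {Ω : Set (Pt d)} (𝒯H 𝒯h : Triangulation Ω) (cP : ℝ) : Prop :=
  ∀ v ∈ 𝒯h.P1, ∀ p, IsL2Proj Ω 𝒯H.P1 v p → gradNorm Ω p ≤ cP * gradNorm Ω v

/-! ### The localized multiscale space -/

section Multiscale

variable {d : ℕ} {Ω : Set (Pt d)} (𝒯H 𝒯h : Triangulation Ω)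

/-- The fine scale space `V^f`: the kernel in `V_h` of the Clément operator. -/
def fineSpace : Set (Pt d → ℝ) := {v | v ∈ 𝒯h.P1 ∧ 𝒯H.clement v = 0}

/-- `V^f(ω_k(K))`: the functions in `V^f` with support in the patch. -/
def fineSpaceOn (k : ℕ) (K : Finset (Pt d)) : Set (Pt d → ℝ) :=
  {w | w ∈ fineSpace 𝒯H 𝒯h ∧ tsupport w ⊆ 𝒯H.patch k K}

/-- `q = R^f_{K,k} v`, the localized corrector of `v` for the element `K`. -/
def IsCorrector (A : Pt d → Matrix (Fin d) (Fin d) ℝ) (k : ℕ) (K : Finset (Pt d))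
    (v q : Pt d → ℝ) : Prop :=
  q ∈ fineSpaceOn 𝒯H 𝒯h k K ∧
    ∀ w ∈ fineSpaceOn 𝒯H 𝒯h k K, form A (𝒯H.patch k K) q w = form A (hull K) v w

/-- The localized multiscale space `V^ms_k`: the functions `v - ∑_K R^f_{K,k} v` with
`v ∈ V_H`. -/
def msSpace (A : Pt d → Matrix (Fin d) (Fin d) ℝ) (k : ℕ) : Set (Pt d → ℝ) :=
  {u | ∃ v ∈ 𝒯H.P1, ∃ q : Finset (Pt d) → Pt d → ℝ,
    (∀ K ∈ 𝒯H.cells, IsCorrector 𝒯H 𝒯h A k K v (q K)) ∧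
    u = fun x => v x - ∑ᶠ K ∈ 𝒯H.cells, q K x}

end Multiscale

/-! ### Time discretization -/

/-- `U_1, …, U_N` is the backward Euler Galerkin approximation in `S` with time step `τ`
and source `f`, starting from `U_0`. -/
def IsBackwardEuler {d : ℕ} {Ω : Set (Pt d)} (A : Pt d → Matrix (Fin d) (Fin d) ℝ)
    (S : Set (Pt d → ℝ)) (τ : ℝ) (N : ℕ)
    (f : ℝ → Lp ℝ 2 ((volume : Measure (Pt d)).restrict Ω)) (U : ℕ → Pt d → ℝ) : Prop :=
  ∀ n, 1 ≤ n → n ≤ N → U n ∈ S ∧ ∀ v ∈ S,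
    (∫ x in Ω, ((U n x - U (n - 1) x) / τ) * v x) + form A Ω (U n) v
      = ∫ x in Ω, f (n * τ) x * v x

/-- `f` and its weak time derivative `f'` belong to `L_∞(0,T;L_2(Ω))`, where `f` is the
(Lipschitz) continuous representative on `[0,T]`, so that its point values are meaningful. -/
def IsSource {d : ℕ} {Ω : Set (Pt d)} (T : ℝ)
    (f f' : ℝ → Lp ℝ 2 ((volume : Measure (Pt d)).restrict Ω)) : Prop :=
  MemLp f ⊤ (volume.restrict (Set.Icc 0 T)) ∧ MemLp f' ⊤ (volume.restrict (Set.Icc 0 T)) ∧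
    ∀ t ∈ Set.Icc 0 T, f t = f 0 + ∫ s in (0 : ℝ)..t, f' s

/-- The norm of `L_∞(0,T;L_2(Ω))`. -/
def linftyNorm {d : ℕ} {Ω : Set (Pt d)} (T : ℝ)
    (f : ℝ → Lp ℝ 2 ((volume : Measure (Pt d)).restrict Ω)) : ℝ :=
  (eLpNorm f ⊤ (volume.restrict (Set.Icc 0 T))).toReal

end LOD

end

/-!
The proof separates time from space.

In time, write `T` for the solution operator of a Galerkin problem, extended by the orthogonal
projection of the right-hand side. It is symmetric and positive semidefinite, so that
`J = (T + τ)⁻¹` exists, and the backward Euler step is `1 - τ J`. Two such steps compare through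
the resolvent identity `J₂ - J₁ = J₂ (T₁ - T₂) J₁` (`step_pow_sub`), and the smoothing property
`‖J (1 - τ J)^j‖ ≤ 1 / (τ (j + 1))` (`IsResolvent.norm_le`) turns a bound for `T₁ - T₂` into the
same bound, times `(1 + log n) / t_n`, for the `n`-th powers: this is the nonsmooth data estimate,
and the source of the logarithm. The source term is summed by parts (`duhamel`), which costs one
derivative of `f` but no negative power of `t_n`. By duality the difference of the solution
operators is of size `ε²` if every solution in the large space is approximated in the energy norm
to order `ε` times the data (`norm_galerkin_backwardEuler_sub_le`).

In space it remains to show that the multiscale space has this property with `ε ~ H + k^(d/2) μ^k`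
(`exists_multiscale_approximation`). The kernel of `𝔍_H` in `V_h` is the `L²` complement of `V_H`
(`mem_fineSpace_iff`), so a discrete solution `u` is the sum of its projection `u₀ = P_H u` and a
fine scale function. Let `p` be the ideal corrector of `u₀`, and `q` the sum of the localized
ones. Then `u - (u₀ - q) = (u - u₀ + p) - (p - q)`. The first summand is a fine scale function
that solves the equation tested with fine scale functions, and so it is `O(H)`, because
`‖v‖ ≤ C H ‖∇v‖` there. The second is the localization error; it is controlled by the energy of
`u₀`, hence by that of `u`, as the projection is `H¹`-stable (`formLin_le_of_projStable`).

The inequality for fine scale functions is local (`exists_localPoincare`). Elements of the star of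
a vertex are linked by chains that cross common faces, along which Poincaré's inequality
propagates. Either a chain from the given element ends at a face on the boundary, where the
function vanishes, or it reaches the whole star, and then orthogonality to the hat function of the
vertex fixes the constant. In dimension one neighbouring elements may have very different
diameters, and the inequality at the scale of the element itself is then available only for the
larger of two neighbours.

The localization error decays exponentially because a corrector is orthogonal to a cutoff of
itself (`Triangulation.HasCutoff.decay_step`,
`Triangulation.HasCutoff.sum_localization_error_le`). The cutoff has to stay in the fine scale
space (`exists_cutoff_of_set`): after multiplication by a coarse cutoff function and
interpolation, the moments against the hat functions are restored by fine functions supported in a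
single coarse element (`exists_bubble`). These exist when the fine mesh resolves each coarse
element, which fixes the constant `c₀`. Elements without the local inequality at their own scale
are kept out of the transition region of the cutoff (`Triangulation.exists_cutoff`).
-/

namespace LOD

/-! ### Galerkin solution operators and backward Euler in a Euclidean space -/

/-- Galerkin problems in finite dimensions: if `a` is definite on `S`, then the problems
`a (u, v) = ℓ_x (v)` for all `v ∈ S` have solutions in `S` that depend linearly on `x`. -/
theorem exists_galerkin {E X : Type*} [AddCommGroup E] [Module ℝ E] [FiniteDimensional ℝ E]
    [AddCommGroup X] [Module ℝ X] (a : E →ₗ[ℝ] E →ₗ[ℝ] ℝ) (S : Submodule ℝ E)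
    (ha : ∀ x ∈ S, a x x = 0 → x = 0) (ℓ : X →ₗ[ℝ] E →ₗ[ℝ] ℝ) :
    ∃ T : X →ₗ[ℝ] E, ∀ x, T x ∈ S ∧ ∀ v ∈ S, a (T x) v = ℓ x v := by
  let r : (E →ₗ[ℝ] ℝ) →ₗ[ℝ] (S →ₗ[ℝ] ℝ) := LinearMap.lcomp ℝ ℝ S.subtype
  let A : S →ₗ[ℝ] (S →ₗ[ℝ] ℝ) := r ∘ₗ a ∘ₗ S.subtype
  have hA : Function.Injective A := by
    rw [← LinearMap.ker_eq_bot, LinearMap.ker_eq_bot']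
    intro x hx
    have : A x x = 0 := by rw [hx]; rfl
    exact Subtype.ext (ha x x.2 this)
  let e : S ≃ₗ[ℝ] (S →ₗ[ℝ] ℝ) :=
    LinearEquiv.ofInjectiveOfFinrankEq A hA (Subspace.dual_finrank_eq (K := ℝ) (V := S)).symm
  refine ⟨S.subtype ∘ₗ e.symm.toLinearMap ∘ₗ r ∘ₗ ℓ, fun x =>
    ⟨(e.symm (r (ℓ x))).2, fun v hv => ?_⟩⟩
  have h : A (e.symm (r (ℓ x))) = r (ℓ x) := e.apply_symm_apply _
  exact congrArg (fun φ => φ ⟨v, hv⟩) h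

open scoped InnerProductSpace

section Euclidean

variable {H : Type*} [NormedAddCommGroup H] [InnerProductSpace ℝ H]

theorem norm_apply_le_of_diagonal {ι : Type*} [Fintype ι] (b : OrthonormalBasis ι ℝ H)
    (L : H →ₗ[ℝ] H) (c : ι → ℝ) (hL : ∀ i, L (b i) = c i • b i) {C : ℝ} (hc : ∀ i, |c i| ≤ C)
    (x : H) : ‖L x‖ ≤ C * ‖x‖ := by
  classical
  rcases isEmpty_or_nonempty ι with hι | ⟨⟨i₀⟩⟩
  · have : x = 0 := by rw [← b.sum_repr x]; simp
    simp [this]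
  have hC : 0 ≤ C := (abs_nonneg _).trans (hc i₀)
  have h1 : ∀ i, ⟪b i, L x⟫_ℝ = c i * ⟪b i, x⟫_ℝ := by
    intro i
    conv_lhs => rw [← b.sum_repr' x]
    simp only [map_sum, map_smul, hL, inner_sum, inner_smul_right]
    rw [Finset.sum_eq_single i]
    · simp; ring
    · intro j _ hj
      simp [b.orthonormal.2 hj.symm]
    · simp
  apply le_of_sq_le_sq _ (by positivity)
  rw [mul_pow, ← b.sum_sq_inner_right (L x), ← b.sum_sq_inner_right x, Finset.mul_sum]
  refine Finset.sum_le_sum fun i _ => ?_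
  rw [h1, mul_pow]
  have : (c i) ^ 2 ≤ C ^ 2 := sq_le_sq' (abs_le.1 (hc i)).1 (abs_le.1 (hc i)).2
  gcongr

theorem mul_one_sub_pow_le {s : ℝ} (h0 : 0 ≤ s) (h1 : s ≤ 1) (j : ℕ) :
    s * (1 - s) ^ j ≤ 1 / (j + 1) := by
  have hr0 : 0 ≤ 1 - s := by linarith
  have h := mul_neg_geom_sum (1 - s) (j + 1)
  have h2 : ((j : ℝ) + 1) * (1 - s) ^ j ≤ ∑ i ∈ Finset.range (j + 1), (1 - s) ^ i := by
    have := Finset.card_nsmul_le_sum (Finset.range (j + 1)) (fun i => (1 - s) ^ i) ((1 - s) ^ j)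
      (fun i hi => pow_le_pow_of_le_one hr0 (by linarith)
        (Nat.lt_succ_iff.1 (Finset.mem_range.1 hi)))
    simpa using this
  have h3 : 0 ≤ (1 - s) ^ (j + 1) := by positivity
  have h4 : s * (((j : ℝ) + 1) * (1 - s) ^ j) ≤ 1 := by
    calc _ ≤ s * ∑ i ∈ Finset.range (j + 1), (1 - s) ^ i := by gcongr
      _ = 1 - (1 - s) ^ (j + 1) := by rw [← h]; ring
      _ ≤ 1 := by linarith
  rw [le_div_iff₀ (by positivity)]
  linarith

/-- `T` is a symmetric positive semidefinite operator and `J = (T + τ)⁻¹`. For the solution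
operator `T` of a Galerkin problem, `1 - τ J` is then the backward Euler step. -/
structure IsResolvent (τ : ℝ) (T J : Module.End ℝ H) : Prop where
  symm : ∀ x y, ⟪T x, y⟫_ℝ = ⟪x, T y⟫_ℝ
  nonneg : ∀ x, 0 ≤ ⟪T x, x⟫_ℝ
  left : J * T + τ • J = 1
  right : T * J + τ • J = 1

theorem exists_isResolvent [FiniteDimensional ℝ H] {τ : ℝ} (hτ : 0 < τ) {T : Module.End ℝ H}
    (hs : ∀ x y, ⟪T x, y⟫_ℝ = ⟪x, T y⟫_ℝ) (hp : ∀ x, 0 ≤ ⟪T x, x⟫_ℝ) :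
    ∃ J, IsResolvent τ T J := by
  have hinj : Function.Injective (T + τ • (1 : Module.End ℝ H)) := by
    rw [← LinearMap.ker_eq_bot, LinearMap.ker_eq_bot']
    intro x hx
    have h1 : ⟪(T + τ • (1 : Module.End ℝ H)) x, x⟫_ℝ = 0 := by rw [hx]; simp
    simp only [LinearMap.add_apply, LinearMap.smul_apply, Module.End.one_apply, inner_add_left,
      inner_smul_left, real_inner_self_eq_norm_sq, conj_trivial] at h1
    have h2 := hp x
    have : ‖x‖ ^ 2 = 0 := by nlinarith [sq_nonneg ‖x‖]
    simpa using this
  let e := LinearEquiv.ofInjectiveEndo _ hinj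
  refine ⟨e.symm.toLinearMap, hs, hp, ?_, ?_⟩
  · ext x
    have : e.symm ((T + τ • (1 : Module.End ℝ H)) x) = x := e.symm_apply_apply x
    simpa using this
  · ext x
    have : (T + τ • (1 : Module.End ℝ H)) (e.symm x) = x := e.apply_symm_apply x
    simpa using this

namespace IsResolvent

variable {τ : ℝ} {T J : Module.End ℝ H}

theorem step_eq_mul (h : IsResolvent τ T J) : 1 - τ • J = T * J := by
  rw [← h.right]; abel

theorem step_eq_mul' (h : IsResolvent τ T J) : 1 - τ • J = J * T := by
  rw [← h.left]; abel

/-- Smoothing by the backward Euler step: `‖J (1 - τ J)^j‖ ≤ 1 / (τ (j + 1))`. -/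
theorem norm_le [FiniteDimensional ℝ H] (h : IsResolvent τ T J) (hτ : 0 < τ) (j : ℕ) (x : H) :
    ‖J (((1 - τ • J) ^ j) x)‖ ≤ 1 / (τ * (j + 1)) * ‖x‖ ∧
      ‖((1 - τ • J) ^ j) x‖ ≤ 1 * ‖x‖ := by
  -- In an eigenbasis of `T` with eigenvalues `λ`, the step `1 - τ J` is multiplication by `1 - s`
  -- with `s = τ / (λ + τ) ∈ [0, 1]`, and `J` is multiplication by `s / τ`.
  have hT : T.IsSymmetric := h.symm
  let b := hT.eigenvectorBasis rfl
  let ev := hT.eigenvalues rfl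
  have hb : ∀ i, T (b i) = ev i • b i := fun i => hT.apply_eigenvectorBasis rfl i
  have hpos : ∀ i, 0 ≤ ev i := by
    intro i
    have := h.nonneg (b i)
    rw [hb, inner_smul_left, real_inner_self_eq_norm_sq, b.orthonormal.1] at this
    simpa using this
  have hJ : ∀ i, J (b i) = (ev i + τ)⁻¹ • b i := by
    intro i
    have h1 := congrArg (fun L : Module.End ℝ H => L (b i)) h.left
    simp only [LinearMap.add_apply, Module.End.mul_apply, hb, map_smul, LinearMap.smul_apply,
      Module.End.one_apply, ← add_smul] at h1
    have h2 : ev i + τ ≠ 0 := by have := hpos i; positivity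
    rw [eq_inv_smul_iff₀ h2]
    exact h1
  have hG : ∀ i, (1 - τ • J) (b i) = (1 - τ * (ev i + τ)⁻¹) • b i := by
    intro i
    simp only [LinearMap.sub_apply, Module.End.one_apply, LinearMap.smul_apply, hJ, smul_smul,
      sub_smul, one_smul]
  have hGj : ∀ i, ((1 - τ • J) ^ j) (b i) = (1 - τ * (ev i + τ)⁻¹) ^ j • b i := by
    intro i
    induction j with
    | zero => simp
    | succ j ih => rw [pow_succ', Module.End.mul_apply, ih, map_smul, hG, smul_smul, pow_succ]
  have hs : ∀ i, 0 ≤ τ * (ev i + τ)⁻¹ ∧ τ * (ev i + τ)⁻¹ ≤ 1 := by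
    intro i
    have := hpos i
    refine ⟨by positivity, ?_⟩
    rw [mul_inv_le_iff₀ (by positivity)]
    linarith
  constructor
  · refine norm_apply_le_of_diagonal b (J * (1 - τ • J) ^ j)
      (fun i => (1 - τ * (ev i + τ)⁻¹) ^ j * (ev i + τ)⁻¹) (fun i => ?_) (fun i => ?_) x
    · rw [Module.End.mul_apply, hGj, map_smul, hJ, smul_smul]
    · have h1 := mul_one_sub_pow_le (hs i).1 (hs i).2 j
      have h2 : 0 ≤ (1 - τ * (ev i + τ)⁻¹) ^ j * (ev i + τ)⁻¹ := by
        have := hpos i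
        have := (hs i).2
        have : 0 ≤ 1 - τ * (ev i + τ)⁻¹ := by linarith
        positivity
      rw [abs_of_nonneg h2, one_div, mul_inv, ← one_div ((j : ℝ) + 1)]
      rw [inv_mul_eq_div, le_div_iff₀ hτ]
      linarith
  · refine norm_apply_le_of_diagonal b ((1 - τ • J) ^ j) _ hGj (fun i => ?_) x
    rw [abs_pow]
    refine pow_le_one₀ (abs_nonneg _) ?_
    rw [abs_le]
    constructor <;> linarith [(hs i).1, (hs i).2]

end IsResolvent

theorem sum_inv_le (n : ℕ) :
    ∑ j ∈ Finset.range n, (1 : ℝ) / (j + 1) ≤ 1 + Real.log n := by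
  have h := harmonic_le_one_add_log n
  have h2 : ((harmonic n : ℚ) : ℝ) = ∑ j ∈ Finset.range n, (1 : ℝ) / (j + 1) := by
    simp [harmonic]
  rwa [h2] at h

/-- By partial fractions, `1 / ((n - j) (j + 1)) ≤ (1 / n) (1 / (n - j) + 1 / (j + 1))`, which
reduces the convolution to two harmonic sums. -/
theorem sum_inv_mul_le (n : ℕ) (hn : 1 ≤ n) :
    ∑ j ∈ Finset.range n, (1 : ℝ) / (((n - 1 - j : ℕ) : ℝ) + 1) * (1 / ((j : ℝ) + 1)) ≤
      2 * (1 + Real.log n) / n := by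
  have hn' : (0 : ℝ) < n := by exact_mod_cast hn
  have h1 : ∀ j ∈ Finset.range n,
      (1 : ℝ) / (((n - 1 - j : ℕ) : ℝ) + 1) * (1 / ((j : ℝ) + 1)) ≤
        1 / n * (1 / (((n - 1 - j : ℕ) : ℝ) + 1) + 1 / ((j : ℝ) + 1)) := by
    intro j hj
    have hj := Finset.mem_range.1 hj
    have hc : ((n - 1 - j : ℕ) : ℝ) + 1 = n - j := by
      have : ((n - 1 - j : ℕ) : ℝ) + 1 + j = n := by
        exact_mod_cast (by omega : n - 1 - j + 1 + j = n)
      linarith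
    have hp : (0 : ℝ) < n - j := by
      have : (j : ℝ) < n := by exact_mod_cast hj
      linarith
    rw [hc, div_add_div _ _ hp.ne' (by positivity), div_mul_div_comm, div_mul_div_comm,
      div_le_div_iff₀ (by positivity) (by positivity)]
    have : 0 < (n - (j : ℝ)) * (j + 1) := by positivity
    nlinarith
  refine (Finset.sum_le_sum h1).trans ?_
  rw [← Finset.mul_sum, Finset.sum_add_distrib,
    Finset.sum_range_reflect (fun j => (1 : ℝ) / (j + 1)) n]
  have := sum_inv_le n
  rw [div_mul_eq_mul_div, one_mul]
  gcongr
  linarith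

theorem pow_sub_pow_eq_sum {R : Type*} [Ring R] (x y : R) (n : ℕ) :
    x ^ n - y ^ n = ∑ j ∈ Finset.range n, y ^ (n - 1 - j) * (x - y) * x ^ j := by
  induction n with
  | zero => simp
  | succ n ih =>
    rw [Finset.sum_range_succ]
    have h : ∀ j ∈ Finset.range n, y ^ (n + 1 - 1 - j) * (x - y) * x ^ j =
        y * (y ^ (n - 1 - j) * (x - y) * x ^ j) := by
      intro j hj
      have hj := Finset.mem_range.1 hj
      rw [show n + 1 - 1 - j = (n - 1 - j) + 1 by omega, pow_succ']
      simp only [mul_assoc]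
    rw [Finset.sum_congr rfl h, ← Finset.mul_sum, ← ih]
    simp only [Nat.add_sub_cancel, Nat.sub_self, pow_zero, one_mul, pow_succ']
    noncomm_ring

variable {τ ε : ℝ} {T₁ J₁ T₂ J₂ : Module.End ℝ H}

/-- The difference of the powers of two backward Euler steps, by the resolvent identity
`J₂ - J₁ = J₂ (T₁ - T₂) J₁`. -/
theorem step_pow_sub (h₁ : IsResolvent τ T₁ J₁) (h₂ : IsResolvent τ T₂ J₂) (n : ℕ) :
    (1 - τ • J₁) ^ n - (1 - τ • J₂) ^ n = ∑ j ∈ Finset.range n,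
      τ • ((1 - τ • J₂) ^ (n - 1 - j) * J₂ * (T₁ - T₂) * (J₁ * (1 - τ • J₁) ^ j)) := by
  rw [pow_sub_pow_eq_sum]
  refine Finset.sum_congr rfl fun j _ => ?_
  have h : (1 - τ • J₁) - (1 - τ • J₂) = τ • (J₂ * (T₁ - T₂) * J₁) := by
    have e1 : J₂ = J₂ * (T₁ * J₁) + τ • (J₂ * J₁) := by
      conv_lhs => rw [← mul_one J₂, ← h₁.right, mul_add, mul_smul_comm]
    have e2 : J₁ = (J₂ * T₂) * J₁ + τ • (J₂ * J₁) := by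
      conv_lhs => rw [← one_mul J₁, ← h₂.left, add_mul, smul_mul_assoc]
    have e3 : J₂ - J₁ = J₂ * (T₁ - T₂) * J₁ := by
      have : J₂ - J₁ = (J₂ * (T₁ * J₁) + τ • (J₂ * J₁)) - ((J₂ * T₂) * J₁ + τ • (J₂ * J₁)) := by
        rw [← e1, ← e2]
      rw [this]
      noncomm_ring
    rw [← e3, smul_sub]
    abel
  rw [h]
  simp only [mul_smul_comm, smul_mul_assoc, mul_assoc]

theorem commute_step (J : Module.End ℝ H) (τ : ℝ) (n : ℕ) :
    (1 - τ • J) ^ n * J = J * (1 - τ • J) ^ n := by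
  have : Commute (1 - τ • J) J := by
    refine Commute.sub_left (Commute.one_left _) (Commute.smul_left (Commute.refl _) _)
  exact (this.pow_left n).eq

/-- In the expansion `step_pow_sub` the smoothing property bounds the term of index `j` by
`ε / (τ (n - j) (j + 1))`; the sum over `j` costs the factor `(1 + log n) / n`. -/
theorem norm_step_pow_sub_le [FiniteDimensional ℝ H]
    (h₁ : IsResolvent τ T₁ J₁) (h₂ : IsResolvent τ T₂ J₂) (hτ : 0 < τ)
    (hε : ∀ x, ‖T₁ x - T₂ x‖ ≤ ε * ‖x‖) (hε0 : 0 ≤ ε) (n : ℕ) (hn : 1 ≤ n) (x : H) :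
    ‖((1 - τ • J₁) ^ n) x - ((1 - τ • J₂) ^ n) x‖ ≤
      ε * (2 * (1 + Real.log n) / (n * τ)) * ‖x‖ := by
  rw [← LinearMap.sub_apply, step_pow_sub h₁ h₂, LinearMap.sum_apply]
  refine (norm_sum_le _ _).trans ?_
  have hj : ∀ j ∈ Finset.range n,
      ‖(τ • ((1 - τ • J₂) ^ (n - 1 - j) * J₂ * (T₁ - T₂) * (J₁ * (1 - τ • J₁) ^ j))) x‖ ≤
        ε / τ * ‖x‖ * (1 / (((n - 1 - j : ℕ) : ℝ) + 1) * (1 / ((j : ℝ) + 1))) := by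
    intro j _
    rw [commute_step, LinearMap.smul_apply, norm_smul, Real.norm_of_nonneg hτ.le]
    simp only [Module.End.mul_apply]
    have e1 := (h₁.norm_le hτ j x).1
    set y := J₁ (((1 - τ • J₁) ^ j) x)
    have e2 := hε y
    have e3 := (h₂.norm_le hτ (n - 1 - j) ((T₁ - T₂) y)).1
    rw [LinearMap.sub_apply] at e3 ⊢
    calc _ ≤ τ * (1 / (τ * (((n - 1 - j : ℕ) : ℝ) + 1)) *
            (ε * (1 / (τ * (j + 1)) * ‖x‖))) := by
          gcongr
          refine e3.trans ?_
          gcongr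
          refine e2.trans ?_
          gcongr
      _ = _ := by field_simp
  refine (Finset.sum_le_sum hj).trans ?_
  rw [← Finset.mul_sum]
  calc _ ≤ ε / τ * ‖x‖ * (2 * (1 + Real.log n) / n) := by
        gcongr
        exact sum_inv_mul_le n hn
    _ = _ := by field_simp

/-- Unlike in `norm_step_pow_sub_le`, there is no singular factor `1 / (n τ)`: the initial values
are of the form `T x`, and `J T = 1 - τ J` saves one use of the smoothing property. -/
theorem norm_step_pow_mul_sub_le [FiniteDimensional ℝ H]
    (h₁ : IsResolvent τ T₁ J₁) (h₂ : IsResolvent τ T₂ J₂)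
    (hτ : 0 < τ) (hε : ∀ x, ‖T₁ x - T₂ x‖ ≤ ε * ‖x‖) (hε0 : 0 ≤ ε) (n : ℕ) (x : H) :
    ‖((1 - τ • J₁) ^ n) (T₁ x) - ((1 - τ • J₂) ^ n) (T₂ x)‖ ≤
      ε * (2 + Real.log n) * ‖x‖ := by
  have e : ((1 - τ • J₁) ^ n) (T₁ x) - ((1 - τ • J₂) ^ n) (T₂ x) =
      ((1 - τ • J₁) ^ n - (1 - τ • J₂) ^ n) (T₁ x) + ((1 - τ • J₂) ^ n) (T₁ x - T₂ x) := by
    simp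
  have hA : ‖((1 - τ • J₂) ^ n) (T₁ x - T₂ x)‖ ≤ ε * ‖x‖ := by
    have := (h₂.norm_le hτ n (T₁ x - T₂ x)).2
    linarith [hε x]
  have hB : ‖((1 - τ • J₁) ^ n - (1 - τ • J₂) ^ n) (T₁ x)‖ ≤ ε * (1 + Real.log n) * ‖x‖ := by
    rw [step_pow_sub h₁ h₂, LinearMap.sum_apply]
    refine (norm_sum_le _ _).trans ?_
    have hj : ∀ j ∈ Finset.range n,
        ‖(τ • ((1 - τ • J₂) ^ (n - 1 - j) * J₂ * (T₁ - T₂) * (J₁ * (1 - τ • J₁) ^ j))) (T₁ x)‖ ≤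
          ε * ‖x‖ * (1 / (((n - 1 - j : ℕ) : ℝ) + 1)) := by
      intro j _
      rw [commute_step, LinearMap.smul_apply, norm_smul, Real.norm_of_nonneg hτ.le,
        ← commute_step J₁]
      simp only [Module.End.mul_apply]
      have e0 : ((1 - τ • J₁) ^ j) (J₁ (T₁ x)) = ((1 - τ • J₁) ^ (j + 1)) x := by
        rw [pow_succ, Module.End.mul_apply, ← Module.End.mul_apply J₁, ← h₁.step_eq_mul']
      rw [e0]
      have e1 := (h₁.norm_le hτ (j + 1) x).2
      set y := ((1 - τ • J₁) ^ (j + 1)) x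
      have e2 := hε y
      have e3 := (h₂.norm_le hτ (n - 1 - j) ((T₁ - T₂) y)).1
      rw [LinearMap.sub_apply] at e3 ⊢
      calc _ ≤ τ * (1 / (τ * (((n - 1 - j : ℕ) : ℝ) + 1)) * (ε * (1 * ‖x‖))) := by
            gcongr
            refine e3.trans ?_
            gcongr
            refine e2.trans ?_
            gcongr
        _ = _ := by field_simp
    refine (Finset.sum_le_sum hj).trans ?_
    rw [← Finset.mul_sum, Finset.sum_range_reflect (fun j => (1 : ℝ) / (j + 1)) n]
    have := sum_inv_le n
    calc _ ≤ ε * ‖x‖ * (1 + Real.log n) := by gcongr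
      _ = _ := by ring
  rw [e]
  refine (norm_add_le _ _).trans ?_
  calc _ ≤ ε * (1 + Real.log n) * ‖x‖ + ε * ‖x‖ := by gcongr
    _ = _ := by ring

/-- Summation by parts in Duhamel's formula for backward Euler. -/
theorem duhamel {τ : ℝ} {T J : Module.End ℝ H} (h : IsResolvent τ T J) (U f : ℕ → H)
    (hU : ∀ n, U (n + 1) = (1 - τ • J) (U n + τ • f n)) (m : ℕ) :
    U (m + 1) = T (f m) + ((1 - τ • J) ^ (m + 1)) (U 0) - ((1 - τ • J) ^ (m + 1)) (T (f 0))
      - ∑ j ∈ Finset.range m, ((1 - τ • J) ^ (m - j)) (T (f (j + 1) - f j)) := by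
  have key : ∀ x, (1 - τ • J) (τ • x) = T x - (1 - τ • J) (T x) := by
    intro x
    have e : (1 - τ • J) * T + τ • (1 - τ • J) = T := by
      rw [h.step_eq_mul, mul_assoc, ← mul_smul_comm, ← mul_add, h.left, mul_one]
    have := congrArg (fun L : Module.End ℝ H => L x) e
    simp only [LinearMap.add_apply, Module.End.mul_apply, LinearMap.smul_apply] at this
    rw [map_smul, eq_sub_iff_add_eq, add_comm]
    exact this
  induction m with
  | zero =>
    rw [hU, map_add, key]
    simp only [zero_add, pow_one, Finset.range_zero, Finset.sum_empty]
    abel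
  | succ m ih =>
    rw [hU, ih, map_add, key, Finset.sum_range_succ]
    have hs : ∀ j ∈ Finset.range m, ((1 - τ • J) ^ (m + 1 - j)) (T (f (j + 1) - f j)) =
        (1 - τ • J) (((1 - τ • J) ^ (m - j)) (T (f (j + 1) - f j))) := by
      intro j hj
      have hj := Finset.mem_range.1 hj
      rw [show m + 1 - j = (m - j) + 1 by omega, pow_succ', Module.End.mul_apply]
    rw [Finset.sum_congr rfl hs, show m + 1 - m = 1 by omega, pow_succ' _ (m + 1)]
    simp only [Module.End.mul_apply, map_add, map_sub, map_sum, pow_one]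
    abel

/-- Error between the backward Euler iterations of two resolvents with common data. -/
theorem norm_backwardEuler_sub_le [FiniteDimensional ℝ H]
    (h₁ : IsResolvent τ T₁ J₁) (h₂ : IsResolvent τ T₂ J₂)
    (hτ : 0 < τ) (hε : ∀ x, ‖T₁ x - T₂ x‖ ≤ ε * ‖x‖) (hε0 : 0 ≤ ε) (U V f : ℕ → H)
    (hU : ∀ n, U (n + 1) = (1 - τ • J₁) (U n + τ • f n))
    (hV : ∀ n, V (n + 1) = (1 - τ • J₂) (V n + τ • f n)) (h0 : U 0 = V 0) (m : ℕ)
    {M₀ M₁ : ℝ} (hM₁0 : 0 ≤ M₁) (hM₀ : ‖f 0‖ ≤ M₀)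
    (hM₁ : ∀ j < m, ‖f (j + 1) - f j‖ ≤ τ * M₁) :
    ‖U (m + 1) - V (m + 1)‖ ≤ ε * (1 + Real.log (m + 1)) *
      (2 * (((m : ℝ) + 1) * τ)⁻¹ * ‖U 0‖ + 3 * M₀ + 3 * (m * τ) * M₁) := by
  have hlog : 0 ≤ Real.log ((m : ℝ) + 1) := by
    have : (0 : ℝ) ≤ m := Nat.cast_nonneg m
    exact Real.log_nonneg (by linarith)
  set L := Real.log ((m : ℝ) + 1) with hL
  have hM₀0 : 0 ≤ M₀ := (norm_nonneg _).trans hM₀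
  have hfm : ∀ i ≤ m, ‖f i‖ ≤ M₀ + i * (τ * M₁) := by
    intro i
    induction i with
    | zero => intro _; simpa using hM₀
    | succ i ih =>
      intro hi
      have e1 := ih (by omega)
      have e2 := hM₁ i (by omega)
      have e3 : ‖f (i + 1)‖ ≤ ‖f i‖ + ‖f (i + 1) - f i‖ := by
        have := norm_add_le (f i) (f (i + 1) - f i)
        simpa using this
      push_cast
      linarith
  rw [duhamel h₁ U f hU, duhamel h₂ V f hV, ← h0]
  -- the four terms of the summed-by-parts Duhamel formula
  have c1 : ‖T₁ (f m) - T₂ (f m)‖ ≤ ε * (M₀ + m * (τ * M₁)) :=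
    (hε _).trans (by gcongr; exact hfm m le_rfl)
  have c2 : ‖((1 - τ • J₁) ^ (m + 1)) (U 0) - ((1 - τ • J₂) ^ (m + 1)) (U 0)‖ ≤
      ε * (2 * (1 + L) / ((m + 1) * τ)) * ‖U 0‖ := by
    have := norm_step_pow_sub_le h₁ h₂ hτ hε hε0 (m + 1) (by omega) (U 0)
    push_cast at this
    exact this
  have c3 : ‖((1 - τ • J₁) ^ (m + 1)) (T₁ (f 0)) - ((1 - τ • J₂) ^ (m + 1)) (T₂ (f 0))‖ ≤
      ε * (2 + L) * M₀ := by
    have := norm_step_pow_mul_sub_le h₁ h₂ hτ hε hε0 (m + 1) (f 0)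
    push_cast at this
    refine this.trans (by gcongr)
  have c4 : ‖∑ j ∈ Finset.range m, (((1 - τ • J₁) ^ (m - j)) (T₁ (f (j + 1) - f j)) -
      ((1 - τ • J₂) ^ (m - j)) (T₂ (f (j + 1) - f j)))‖ ≤ m * (ε * (2 + L) * (τ * M₁)) := by
    refine (norm_sum_le _ _).trans ?_
    refine (Finset.sum_le_card_nsmul _ _ (ε * (2 + L) * (τ * M₁)) fun j hj => ?_).trans ?_
    · have hj := Finset.mem_range.1 hj
      refine (norm_step_pow_mul_sub_le h₁ h₂ hτ hε hε0 (m - j) _).trans ?_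
      have : Real.log ((m - j : ℕ) : ℝ) ≤ L := by
        apply Real.log_le_log
        · exact_mod_cast (by omega : 0 < m - j)
        · exact_mod_cast (by omega : m - j ≤ m + 1)
      have h5 := hM₁ j hj
      gcongr
    · simp
  have e : T₁ (f m) + ((1 - τ • J₁) ^ (m + 1)) (U 0) - ((1 - τ • J₁) ^ (m + 1)) (T₁ (f 0))
      - ∑ j ∈ Finset.range m, ((1 - τ • J₁) ^ (m - j)) (T₁ (f (j + 1) - f j)) -
      (T₂ (f m) + ((1 - τ • J₂) ^ (m + 1)) (U 0) - ((1 - τ • J₂) ^ (m + 1)) (T₂ (f 0))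
      - ∑ j ∈ Finset.range m, ((1 - τ • J₂) ^ (m - j)) (T₂ (f (j + 1) - f j))) =
      (T₁ (f m) - T₂ (f m)) +
      (((1 - τ • J₁) ^ (m + 1)) (U 0) - ((1 - τ • J₂) ^ (m + 1)) (U 0)) -
      (((1 - τ • J₁) ^ (m + 1)) (T₁ (f 0)) - ((1 - τ • J₂) ^ (m + 1)) (T₂ (f 0))) -
      ∑ j ∈ Finset.range m, (((1 - τ • J₁) ^ (m - j)) (T₁ (f (j + 1) - f j)) -
      ((1 - τ • J₂) ^ (m - j)) (T₂ (f (j + 1) - f j))) := by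
    rw [Finset.sum_sub_distrib]
    abel
  rw [e]
  refine (norm_sub_le _ _).trans ((add_le_add ((norm_sub_le _ _).trans
    (add_le_add ((norm_add_le _ _).trans (add_le_add c1 c2)) c3)) c4).trans ?_)
  have hm : (0 : ℝ) ≤ m := Nat.cast_nonneg m
  have p1 : 0 ≤ ε * L * M₀ := by positivity
  have p2 : 0 ≤ ε * L * (m * τ * M₁) := by positivity
  have e2 : ε * (2 * (1 + L) / ((m + 1) * τ)) * ‖U 0‖ =
      ε * (1 + L) * (2 * (((m : ℝ) + 1) * τ)⁻¹ * ‖U 0‖) := by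
    rw [div_eq_mul_inv]; ring
  rw [e2]
  nlinarith

end Euclidean

/-! ### Galerkin subspaces -/

/-- The Cauchy–Schwarz inequality for a symmetric positive semidefinite form. -/
theorem bilin_cauchy_schwarz {E : Type*} [AddCommGroup E] [Module ℝ E]
    (a : E →ₗ[ℝ] E →ₗ[ℝ] ℝ) (hs : ∀ x y, a x y = a y x) (hp : ∀ x, 0 ≤ a x x) (x y : E) :
    |a x y| ≤ Real.sqrt (a x x) * Real.sqrt (a y y) := by
  have h : ∀ t : ℝ, 0 ≤ a y y * (t * t) + 2 * a x y * t + a x x := by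
    intro t
    have := hp (x + t • y)
    simp only [map_add, map_smul, LinearMap.add_apply, LinearMap.smul_apply, smul_eq_mul] at this
    rw [hs y x] at this
    nlinarith
  have hd := discrim_le_zero h
  rw [discrim] at hd
  rw [← Real.sqrt_mul (hp x)]
  apply Real.abs_le_sqrt
  nlinarith

section Subspace

variable {H : Type*} [NormedAddCommGroup H] [InnerProductSpace ℝ H] [FiniteDimensional ℝ H]

/-- The backward Euler approximations in the full space and in a subspace `S` are close if every
`u` with `a (u, v) = (g, v)` is approximated in the energy norm by `S` up to `ε ‖g‖`. -/
theorem norm_galerkin_backwardEuler_sub_le (a : H →ₗ[ℝ] H →ₗ[ℝ] ℝ)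
    (hs : ∀ x y, a x y = a y x) (hp : ∀ x, 0 ≤ a x x) (hd : ∀ x, a x x = 0 → x = 0)
    (S : Submodule ℝ H) {ε τ : ℝ} (hε : 0 ≤ ε) (hτ : 0 < τ)
    (happ : ∀ u g : H, (∀ v, a u v = ⟪g, v⟫_ℝ) →
      ∃ w ∈ S, a (u - w) (u - w) ≤ (ε * ‖g‖) ^ 2)
    (U V f : ℕ → H) (N : ℕ)
    (hU : ∀ n < N, ∀ v, ⟪U (n + 1) - U n, v⟫_ℝ / τ + a (U (n + 1)) v = ⟪f n, v⟫_ℝ)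
    (hVS : ∀ n < N, V (n + 1) ∈ S)
    (hV : ∀ n < N, ∀ v ∈ S, ⟪V (n + 1) - V n, v⟫_ℝ / τ + a (V (n + 1)) v = ⟪f n, v⟫_ℝ)
    (hV0 : ∀ v ∈ S, ⟪U 0 - V 0, v⟫_ℝ = 0)
    (m : ℕ) (hm : m < N) {M₀ M₁ : ℝ} (hM₁0 : 0 ≤ M₁) (hM₀ : ‖f 0‖ ≤ M₀)
    (hM₁ : ∀ j < m, ‖f (j + 1) - f j‖ ≤ τ * M₁) :
    ‖U (m + 1) - V (m + 1)‖ ≤ ε ^ 2 * (1 + Real.log (m + 1)) *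
      (2 * (((m : ℝ) + 1) * τ)⁻¹ * ‖U 0‖ + 3 * M₀ + 3 * (m * τ) * M₁) := by
  obtain ⟨T₁, hT₁⟩ := exists_galerkin a ⊤ (fun x _ => hd x) (innerₗ H)
  obtain ⟨T₂, hT₂⟩ := exists_galerkin a S (fun x _ => hd x) (innerₗ H)
  have hT₁' : ∀ g v, a (T₁ g) v = ⟪g, v⟫_ℝ := fun g v => (hT₁ g).2 v trivial
  have hT₂' : ∀ g, ∀ v ∈ S, a (T₂ g) v = ⟪g, v⟫_ℝ := fun g v hv => (hT₂ g).2 v hv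
  have hT₂S : ∀ g, T₂ g ∈ S := fun g => (hT₂ g).1
  -- Galerkin orthogonality and best approximation
  have horth : ∀ g, ∀ v ∈ S, a (T₁ g - T₂ g) v = 0 := by
    intro g v hv
    rw [map_sub, LinearMap.sub_apply, hT₁', hT₂' g v hv, sub_self]
  have henergy : ∀ g, Real.sqrt (a (T₁ g - T₂ g) (T₁ g - T₂ g)) ≤ ε * ‖g‖ := by
    intro g
    obtain ⟨w, hw, hle⟩ := happ (T₁ g) g (hT₁' g)
    have e : a (T₁ g - w) (T₁ g - w) = a (T₁ g - T₂ g) (T₁ g - T₂ g) +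
        a (T₂ g - w) (T₂ g - w) := by
      have h1 := horth g (T₂ g - w) (S.sub_mem (hT₂S g) hw)
      have h2 : T₁ g - w = (T₁ g - T₂ g) + (T₂ g - w) := by abel
      rw [h2]
      generalize T₂ g - w = p at h1 ⊢
      generalize T₁ g - T₂ g = q at h1 ⊢
      simp only [map_add, LinearMap.add_apply]
      rw [hs p q, h1]
      ring
    rw [Real.sqrt_le_left (by positivity)]
    linarith [hp (T₂ g - w)]
  -- Aubin–Nitsche duality
  have hdual : ∀ g, ‖T₁ g - T₂ g‖ ≤ ε ^ 2 * ‖g‖ := by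
    intro g
    set e := T₁ g - T₂ g with he
    have h1 : ‖e‖ ^ 2 = a e (T₁ e - T₂ e) := by
      rw [map_sub, horth g _ (hT₂S e), sub_zero, hs, hT₁', real_inner_self_eq_norm_sq]
    have h2 := (le_abs_self _).trans (bilin_cauchy_schwarz a hs hp e (T₁ e - T₂ e))
    have h3 : ‖e‖ ^ 2 ≤ (ε * ‖g‖) * (ε * ‖e‖) := by
      rw [h1]
      refine h2.trans ?_
      gcongr
      · exact henergy g
      · exact henergy e
    rcases (norm_nonneg e).eq_or_lt with h0 | h0
    · rw [← h0]; positivity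
    · nlinarith
  have hsymm : ∀ (S' : Submodule ℝ H) (T : H →ₗ[ℝ] H), (∀ g, T g ∈ S') →
      (∀ g, ∀ v ∈ S', a (T g) v = ⟪g, v⟫_ℝ) →
      (∀ x y, ⟪T x, y⟫_ℝ = ⟪x, T y⟫_ℝ) ∧ ∀ x, 0 ≤ ⟪T x, x⟫_ℝ := by
    intro S' T h1 h2
    refine ⟨fun x y => ?_, fun x => ?_⟩
    · rw [real_inner_comm, ← h2 y _ (h1 x), ← h2 x _ (h1 y), hs]
    · rw [real_inner_comm, ← h2 x _ (h1 x)]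
      exact hp _
  obtain ⟨J₁, hJ₁⟩ := exists_isResolvent hτ (hsymm ⊤ T₁ (fun _ => trivial)
    (fun g v _ => hT₁' g v)).1 (hsymm ⊤ T₁ (fun _ => trivial) (fun g v _ => hT₁' g v)).2
  obtain ⟨J₂, hJ₂⟩ := exists_isResolvent hτ (hsymm S T₂ hT₂S hT₂').1 (hsymm S T₂ hT₂S hT₂').2
  -- A solution of the Galerkin time step is given by the resolvent.
  have hstep : ∀ (S' : Submodule ℝ H) (T J : H →ₗ[ℝ] H), IsResolvent τ T J → (∀ g, T g ∈ S') →
      (∀ g, ∀ v ∈ S', a (T g) v = ⟪g, v⟫_ℝ) → ∀ u p g : H, u ∈ S' →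
      (∀ v ∈ S', ⟪u - p, v⟫_ℝ / τ + a u v = ⟪g, v⟫_ℝ) → u = (1 - τ • J) (p + τ • g) := by
    intro S' T J hJ h1 h2 u p g hu hup
    set q := p + τ • g with hq
    have hw : (1 - τ • J) q = T (J q) := by rw [hJ.step_eq_mul]; rfl
    set w := (1 - τ • J) q with hwdef
    have hwS : w ∈ S' := by rw [hw]; exact h1 _
    have hJq : τ • J q = q - w := by rw [hwdef]; simp
    have e1 : ∀ v ∈ S', ⟪u - w, v⟫_ℝ + τ * a (u - w) v = 0 := by
      intro v hv
      have h3 := hup v hv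
      have h4 : a w v = ⟪J q, v⟫_ℝ := by rw [hw, h2 _ v hv]
      have h5 : τ * ⟪J q, v⟫_ℝ = ⟪q - w, v⟫_ℝ := by rw [← hJq, inner_smul_left]; simp
      have h6 : ⟪u - p, v⟫_ℝ + τ * a u v = τ * ⟪g, v⟫_ℝ := by
        rw [← h3]; field_simp
      rw [map_sub, LinearMap.sub_apply, mul_sub, h4, h5, hq]
      simp only [inner_sub_left, inner_add_left, inner_smul_left, conj_trivial] at h6 ⊢
      linarith
    have e2 := e1 (u - w) (S'.sub_mem hu hwS)
    rw [real_inner_self_eq_norm_sq] at e2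
    have : ‖u - w‖ ^ 2 = 0 := by
      nlinarith [hp (u - w), sq_nonneg ‖u - w‖, mul_nonneg hτ.le (hp (u - w))]
    exact sub_eq_zero.1 (by simpa using this)
  -- Extend both iterations beyond `N` and start the second one at `U 0`.
  let U' : ℕ → H := fun n => Nat.rec (U 0) (fun n u => (1 - τ • J₁) (u + τ • f n)) n
  let V' : ℕ → H := fun n => Nat.rec (U 0) (fun n u => (1 - τ • J₂) (u + τ • f n)) n
  have hU' : ∀ n ≤ N, U' n = U n := by
    intro n
    induction n with
    | zero => intro _; rfl
    | succ n ih =>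
      intro hn
      have := hstep ⊤ T₁ J₁ hJ₁ (fun _ => trivial) (fun g v _ => hT₁' g v) (U (n + 1)) (U n) (f n)
        trivial (fun v _ => hU n (by omega) v)
      rw [this, ← ih (by omega)]
  have hV' : ∀ n < N, V' (n + 1) = V (n + 1) := by
    intro n
    induction n with
    | zero =>
      intro hn
      refine (hstep S T₂ J₂ hJ₂ hT₂S hT₂' (V 1) (U 0) (f 0) (hVS 0 hn) (fun v hv => ?_)).symm
      rw [← hV 0 hn v hv]
      have h3 := hV0 v hv
      simp only [inner_sub_left, zero_add] at h3 ⊢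
      congr 2
      linarith
    | succ n ih =>
      intro hn
      have := hstep S T₂ J₂ hJ₂ hT₂S hT₂' (V (n + 1 + 1)) (V (n + 1)) (f (n + 1)) (hVS _ hn)
        (fun v hv => hV _ hn v hv)
      rw [this, ← ih (by omega)]
  have := norm_backwardEuler_sub_le hJ₁ hJ₂ hτ hdual (by positivity) U' V' f (fun _ => rfl)
    (fun _ => rfl) rfl m hM₁0 hM₀ hM₁
  rwa [hU' (m + 1) (by omega), hV' m hm, hU' 0 (by omega)] at this

end Subspace

end LOD

namespace LOD

open scoped InnerProductSpace

variable {d : ℕ}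

/-! ### Simplices and barycentric coordinates -/

/-- `K` is the vertex set of a nondegenerate `d`-simplex in `ℝ^d`. -/
def IsSimplex (K : Finset (Pt d)) : Prop :=
  AffineIndependent ℝ ((↑) : K → Pt d) ∧ K.card = d + 1

/-- The affine basis of `ℝ^d` formed by the vertices of a simplex. -/
noncomputable def IsSimplex.basis {K : Finset (Pt d)} (hK : IsSimplex K) : AffineBasis K ℝ (Pt d) :=
  ⟨((↑) : K → Pt d), hK.1, by
    rw [hK.1.affineSpan_eq_top_iff_card_eq_finrank_add_one]
    simp [hK.2]⟩

open Classical in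
/-- The barycentric coordinate of the simplex `K` that belongs to the vertex `y`, as an affine
function on `ℝ^d`. It is `0` if `y` is not a vertex of `K`. -/
noncomputable def coord (K : Finset (Pt d)) (y : Pt d) : Pt d →ᵃ[ℝ] ℝ :=
  if h : IsSimplex K ∧ y ∈ K then h.1.basis.coord ⟨y, h.2⟩ else 0

theorem coord_eq {K : Finset (Pt d)} (hK : IsSimplex K) (y : K) :
    coord K y = hK.basis.coord y := by
  rw [coord, dif_pos ⟨hK, y.2⟩]

theorem coord_of_notMem {K : Finset (Pt d)} {y : Pt d} (hy : y ∉ K) (x : Pt d) :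
    coord K y x = 0 := by
  rw [coord, dif_neg (fun h => hy h.2)]
  rfl

section Simplex

variable {K : Finset (Pt d)} (hK : IsSimplex K)

include hK

theorem coord_self {y : Pt d} (hy : y ∈ K) : coord K y y = 1 := by
  rw [coord_eq hK ⟨y, hy⟩]
  exact hK.basis.coord_apply_eq ⟨y, hy⟩

theorem coord_of_ne {y y' : Pt d} (hy' : y' ∈ K) (h : y ≠ y') : coord K y y' = 0 := by
  by_cases hy : y ∈ K
  · rw [coord_eq hK ⟨y, hy⟩]
    exact hK.basis.coord_apply_ne (i := ⟨y, hy⟩) (j := ⟨y', hy'⟩) 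
      (fun e => h (congrArg Subtype.val e))
  · exact coord_of_notMem hy _

theorem sum_coord (x : Pt d) : ∑ y ∈ K, coord K y x = 1 := by
  rw [← Finset.sum_coe_sort]
  simp only [coord_eq hK]
  exact hK.basis.sum_coord_apply_eq_one x

theorem sum_coord_smul (x : Pt d) : ∑ y ∈ K, coord K y x • y = x := by
  rw [← Finset.sum_coe_sort]
  simp only [coord_eq hK]
  exact hK.basis.linear_combination_coord_eq_self x

theorem affine_eq_sum (g : Pt d →ᵃ[ℝ] ℝ) (x : Pt d) : g x = ∑ y ∈ K, coord K y x * g y := by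
  have h := Finset.map_affineCombination K (id : Pt d → Pt d) (fun y => coord K y x)
    (sum_coord hK x) g
  rw [Finset.affineCombination_eq_linear_combination _ _ _ (sum_coord hK x),
    Finset.affineCombination_eq_linear_combination _ _ _ (sum_coord hK x)] at h
  simp only [id, sum_coord_smul hK] at h
  simpa using h

theorem mem_hull_iff {x : Pt d} : x ∈ hull K ↔ ∀ y ∈ K, 0 ≤ coord K y x := by
  have h := hK.basis.convexHull_eq_nonneg_coord
  have hr : Set.range hK.basis = (K : Set (Pt d)) := by
    change Set.range ((↑) : K → Pt d) = _
    simp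
  rw [hr] at h
  rw [hull, h]
  constructor
  · intro h y hy
    rw [coord_eq hK ⟨y, hy⟩]
    exact h ⟨y, hy⟩
  · intro h y
    have := h y y.2
    rwa [coord_eq hK y] at this

theorem mem_interior_hull_iff {x : Pt d} : x ∈ interior (hull K) ↔ ∀ y ∈ K, 0 < coord K y x := by
  have h := hK.basis.interior_convexHull
  have hr : Set.range hK.basis = (K : Set (Pt d)) := by
    change Set.range ((↑) : K → Pt d) = _
    simp
  rw [hr] at h
  rw [hull, h]
  constructor
  · intro h y hy
    rw [coord_eq hK ⟨y, hy⟩]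
    exact h ⟨y, hy⟩
  · intro h y
    have := h y y.2
    rwa [coord_eq hK y] at this

theorem coord_le_one {x y : Pt d} (hx : x ∈ hull K) : coord K y x ≤ 1 := by
  by_cases hy : y ∈ K
  · rw [← sum_coord hK x]
    exact Finset.single_le_sum (f := fun y => coord K y x) (fun i hi => (mem_hull_iff hK).1 hx i hi)
        hy
  · rw [coord_of_notMem hy]; exact zero_le_one

theorem coord_nonneg {x y : Pt d} (hx : x ∈ hull K) : 0 ≤ coord K y x := by
  by_cases hy : y ∈ K
  · exact (mem_hull_iff hK).1 hx y hy
  · rw [coord_of_notMem hy]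

theorem coord_eq_zero_of_mem_hull {s : Finset (Pt d)} (hs : s ⊆ K) {x y : Pt d} (hx : x ∈ hull s)
    (hy : y ∉ s) : coord K y x = 0 := by
  have hc : Convex ℝ {x | coord K y x = 0} := by
    have : {x | coord K y x = 0} = (coord K y) ⁻¹' {0} := rfl
    rw [this]
    exact (convex_singleton (0 : ℝ)).affine_preimage _
  exact convexHull_min (t := {x | coord K y x = 0})
    (fun z hz => coord_of_ne hK (hs hz) (fun e => hy (e ▸ hz))) hc hx

theorem mem_hull_of_coord_eq_zero {s : Finset (Pt d)} (hs : s ⊆ K) {x : Pt d} (hx : x ∈ hull K)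
    (h : ∀ y ∈ K, y ∉ s → coord K y x = 0) : x ∈ hull s := by
  have h1 : ∑ y ∈ s, coord K y x = 1 := by
    rw [← sum_coord hK x]
    exact Finset.sum_subset hs h
  have h2 : ∑ y ∈ s, coord K y x • y = x := by
    conv_rhs => rw [← sum_coord_smul hK x]
    refine Finset.sum_subset hs fun y hy hys => ?_
    rw [h y hy hys, zero_smul]
  rw [← h2]
  exact (convex_convexHull ℝ (s : Set (Pt d))).sum_mem (fun y _ => coord_nonneg hK hx) h1
    (fun y hy => subset_convexHull ℝ _ hy)

/-- The barycentric coordinates of the centre of a face. -/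
theorem coord_centroid {s : Finset (Pt d)} (hs : s ⊆ K) {v : Pt d} (hv : v ∈ s) :
    coord K v (s.centroid ℝ id) = (s.card : ℝ)⁻¹ := by
  have h1 := s.sum_centroidWeights_eq_one_of_nonempty ℝ ⟨v, hv⟩
  rw [Finset.centroid_def, Finset.map_affineCombination _ _ _ h1,
    Finset.affineCombination_eq_linear_combination _ _ _ h1, Finset.sum_eq_single v]
  · simp [coord_self hK (hs hv)]
  · intro w hw hne
    simp [coord_of_ne hK (hs hw) hne.symm]
  · exact fun h => absurd hv h

theorem IsSimplex.nonempty : K.Nonempty := by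
  rw [← Finset.card_pos, hK.2]; omega

end Simplex

theorem isCompact_hull (K : Finset (Pt d)) : IsCompact (hull K) :=
  K.finite_toSet.isCompact_convexHull ℝ

theorem isClosed_hull (K : Finset (Pt d)) : IsClosed (hull K) := (isCompact_hull K).isClosed

theorem convex_hull (K : Finset (Pt d)) : Convex ℝ (hull K) := convex_convexHull ℝ _

theorem measurableSet_hull (K : Finset (Pt d)) : MeasurableSet (hull K) :=
  (isClosed_hull K).measurableSet

theorem subset_hull (K : Finset (Pt d)) : (K : Set (Pt d)) ⊆ hull K := subset_convexHull ℝ _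

theorem hull_mono {s K : Finset (Pt d)} (h : s ⊆ K) : hull s ⊆ hull K :=
  convexHull_mono (by exact_mod_cast h)

theorem volume_hull_ne_top (K : Finset (Pt d)) : volume (hull K) ≠ ⊤ :=
  (isCompact_hull K).measure_lt_top.ne

theorem interior_ae_hull (K : Finset (Pt d)) : interior (hull K) =ᵐ[volume] hull K :=
  interior_ae_eq_of_null_frontier ((convex_hull K).addHaar_frontier volume)

theorem dist_le_diam {K : Finset (Pt d)} {x y : Pt d} (hx : x ∈ hull K) (hy : y ∈ hull K) :
    ‖x - y‖ ≤ Metric.diam (hull K) := by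
  rw [← dist_eq_norm]
  exact Metric.dist_le_diam_of_mem (isCompact_hull K).isBounded hx hy

theorem closure_interior_hull {K : Finset (Pt d)} (hK : IsSimplex K) :
    closure (interior (hull K)) = hull K := by
  rw [(convex_hull K).closure_interior_eq_closure_of_nonempty_interior,
    (isClosed_hull K).closure_eq]
  refine ⟨Finset.univ.centroid ℝ hK.basis, ?_⟩
  have := hK.basis.centroid_mem_interior_convexHull
  have hr : Set.range hK.basis = (K : Set (Pt d)) := by
    change Set.range ((↑) : K → Pt d) = _
    simp
  rwa [hr] at this

/-! ### Slopes of affine functions -/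

/-- The gradient of an affine function. -/
noncomputable def slope (g : Pt d →ᵃ[ℝ] ℝ) : Pt d :=
  (InnerProductSpace.toDual ℝ (Pt d)).symm (LinearMap.toContinuousLinearMap g.linear)

theorem affine_sub_eq (g : Pt d →ᵃ[ℝ] ℝ) (x y : Pt d) : g x - g y = ⟪slope g, x - y⟫_ℝ := by
  rw [slope, InnerProductSpace.toDual_symm_apply]
  exact (g.linearMap_vsub x y).symm

theorem hasGradientAt_affine (g : Pt d →ᵃ[ℝ] ℝ) (x : Pt d) : HasGradientAt g (slope g) x := by
  rw [hasGradientAt_iff_hasFDerivAt]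
  have h : (g : Pt d → ℝ) = fun y => (InnerProductSpace.toDual ℝ (Pt d) (slope g)) y + g 0 := by
    ext y
    have := affine_sub_eq g y 0
    simp only [sub_zero] at this
    rw [InnerProductSpace.toDual_apply_apply]
    linarith
  rw [h]
  exact (ContinuousLinearMap.hasFDerivAt _).add_const _

theorem abs_affine_sub_le (g : Pt d →ᵃ[ℝ] ℝ) (x y : Pt d) : |g x - g y| ≤ ‖slope g‖ * ‖x - y‖ := by
  rw [affine_sub_eq]
  exact abs_real_inner_le_norm _ _

theorem affine_sub_le_of_mem_hull {K : Finset (Pt d)} (g : Pt d →ᵃ[ℝ] ℝ) {δ : ℝ}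
    (h : ∀ y ∈ K, ∀ y' ∈ K, g y - g y' ≤ δ) {x x' : Pt d} (hx : x ∈ hull K) (hx' : x' ∈ hull K) :
    g x - g x' ≤ δ := by
  have h1 : ∀ y ∈ K, g y ≤ δ + g x' := by
    intro y hy
    have hc : Convex ℝ {z | g y - δ ≤ g z} := by
      have : {z | g y - δ ≤ g z} = g ⁻¹' (Set.Ici (g y - δ)) := rfl
      rw [this]
      exact (convex_Ici _).affine_preimage _
    have := convexHull_min (t := {z | g y - δ ≤ g z})
      (fun z hz => by have := h y hy z hz; simp only [Set.mem_ofPred_eq]; linarith) hc hx'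
    simp only [Set.mem_ofPred_eq] at this
    linarith
  have hc : Convex ℝ {z | g z ≤ δ + g x'} := by
    have : {z | g z ≤ δ + g x'} = g ⁻¹' (Set.Iic (δ + g x')) := rfl
    rw [this]
    exact (convex_Iic _).affine_preimage _
  have := convexHull_min (t := {z | g z ≤ δ + g x'}) (fun z hz => h1 z hz) hc hx
  simp only [Set.mem_ofPred_eq] at this
  linarith

/-- The slope of an affine function is controlled by its oscillation on the vertices of a simplex
and the size of a ball inside the simplex. -/
theorem norm_slope_le {K : Finset (Pt d)} {c : Pt d} {r : ℝ} (hr : 0 ≤ r)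
    (hc : Metric.closedBall c r ⊆ hull K) (g : Pt d →ᵃ[ℝ] ℝ) {δ : ℝ}
    (h : ∀ y ∈ K, ∀ y' ∈ K, g y - g y' ≤ δ) : 2 * r * ‖slope g‖ ≤ δ := by
  rcases eq_or_ne (slope g) 0 with h0 | h0
  · rw [h0, norm_zero, mul_zero]
    have hcK := hc (Metric.mem_closedBall_self hr)
    have := affine_sub_le_of_mem_hull g h hcK hcK
    linarith
  · have hn : 0 < ‖slope g‖ := norm_pos_iff.2 h0
    set u := (r / ‖slope g‖) • slope g with hu
    have hun : ‖u‖ ≤ r := by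
      rw [hu, norm_smul, Real.norm_of_nonneg (by positivity), div_mul_cancel₀ _ hn.ne']
    have h1 : c + u ∈ hull K := hc (by simpa [Metric.mem_closedBall, dist_eq_norm] using hun)
    have h2 : c - u ∈ hull K := hc (by simpa [Metric.mem_closedBall, dist_eq_norm] using hun)
    have h3 := affine_sub_le_of_mem_hull g h h1 h2
    have h4 : c + u - (c - u) = (2 : ℝ) • u := by rw [two_smul]; abel
    rw [affine_sub_eq, h4, hu, smul_smul, inner_smul_right, real_inner_self_eq_norm_sq] at h3
    have : 2 * (r / ‖slope g‖) * ‖slope g‖ ^ 2 = 2 * r * ‖slope g‖ := by field_simp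
    linarith

/-- `K` contains a ball of radius `ρ diam K`. -/
def Fat (ρ : ℝ) (K : Finset (Pt d)) : Prop :=
  ∃ c : Pt d, Metric.closedBall c (ρ * Metric.diam (hull K)) ⊆ hull K

theorem diam_hull_pos {K : Finset (Pt d)} (hK : IsSimplex K) (hd : 1 ≤ d) :
    0 < Metric.diam (hull K) := by
  have h1 : 1 < K.card := by rw [hK.2]; omega
  obtain ⟨a, ha, b, hb, hab⟩ := Finset.one_lt_card.1 h1
  have := dist_le_diam (subset_hull K ha) (subset_hull K hb)
  exact (norm_pos_iff.2 (sub_ne_zero.2 hab)).trans_le this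

/-- The factor `1 / 4` instead of `1 / 2` accounts for the supremum in `shapeRatio`, which need not
be known to be attained. -/
theorem fat_of_shapeRatio {K : Finset (Pt d)} (hK : IsSimplex K) (hd : 1 ≤ d) {γ : ℝ} (hγ : 0 < γ)
    (h : γ ≤ shapeRatio K) : Fat (γ / 4) K := by
  have hD := diam_hull_pos hK hd
  rw [shapeRatio, le_div_iff₀ hD] at h
  -- The set in `shapeRatio` contains all negative numbers, whose balls are empty.
  have hne : {δ : ℝ | ∃ c : Pt d, Metric.closedBall c (δ / 2) ⊆ hull K}.Nonempty := by
    refine ⟨-1, 0, ?_⟩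
    rw [Metric.closedBall_eq_empty.2 (by norm_num)]
    exact Set.empty_subset _
  obtain ⟨δ, ⟨c, hc⟩, hδ⟩ := exists_lt_of_lt_csSup hne
    (lt_of_lt_of_le (show γ / 2 * Metric.diam (hull K) < γ * Metric.diam (hull K) by nlinarith) h)
  exact ⟨c, (Metric.closedBall_subset_closedBall (by linarith)).trans hc⟩

theorem abs_coord_sub_le {K : Finset (Pt d)} (hK : IsSimplex K) {ρ : ℝ} (hρ : 0 < ρ)
    (hd : 1 ≤ d) (hf : Fat ρ K) (y x x' : Pt d) :
    |coord K y x - coord K y x'| ≤ ‖x - x'‖ / (2 * ρ * Metric.diam (hull K)) := by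
  obtain ⟨c, hc⟩ := hf
  have hD := diam_hull_pos hK hd
  have h := norm_slope_le (by positivity) hc (coord K y) (δ := 1) (by
    intro z hz z' hz'
    linarith [coord_le_one hK (y := y) (subset_hull K hz), 
      coord_nonneg hK (y := y) (subset_hull K hz')])
  have h2 := abs_affine_sub_le (coord K y) x x'
  rw [le_div_iff₀ (by positivity)]
  have h3 : 0 ≤ ‖x - x'‖ := norm_nonneg _
  have h4 : 0 < 2 * ρ * Metric.diam (hull K) := by positivity
  calc _ ≤ (‖slope (coord K y)‖ * ‖x - x'‖) * (2 * ρ * Metric.diam (hull K)) := by gcongr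
    _ = (2 * (ρ * Metric.diam (hull K)) * ‖slope (coord K y)‖) * ‖x - x'‖ := by ring
    _ ≤ 1 * ‖x - x'‖ := by gcongr
    _ = _ := one_mul _

/-! ### Volumes -/

/-- The volume of the unit ball of `ℝ^d`. -/
noncomputable def ballVol (d : ℕ) : ℝ := volume.real (Metric.ball (0 : Pt d) 1)

theorem ballVol_pos : 0 < ballVol d :=
  ENNReal.toReal_pos (Metric.measure_ball_pos volume _ one_pos).ne' measure_ball_lt_top.ne

theorem volume_closedBall (c : Pt d) {r : ℝ} (hr : 0 ≤ r) :
    volume.real (Metric.closedBall c r) = r ^ d * ballVol d := by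
  rw [measureReal_def, Measure.addHaar_closedBall _ _ hr, ENNReal.toReal_mul,
    ENNReal.toReal_ofReal (by positivity)]
  simp [ballVol, measureReal_def]

theorem volume_homothety (x : Pt d) {t : ℝ} (ht : 0 ≤ t) (s : Set (Pt d)) :
    volume.real (AffineMap.homothety x t '' s) = t ^ d * volume.real s := by
  rw [measureReal_def, Measure.addHaar_image_homothety, ENNReal.toReal_mul,
    ENNReal.toReal_ofReal (abs_nonneg _), abs_of_nonneg (by positivity)]
  simp [measureReal_def]

theorem homothety_subset {K : Finset (Pt d)} {x : Pt d} (hx : x ∈ hull K) {t : ℝ} (ht0 : 0 ≤ t)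
    (ht1 : t ≤ 1) : AffineMap.homothety x t '' hull K ⊆ hull K := by
  rintro _ ⟨y, hy, rfl⟩
  rw [AffineMap.homothety_eq_lineMap]
  exact (convex_hull K).lineMap_mem hx hy ⟨ht0, ht1⟩

theorem homothety_subset_closedBall {K : Finset (Pt d)} {x : Pt d} (hx : x ∈ hull K) {t : ℝ}
    (ht0 : 0 ≤ t) :
    AffineMap.homothety x t '' hull K ⊆ Metric.closedBall x (t * Metric.diam (hull K)) := by
  rintro _ ⟨y, hy, rfl⟩
  rw [Metric.mem_closedBall, dist_homothety_center, Real.norm_of_nonneg ht0, dist_eq_norm]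
  gcongr
  exact dist_le_diam hx hy

theorem volume_hull_le (K : Finset (Pt d)) :
    volume.real (hull K) ≤ Metric.diam (hull K) ^ d * ballVol d := by
  rcases (hull K).eq_empty_or_nonempty with h | ⟨x, hx⟩
  · rw [h]
    simp only [measureReal_empty]
    have := (ballVol_pos (d := d)).le
    have : 0 ≤ Metric.diam (∅ : Set (Pt d)) := Metric.diam_nonneg
    positivity
  · rw [← volume_closedBall x Metric.diam_nonneg]
    refine measureReal_mono (fun y hy => ?_) measure_closedBall_lt_top.ne
    rw [Metric.mem_closedBall, dist_eq_norm]
    exact dist_le_diam hy hx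

theorem le_volume_hull {K : Finset (Pt d)} {ρ : ℝ} (hρ : 0 ≤ ρ) (hf : Fat ρ K) :
    (ρ * Metric.diam (hull K)) ^ d * ballVol d ≤ volume.real (hull K) := by
  obtain ⟨c, hc⟩ := hf
  rw [← volume_closedBall c (mul_nonneg hρ Metric.diam_nonneg)]
  exact measureReal_mono hc (volume_hull_ne_top K)

theorem volume_hull_pos {K : Finset (Pt d)} (hK : IsSimplex K) : 0 < volume.real (hull K) := by
  refine ENNReal.toReal_pos (fun h => ?_) (volume_hull_ne_top K)
  have h1 : (interior (hull K)).Nonempty := by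
    by_contra hne
    have := closure_interior_hull hK
    rw [Set.not_nonempty_iff_eq_empty.1 hne, closure_empty] at this
    obtain ⟨y, hy⟩ := hK.nonempty
    have hy' := subset_hull K hy
    rw [← this] at hy'
    exact hy'
  exact (isOpen_interior.measure_pos volume h1).ne' (measure_mono_null interior_subset h)

theorem continuous_affine (g : Pt d →ᵃ[ℝ] ℝ) : Continuous g := g.continuous_of_finiteDimensional

/-- The vertex values of an affine function are controlled by its `L_2`-norm on the simplex:
near the vertex of largest modulus the function has at least half this modulus. -/
theorem vertex_sq_le {K : Finset (Pt d)} (g : Pt d →ᵃ[ℝ] ℝ) {y : Pt d}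
    (hy : y ∈ K) : (g y) ^ 2 * volume.real (hull K) ≤ 4 ^ (d + 1) * ∫ x in hull K, (g x) ^ 2 := by
  obtain ⟨z, hz, hmax⟩ := K.exists_max_image (fun z => |g z|) ⟨y, hy⟩
  set M := |g z| with hM
  have hbound : ∀ x ∈ hull K, |g x| ≤ M := by
    have hc : Convex ℝ {x | |g x| ≤ M} := by
      have : {x | |g x| ≤ M} = g ⁻¹' (Set.Icc (-M) M) := by ext; simp [abs_le]
      rw [this]
      exact (convex_Icc _ _).affine_preimage _
    exact fun x hx => convexHull_min (t := {x | |g x| ≤ M}) (fun w hw => hmax w hw) hc hx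
  -- On the copy `S` of the simplex scaled by `1 / 4` towards `z`, the modulus of `g` is at least
  -- `(3 / 4 - 1 / 4) M`.
  set S := AffineMap.homothety z (1 / 4 : ℝ) '' hull K with hS
  have hSK : S ⊆ hull K := homothety_subset (subset_hull K hz) (by norm_num) (by norm_num)
  have hlow : ∀ x ∈ S, (M / 2) ^ 2 ≤ (g x) ^ 2 := by
    rintro _ ⟨x, hx, rfl⟩
    rw [AffineMap.homothety_eq_lineMap, AffineMap.apply_lineMap, AffineMap.lineMap_apply_ring]
    have h1 := hbound x hx
    rw [← sq_abs ((1 - 1 / 4) * g z + 1 / 4 * g x)]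
    apply pow_le_pow_left₀ (by positivity)
    have h2 : |(1 - 1 / 4) * g z + 1 / 4 * g x| ≥ |(1 - 1 / 4 : ℝ) * g z| - |1 / 4 * g x| := by
      have := abs_sub_abs_le_abs_sub ((1 - 1 / 4) * g z) (-(1 / 4 * g x))
      rw [abs_neg, sub_neg_eq_add] at this
      exact this
    rw [abs_mul, abs_mul] at h2
    norm_num at h2 ⊢
    linarith
  have hSc : IsCompact S := (isCompact_hull K).image (AffineMap.homothety_continuous _ _)
  have hint : IntegrableOn (fun x => (g x) ^ 2) (hull K) volume :=
    ((continuous_affine g).pow 2).continuousOn.integrableOn_compact (isCompact_hull K)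
  have h3 : (M / 2) ^ 2 * volume.real S ≤ ∫ x in hull K, (g x) ^ 2 := by
    calc _ = ∫ x in S, (M / 2) ^ 2 := by simp [mul_comm]
      _ ≤ ∫ x in S, (g x) ^ 2 := by
        refine setIntegral_mono_on ?_ (hint.mono_set hSK) hSc.measurableSet hlow
        exact integrableOn_const hSc.measure_lt_top.ne
      _ ≤ _ := setIntegral_mono_set hint (ae_of_all _ fun x => sq_nonneg _) hSK.eventuallyLE
  rw [hS, volume_homothety _ (by norm_num)] at h3
  have h4 : (g y) ^ 2 ≤ M ^ 2 := by
    rw [← sq_abs (g y)]; exact pow_le_pow_left₀ (abs_nonneg _) (hmax y hy) 2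
  have h5 : 0 ≤ volume.real (hull K) := measureReal_nonneg
  calc _ ≤ M ^ 2 * volume.real (hull K) := by gcongr
    _ = 4 ^ (d + 1) * ((M / 2) ^ 2 * ((1 / 4) ^ d * volume.real (hull K))) := by
      rw [one_div, inv_pow]; field_simp; ring
    _ ≤ _ := by gcongr

end LOD

namespace LOD

open scoped InnerProductSpace NNReal ENNReal

variable {d : ℕ}

/-! ### Lipschitz functions and their gradients -/

theorem measurable_gradient' (w : Pt d → ℝ) : Measurable (gradient w) :=
  (InnerProductSpace.toDual ℝ (Pt d)).symm.continuous.measurable.comp (measurable_fderiv ℝ w)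

theorem norm_gradient_eq (w : Pt d → ℝ) (x : Pt d) : ‖gradient w x‖ = ‖fderiv ℝ w x‖ := by
  rw [gradient, LinearIsometryEquiv.norm_map]

theorem norm_gradient_le {L : ℝ≥0} {w : Pt d → ℝ} (hw : LipschitzWith L w) (x : Pt d) :
    ‖gradient w x‖ ≤ L := by
  rw [norm_gradient_eq]
  exact norm_fderiv_le_of_lipschitz ℝ hw

theorem fderiv_apply_eq_inner (w : Pt d → ℝ) (x v : Pt d) :
    fderiv ℝ w x v = ⟪gradient w x, v⟫_ℝ := by
  rw [gradient, InnerProductSpace.toDual_symm_apply]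

theorem integrableOn_gradient_sq {L : ℝ≥0} {w : Pt d → ℝ} (hw : LipschitzWith L w) {E : Set (Pt d)}
    (hE : volume E ≠ ⊤) : IntegrableOn (fun x => ‖gradient w x‖ ^ 2) E volume := by
  refine IntegrableOn.of_bound hE.lt_top
    ((measurable_gradient' w).norm.pow_const 2).aestronglyMeasurable ((L : ℝ) ^ 2)
    (ae_of_all _ fun x => ?_)
  rw [Real.norm_of_nonneg (by positivity)]
  exact pow_le_pow_left₀ (norm_nonneg _) (norm_gradient_le hw x) 2

theorem integrableOn_sq {w : Pt d → ℝ} (hw : Continuous w) {E : Set (Pt d)}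
    (hE : Bornology.IsBounded E) : IntegrableOn (fun x => (w x) ^ 2) E volume :=
  ((hw.pow 2).continuousOn.integrableOn_compact hE.isCompact_closure).mono_set subset_closure

/-! ### Poincaré inequalities -/

open Classical in
/-- The squared modulus of the gradient of a function with Lipschitz constant `L`, replaced by
`L ^ 2` at the points where the function is not differentiable. -/
noncomputable def gradSqBound (L : ℝ≥0) (w : Pt d → ℝ) (x : Pt d) : ℝ≥0∞ :=
  if DifferentiableAt ℝ w x then ENNReal.ofReal (‖gradient w x‖ ^ 2)
  else ENNReal.ofReal ((L : ℝ) ^ 2)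

theorem measurable_gradSqBound (L : ℝ≥0) (w : Pt d → ℝ) : Measurable (gradSqBound L w) := by
  unfold gradSqBound
  refine Measurable.ite (measurableSet_of_differentiableAt ℝ w) ?_ measurable_const
  exact ((measurable_gradient' w).norm.pow_const 2).ennreal_ofReal

theorem gradSqBound_ae {L : ℝ≥0} {w : Pt d → ℝ} (hw : LipschitzWith L w) :
    ∀ᵐ x ∂(volume : Measure (Pt d)), gradSqBound L w x = ENNReal.ofReal (‖gradient w x‖ ^ 2) := by
  filter_upwards [hw.ae_differentiableAt (μ := volume)] with x hx
  rw [gradSqBound, if_pos hx]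

/-- The fundamental theorem of calculus along a segment, squared by Jensen's inequality. On a given
segment `w` need not be differentiable anywhere, whence `gradSqBound` instead of the gradient. -/
theorem sq_sub_le_lintegral_segment {L : ℝ≥0} {w : Pt d → ℝ} (hw : LipschitzWith L w) (p q : Pt d) :
    ENNReal.ofReal ((w p - w q) ^ 2) ≤ ENNReal.ofReal (‖p - q‖ ^ 2) *
      ∫⁻ t in Set.Ioc (0 : ℝ) 1, gradSqBound L w (q + t • (p - q)) := by
  set h : ℝ → ℝ := fun t => w (q + t • (p - q)) with hh
  have hL : LipschitzWith (L * ‖p - q‖₊) h := by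
    refine hw.comp (LipschitzWith.of_dist_le_mul fun s t => ?_)
    rw [dist_add_left, dist_eq_norm, ← sub_smul, norm_smul, mul_comm, coe_nnnorm, dist_eq_norm]
  have hb : ∀ t, ‖deriv h t‖ ≤ L * ‖p - q‖ := fun t => norm_deriv_le_of_lipschitz hL
  have hd : ∀ t, ENNReal.ofReal ((deriv h t) ^ 2) ≤
      ENNReal.ofReal (‖p - q‖ ^ 2) * gradSqBound L w (q + t • (p - q)) := by
    intro t
    rw [gradSqBound]
    split_ifs with hdiff
    · have h1 : HasDerivAt (fun t : ℝ => q + t • (p - q)) ((1 : ℝ) • (p - q)) t :=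
        ((hasDerivAt_id t).smul_const (p - q)).const_add q
      have h2 := (hdiff.hasFDerivAt.comp_hasDerivAt t h1).deriv
      have h3 : deriv h t = ⟪gradient w (q + t • (p - q)), p - q⟫_ℝ := by
        rw [← fderiv_apply_eq_inner]
        rw [one_smul] at h2
        exact h2
      rw [← ENNReal.ofReal_mul (by positivity), h3, ← sq_abs, ← mul_pow, mul_comm]
      exact ENNReal.ofReal_le_ofReal 
        (pow_le_pow_left₀ (abs_nonneg _) (abs_real_inner_le_norm _ _) 2)
    · rw [← ENNReal.ofReal_mul (by positivity), ← sq_abs, ← mul_pow, mul_comm]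
      exact ENNReal.ofReal_le_ofReal (pow_le_pow_left₀ (abs_nonneg _) (hb t) 2)
  have hftc : ∫ t in (0 : ℝ)..1, deriv h t = w p - w q := by
    have := 
      (hL.lipschitzOnWith (s := Set.uIcc 0 1)).absolutelyContinuousOnInterval.integral_deriv_eq_sub
    rw [this]
    simp [hh]
  have hprob : IsProbabilityMeasure ((volume : Measure ℝ).restrict (Set.Ioc 0 1)) := ⟨by simp⟩
  have hi1 : Integrable (deriv h) (volume.restrict (Set.Ioc 0 1)) :=
    Integrable.of_bound (measurable_deriv h).aestronglyMeasurable _ (ae_of_all _ hb)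
  have hi2 : Integrable (fun t => (deriv h t) ^ 2) (volume.restrict (Set.Ioc 0 1)) := by
    refine Integrable.of_bound ((measurable_deriv h).pow_const 2).aestronglyMeasurable
      ((L * ‖p - q‖) ^ 2) (ae_of_all _ fun t => ?_)
    rw [norm_pow]
    exact pow_le_pow_left₀ (norm_nonneg _) (hb t) 2
  have hj := (even_two.convexOn_pow (𝕜 := ℝ)).map_integral_le
    (μ := volume.restrict (Set.Ioc (0 : ℝ) 1)) (f := deriv h)
    (by fun_prop) isClosed_univ (ae_of_all _ fun _ => Set.mem_univ _) hi1 hi2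
  rw [← intervalIntegral.integral_of_le zero_le_one, hftc] at hj
  calc _ ≤ ENNReal.ofReal (∫ t in Set.Ioc (0 : ℝ) 1, (deriv h t) ^ 2) := ENNReal.ofReal_le_ofReal hj
    _ = ∫⁻ t in Set.Ioc (0 : ℝ) 1, ENNReal.ofReal ((deriv h t) ^ 2) :=
      ofReal_integral_eq_lintegral_ofReal hi2 (ae_of_all _ fun t => sq_nonneg _)
    _ ≤ ∫⁻ t in Set.Ioc (0 : ℝ) 1,
        ENNReal.ofReal (‖p - q‖ ^ 2) * gradSqBound L w (q + t • (p - q)) := lintegral_mono hd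
    _ = _ := by
      rw [lintegral_const_mul]
      exact (measurable_gradSqBound L w).comp (by fun_prop)

/-- The map `p ↦ q + t (p - q)` maps `E` into itself, and for `t ≥ 1 / 2` its Jacobian is at least
`2 ^ (-d)`. -/
theorem lintegral_comp_segment_le {E : Set (Pt d)} (hE : Convex ℝ E) (hm : MeasurableSet E)
    (g : Pt d → ℝ≥0∞) {q : Pt d} (hq : q ∈ E) {t : ℝ} (ht : 1 / 2 ≤ t) (ht1 : t ≤ 1) :
    ∫⁻ p in E, g (q + t • (p - q)) ≤ 2 ^ d * ∫⁻ x in E, g x := by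
  have ht0 : 0 < t := by linarith
  set φ : Pt d → Pt d := fun p => q + t • (p - q) with hφ
  have hder : ∀ x ∈ E, HasFDerivWithinAt φ (t • ContinuousLinearMap.id ℝ (Pt d)) E x := by
    intro x _
    exact ((((hasFDerivAt_id x).sub_const q).const_smul t).const_add q).hasFDerivWithinAt
  have hinj : Set.InjOn φ E := by
    intro x _ y _ hxy
    have : t • (x - q) = t • (y - q) := add_left_cancel hxy
    exact sub_left_injective (smul_right_injective _ ht0.ne' this)
  have h := lintegral_image_eq_lintegral_abs_det_fderiv_mul volume hm hder hinj g
  have hdet : (t • ContinuousLinearMap.id ℝ (Pt d)).det = t ^ d := by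
    rw [ContinuousLinearMap.det]
    simp [LinearMap.det_smul]
  have hsub : φ '' E ⊆ E := by
    rintro _ ⟨x, hx, rfl⟩
    exact hE.add_smul_sub_mem hq hx ⟨ht0.le, ht1⟩
  rw [hdet, lintegral_const_mul' _ _ ENNReal.ofReal_ne_top, abs_of_nonneg (by positivity)] at h
  have h1 : (1 : ℝ≥0∞) ≤ 2 ^ d * ENNReal.ofReal (t ^ d) := by
    rw [← ENNReal.ofReal_one, show (2 : ℝ≥0∞) = ENNReal.ofReal 2 by simp,
      ← ENNReal.ofReal_pow (by norm_num), ← ENNReal.ofReal_mul (by positivity), ← mul_pow]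
    exact ENNReal.ofReal_le_ofReal (one_le_pow₀ (by linarith))
  calc _ = 1 * ∫⁻ p in E, g (φ p) := (one_mul _).symm
    _ ≤ 2 ^ d * ENNReal.ofReal (t ^ d) * ∫⁻ p in E, g (φ p) := by gcongr
    _ = 2 ^ d * ∫⁻ x in φ '' E, g x := by rw [h, mul_assoc]
    _ ≤ _ := by gcongr

/-- For `t ≥ 1 / 2` this is the change of variables in `p`; otherwise the roles of `p` and `q` are
exchanged. -/
theorem lintegral_lintegral_segment_le {E : Set (Pt d)} (hE : Convex ℝ E) (hm : MeasurableSet E)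
    {g : Pt d → ℝ≥0∞} (hg : Measurable g) {t : ℝ} (ht0 : 0 ≤ t) (ht1 : t ≤ 1) :
    ∫⁻ p in E, ∫⁻ q in E, g (q + t • (p - q)) ≤ 2 ^ d * volume E * ∫⁻ x in E, g x := by
  have key : ∀ s : ℝ, 1 / 2 ≤ s → s ≤ 1 →
      ∫⁻ q in E, ∫⁻ p in E, g (q + s • (p - q)) ≤ 2 ^ d * volume E * ∫⁻ x in E, g x := by
    intro s hs hs1
    calc _ ≤ ∫⁻ q in E, 2 ^ d * ∫⁻ x in E, g x :=
          setLIntegral_mono' hm fun q hq => lintegral_comp_segment_le hE hm g hq hs hs1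
      _ = _ := by rw [setLIntegral_const]; ring
  rcases le_total (1 / 2) t with h | h
  · rw [lintegral_lintegral_swap]
    · exact key t h ht1
    · refine (hg.comp ?_).aemeasurable
      fun_prop
  · have := key (1 - t) (by linarith) (by linarith)
    have e : ∀ p q : Pt d, p + (1 - t) • (q - p) = q + t • (p - q) := by
      intro p q
      rw [sub_smul, one_smul, smul_sub, smul_sub]; abel
    simpa only [e] using this

/-- The Poincaré inequality on a convex set, in the form of a double integral. -/
theorem poincare_double {L : ℝ≥0} {w : Pt d → ℝ} (hw : LipschitzWith L w) {E : Set (Pt d)}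
    (hE : Convex ℝ E) (hm : MeasurableSet E) {D : ℝ}
    (hD : ∀ x ∈ E, ∀ y ∈ E, ‖x - y‖ ≤ D) :
    ∫⁻ p in E, ∫⁻ q in E, ENNReal.ofReal ((w p - w q) ^ 2) ≤
      ENNReal.ofReal (D ^ 2) *
        (2 ^ d * volume E * ∫⁻ x in E, ENNReal.ofReal (‖gradient w x‖ ^ 2)) := by
  have hg := measurable_gradSqBound L w
  have hF : ∫⁻ x in E, gradSqBound L w x = ∫⁻ x in E, ENNReal.ofReal (‖gradient w x‖ ^ 2) :=
    lintegral_congr_ae (ae_restrict_of_ae (gradSqBound_ae hw))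
  rw [← hF]
  calc _ ≤ ∫⁻ p in E, ∫⁻ q in E, ENNReal.ofReal (D ^ 2) *
        ∫⁻ t in Set.Ioc (0 : ℝ) 1, gradSqBound L w (q + t • (p - q)) := by
        refine setLIntegral_mono' hm fun p hp => setLIntegral_mono' hm fun q hq => ?_
        refine (sq_sub_le_lintegral_segment hw p q).trans ?_
        gcongr
        exact hD p hp q hq
    _ = ENNReal.ofReal (D ^ 2) * ∫⁻ p in E, ∫⁻ t in Set.Ioc (0 : ℝ) 1, ∫⁻ q in E,
          gradSqBound L w (q + t • (p - q)) := by
        simp only [lintegral_const_mul' _ _ ENNReal.ofReal_ne_top]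
        congr 1
        refine lintegral_congr fun p => ?_
        rw [lintegral_lintegral_swap]
        refine (hg.comp ?_).aemeasurable
        fun_prop
    _ = ENNReal.ofReal (D ^ 2) * ∫⁻ t in Set.Ioc (0 : ℝ) 1, ∫⁻ p in E, ∫⁻ q in E,
          gradSqBound L w (q + t • (p - q)) := by
        congr 1
        rw [lintegral_lintegral_swap]
        refine (Measurable.lintegral_prod_right' (f := fun z : (Pt d × ℝ) × Pt d =>
          gradSqBound L w (z.2 + z.1.2 • (z.1.1 - z.2))) (hg.comp ?_)).aemeasurable
        fun_prop
    _ ≤ ENNReal.ofReal (D ^ 2) * ∫⁻ t in Set.Ioc (0 : ℝ) 1,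
          2 ^ d * volume E * ∫⁻ x in E, gradSqBound L w x := by
        gcongr 1
        refine setLIntegral_mono' measurableSet_Ioc fun t ht => ?_
        exact lintegral_lintegral_segment_le hE hm hg ht.1.le ht.2
    _ = _ := by
        rw [setLIntegral_const]; simp

theorem lintegral_ofReal_sq {f : Pt d → ℝ} {E : Set (Pt d)}
    (hf : IntegrableOn (fun x => f x ^ 2) E volume) :
    ∫⁻ x in E, ENNReal.ofReal (f x ^ 2) = ENNReal.ofReal (∫ x in E, f x ^ 2) :=
  (ofReal_integral_eq_lintegral_ofReal hf (ae_of_all _ fun _ => sq_nonneg _)).symm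

/-- On a convex set `E`, the `L_2`-norm is controlled by the one on a part `E'` of `E` and by the
gradient. -/
theorem poincare_subset {L : ℝ≥0} {w : Pt d → ℝ} (hw : LipschitzWith L w) {E E' : Set (Pt d)}
    (hE : Convex ℝ E) (hm : MeasurableSet E) (hEE' : E' ⊆ E) {D : ℝ} (hb : Bornology.IsBounded E)
    (hD : ∀ x ∈ E, ∀ y ∈ E, ‖x - y‖ ≤ D) :
    volume.real E' * ∫ x in E, (w x) ^ 2 ≤ 2 * volume.real E * (∫ x in E', (w x) ^ 2) +
      2 ^ (d + 1) * D ^ 2 * volume.real E * ∫ x in E, ‖gradient w x‖ ^ 2 := by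
  have hfin : volume E ≠ ⊤ := hb.measure_lt_top.ne
  have hfin' : volume E' ≠ ⊤ := (hb.subset hEE').measure_lt_top.ne
  have hi := integrableOn_sq hw.continuous hb
  have hi' := integrableOn_sq hw.continuous (hb.subset hEE')
  have hig := integrableOn_gradient_sq hw hfin
  have h1 := poincare_double hw hE hm hD
  have hsplit : ∀ p q : Pt d, ENNReal.ofReal (w p ^ 2) ≤
      2 * ENNReal.ofReal (w q ^ 2) + 2 * ENNReal.ofReal ((w p - w q) ^ 2) := by
    intro p q
    rw [show (2 : ℝ≥0∞) = ENNReal.ofReal 2 by simp, ← ENNReal.ofReal_mul (by norm_num),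
      ← ENNReal.ofReal_mul (by norm_num), ← ENNReal.ofReal_add (by positivity) (by positivity)]
    apply ENNReal.ofReal_le_ofReal
    nlinarith [sq_nonneg (2 * w q - w p)]
  have h2 : volume E' * ∫⁻ p in E, ENNReal.ofReal (w p ^ 2) ≤
      2 * volume E * (∫⁻ q in E', ENNReal.ofReal (w q ^ 2)) +
      2 * ∫⁻ p in E, ∫⁻ q in E, ENNReal.ofReal ((w p - w q) ^ 2) := by
    have hmw : Measurable fun q => ENNReal.ofReal (w q ^ 2) :=
      (hw.continuous.measurable.pow_const 2).ennreal_ofReal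
    calc _ = ∫⁻ p in E, ∫⁻ q in E', ENNReal.ofReal (w p ^ 2) := by
          rw [← lintegral_const_mul' _ _ hfin']
          refine lintegral_congr fun p => ?_
          rw [setLIntegral_const, mul_comm]
      _ ≤ ∫⁻ p in E, ∫⁻ q in E', (2 * ENNReal.ofReal (w q ^ 2) +
            2 * ENNReal.ofReal ((w p - w q) ^ 2)) :=
          lintegral_mono fun p => lintegral_mono fun q => hsplit p q
      _ ≤ ∫⁻ p in E, (2 * (∫⁻ q in E', ENNReal.ofReal (w q ^ 2)) +
            2 * ∫⁻ q in E, ENNReal.ofReal ((w p - w q) ^ 2)) := by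
          refine lintegral_mono fun p => ?_
          rw [lintegral_add_left (hmw.const_mul 2), lintegral_const_mul' _ _ (by simp),
            lintegral_const_mul' _ _ (by simp)]
          gcongr
      _ = _ := by
          rw [lintegral_add_left measurable_const, setLIntegral_const,
            lintegral_const_mul' _ _ (by simp)]
          ring
  have h3 := h2.trans (add_le_add le_rfl (mul_le_mul_right h1 2))
  rw [lintegral_ofReal_sq hi, lintegral_ofReal_sq hi', lintegral_ofReal_sq hig] at h3
  have e1 : volume E = ENNReal.ofReal (volume.real E) := (ofReal_measureReal hfin).symm
  have e2 : volume E' = ENNReal.ofReal (volume.real E') := (ofReal_measureReal hfin').symm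
  have p1 : 0 ≤ volume.real E := measureReal_nonneg
  have p2 : 0 ≤ volume.real E' := measureReal_nonneg
  have p3 : 0 ≤ ∫ x in E, (w x) ^ 2 := integral_nonneg fun _ => sq_nonneg _
  have p4 : 0 ≤ ∫ x in E', (w x) ^ 2 := integral_nonneg fun _ => sq_nonneg _
  have p5 : 0 ≤ ∫ x in E, ‖gradient w x‖ ^ 2 := integral_nonneg fun _ => sq_nonneg _
  generalize (∫ x in E, (w x) ^ 2) = X at h3 p3 ⊢
  generalize (∫ x in E', (w x) ^ 2) = Y at h3 p4 ⊢
  generalize (∫ x in E, ‖gradient w x‖ ^ 2) = Z at h3 p5 ⊢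
  rw [e1, e2] at h3
  generalize volume.real E = a at h3 p1 ⊢
  generalize volume.real E' = b at h3 p2 ⊢
  rw [show (2 : ℝ≥0∞) = ENNReal.ofReal 2 by simp, ← ENNReal.ofReal_pow (by norm_num)] at h3
  have hD2 : 0 ≤ D ^ 2 := sq_nonneg D
  have h2d : (0 : ℝ) ≤ 2 ^ d := by positivity
  have e3 : ENNReal.ofReal (2 * a * Y + 2 * (D ^ 2 * (2 ^ d * a * Z))) =
      ENNReal.ofReal 2 * ENNReal.ofReal a * ENNReal.ofReal Y +
        ENNReal.ofReal 2 * (ENNReal.ofReal (D ^ 2) *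
          (ENNReal.ofReal (2 ^ d) * ENNReal.ofReal a * ENNReal.ofReal Z)) := by
    rw [ENNReal.ofReal_add (by positivity) (by positivity),
      ENNReal.ofReal_mul (by positivity : 0 ≤ 2 * a),
      ENNReal.ofReal_mul zero_le_two, ENNReal.ofReal_mul zero_le_two, ENNReal.ofReal_mul hD2,
      ENNReal.ofReal_mul (by positivity : 0 ≤ 2 ^ d * a), ENNReal.ofReal_mul h2d]
  rw [← e3, ← ENNReal.ofReal_mul p2, ENNReal.ofReal_le_ofReal_iff (by positivity)] at h3
  refine h3.trans (le_of_eq ?_)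
  ring

/-- The Poincaré inequality on a convex set. -/
theorem poincare_const {L : ℝ≥0} {w : Pt d → ℝ} (hw : LipschitzWith L w) {E : Set (Pt d)}
    (hE : Convex ℝ E) (hm : MeasurableSet E) {D : ℝ} (hb : Bornology.IsBounded E)
    (hD : ∀ x ∈ E, ∀ y ∈ E, ‖x - y‖ ≤ D) (hpos : 0 < volume.real E) :
    ∃ c, ∫ x in E, (w x - c) ^ 2 ≤ 2 ^ d * D ^ 2 * ∫ x in E, ‖gradient w x‖ ^ 2 := by
  have hfin : volume E ≠ ⊤ := hb.measure_lt_top.ne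
  have hig := integrableOn_gradient_sq hw hfin
  have h1 := poincare_double hw hE hm hD
  have hne : volume E ≠ 0 := fun h => by simp [measureReal_def, h] at hpos
  -- If the inequality fails for `c = w q` at every `q`, then integration over `q` contradicts the
  -- double integral form.
  by_contra! hcon
  have p5 : 0 ≤ ∫ x in E, ‖gradient w x‖ ^ 2 := integral_nonneg fun _ => sq_nonneg _
  rw [lintegral_lintegral_swap] at h1
  · have h2 : ∀ c, ENNReal.ofReal (2 ^ d * D ^ 2 * ∫ x in E, ‖gradient w x‖ ^ 2) <
        ∫⁻ p in E, ENNReal.ofReal ((w p - c) ^ 2) := by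
      intro c
      rw [lintegral_ofReal_sq (f := fun p => w p - c)
        (integrableOn_sq (hw.continuous.sub continuous_const) hb)]
      exact (ENNReal.ofReal_lt_ofReal_iff_of_nonneg (by positivity)).2 (hcon c)
    have h3 : ∫⁻ q in E, ENNReal.ofReal (2 ^ d * D ^ 2 * ∫ x in E, ‖gradient w x‖ ^ 2) <
        ∫⁻ q in E, ∫⁻ p in E, ENNReal.ofReal ((w p - w q) ^ 2) := by
      refine lintegral_strict_mono (by simpa using hne) ?_ ?_ (ae_of_all _ fun q => h2 (w q))
      · refine (Measurable.lintegral_prod_right' (f := fun z : Pt d × Pt d =>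
          ENNReal.ofReal ((w z.2 - w z.1) ^ 2)) ?_).aemeasurable
        have := hw.continuous.measurable
        fun_prop
      · rw [setLIntegral_const]
        exact ENNReal.mul_ne_top ENNReal.ofReal_ne_top hfin
    rw [setLIntegral_const] at h3
    refine absurd (h3.trans_le h1) (not_lt.2 (le_of_eq ?_))
    rw [lintegral_ofReal_sq hig, ENNReal.ofReal_mul (by positivity),
      ENNReal.ofReal_mul (by positivity),
      ENNReal.ofReal_pow (by norm_num : (0 : ℝ) ≤ 2), show ENNReal.ofReal 2 = 2 by simp]
    ring
  · have := hw.continuous.measurable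
    refine Measurable.aemeasurable ?_
    fun_prop

theorem gradient_congr {w w' : Pt d → ℝ} {x : Pt d} (h : w =ᶠ[nhds x] w') :
    gradient w x = gradient w' x := by
  rw [gradient, gradient, h.fderiv_eq]

theorem gradient_eq_zero {w : Pt d → ℝ} {x : Pt d} (h : w =ᶠ[nhds x] 0) : gradient w x = 0 := by
  rw [gradient_congr h]
  simp [gradient]

/-- The Friedrichs inequality on a simplex for functions that vanish on the face opposite to the
vertex `a`. The function is extended by zero across this face to the simplex that is twice as
large, with the same vertex `a`. -/
theorem friedrichs_face (hd : 1 ≤ d) {K : Finset (Pt d)} (hK : IsSimplex K) {a : Pt d} (ha : a ∈ K)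
    {L : ℝ≥0} {w : Pt d → ℝ} (hw : LipschitzWith L w) (hz : ∀ x ∈ hull (K.erase a), w x = 0) :
    ∫ x in hull K, (w x) ^ 2 ≤
      2 ^ (d + 1) * 4 * 2 ^ d * Metric.diam (hull K) ^ 2 * ∫ x in hull K, ‖gradient w x‖ ^ 2 := by
  set D := Metric.diam (hull K) with hD
  set E : Set (Pt d) := AffineMap.homothety a (2 : ℝ) '' hull K with hE
  have haK := subset_hull K ha
  have hKE : hull K ⊆ E := by
    intro x hx
    refine ⟨AffineMap.homothety a (1 / 2 : ℝ) x,
      homothety_subset haK (by norm_num) (by norm_num) ⟨x, hx, rfl⟩, ?_⟩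
    rw [← AffineMap.homothety_mul_apply]
    norm_num
  have hEconv : Convex ℝ E := (convex_hull K).affine_image _
  have hEcomp : IsCompact E := (isCompact_hull K).image (AffineMap.homothety_continuous _ _)
  have hcoord : ∀ x ∈ E, ∀ y ∈ K, y ≠ a → 0 ≤ coord K y x := by
    rintro _ ⟨x, hx, rfl⟩ y hy hya
    rw [AffineMap.homothety_eq_lineMap, AffineMap.apply_lineMap, AffineMap.lineMap_apply_ring,
      coord_of_ne hK ha hya]
    have := coord_nonneg hK (y := y) hx
    linarith
  have hEK : ∀ x ∈ E, 0 ≤ coord K a x → x ∈ hull K := by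
    intro x hx h0
    rw [mem_hull_iff hK]
    intro y hy
    rcases eq_or_ne y a with rfl | h
    · exact h0
    · exact hcoord x hx y hy h
  have hface : ∀ x ∈ E, coord K a x = 0 → w x = 0 := by
    intro x hx h0
    refine hz x (mem_hull_of_coord_eq_zero hK (Finset.erase_subset a K) (hEK x hx h0.ge) ?_)
    intro y hy hya
    have : y = a := by
      by_contra hne
      exact hya (Finset.mem_erase.2 ⟨hne, hy⟩)
    rw [this, h0]
  -- the extension by zero; a segment between the two parts crosses the face, where `w` vanishes
  let W₀ : Pt d → ℝ := fun x => if 0 ≤ coord K a x then w x else 0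
  have hcross : ∀ p ∈ E, ∀ q ∈ E, 0 ≤ coord K a p → coord K a q < 0 → |w p| ≤ L * ‖p - q‖ := by
    intro p hp q hq h1 h2
    have h3 : 0 < coord K a p - coord K a q := by linarith
    set t := coord K a p / (coord K a p - coord K a q) with ht
    have ht0 : 0 ≤ t := by positivity
    have ht1 : t ≤ 1 := by rw [ht, div_le_one h3]; linarith
    have hr : AffineMap.lineMap p q t ∈ E := hEconv.lineMap_mem hp hq ⟨ht0, ht1⟩
    have h4 : coord K a (AffineMap.lineMap p q t) = 0 := by
      rw [AffineMap.apply_lineMap, AffineMap.lineMap_apply_ring, ht]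
      field_simp
      ring
    have h5 := hw.dist_le_mul p (AffineMap.lineMap p q t)
    rw [hface _ hr h4, Real.dist_eq, sub_zero, dist_left_lineMap, Real.norm_of_nonneg ht0,
      dist_eq_norm] at h5
    refine h5.trans ?_
    gcongr
    nlinarith [norm_nonneg (p - q)]
  have hW₀ : LipschitzOnWith L W₀ E := by
    refine LipschitzOnWith.of_dist_le_mul fun p hp q hq => ?_
    rw [Real.dist_eq, dist_eq_norm]
    simp only [W₀]
    split_ifs with h1 h2 h2
    · rw [← Real.dist_eq, ← dist_eq_norm]
      exact hw.dist_le_mul p q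
    · rw [sub_zero]
      exact hcross p hp q hq h1 (not_le.1 h2)
    · rw [zero_sub, abs_neg, norm_sub_rev]
      exact hcross q hq p hp h2 (not_le.1 h1)
    · simp; positivity
  obtain ⟨W, hWL, hWE⟩ := hW₀.extend_real
  have hWK : ∀ x ∈ hull K, W x = w x := by
    intro x hx
    rw [← hWE (hKE hx)]
    exact if_pos (coord_nonneg hK hx)
  have hWz : ∀ x ∈ E \ hull K, W x = 0 := by
    intro x hx
    rw [← hWE hx.1]
    exact if_neg fun h => hx.2 (hEK x hx.1 h)
  have hEm : MeasurableSet E := hEcomp.measurableSet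
  have hdist : ∀ x ∈ E, ∀ y ∈ E, ‖x - y‖ ≤ 2 * D := by
    rintro _ ⟨x, hx, rfl⟩ _ ⟨y, hy, rfl⟩
    have e : AffineMap.homothety a (2 : ℝ) x - AffineMap.homothety a (2 : ℝ) y =
        (2 : ℝ) • (x - y) := by
      simp only [AffineMap.homothety_apply, vsub_eq_sub, vadd_eq_add, smul_sub]; abel
    rw [e, norm_smul, Real.norm_of_nonneg (by norm_num)]
    gcongr
    exact dist_le_diam hx hy
  have hmain := poincare_subset hWL hEconv hEm (Set.sdiff_subset : E \ hull K ⊆ E)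
    hEcomp.isBounded hdist
  have hvE : volume.real E = 2 ^ d * volume.real (hull K) := volume_homothety a (by norm_num) _
  have hvd : volume.real (E \ hull K) = volume.real E - volume.real (hull K) :=
    measureReal_sdiff hKE (measurableSet_hull K) hEcomp.measure_lt_top.ne
  have hVK := volume_hull_pos hK
  have h2d : (2 : ℝ) ≤ 2 ^ d := by
    calc (2 : ℝ) = 2 ^ 1 := (pow_one _).symm
      _ ≤ 2 ^ d := pow_le_pow_right₀ (by norm_num) hd
  have i1 : ∫ x in E \ hull K, (W x) ^ 2 = 0 := by
    rw [setIntegral_congr_fun (hEm.diff (measurableSet_hull K))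
      (g := fun _ => (0 : ℝ)) (fun x hx => by simp [hWz x hx])]
    simp
  have i2 : ∫ x in hull K, (w x) ^ 2 ≤ ∫ x in E, (W x) ^ 2 := by
    rw [← setIntegral_congr_fun (measurableSet_hull K) (f := fun x => (W x) ^ 2)
      (fun x hx => by simp [hWK x hx])]
    exact setIntegral_mono_set (integrableOn_sq hWL.continuous hEcomp.isBounded)
      (ae_of_all _ fun x => sq_nonneg _) hKE.eventuallyLE
  have i3 : ∫ x in E, ‖gradient W x‖ ^ 2 = ∫ x in hull K, ‖gradient w x‖ ^ 2 := by
    have g1 : ∀ x ∈ interior (hull K), ‖gradient W x‖ ^ 2 = ‖gradient w x‖ ^ 2 := by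
      intro x hx
      rw [gradient_congr]
      filter_upwards [isOpen_interior.mem_nhds hx] with y hy using hWK y (interior_subset hy)
    have g2 : ∀ x ∈ interior E \ hull K, ‖gradient W x‖ ^ 2 = 0 := by
      intro x hx
      rw [gradient_eq_zero, norm_zero, zero_pow two_ne_zero]
      filter_upwards [(isOpen_interior.sdiff (isClosed_hull K)).mem_nhds hx] with y hy
      exact hWz y ⟨interior_subset hy.1, hy.2⟩
    have g3 : ∫ x in E \ hull K, ‖gradient W x‖ ^ 2 = 0 := by
      have hae : (E \ hull K : Set (Pt d)) =ᵐ[volume] (interior E \ hull K : Set (Pt d)) :=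
        (interior_ae_eq_of_null_frontier (hEconv.addHaar_frontier volume)).symm.diff ae_eq_rfl
      rw [setIntegral_congr_set hae, setIntegral_congr_fun
        (isOpen_interior.measurableSet.diff (measurableSet_hull K)) (g := fun _ => (0 : ℝ)) g2]
      simp
    have hi := integrableOn_gradient_sq hWL hEcomp.measure_lt_top.ne
    rw [← Set.union_sdiff_cancel hKE, setIntegral_union Set.disjoint_sdiff_right
      (hEm.diff (measurableSet_hull K)) (hi.mono_set hKE) (hi.mono_set Set.sdiff_subset), g3,
      add_zero,
      ← setIntegral_congr_set (interior_ae_hull K), ← setIntegral_congr_set (interior_ae_hull K)]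
    exact setIntegral_congr_fun isOpen_interior.measurableSet g1
  rw [i1, i3, hvd, hvE] at hmain
  have p3 : 0 ≤ ∫ x in E, (W x) ^ 2 := integral_nonneg fun _ => sq_nonneg _
  have h4 : volume.real (hull K) * ∫ x in E, (W x) ^ 2 ≤ volume.real (hull K) *
      (2 ^ (d + 1) * 4 * 2 ^ d * D ^ 2 * ∫ x in hull K, ‖gradient w x‖ ^ 2) := by
    calc _ ≤ (2 ^ d * volume.real (hull K) - volume.real (hull K)) * ∫ x in E, (W x) ^ 2 := by
          gcongr
          nlinarith
      _ ≤ _ := hmain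
      _ = _ := by ring
  exact i2.trans (le_of_mul_le_mul_left h4 hVK)

/-- The Friedrichs inequality for Lipschitz functions that vanish outside a bounded set. It follows
by integration by parts of `v ^ 2` against a coordinate function. -/
theorem friedrichs (hd : 1 ≤ d) {Ω : Set (Pt d)} (hm : MeasurableSet Ω) (hΩ : Bornology.IsBounded Ω)
    {D : ℝ} (hD : Metric.diam Ω ≤ D) {L : ℝ≥0} {v : Pt d → ℝ} (hv : LipschitzWith L v)
    (hz : ∀ x, x ∉ Ω → v x = 0) :
    ∫ x in Ω, (v x) ^ 2 ≤ 4 * D ^ 2 * ∫ x in Ω, ‖gradient v x‖ ^ 2 := by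
  rcases Ω.eq_empty_or_nonempty with rfl | ⟨x₀, hx₀⟩
  · simp
  have hsupp : Function.support v ⊆ Ω := fun x hx => by
    by_contra h
    exact hx (hz x h)
  have hcs : HasCompactSupport v :=
    HasCompactSupport.of_support_subset_isCompact hΩ.isCompact_closure
      (hsupp.trans subset_closure)
  obtain ⟨M, hM⟩ := hcs.exists_bound_of_continuous hv.continuous
  have hM0 : 0 ≤ M := (norm_nonneg _).trans (hM x₀)
  set e : Pt d := EuclideanSpace.single ⟨0, hd⟩ 1 with he
  have hen : ‖e‖ = 1 := by simp [he]
  let f : Pt d → ℝ := fun x => ⟪e, x - x₀⟫_ℝ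
  have hf : LipschitzWith 1 f := by
    refine LipschitzWith.of_dist_le_mul fun x y => ?_
    simp only [f]
    rw [Real.dist_eq, ← inner_sub_right, dist_eq_norm]
    have := abs_real_inner_le_norm e (x - x₀ - (y - x₀))
    rw [hen, sub_sub_sub_cancel_right] at this
    simpa using this
  let g : Pt d → ℝ := fun x => v x * v x
  have hg : LipschitzWith (2 * M.toNNReal * L) g := by
    refine LipschitzWith.of_dist_le_mul fun x y => ?_
    have h1 := hv.dist_le_mul x y
    rw [Real.dist_eq] at h1 ⊢
    have h2 : v x * v x - v y * v y = (v x + v y) * (v x - v y) := by ring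
    have h3 : |v x + v y| ≤ 2 * M := by
      have := norm_add_le (v x) (v y)
      rw [Real.norm_eq_abs] at this
      linarith [hM x, hM y]
    simp only [g]
    rw [h2, abs_mul]
    push_cast
    rw [Real.coe_toNNReal _ hM0]
    calc _ ≤ (2 * M) * (L * dist x y) := by gcongr
      _ = _ := by ring
  have hgc : HasCompactSupport g := hcs.mul_right
  have hparts := LipschitzWith.integral_lineDeriv_mul_eq (μ := volume) hf hg hgc e
  have hfder : ∀ x, lineDeriv ℝ f x e = 1 := by
    intro x
    have h1 : HasFDerivAt f (innerSL ℝ e) x := by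
      have := (innerSL ℝ e).hasFDerivAt (x := x)
      have h2 : f = fun y => innerSL ℝ e y - ⟪e, x₀⟫_ℝ := by
        ext y; simp [f, inner_sub_right]
      rw [h2]
      exact this.sub_const _
    rw [(h1.hasLineDerivAt e).lineDeriv]
    simp [hen]
  simp only [hfder, one_mul] at hparts
  have hrestrict : ∀ F : Pt d → ℝ, (∀ x, x ∉ Ω → F x = 0) → ∫ x, F x = ∫ x in Ω, F x := by
    intro F hF
    exact (setIntegral_eq_integral_of_forall_compl_eq_zero hF).symm
  have e1 : ∫ x, g x = ∫ x in Ω, (v x) ^ 2 := by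
    rw [hrestrict _ (fun x hx => by simp [g, hz x hx])]
    simp [g, sq]
  have hi1 := integrableOn_sq hv.continuous hΩ
  have hi2 := integrableOn_gradient_sq hv (E := Ω) hΩ.measure_lt_top.ne
  have hbound : ∀ᵐ x ∂(volume : Measure (Pt d)), lineDeriv ℝ g x (-e) * f x ≤
      Ω.indicator (fun x => 1 / 2 * (v x) ^ 2 + 2 * D ^ 2 * ‖gradient v x‖ ^ 2) x := by
    filter_upwards [hv.ae_differentiableAt (μ := volume)] with x hx
    have h1 : HasFDerivAt g (v x • fderiv ℝ v x + v x • fderiv ℝ v x) x :=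
      hx.hasFDerivAt.mul hx.hasFDerivAt
    rw [(h1.hasLineDerivAt (-e)).lineDeriv]
    by_cases hxΩ : x ∈ Ω
    · rw [Set.indicator_of_mem hxΩ]
      have h2 : |fderiv ℝ v x (-e)| ≤ ‖gradient v x‖ := by
        rw [norm_gradient_eq]
        have := (fderiv ℝ v x).le_opNorm (-e)
        rwa [norm_neg, hen, mul_one] at this
      have h3 : |f x| ≤ D := by
        have h4 := abs_real_inner_le_norm e (x - x₀)
        rw [hen, one_mul, ← dist_eq_norm] at h4
        exact h4.trans ((Metric.dist_le_diam_of_mem hΩ hxΩ hx₀).trans hD)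
      simp only [add_apply, smul_apply, smul_eq_mul]
      have h5 : (v x * fderiv ℝ v x (-e) + v x * fderiv ℝ v x (-e)) * f x ≤
          2 * |v x| * (D * ‖gradient v x‖) := by
        have hD0 : 0 ≤ D := (abs_nonneg _).trans h3
        refine (le_abs_self _).trans ?_
        rw [← two_mul, abs_mul, abs_mul, abs_mul, abs_two]
        calc _ = 2 * |v x| * (|f x| * |fderiv ℝ v x (-e)|) := by ring
          _ ≤ _ := by gcongr
      have h6 := sq_nonneg (|v x| - 2 * (D * ‖gradient v x‖))
      have h7 := sq_abs (v x)
      nlinarith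
    · rw [Set.indicator_of_notMem hxΩ, hz x hxΩ]
      simp
  have hi3 : IntegrableOn (fun x => 1 / 2 * (v x) ^ 2 + 2 * D ^ 2 * ‖gradient v x‖ ^ 2) Ω volume :=
    (hi1.const_mul _).add (hi2.const_mul _)
  have h8 : ∫ x, g x ≤ ∫ x in Ω, (1 / 2 * (v x) ^ 2 + 2 * D ^ 2 * ‖gradient v x‖ ^ 2) := by
    rw [hparts, ← integral_indicator hm]
    -- In the non-integrable case the integral on the left is `0` by convention.
    by_cases hint : Integrable (fun x => lineDeriv ℝ g x (-e) * f x)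
    · exact integral_mono_ae hint (hi3.integrable_indicator hm) hbound
    · rw [integral_undef hint]
      exact integral_nonneg fun x => Set.indicator_nonneg (fun x _ => by positivity) x
  rw [e1, integral_add (hi1.const_mul _) (hi2.const_mul _), integral_const_mul,
    integral_const_mul] at h8
  linarith

end LOD

namespace LOD

open scoped InnerProductSpace NNReal ENNReal Topology

variable {d : ℕ} {Ω : Set (Pt d)}

/-! ### Cells of a triangulation -/

namespace Triangulation

variable (𝒯 : Triangulation Ω) {K K' K₁ K₂ : Finset (Pt d)}

theorem isSimplex (hK : K ∈ 𝒯.cells) : IsSimplex K := ⟨𝒯.complex.indep hK.1, hK.2⟩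

theorem finite_cells : 𝒯.cells.Finite := 𝒯.finite_faces.subset fun _ h => h.1

/-- The finite set of the cells of the mesh. -/
noncomputable def cellSet : Finset (Finset (Pt d)) := 𝒯.finite_cells.toFinset

theorem mem_cellSet : K ∈ 𝒯.cellSet ↔ K ∈ 𝒯.cells := Set.Finite.mem_toFinset _

theorem mem_hull_inter (hK : K ∈ 𝒯.cells) (hK' : K' ∈ 𝒯.cells) {x : Pt d} (hx : x ∈ hull K)
    (hx' : x ∈ hull K') : x ∈ hull (K ∩ K') := by
  have := 𝒯.complex.inter_subset_convexHull hK.1 hK'.1 ⟨hx, hx'⟩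
  rwa [← Finset.coe_inter] at this

theorem hull_subset_closure (hK : K ∈ 𝒯.cells) : hull K ⊆ closure Ω := by
  rw [← 𝒯.space_eq]
  exact 𝒯.complex.convexHull_subset_space hK.1

theorem exists_cell {x : Pt d} (hx : x ∈ closure Ω) : ∃ K ∈ 𝒯.cells, x ∈ hull K := by
  rw [← 𝒯.space_eq, Geometry.SimplicialComplex.mem_space_iff] at hx
  obtain ⟨s, hs, hxs⟩ := hx
  obtain ⟨K, hK, hc, hsK⟩ := 𝒯.pure s hs
  exact ⟨K, ⟨hK, hc⟩, hull_mono hsK hxs⟩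

theorem exists_cell_of_vertex {x : Pt d} (hx : x ∈ 𝒯.complex.vertices) : ∃ K ∈ 𝒯.cells, x ∈ K := by
  obtain ⟨K, hK, hc, hsK⟩ := 𝒯.pure _ hx
  exact ⟨K, ⟨hK, hc⟩, hsK (Finset.mem_singleton_self x)⟩

theorem vertex_of_mem_cell {x : Pt d} (hK : K ∈ 𝒯.cells) (hx : x ∈ K) : x ∈ 𝒯.complex.vertices :=
  𝒯.complex.down_closed hK.1 (Finset.singleton_subset_iff.2 hx) (Finset.singleton_nonempty x)

theorem finite_vertices : 𝒯.complex.vertices.Finite := by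
  refine (𝒯.finite_cells.biUnion fun K _ => K.finite_toSet).subset fun x hx => ?_
  obtain ⟨K, hK, hxK⟩ := 𝒯.exists_cell_of_vertex hx
  exact Set.mem_biUnion hK hxK

theorem mem_of_coord_ne_zero (hK : K ∈ 𝒯.cells) (hK' : K' ∈ 𝒯.cells) {x y : Pt d}
    (hx : x ∈ hull K) (hx' : x ∈ hull K') (h : coord K y x ≠ 0) : y ∈ K' := by
  by_contra hy
  exact h (coord_eq_zero_of_mem_hull (𝒯.isSimplex hK) Finset.inter_subset_left
    (𝒯.mem_hull_inter hK hK' hx hx') (fun h => hy (Finset.mem_inter.1 h).2))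

theorem mem_of_mem_hull (hK : K ∈ 𝒯.cells) (hK' : K' ∈ 𝒯.cells) {y : Pt d}
    (hy : y ∈ K) (hy' : y ∈ hull K') : y ∈ K' := by
  refine 𝒯.mem_of_coord_ne_zero hK hK' (subset_hull K hy) hy' (y := y) ?_
  rw [coord_self (𝒯.isSimplex hK) hy]
  exact one_ne_zero

theorem coord_congr (hK : K ∈ 𝒯.cells) (hK' : K' ∈ 𝒯.cells) {x : Pt d}
    (hx : x ∈ hull K) (hx' : x ∈ hull K') (y : Pt d) : coord K y x = coord K' y x := by
  by_cases hy : y ∈ K ∩ K'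
  · have hy := Finset.mem_inter.1 hy
    have h := affine_eq_sum (𝒯.isSimplex hK) (coord K' y) x
    rw [h, Finset.sum_eq_single y]
    · rw [coord_self (𝒯.isSimplex hK') hy.2, mul_one]
    · intro z hz hzy
      by_cases h0 : coord K z x = 0
      · rw [h0, zero_mul]
      · rw [coord_of_ne (𝒯.isSimplex hK') (𝒯.mem_of_coord_ne_zero hK hK' hx hx' h0) hzy.symm,
            mul_zero]
    · exact fun h => absurd hy.1 h
  · have hs := 𝒯.mem_hull_inter hK hK' hx hx'
    rw [coord_eq_zero_of_mem_hull (𝒯.isSimplex hK) Finset.inter_subset_left hs hy,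
      coord_eq_zero_of_mem_hull (𝒯.isSimplex hK') Finset.inter_subset_right hs hy]

theorem eq_of_mem_interior (hK : K ∈ 𝒯.cells) (hK' : K' ∈ 𝒯.cells) {x : Pt d}
    (hx : x ∈ interior (hull K)) (hx' : x ∈ hull K') : K = K' := by
  refine Finset.eq_of_subset_of_card_le (fun y hy => ?_) (by rw [hK.2, hK'.2])
  exact 𝒯.mem_of_coord_ne_zero hK hK' (interior_subset hx) hx'
    ((mem_interior_hull_iff (𝒯.isSimplex hK)).1 hx y hy).ne'

theorem interior_hull_subset (hΩ : IsBoundedDomain Ω) (hK : K ∈ 𝒯.cells) :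
    interior (hull K) ⊆ Ω := by
  rw [← hΩ.interior_closure]
  exact interior_mono (𝒯.hull_subset_closure hK)

/-- Near a point `x`, there are only cells that contain `x`. -/
theorem eventually_mem_hull (x : Pt d) : ∀ᶠ y in 𝓝 x, ∀ K ∈ 𝒯.cells, y ∈ hull K → x ∈ hull K := by
  rw [Filter.eventually_all_finite 𝒯.finite_cells]
  intro K _
  by_cases h : x ∈ hull K
  · exact Filter.Eventually.of_forall fun _ _ => h
  · filter_upwards [(isClosed_hull K).isOpen_compl.mem_nhds h] with y hy hy'
    exact absurd hy' hy

/-- A point of a cell with a positive barycentric coordinate for an interior node is an interior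
point of the domain: near this point the mesh looks as near a point close to the node. -/
theorem mem_domain_of_coord_pos (hΩ : IsBoundedDomain Ω) (hK : K ∈ 𝒯.cells) {x z : Pt d}
    (hz : z ∈ K) (hzΩ : z ∈ Ω) (hx : x ∈ hull K) (hpos : 0 < coord K z x) : x ∈ Ω := by
  have hKs := 𝒯.isSimplex hK
  have hlim : Filter.Tendsto (fun ε : ℝ => AffineMap.lineMap z x ε) (𝓝[>] 0) (𝓝 z) := by
    have : Continuous (fun ε : ℝ => AffineMap.lineMap z x ε) := AffineMap.lineMap_continuous
    have h2 := this.tendsto 0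
    rw [AffineMap.lineMap_apply_zero] at h2
    exact h2.mono_left nhdsWithin_le_nhds
  -- For a small `ε` the point `z + ε (x - z)` lies in the domain and in the relative interior of
  -- the same face as `x`. For `y` near `x`, an element that contains `z + ε (y - z)` therefore
  -- contains `x` and `z`, and then `y` as well.
  obtain ⟨ε, hεΩ, hε0, hε1⟩ := ((hlim.eventually (hΩ.isOpen.mem_nhds hzΩ)).and
    ((Ioo_mem_nhdsGT (zero_lt_one : (0 : ℝ) < 1)))).exists
  have hcont : Continuous (fun y : Pt d => AffineMap.lineMap z y ε) := by
    simp only [AffineMap.lineMap_apply_module]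
    fun_prop
  have hev1 : ∀ᶠ y in 𝓝 x, AffineMap.lineMap z y ε ∈ Ω :=
    hcont.continuousAt.eventually (hΩ.isOpen.mem_nhds hεΩ)
  have hev2 := hcont.continuousAt.eventually (𝒯.eventually_mem_hull (AffineMap.lineMap z x ε))
  have hev3 : ∀ᶠ y in 𝓝 x, ∀ K' ∈ 𝒯.cells, x ∈ hull K' → 0 < coord K' z y := by
    rw [Filter.eventually_all_finite 𝒯.finite_cells]
    intro K' hK'
    by_cases h : x ∈ hull K'
    · have h1 : 0 < coord K' z x := by rwa [← 𝒯.coord_congr hK hK' hx h]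
      filter_upwards [(continuous_affine (coord K' z)).continuousAt.eventually (lt_mem_nhds h1)]
        with y hy _ using hy
    · exact Filter.Eventually.of_forall fun _ h' => absurd h' h
  rw [← hΩ.interior_closure, mem_interior_iff_mem_nhds]
  filter_upwards [hev1, hev2, hev3] with y h1 h2 h3
  obtain ⟨K', hK', hyK'⟩ := 𝒯.exists_cell (subset_closure h1)
  have hK's := 𝒯.isSimplex hK'
  have hxε := h2 K' hK' hyK'
  have hxεK : AffineMap.lineMap z x ε ∈ hull K :=
    (convex_hull K).lineMap_mem (subset_hull K hz) hx ⟨hε0.le, hε1.le⟩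
  have hsub : ∀ v ∈ K, coord K v x ≠ 0 → v ∈ K' := by
    intro v hv hne
    refine 𝒯.mem_of_coord_ne_zero hK hK' hxεK hxε (y := v) (ne_of_gt ?_)
    rw [AffineMap.apply_lineMap, AffineMap.lineMap_apply_ring]
    have h4 : 0 < coord K v x := (coord_nonneg hKs hx).lt_of_ne hne.symm
    have h5 : 0 ≤ coord K v z := coord_nonneg hKs (subset_hull K hz)
    have h6 : 0 < 1 - ε := by linarith
    positivity
  have hxK' : x ∈ hull K' := by
    refine hull_mono (Finset.inter_subset_right (s₁ := K)) (mem_hull_of_coord_eq_zero hKs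
      Finset.inter_subset_left hx fun v hv hv' => ?_)
    by_contra hne
    exact hv' (Finset.mem_inter.2 ⟨hv, hsub v hv hne⟩)
  have hzK' := hsub z hz hpos.ne'
  refine 𝒯.hull_subset_closure hK' ((mem_hull_iff hK's).2 fun v hv => ?_)
  rcases eq_or_ne v z with rfl | hvz
  · exact (h3 K' hK' hxK').le
  · have h4 := coord_nonneg hK's (y := v) hyK'
    rw [AffineMap.apply_lineMap, AffineMap.lineMap_apply_ring, coord_of_ne hK's hzK' hvz, mul_zero,
      zero_add] at h4
    exact nonneg_of_mul_nonneg_right h4 hε0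

/-! ### Integrals over unions of cells -/

theorem closure_eq : closure Ω = ⋃ K ∈ 𝒯.cellSet, hull K := by
  ext x
  simp only [Set.mem_iUnion, mem_cellSet, exists_prop]
  exact ⟨𝒯.exists_cell, fun ⟨K, hK, hx⟩ => 𝒯.hull_subset_closure hK hx⟩

theorem ae_eq_iUnion (hΩ : IsBoundedDomain Ω) :
    Ω =ᵐ[volume] (⋃ K ∈ 𝒯.cellSet, hull K : Set (Pt d)) := by
  have h1 : volume (closure Ω \ Ω) = 0 := by
    have h2 : closure Ω \ Ω ⊆ ⋃ K ∈ 𝒯.cellSet, frontier (hull K) := by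
      rintro x ⟨hx, hxΩ⟩
      obtain ⟨K, hK, hxK⟩ := 𝒯.exists_cell hx
      refine Set.mem_biUnion (𝒯.mem_cellSet.2 hK) ⟨subset_closure hxK, fun h => hxΩ ?_⟩
      exact 𝒯.interior_hull_subset hΩ hK h
    refine measure_mono_null h2 ?_
    exact (measure_biUnion_null_iff (Finset.countable_toSet 𝒯.cellSet)).2
      fun K _ => (convex_hull K).addHaar_frontier volume
  rw [← 𝒯.closure_eq]
  exact (subset_closure.eventuallyLE).antisymm (ae_le_set.2 h1)

theorem setIntegral_iUnion {S : Finset (Finset (Pt d))} (hS : ∀ K ∈ S, K ∈ 𝒯.cells)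
    {f : Pt d → ℝ} (hf : ∀ K ∈ S, IntegrableOn f (hull K) volume) :
    ∫ x in ⋃ K ∈ S, hull K, f x = ∑ K ∈ S, ∫ x in hull K, f x := by
  have hae : (⋃ K ∈ S, hull K : Set (Pt d)) =ᵐ[volume]
      (⋃ K ∈ S, interior (hull K) : Set (Pt d)) := by
    refine Filter.EventuallyEq.symm ?_
    have : ∀ K ∈ S, (interior (hull K) : Set (Pt d)) =ᵐ[volume] hull K :=
      fun K _ => interior_ae_hull K
    exact Filter.EventuallyEq.countable_bUnion (Finset.countable_toSet S) this
  rw [setIntegral_congr_set hae, integral_biUnion_finset S]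
  · exact Finset.sum_congr rfl fun K _ => setIntegral_congr_set (interior_ae_hull K)
  · exact fun K _ => isOpen_interior.measurableSet
  · intro K hK K' hK' hne
    refine Set.disjoint_left.2 fun x hx hx' => hne ?_
    exact 𝒯.eq_of_mem_interior (hS K hK) (hS K' hK') hx (interior_subset hx')
  · exact fun K hK => (hf K hK).mono_set interior_subset

theorem setIntegral_domain (hΩ : IsBoundedDomain Ω) {f : Pt d → ℝ}
    (hf : ∀ K ∈ 𝒯.cellSet, IntegrableOn f (hull K) volume) :
    ∫ x in Ω, f x = ∑ K ∈ 𝒯.cellSet, ∫ x in hull K, f x := by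
  rw [setIntegral_congr_set (𝒯.ae_eq_iUnion hΩ)]
  exact 𝒯.setIntegral_iUnion (fun K hK => 𝒯.mem_cellSet.1 hK) hf

/-! ### Pairs of cells with a common face -/

/-- Around a point of their common face, two neighbouring cells cover everything. The reflection of
`y` at the point `r` of the face lies in both cells if `y` lies in none of them. -/
theorem mem_union_of_coord_nonneg (hK₁ : K₁ ∈ 𝒯.cells) (hK₂ : K₂ ∈ 𝒯.cells)
    (hcard : (K₁ ∩ K₂).card = d) {r y : Pt d} (hr : r ∈ hull (K₁ ∩ K₂))
    (h₁ : ∀ v ∈ K₁ ∩ K₂, 0 ≤ coord K₁ v y ∧ 0 ≤ coord K₁ v (AffineMap.lineMap y r (2 : ℝ)))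
    (h₂ : ∀ v ∈ K₁ ∩ K₂, 0 ≤ coord K₂ v y ∧ 0 ≤ coord K₂ v (AffineMap.lineMap y r (2 : ℝ))) :
    y ∈ hull K₁ ∪ hull K₂ := by
  have hs₁ := 𝒯.isSimplex hK₁
  have hs₂ := 𝒯.isSimplex hK₂
  have key : ∀ K : Finset (Pt d), IsSimplex K → K₁ ∩ K₂ ⊆ K →
      (∀ v ∈ K₁ ∩ K₂, 0 ≤ coord K v y ∧ 0 ≤ coord K v (AffineMap.lineMap y r (2 : ℝ))) →
      y ∉ hull K → ∃ a ∈ K, a ∉ K₁ ∩ K₂ ∧ 0 < coord K a (AffineMap.lineMap y r (2 : ℝ)) ∧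
        AffineMap.lineMap y r (2 : ℝ) ∈ hull K := by
    intro K hK hsub h hy
    -- Outside `K`, only the coordinate of the vertex `a` opposite to the face can be negative,
    -- and the reflection changes its sign.
    have hc : (K \ (K₁ ∩ K₂)).card = 1 := by
      rw [Finset.card_sdiff_of_subset hsub, hcard, hK.2]; omega
    obtain ⟨a, ha⟩ := Finset.card_eq_one.1 hc
    have ha' : a ∈ K ∧ a ∉ K₁ ∩ K₂ := Finset.mem_sdiff.1 (ha ▸ Finset.mem_singleton_self a)
    have hor : ∀ v ∈ K, v ∈ K₁ ∩ K₂ ∨ v = a := by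
      intro v hv
      by_cases hvs : v ∈ K₁ ∩ K₂
      · exact Or.inl hvs
      · right
        have : v ∈ K \ (K₁ ∩ K₂) := Finset.mem_sdiff.2 ⟨hv, hvs⟩
        rw [ha] at this
        exact Finset.mem_singleton.1 this
    have hneg : coord K a y < 0 := by
      by_contra hn
      refine hy ((mem_hull_iff hK).2 fun v hv => ?_)
      rcases hor v hv with hv' | rfl
      · exact (h v hv').1
      · exact not_lt.1 hn
    have hposa : 0 < coord K a (AffineMap.lineMap y r (2 : ℝ)) := by
      rw [AffineMap.apply_lineMap, AffineMap.lineMap_apply_ring,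
        coord_eq_zero_of_mem_hull hK hsub hr ha'.2]
      linarith
    refine ⟨a, ha'.1, ha'.2, hposa, (mem_hull_iff hK).2 fun v hv => ?_⟩
    rcases hor v hv with hv' | rfl
    · exact (h v hv').2
    · exact hposa.le
  by_contra hy
  rw [Set.mem_union, not_or] at hy
  obtain ⟨a, _, ha, hpos, hm₁⟩ := key K₁ hs₁ Finset.inter_subset_left h₁ hy.1
  obtain ⟨_, _, _, _, hm₂⟩ := key K₂ hs₂ Finset.inter_subset_right h₂ hy.2
  exact hpos.ne' (coord_eq_zero_of_mem_hull hs₁ Finset.inter_subset_left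
    (𝒯.mem_hull_inter hK₁ hK₂ hm₁ hm₂) ha)

theorem union_mem_nhds (hK₁ : K₁ ∈ 𝒯.cells) (hK₂ : K₂ ∈ 𝒯.cells)
    (hcard : (K₁ ∩ K₂).card = d) {r : Pt d} (hr : r ∈ hull (K₁ ∩ K₂))
    (hpos : ∀ v ∈ K₁ ∩ K₂, 0 < coord K₁ v r) : hull K₁ ∪ hull K₂ ∈ 𝓝 r := by
  have key : ∀ K ∈ 𝒯.cells, (∀ v ∈ K₁ ∩ K₂, 0 < coord K v r) → ∀ᶠ y in 𝓝 r,
      ∀ v ∈ K₁ ∩ K₂, 0 ≤ coord K v y ∧ 0 ≤ coord K v (AffineMap.lineMap y r (2 : ℝ)) := by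
    intro K _ h
    rw [Filter.eventually_all_finset]
    intro v hv
    have h1 := (continuous_affine (coord K v)).continuousAt.eventually (lt_mem_nhds (h v hv))
    have hc : Continuous (fun y : Pt d => AffineMap.lineMap y r (2 : ℝ)) := by
      simp only [AffineMap.lineMap_apply_module]
      fun_prop
    have h2 := hc.tendsto r
    rw [AffineMap.lineMap_same_apply] at h2
    filter_upwards [h1, h2.eventually h1] with y a b using ⟨a.le, b.le⟩
  have hr₁ := hull_mono Finset.inter_subset_left hr
  have hr₂ := hull_mono Finset.inter_subset_right hr
  filter_upwards [key K₁ hK₁ hpos, key K₂ hK₂ (fun v hv => by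
    rw [← 𝒯.coord_congr hK₁ hK₂ hr₁ hr₂]; exact hpos v hv)] with y h1 h2
  exact 𝒯.mem_union_of_coord_nonneg hK₁ hK₂ hcard hr h1 h2

/-! ### Face-connected components of vertex stars -/

/-- `K₁` and `K₂` are different cells with the common vertex `z` that share a `(d - 1)`-face. -/
def FaceAdj (z : Pt d) (K₁ K₂ : Finset (Pt d)) : Prop :=
  K₁ ∈ 𝒯.cells ∧ K₂ ∈ 𝒯.cells ∧ z ∈ K₁ ∧ z ∈ K₂ ∧ (K₁ ∩ K₂).card = d

theorem reach_mem {z : Pt d} (hK : K ∈ 𝒯.cells) (hz : z ∈ K)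
    (h : Relation.ReflTransGen (𝒯.FaceAdj z) K K') : K' ∈ 𝒯.cells ∧ z ∈ K' := by
  induction h with
  | refl => exact ⟨hK, hz⟩
  | tail _ h _ => exact ⟨h.2.1, h.2.2.2.1⟩

/-- The face-connected component of a cell in the star of its vertex `z` contains a face through
`z` that belongs to one cell only, or it is a neighbourhood of `z`. A generic segment that leaves
the component does not meet faces of codimension at least `2`, so it leaves through a
`(d - 1)`-face. -/
theorem exists_boundary_face_or_mem_nhds {z : Pt d} (hK : K ∈ 𝒯.cells) (hz : z ∈ K) :
    (∃ K₁, Relation.ReflTransGen (𝒯.FaceAdj z) K K₁ ∧ ∃ a ∈ K₁, z ∈ K₁.erase a ∧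
      ∀ K₂ ∈ 𝒯.cells, K₁.erase a ⊆ K₂ → K₂ = K₁) ∨
    (⋃ K₁ ∈ {K₁ | Relation.ReflTransGen (𝒯.FaceAdj z) K K₁}, hull K₁) ∈ 𝓝 z := by
  by_contra! hcon
  obtain ⟨hnoface, hnhds⟩ := hcon
  set 𝒞 := {K₁ | Relation.ReflTransGen (𝒯.FaceAdj z) K K₁} with h𝒞
  have h𝒞fin : 𝒞.Finite := 𝒯.finite_cells.subset fun K₁ h => (𝒯.reach_mem hK hz h).1
  set G := ⋃ K₁ ∈ 𝒞, hull K₁ with hG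
  have hGclosed : IsClosed G := h𝒞fin.isClosed_biUnion fun K₁ _ => isClosed_hull K₁
  -- a ball around `z` that meets only faces containing `z`
  have hU : ∀ᶠ y in 𝓝 z, ∀ K₁ ∈ 𝒯.cells, ∀ s ∈ K₁.powerset, z ∉ s → y ∉ hull s := by
    rw [Filter.eventually_all_finite 𝒯.finite_cells]
    intro K₁ hK₁
    rw [Filter.eventually_all_finset]
    intro s hs
    by_cases hzs : z ∈ s
    · exact Filter.Eventually.of_forall fun _ h => absurd hzs h
    · have hzs' : z ∉ hull s := by
        intro h
        have h1 := 𝒯.mem_of_mem_hull hK hK₁ hz (hull_mono (Finset.mem_powerset.1 hs) h)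
        have h2 := coord_eq_zero_of_mem_hull (𝒯.isSimplex hK₁) (Finset.mem_powerset.1 hs) h hzs
        rw [coord_self (𝒯.isSimplex hK₁) h1] at h2
        exact one_ne_zero h2
      filter_upwards [(isClosed_hull s).isOpen_compl.mem_nhds hzs'] with y hy _ using hy
  obtain ⟨ρ, hρ, hball⟩ := Metric.eventually_nhds_iff_ball.1 hU
  obtain ⟨q, hq, hqG⟩ : ∃ q ∈ Metric.ball z ρ, q ∉ G := by
    by_contra! h
    exact hnhds (Filter.mem_of_superset (Metric.ball_mem_nhds z hρ) h)
  -- a generic starting point in `K`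
  obtain ⟨p, ⟨hpK, hpU⟩, hpgen⟩ : ∃ p, p ∈ interior (hull K) ∩ Metric.ball z ρ ∧
      ∀ K₁ ∈ 𝒯.cells, ∀ s ∈ K₁.powerset, s.card < d →
        p ∉ affineSpan ℝ (insert q (s : Set (Pt d))) := by
    have hne : (interior (hull K) ∩ Metric.ball z ρ).Nonempty := by
      have hzc : z ∈ closure (interior (hull K)) := by
        rw [closure_interior_hull (𝒯.isSimplex hK)]
        exact subset_hull K hz
      obtain ⟨y, hy1, hy2⟩ := mem_closure_iff.1 hzc _ Metric.isOpen_ball (Metric.mem_ball_self hρ)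
      exact ⟨y, hy2, hy1⟩
    have hpos := (isOpen_interior.inter Metric.isOpen_ball).measure_pos volume hne
    have hnull : volume (⋃ K₁ ∈ 𝒯.cellSet, ⋃ s ∈ K₁.powerset.filter (fun s => s.card < d),
        (affineSpan ℝ (insert q (s : Set (Pt d))) : Set (Pt d))) = 0 := by
      refine (measure_biUnion_null_iff (Finset.countable_toSet 𝒯.cellSet)).2 fun K₁ _ =>
        (measure_biUnion_null_iff (Finset.countable_toSet _)).2 fun s hs => ?_
      have hs := (Finset.mem_filter.1 (Finset.mem_coe.1 hs)).2
      refine Measure.addHaar_affineSubspace volume _ fun htop => ?_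
      have h1 : Module.finrank ℝ (vectorSpan ℝ (insert q (s : Set (Pt d)))) < d := by
        have hpos' := Finset.card_pos.2 (Finset.insert_nonempty q s)
        have h2 := finrank_vectorSpan_image_finset_le ℝ (id : Pt d → Pt d) (insert q s)
          (n := (insert q s).card - 1) (by omega)
        have h3 := Finset.card_insert_le q s
        rw [Finset.image_id, Finset.coe_insert] at h2
        omega
      rw [← direction_affineSpan, htop, AffineSubspace.direction_top, finrank_top] at h1
      simp at h1
    by_contra! hall
    refine hpos.ne' (measure_mono_null (fun p hp => ?_) hnull)
    obtain ⟨K₁, hK₁, s, hs, hsd, hps⟩ := hall p hp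
    exact Set.mem_biUnion (𝒯.mem_cellSet.2 hK₁)
      (Set.mem_biUnion (Finset.mem_coe.2 (Finset.mem_filter.2 ⟨hs, hsd⟩)) hps)
  -- the last point of the segment in the component
  set A := Set.Icc (0 : ℝ) 1 ∩ (fun t : ℝ => AffineMap.lineMap p q t) ⁻¹' G with hA
  have hlc : Continuous (fun t : ℝ => AffineMap.lineMap p q t) := AffineMap.lineMap_continuous
  have hAc : IsCompact A := isCompact_Icc.inter_right (hGclosed.preimage hlc)
  have hKG : hull K ⊆ G := Set.subset_biUnion_of_mem (u := hull) Relation.ReflTransGen.refl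
  have hA0 : (0 : ℝ) ∈ A :=
    ⟨⟨le_rfl, zero_le_one⟩, by
      rw [Set.mem_preimage, AffineMap.lineMap_apply_zero]; exact hKG (interior_subset hpK)⟩
  obtain ⟨t, htA, htmax⟩ := hAc.exists_isGreatest ⟨0, hA0⟩
  have ht1 : t < 1 := by
    refine lt_of_le_of_ne htA.1.2 fun h => hqG ?_
    have := htA.2
    rwa [Set.mem_preimage, h, AffineMap.lineMap_apply_one] at this
  set r := AffineMap.lineMap p q t with hr
  have hnotnhds : ∀ V ∈ 𝓝 r, V ⊆ G → False := by
    intro V hV hVG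
    have h1 : ∀ᶠ t' in 𝓝[>] t, AffineMap.lineMap p q t' ∈ V :=
      (hlc.tendsto t).mono_left nhdsWithin_le_nhds hV
    obtain ⟨t', h2, h3, h4⟩ := (h1.and (Ioo_mem_nhdsGT ht1)).exists
    exact absurd (htmax ⟨⟨htA.1.1.trans h3.le, h4.le⟩, hVG h2⟩) (not_le.2 h3)
  obtain ⟨K₁, hK₁𝒞, hrK₁⟩ := Set.mem_iUnion₂.1 htA.2
  have hrK₁ : r ∈ hull K₁ := hrK₁
  obtain ⟨hK₁, hzK₁⟩ := 𝒯.reach_mem hK hz hK₁𝒞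
  have hs₁ := 𝒯.isSimplex hK₁
  set s := K₁.filter (fun v => 0 < coord K₁ v r) with hs
  have hsK₁ : s ⊆ K₁ := Finset.filter_subset _ _
  have hrs : r ∈ hull s := by
    refine mem_hull_of_coord_eq_zero hs₁ hsK₁ hrK₁ fun v hv hvs => ?_
    by_contra hne
    exact hvs (Finset.mem_filter.2 ⟨hv, (coord_nonneg hs₁ hrK₁).lt_of_ne (Ne.symm hne)⟩)
  have hrU : r ∈ Metric.ball z ρ := (convex_ball z ρ).lineMap_mem hpU hq htA.1
  have hzs : z ∈ s := by
    by_contra h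
    exact hball r hrU K₁ hK₁ s (Finset.mem_powerset.2 hsK₁) h hrs
  have hscard : d ≤ s.card := by
    by_contra hlt
    refine hpgen K₁ hK₁ s (Finset.mem_powerset.2 hsK₁) (not_le.1 hlt) ?_
    have hq' : q ∈ affineSpan ℝ (insert q (s : Set (Pt d))) :=
      mem_affineSpan ℝ (Set.mem_insert _ _)
    have hr' : r ∈ affineSpan ℝ (insert q (s : Set (Pt d))) :=
      affineSpan_mono ℝ (Set.subset_insert _ _) (convexHull_subset_affineSpan _ hrs)
    have hpr : p = AffineMap.lineMap q r (1 / (1 - t)) := by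
      have h1 : (1 - t) ≠ 0 := by linarith
      rw [hr]
      simp only [AffineMap.lineMap_apply_module]
      have e1 : 1 - 1 / (1 - t) = -(t / (1 - t)) := by field_simp; ring
      rw [e1, smul_add, smul_smul, smul_smul, one_div_mul_cancel h1, one_smul, neg_smul,
        one_div_mul_eq_div]
      abel
    rw [hpr]
    exact AffineMap.lineMap_mem _ hq' hr'
  -- `s` is the vertex set of the smallest face of `K₁` that contains `r`: it is all of `K₁`, or a
  -- `(d - 1)`-face, across which there is another element.
  rcases eq_or_ne s K₁ with hsEq | hsNe
  · refine hnotnhds (interior (hull K₁)) (isOpen_interior.mem_nhds ?_)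
      (interior_subset.trans (Set.subset_biUnion_of_mem (u := hull) hK₁𝒞))
    rw [mem_interior_hull_iff hs₁]
    intro y hy
    rw [← hsEq] at hy
    exact (Finset.mem_filter.1 hy).2
  · have hlt := Finset.card_lt_card (hsK₁.ssubset_of_ne hsNe)
    rw [hs₁.2] at hlt
    have hsd : s.card = d := by omega
    have hc1 : (K₁ \ s).card = 1 := by
      rw [Finset.card_sdiff_of_subset hsK₁, hs₁.2, hsd]; omega
    obtain ⟨a, ha⟩ := Finset.card_eq_one.1 hc1
    have ha' := Finset.mem_sdiff.1 (ha ▸ Finset.mem_singleton_self a : a ∈ K₁ \ s)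
    have hse : K₁.erase a = s := by
      rw [← Finset.sdiff_singleton_eq_erase, ← ha, Finset.sdiff_sdiff_eq_self hsK₁]
    obtain ⟨K₂, hK₂, hsub, hne⟩ := hnoface K₁ hK₁𝒞 a ha'.1 (hse ▸ hzs)
    rw [hse] at hsub
    have hinter : K₁ ∩ K₂ = s := by
      refine (Finset.eq_of_subset_of_card_le (Finset.subset_inter hsK₁ hsub) ?_).symm
      rw [hsd]
      by_contra hgt
      have h1 : K₁ ∩ K₂ = K₁ := Finset.eq_of_subset_of_card_le Finset.inter_subset_left
        (by rw [hs₁.2]; omega)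
      refine hne (Finset.eq_of_subset_of_card_le ?_ (by rw [hK₂.2, hK₁.2])).symm
      intro v hv
      rw [← h1] at hv
      exact (Finset.mem_inter.1 hv).2
    have hadj : 𝒯.FaceAdj z K₁ K₂ := ⟨hK₁, hK₂, hzK₁, hsub hzs, by rw [hinter, hsd]⟩
    refine hnotnhds _ (𝒯.union_mem_nhds hK₁ hK₂ (by rw [hinter, hsd]) (by rwa [hinter]) ?_)
      (Set.union_subset (Set.subset_biUnion_of_mem (u := hull) hK₁𝒞)
        (Set.subset_biUnion_of_mem (u := hull) (Relation.ReflTransGen.tail hK₁𝒞 hadj)))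
    rw [hinter]
    exact fun v hv => (Finset.mem_filter.1 hv).2

theorem exists_boundary_face_or_star (hΩ : IsBoundedDomain Ω) {z : Pt d}
    (hK : K ∈ 𝒯.cells) (hz : z ∈ K) :
    (∃ K₁, Relation.ReflTransGen (𝒯.FaceAdj z) K K₁ ∧ ∃ a ∈ K₁, z ∈ K₁.erase a ∧
      ∀ K₂ ∈ 𝒯.cells, K₁.erase a ⊆ K₂ → K₂ = K₁) ∨
    (z ∈ Ω ∧ ∀ K' ∈ 𝒯.cells, z ∈ K' → Relation.ReflTransGen (𝒯.FaceAdj z) K K') := by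
  rcases 𝒯.exists_boundary_face_or_mem_nhds hK hz with h | h
  · exact Or.inl h
  · right
    constructor
    · rw [← hΩ.interior_closure, mem_interior_iff_mem_nhds]
      refine Filter.mem_of_superset h (Set.iUnion₂_subset fun K₁ hK₁ => ?_)
      exact 𝒯.hull_subset_closure (𝒯.reach_mem hK hz hK₁).1
    · intro K' hK' hzK'
      have hzc : z ∈ closure (interior (hull K')) := by
        rw [closure_interior_hull (𝒯.isSimplex hK')]
        exact subset_hull K' hzK'
      obtain ⟨y, hy1, hy2⟩ := mem_closure_iff_nhds.1 hzc _ h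
      obtain ⟨K₁, hK₁, hyK₁⟩ := Set.mem_iUnion₂.1 hy1
      rw [𝒯.eq_of_mem_interior hK' (𝒯.reach_mem hK hz hK₁).1 hy2 hyK₁]
      exact hK₁

/-- The points of a face that belongs to one cell only do not lie in the domain. -/
theorem notMem_domain_of_boundary_face (hΩ : IsBoundedDomain Ω) (hK : K ∈ 𝒯.cells)
    {a : Pt d} (ha : a ∈ K) (h : ∀ K₂ ∈ 𝒯.cells, K.erase a ⊆ K₂ → K₂ = K)
    {x : Pt d} (hx : x ∈ hull (K.erase a)) : x ∉ Ω := by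
  have hKs := 𝒯.isSimplex hK
  have hxK := hull_mono (Finset.erase_subset a K) hx
  have hx0 : coord K a x = 0 :=
    coord_eq_zero_of_mem_hull hKs (Finset.erase_subset a K) hx (Finset.notMem_erase a K)
  -- points in the relative interior of the face
  have hrel : ∀ y, (∀ v ∈ K.erase a, 0 < coord K v y) → coord K a y = 0 → y ∉ Ω := by
    intro y hy hy0 hyΩ
    have hyK : y ∈ hull K := by
      rw [mem_hull_iff hKs]
      intro v hv
      rcases eq_or_ne v a with rfl | hva
      · exact hy0.ge
      · exact (hy v (Finset.mem_erase.2 ⟨hva, hv⟩)).le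
    have hint : y ∈ interior (hull K) := by
      rw [mem_interior_iff_mem_nhds]
      filter_upwards [hΩ.isOpen.mem_nhds hyΩ, 𝒯.eventually_mem_hull y] with y' hy'Ω hy'
      obtain ⟨K₂, hK₂, hy'K₂⟩ := 𝒯.exists_cell (subset_closure hy'Ω)
      have := h K₂ hK₂ fun v hv =>
        𝒯.mem_of_coord_ne_zero hK hK₂ hyK (hy' K₂ hK₂ hy'K₂) (hy v hv).ne'
      rwa [this] at hy'K₂
    exact ((mem_interior_hull_iff hKs).1 hint a ha).ne' hy0
  intro hxΩ
  rcases (K.erase a).eq_empty_or_nonempty with he | hne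
  · rw [he, hull, Finset.coe_empty, convexHull_empty] at hx
    exact hx
  -- move `x` towards the centre of the face
  set m := (K.erase a).centroid ℝ id with hm
  have hmc : ∀ v ∈ K.erase a, 0 < coord K v m := by
    intro v hv
    rw [hm, coord_centroid hKs (Finset.erase_subset a K) hv]
    have := Finset.card_pos.2 hne
    positivity
  have hm0 : coord K a m = 0 := by
    refine coord_eq_zero_of_mem_hull hKs (Finset.erase_subset a K) ?_ (Finset.notMem_erase a K)
    have := Finset.centroid_mem_convexHull (R := ℝ) (K.erase a) hne
    exact this
  have hlim : Filter.Tendsto (fun ε : ℝ => AffineMap.lineMap x m ε) (𝓝[>] 0) (𝓝 x) := by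
    have : Continuous (fun ε : ℝ => AffineMap.lineMap x m ε) := AffineMap.lineMap_continuous
    have h2 := this.tendsto 0
    rw [AffineMap.lineMap_apply_zero] at h2
    exact h2.mono_left nhdsWithin_le_nhds
  obtain ⟨ε, hεΩ, hε0, hε1⟩ := ((hlim.eventually (hΩ.isOpen.mem_nhds hxΩ)).and
    ((Ioo_mem_nhdsGT (zero_lt_one : (0 : ℝ) < 1)))).exists
  refine hrel _ (fun v hv => ?_) ?_ hεΩ
  · rw [AffineMap.apply_lineMap, AffineMap.lineMap_apply_ring]
    have h1 := hmc v hv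
    have h2 := coord_nonneg hKs (y := v) hxK
    have h3 : 0 < 1 - ε := by linarith
    positivity
  · rw [AffineMap.apply_lineMap, AffineMap.lineMap_apply_ring, hx0, hm0]
    ring

end Triangulation

end LOD

namespace LOD

open scoped InnerProductSpace NNReal ENNReal Topology

variable {d : ℕ} {Ω : Set (Pt d)}

/-! ### Piecewise affine functions -/

/-- A function that is `L`-Lipschitz on each of finitely many closed sets covering an interval is
`L`-Lipschitz on the interval. -/
theorem abs_sub_le_of_closed_cover {ι : Type*} {f : ℝ → ℝ} {L : ℝ} {C : ι → Set ℝ} (S : Finset ι)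
    (hC : ∀ i ∈ S, IsClosed (C i)) (hL : ∀ i ∈ S, ∀ s ∈ C i, ∀ t ∈ C i, |f s - f t| ≤ L * |s - t|)
    {a b : ℝ} (hab : a ≤ b) (hcov : Set.Icc a b ⊆ ⋃ i ∈ S, C i) : |f b - f a| ≤ L * (b - a) := by
  classical
  induction S using Finset.strongInduction generalizing a with
  | H S ih =>
    obtain ⟨i, hi, hai⟩ := Set.mem_iUnion₂.1 (hcov ⟨le_rfl, hab⟩)
    have hcomp : IsCompact (Set.Icc a b ∩ C i) := isCompact_Icc.inter_right (hC i hi)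
    -- Beyond the last point `t` of the set `C i` that contains `a`, the other sets cover the
    -- interval.
    obtain ⟨t, ht, htmax⟩ := hcomp.exists_isGreatest ⟨a, ⟨le_rfl, hab⟩, hai⟩
    have h1 : |f t - f a| ≤ L * (t - a) := by
      have := hL i hi t ht.2 a hai
      rwa [abs_of_nonneg (sub_nonneg.2 ht.1.1)] at this
    rcases ht.1.2.eq_or_lt with htb | htb
    · rwa [htb] at h1
    · have hcov' : Set.Icc t b ⊆ ⋃ j ∈ S.erase i, C j := by
        have hcl : IsClosed (⋃ j ∈ S.erase i, C j) :=
          isClosed_biUnion_finset fun j hj => hC j (Finset.mem_of_mem_erase hj)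
        rw [← closure_Ioc htb.ne]
        refine closure_minimal (fun s hs => ?_) hcl
        obtain ⟨j, hj, hsj⟩ := Set.mem_iUnion₂.1 (hcov ⟨ht.1.1.trans hs.1.le, hs.2⟩)
        refine Set.mem_biUnion (Finset.mem_coe.2 (Finset.mem_erase.2 ⟨?_, hj⟩)) hsj
        rintro rfl
        exact absurd (htmax ⟨⟨ht.1.1.trans hs.1.le, hs.2⟩, hsj⟩) (not_le.2 hs.1)
      have h2 := ih (S.erase i) (Finset.erase_ssubset hi)
        (fun j hj => hC j (Finset.mem_of_mem_erase hj))
        (fun j hj => hL j (Finset.mem_of_mem_erase hj)) htb.le hcov'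
      calc |f b - f a| = |(f b - f t) + (f t - f a)| := by ring_nf
        _ ≤ |f b - f t| + |f t - f a| := abs_add_le _ _
        _ ≤ L * (b - t) + L * (t - a) := add_le_add h2 h1
        _ = _ := by ring

namespace Triangulation

variable (𝒯 : Triangulation Ω) {K K' : Finset (Pt d)}

theorem eq_sum_of_mem_P1 {v : Pt d → ℝ} (hv : v ∈ 𝒯.P1) (hK : K ∈ 𝒯.cells) {x : Pt d}
    (hx : x ∈ hull K) : v x = ∑ y ∈ K, coord K y x * v y := by
  obtain ⟨g, hg⟩ := hv.2.2 K hK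
  rw [hg hx, affine_eq_sum (𝒯.isSimplex hK) g x]
  exact Finset.sum_congr rfl fun y hy => by rw [hg (subset_hull K hy)]

theorem P1_ext {v w : Pt d → ℝ} (hv : v ∈ 𝒯.P1) (hw : w ∈ 𝒯.P1) (h : ∀ x ∈ 𝒯.nodes, v x = w x) :
    v = w := by
  ext x
  by_cases hx : x ∈ closure Ω
  · obtain ⟨K, hK, hxK⟩ := 𝒯.exists_cell hx
    rw [𝒯.eq_sum_of_mem_P1 hv hK hxK, 𝒯.eq_sum_of_mem_P1 hw hK hxK]
    refine Finset.sum_congr rfl fun y hy => ?_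
    by_cases hyΩ : y ∈ Ω
    · rw [h y ⟨𝒯.vertex_of_mem_cell hK hy, hyΩ⟩]
    · rw [hv.2.1 y hyΩ, hw.2.1 y hyΩ]
  · have hx' : x ∉ Ω := fun h => hx (subset_closure h)
    rw [hv.2.1 x hx', hw.2.1 x hx']

/-- The finite element space as a vector space. -/
def P1Sub : Submodule ℝ (Pt d → ℝ) where
  carrier := 𝒯.P1
  zero_mem' := ⟨continuous_const, fun _ _ => rfl, fun _ _ => ⟨0, fun _ _ => rfl⟩⟩
  add_mem' := by
    rintro v w hv hw
    refine ⟨hv.1.add hw.1, fun x hx => ?_, fun K hK => ?_⟩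
    · rw [Pi.add_apply, hv.2.1 x hx, hw.2.1 x hx, add_zero]
    · obtain ⟨g, hg⟩ := hv.2.2 K hK
      obtain ⟨g', hg'⟩ := hw.2.2 K hK
      exact ⟨g + g', fun x hx => by simp [hg hx, hg' hx]⟩
  smul_mem' := by
    rintro c v hv
    refine ⟨continuous_const.mul hv.1, fun x hx => ?_, fun K hK => ?_⟩
    · rw [Pi.smul_apply, hv.2.1 x hx, smul_zero]
    · obtain ⟨g, hg⟩ := hv.2.2 K hK
      exact ⟨c • g, fun x hx => by simp [hg hx]⟩

theorem finite_nodes : 𝒯.nodes.Finite := 𝒯.finite_vertices.subset fun _ h => h.1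

instance finiteDimensional_P1Sub : FiniteDimensional ℝ 𝒯.P1Sub := by
  have : Finite 𝒯.nodes := 𝒯.finite_nodes
  let φ : 𝒯.P1Sub →ₗ[ℝ] (𝒯.nodes → ℝ) :=
    { toFun := fun v x => v.1 x
      map_add' := fun _ _ => rfl
      map_smul' := fun _ _ => rfl }
  refine FiniteDimensional.of_injective φ fun v w h => Subtype.ext ?_
  exact 𝒯.P1_ext v.2 w.2 fun x hx => congrFun h ⟨x, hx⟩

/-- The segment between two points is covered by the elements, where `v` is affine, and by the
complement of the domain, where `v` is `0`. -/
theorem exists_lipschitz (hΩ : IsBoundedDomain Ω) {v : Pt d → ℝ} (hv : v ∈ 𝒯.P1) :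
    ∃ L : ℝ≥0, LipschitzWith L v := by
  choose! g hg using hv.2.2
  obtain ⟨L, hL⟩ : ∃ L : ℝ≥0, ∀ K ∈ 𝒯.cellSet, ‖slope (g K)‖ ≤ L := by
    obtain ⟨M, hM⟩ := (𝒯.cellSet.image fun K => ‖slope (g K)‖₊).bddAbove
    exact ⟨M, fun K hK => by exact_mod_cast hM (Finset.mem_coe.2 (Finset.mem_image_of_mem _ hK))⟩
  refine ⟨L, LipschitzWith.of_dist_le_mul fun p q => ?_⟩
  let C : Option (Finset (Pt d)) → Set (Pt d) := fun o => o.elim Ωᶜ hull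
  let l : ℝ → Pt d := fun t => AffineMap.lineMap q p t
  have hlc : Continuous l := AffineMap.lineMap_continuous
  have hC : ∀ o, IsClosed (C o) := by
    rintro (_ | K)
    · exact hΩ.isOpen.isClosed_compl
    · exact isClosed_hull K
  have hLip : ∀ o ∈ 𝒯.cellSet.insertNone, ∀ x ∈ C o, ∀ y ∈ C o, |v x - v y| ≤ L * ‖x - y‖ := by
    rintro (_ | K) ho x hx y hy
    · rw [hv.2.1 x hx, hv.2.1 y hy, sub_zero, abs_zero]
      positivity
    · have hK : K ∈ 𝒯.cellSet := Finset.some_mem_insertNone.1 ho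
      rw [hg K (𝒯.mem_cellSet.1 hK) hx, hg K (𝒯.mem_cellSet.1 hK) hy]
      refine (abs_affine_sub_le _ _ _).trans ?_
      gcongr
      exact hL K hK
  have hdist : ∀ s t, ‖l s - l t‖ = |s - t| * ‖p - q‖ := by
    intro s t
    rw [← dist_eq_norm, dist_lineMap_lineMap, Real.dist_eq, dist_comm, dist_eq_norm]
  have := abs_sub_le_of_closed_cover (f := v ∘ l) (L := L * ‖p - q‖) (C := fun o => l ⁻¹' C o)
    𝒯.cellSet.insertNone (fun o _ => (hC o).preimage hlc)
    (fun o ho s hs t ht => by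
      have := hLip o ho (l s) hs (l t) ht
      rw [hdist] at this
      simp only [Function.comp]
      linarith) zero_le_one (fun t _ => by
      by_cases h : l t ∈ Ω
      · obtain ⟨K, hK, hx⟩ := 𝒯.exists_cell (subset_closure h)
        exact Set.mem_biUnion (Finset.mem_coe.2
          (Finset.some_mem_insertNone.2 (𝒯.mem_cellSet.2 hK))) hx
      · exact Set.mem_biUnion (Finset.mem_coe.2 Finset.none_mem_insertNone)
          (x := none) (show l t ∈ Ωᶜ from h))
  simp only [Function.comp, l, AffineMap.lineMap_apply_one, AffineMap.lineMap_apply_zero] at this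
  rw [Real.dist_eq, dist_eq_norm]
  linarith

/-! ### Nodal interpolation -/

open Classical in
/-- The function on the closure of the domain that is affine on each cell and takes the values of
`c` at the vertices; it is `0` elsewhere. -/
noncomputable def interp (c : Pt d → ℝ) (x : Pt d) : ℝ :=
  if h : ∃ K ∈ 𝒯.cells, x ∈ hull K then ∑ y ∈ h.choose, coord h.choose y x * c y else 0

theorem interp_eq (c : Pt d → ℝ) (hK : K ∈ 𝒯.cells) {x : Pt d} (hx : x ∈ hull K) :
    𝒯.interp c x = ∑ y ∈ K, coord K y x * c y := by
  have h : ∃ K ∈ 𝒯.cells, x ∈ hull K := ⟨K, hK, hx⟩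
  rw [interp, dif_pos h]
  obtain ⟨h1, h2⟩ := h.choose_spec
  set K' := h.choose
  have e1 : ∑ y ∈ K', coord K' y x * c y = ∑ y ∈ K ∪ K', coord K' y x * c y :=
    Finset.sum_subset Finset.subset_union_right fun y _ hy => by
      rw [coord_of_notMem hy, zero_mul]
  have e2 : ∑ y ∈ K, coord K y x * c y = ∑ y ∈ K ∪ K', coord K y x * c y :=
    Finset.sum_subset Finset.subset_union_left fun y _ hy => by
      rw [coord_of_notMem hy, zero_mul]
  rw [e1, e2]
  exact Finset.sum_congr rfl fun y _ => by rw [𝒯.coord_congr hK h1 hx h2]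

theorem interp_vertex (c : Pt d → ℝ) {y : Pt d} (hy : y ∈ 𝒯.complex.vertices) :
    𝒯.interp c y = c y := by
  obtain ⟨K, hK, hyK⟩ := 𝒯.exists_cell_of_vertex hy
  rw [𝒯.interp_eq c hK (subset_hull K hyK), Finset.sum_eq_single y]
  · rw [coord_self (𝒯.isSimplex hK) hyK, one_mul]
  · intro z _ hzy
    rw [coord_of_ne (𝒯.isSimplex hK) hyK hzy, zero_mul]
  · exact fun h => absurd hyK h

theorem interp_eq_zero (hΩ : IsBoundedDomain Ω) {c : Pt d → ℝ}
    (hc : ∀ y ∈ 𝒯.complex.vertices, y ∉ Ω → c y = 0) {x : Pt d} (hx : x ∉ Ω) :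
    𝒯.interp c x = 0 := by
  by_cases h : ∃ K ∈ 𝒯.cells, x ∈ hull K
  · obtain ⟨K, hK, hxK⟩ := h
    rw [𝒯.interp_eq c hK hxK]
    refine Finset.sum_eq_zero fun y hy => ?_
    by_cases hyΩ : y ∈ Ω
    · have h0 : coord K y x = 0 := by
        by_contra hne
        exact hx (𝒯.mem_domain_of_coord_pos hΩ hK hy hyΩ hxK
          ((coord_nonneg (𝒯.isSimplex hK) hxK).lt_of_ne (Ne.symm hne)))
      rw [h0, zero_mul]
    · rw [hc y (𝒯.vertex_of_mem_cell hK hy) hyΩ, mul_zero]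
  · rw [interp, dif_neg h]

theorem exists_affine_interp (c : Pt d → ℝ) (hK : K ∈ 𝒯.cells) :
    ∃ g : Pt d →ᵃ[ℝ] ℝ, Set.EqOn (𝒯.interp c) g (hull K) ∧ ∀ y ∈ K, g y = c y := by
  have h : Set.EqOn (𝒯.interp c) (∑ y ∈ K, c y • coord K y : Pt d →ᵃ[ℝ] ℝ) (hull K) := by
    intro x hx
    rw [𝒯.interp_eq c hK hx]
    have : ∀ s : Finset (Pt d), (∑ y ∈ s, c y • coord K y) x = ∑ y ∈ s, coord K y x * c y := by
      intro s
      induction s using Finset.induction_on with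
      | empty => simp
      | insert a s ha ih =>
        rw [Finset.sum_insert ha, Finset.sum_insert ha, ← ih]
        simp [mul_comm]
    exact (this K).symm
  refine ⟨_, h, fun y hy => ?_⟩
  rw [← h (subset_hull K hy), 𝒯.interp_vertex c (vertex_of_mem_cell 𝒯 hK hy)]

theorem interp_mem_P1 (hΩ : IsBoundedDomain Ω) {c : Pt d → ℝ}
    (hc : ∀ y ∈ 𝒯.complex.vertices, y ∉ Ω → c y = 0) : 𝒯.interp c ∈ 𝒯.P1 := by
  have haff := fun K (hK : K ∈ 𝒯.cells) => (𝒯.exists_affine_interp c hK).imp fun g h => h.1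
  refine ⟨?_, fun x hx => 𝒯.interp_eq_zero hΩ hc hx, haff⟩
  have : Finite 𝒯.cells := 𝒯.finite_cells
  let C : Option 𝒯.cells → Set (Pt d) := fun o => o.elim Ωᶜ fun K => hull K.1
  refine (locallyFinite_of_finite C).continuous ?_ ?_ ?_
  · rw [Set.eq_univ_iff_forall]
    intro x
    by_cases h : x ∈ Ω
    · obtain ⟨K, hK, hx⟩ := 𝒯.exists_cell (subset_closure h)
      exact Set.mem_iUnion.2 ⟨some ⟨K, hK⟩, hx⟩
    · exact Set.mem_iUnion.2 ⟨none, h⟩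
  · rintro (_ | K)
    · exact hΩ.isOpen.isClosed_compl
    · exact isClosed_hull K.1
  · rintro (_ | K)
    · exact (continuousOn_const (c := (0 : ℝ))).congr fun _ hx => 𝒯.interp_eq_zero hΩ hc hx
    · obtain ⟨g, hg⟩ := haff K.1 K.2
      exact (continuous_affine g).continuousOn.congr hg

/-! ### Hat functions and the kernel of the Clément operator -/

theorem hat_spec (hΩ : IsBoundedDomain Ω) {x : Pt d} (hx : x ∈ 𝒯.nodes) :
    𝒯.hat x ∈ 𝒯.P1 ∧ 𝒯.hat x x = 1 ∧ ∀ y ∈ 𝒯.complex.vertices, y ≠ x → 𝒯.hat x y = 0 := by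
  refine Classical.epsilon_spec (p := fun φ : Pt d → ℝ =>
    φ ∈ 𝒯.P1 ∧ φ x = 1 ∧ ∀ y ∈ 𝒯.complex.vertices, y ≠ x → φ y = 0) 
      ⟨𝒯.interp (Pi.single x 1), ?_, ?_, ?_⟩
  · refine 𝒯.interp_mem_P1 hΩ fun y _ hy => Pi.single_eq_of_ne ?_ _
    rintro rfl
    exact hy hx.2
  · rw [𝒯.interp_vertex _ hx.1, Pi.single_eq_same]
  · intro y hy hne
    rw [𝒯.interp_vertex _ hy, Pi.single_eq_of_ne hne]

theorem hat_eq_coord (hΩ : IsBoundedDomain Ω) {x : Pt d} (hx : x ∈ 𝒯.nodes) (hK : K ∈ 𝒯.cells)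
    {p : Pt d} (hp : p ∈ hull K) : 𝒯.hat x p = coord K x p := by
  obtain ⟨h1, h2, h3⟩ := 𝒯.hat_spec hΩ hx
  rw [𝒯.eq_sum_of_mem_P1 h1 hK hp]
  by_cases hxK : x ∈ K
  · rw [Finset.sum_eq_single x]
    · rw [h2, mul_one]
    · intro y hy hne
      rw [h3 y (𝒯.vertex_of_mem_cell hK hy) hne, mul_zero]
    · exact fun h => absurd hxK h
  · rw [coord_of_notMem hxK]
    refine Finset.sum_eq_zero fun y hy => ?_
    rw [h3 y (𝒯.vertex_of_mem_cell hK hy) (fun h => hxK (h ▸ hy)), mul_zero]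

theorem hat_nonneg (hΩ : IsBoundedDomain Ω) {x : Pt d} (hx : x ∈ 𝒯.nodes) (p : Pt d) :
    0 ≤ 𝒯.hat x p := by
  by_cases h : p ∈ Ω
  · obtain ⟨K, hK, hp⟩ := 𝒯.exists_cell (subset_closure h)
    rw [𝒯.hat_eq_coord hΩ hx hK hp]
    exact coord_nonneg (𝒯.isSimplex hK) hp
  · rw [(𝒯.hat_spec hΩ hx).1.2.1 p h]

theorem hasCompactSupport_of_mem_P1 (hΩ : IsBoundedDomain Ω) {v : Pt d → ℝ} (hv : v ∈ 𝒯.P1) :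
    HasCompactSupport v :=
  HasCompactSupport.of_support_subset_isCompact hΩ.isBounded.isCompact_closure fun x hx =>
    subset_closure (by by_contra h; exact hx (hv.2.1 x h))

theorem integral_hat_pos (hΩ : IsBoundedDomain Ω) {x : Pt d} (hx : x ∈ 𝒯.nodes) :
    0 < ∫ y in Ω, 𝒯.hat x y := by
  obtain ⟨h1, h2, _⟩ := 𝒯.hat_spec hΩ hx
  rw [setIntegral_eq_integral_of_forall_compl_eq_zero h1.2.1]
  exact h1.1.integral_pos_of_hasCompactSupport_nonneg_nonzero
    (𝒯.hasCompactSupport_of_mem_P1 hΩ h1) (𝒯.hat_nonneg hΩ hx) (x := x) 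
    (by rw [h2]; exact one_ne_zero)

theorem eq_sum_hat (hΩ : IsBoundedDomain Ω) {v : Pt d → ℝ} (hv : v ∈ 𝒯.P1) (p : Pt d) :
    v p = ∑ x ∈ 𝒯.finite_nodes.toFinset, v x * 𝒯.hat x p := by
  have hmem : (fun p => ∑ x ∈ 𝒯.finite_nodes.toFinset, v x * 𝒯.hat x p) ∈ 𝒯.P1Sub := by
    have : (fun p => ∑ x ∈ 𝒯.finite_nodes.toFinset, v x * 𝒯.hat x p) =
        ∑ x ∈ 𝒯.finite_nodes.toFinset, v x • 𝒯.hat x := by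
      ext p; simp
    rw [this]
    exact Submodule.sum_mem _ fun x hx => Submodule.smul_mem _ _
      (𝒯.hat_spec hΩ (𝒯.finite_nodes.mem_toFinset.1 hx)).1
  refine congrFun (𝒯.P1_ext hv hmem fun y hy => ?_) p
  rw [Finset.sum_eq_single y]
  · rw [(𝒯.hat_spec hΩ hy).2.1, mul_one]
  · intro x hx hne
    rw [(𝒯.hat_spec hΩ (𝒯.finite_nodes.mem_toFinset.1 hx)).2.2 y hy.1 hne.symm, mul_zero]
  · exact fun h => absurd (𝒯.finite_nodes.mem_toFinset.2 hy) h

theorem clement_eq_zero_iff (hΩ : IsBoundedDomain Ω) (v : Pt d → ℝ) :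
    𝒯.clement v = 0 ↔ ∀ x ∈ 𝒯.nodes, ∫ y in Ω, v y * 𝒯.hat x y = 0 := by
  have hsum : ∀ p, 𝒯.clement v p = ∑ x ∈ 𝒯.finite_nodes.toFinset,
      ((∫ y in Ω, v y * 𝒯.hat x y) / (∫ y in Ω, 𝒯.hat x y)) * 𝒯.hat x p := by
    intro p
    exact finsum_mem_eq_finite_toFinset_sum _ 𝒯.finite_nodes
  constructor
  · intro h x hx
    have h1 := hsum x
    rw [h, Finset.sum_eq_single x] at h1
    · rw [(𝒯.hat_spec hΩ hx).2.1, mul_one] at h1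
      have h2 := div_eq_zero_iff.1 h1.symm
      exact h2.resolve_right (𝒯.integral_hat_pos hΩ hx).ne'
    · intro z hz hne
      rw [(𝒯.hat_spec hΩ (𝒯.finite_nodes.mem_toFinset.1 hz)).2.2 x hx.1 hne.symm, mul_zero]
    · exact fun h => absurd (𝒯.finite_nodes.mem_toFinset.2 hx) h
  · intro h
    ext p
    rw [hsum]
    refine Finset.sum_eq_zero fun x hx => ?_
    rw [h x (𝒯.finite_nodes.mem_toFinset.1 hx), zero_div, zero_mul]

theorem integrable_of_continuous (hΩ : IsBoundedDomain Ω) {f : Pt d → ℝ} (hf : Continuous f) :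
    IntegrableOn f Ω volume :=
  (hf.continuousOn.integrableOn_compact hΩ.isBounded.isCompact_closure).mono_set subset_closure

/-- The kernel of the Clément operator is the `L_2`-orthogonal complement of the coarse space. -/
theorem mem_fineSpace_iff (hΩ : IsBoundedDomain Ω) (𝒯h : Triangulation Ω) {v : Pt d → ℝ} :
    v ∈ fineSpace 𝒯 𝒯h ↔ v ∈ 𝒯h.P1 ∧ ∀ w ∈ 𝒯.P1, ∫ y in Ω, v y * w y = 0 := by
  rw [fineSpace, Set.mem_ofPred_eq, 𝒯.clement_eq_zero_iff hΩ]
  refine and_congr_right fun hv => ⟨fun h w hw => ?_, fun h x hx => h _ (𝒯.hat_spec hΩ hx).1⟩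
  have e : ∀ y, v y * w y = ∑ x ∈ 𝒯.finite_nodes.toFinset, w x * (v y * 𝒯.hat x y) := by
    intro y
    rw [𝒯.eq_sum_hat hΩ hw y, Finset.mul_sum]
    exact Finset.sum_congr rfl fun x _ => by ring
  simp only [e]
  rw [integral_finsetSum]
  · refine Finset.sum_eq_zero fun x hx => ?_
    rw [integral_const_mul, h x (𝒯.finite_nodes.mem_toFinset.1 hx), mul_zero]
  · intro x hx
    refine Integrable.const_mul ?_ _
    exact integrable_of_continuous hΩ
      (hv.1.mul (𝒯.hat_spec hΩ (𝒯.finite_nodes.mem_toFinset.1 hx)).1.1)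

theorem P1_subset_of_refinement {𝒯h : Triangulation Ω} (h : 𝒯h.IsRefinement 𝒯) : 𝒯.P1 ⊆ 𝒯h.P1 := by
  intro v hv
  refine ⟨hv.1, hv.2.1, fun K' hK' => ?_⟩
  obtain ⟨K, hK, hsub⟩ := h K' hK'
  obtain ⟨g, hg⟩ := hv.2.2 K hK
  exact ⟨g, hg.mono hsub⟩

end Triangulation

end LOD

namespace LOD

open scoped InnerProductSpace NNReal ENNReal Topology

variable {d : ℕ} {Ω : Set (Pt d)}

/-! ### Local Poincaré inequalities -/

/-- `‖w‖²` over the simplex `K`. -/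
noncomputable abbrev massOn (K : Finset (Pt d)) (w : Pt d → ℝ) : ℝ := ∫ x in hull K, (w x) ^ 2

/-- `‖∇w‖²` over the simplex `K`. -/
noncomputable abbrev energyOn (K : Finset (Pt d)) (w : Pt d → ℝ) : ℝ :=
  ∫ x in hull K, ‖gradient w x‖ ^ 2

theorem energyOn_nonneg (K : Finset (Pt d)) (w : Pt d → ℝ) : 0 ≤ energyOn K w :=
  integral_nonneg fun _ => by positivity

theorem massOn_nonneg (K : Finset (Pt d)) (w : Pt d → ℝ) : 0 ≤ massOn K w :=
  integral_nonneg fun _ => by positivity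

theorem gradient_sub_const' (w : Pt d → ℝ) (c : ℝ) (x : Pt d) :
    gradient (fun y => w y - c) x = gradient w x := by
  rw [gradient, gradient, fderiv_sub_const]

/-- A quantity that grows at most by the factor `q` in each step of a relation on a finite set
of `n` elements grows at most by `q ^ n` along chains, because chains can be made simple. -/
theorem le_pow_mul_of_reflTransGen {α : Type*} [DecidableEq α] {q : ℝ} (hq : 1 ≤ q) (m : α → ℝ)
    (hm : ∀ a, 0 ≤ m a) (n : ℕ) : ∀ (F : Finset α), F.card ≤ n → ∀ (r : α → α → Prop),
    (∀ a b, r a b → a ∈ F ∧ b ∈ F ∧ m b ≤ q * m a) → ∀ {x y : α},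
    Relation.ReflTransGen r x y → m y ≤ q ^ n * m x := by
  have hsplit : ∀ (r : α → α → Prop) (x y : α), Relation.ReflTransGen r x y →
      x = y ∨ ∃ b, r x b ∧ Relation.ReflTransGen (fun a c => r a c ∧ a ≠ x ∧ c ≠ x) b y := by
    intro r x y h
    induction h with
    | refl => exact Or.inl rfl
    | @tail b c _ hbc ih =>
      by_cases hc : c = x
      · exact Or.inl hc.symm
      · right
        rcases eq_or_ne b x with hb | hb
        · subst hb; exact ⟨c, hbc, Relation.ReflTransGen.refl⟩
        · rcases ih with h | ⟨e, he, h⟩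
          · exact absurd h.symm hb
          · exact ⟨e, he, h.tail ⟨hbc, hb, hc⟩⟩
  induction n with
  | zero =>
    intro F hF r hr x y h
    rcases hsplit r x y h with h | ⟨b, hb, -⟩
    · simp [h]
    · have := (hr _ _ hb).1
      rw [Nat.le_zero, Finset.card_eq_zero] at hF
      simp [hF] at this
  | succ n ih =>
    intro F hF r hr x y h
    rcases hsplit r x y h with h | ⟨b, hb, hby⟩
    · subst h
      exact le_mul_of_one_le_left (hm _) (one_le_pow₀ hq)
    · obtain ⟨hx, -, hxb⟩ := hr _ _ hb
      have h1 := ih (F.erase x) (by rw [Finset.card_erase_of_mem hx]; omega)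
        (fun a c => r a c ∧ a ≠ x ∧ c ≠ x)
        (fun a c h => ⟨Finset.mem_erase.2 ⟨h.2.1, (hr _ _ h.1).1⟩,
          Finset.mem_erase.2 ⟨h.2.2, (hr _ _ h.1).2.1⟩, (hr _ _ h.1).2.2⟩) hby
      calc m y ≤ q ^ n * m b := h1
        _ ≤ q ^ n * (q * m x) := by gcongr
        _ = q ^ (n + 1) * m x := by ring

namespace Triangulation

variable {𝒯 : Triangulation Ω} {K K' K₁ K₂ : Finset (Pt d)}

variable (𝒯) in
/-- The elements with vertex `z`. -/
noncomputable def star (z : Pt d) : Finset (Finset (Pt d)) := 𝒯.cellSet.filter fun K => z ∈ K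

variable (𝒯) in
/-- The elements that meet `K`. -/
noncomputable def nbrs (K : Finset (Pt d)) : Finset (Finset (Pt d)) :=
  𝒯.cellSet.filter fun K' => (K ∩ K').Nonempty

theorem mem_star {z : Pt d} : K ∈ 𝒯.star z ↔ K ∈ 𝒯.cells ∧ z ∈ K := by
  rw [star, Finset.mem_filter, mem_cellSet]

theorem mem_nbrs : K' ∈ 𝒯.nbrs K ↔ K' ∈ 𝒯.cells ∧ (K ∩ K').Nonempty := by
  rw [nbrs, Finset.mem_filter, mem_cellSet]

theorem mem_nbrs_self (hK : K ∈ 𝒯.cells) : K ∈ 𝒯.nbrs K :=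
  mem_nbrs.2 ⟨hK, by rw [Finset.inter_self]; exact (𝒯.isSimplex hK).nonempty⟩

theorem mem_nbrs_comm (hK : K ∈ 𝒯.cells) (h : K' ∈ 𝒯.nbrs K) : K ∈ 𝒯.nbrs K' :=
  mem_nbrs.2 ⟨hK, by rw [Finset.inter_comm]; exact (mem_nbrs.1 h).2⟩

theorem star_subset_nbrs {z : Pt d} (hz : z ∈ K) : 𝒯.star z ⊆ 𝒯.nbrs K := fun _ h =>
  mem_nbrs.2 ⟨(mem_star.1 h).1, z, Finset.mem_inter.2 ⟨hz, (mem_star.1 h).2⟩⟩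

theorem aedisjoint_hull (hK : K ∈ 𝒯.cells) (hK' : K' ∈ 𝒯.cells) (h : K ≠ K') :
    AEDisjoint volume (hull K) (hull K') := by
  have h1 : interior (hull K) ∩ hull K' = ∅ := by
    ext x
    simp only [Set.mem_inter_iff, Set.mem_empty_iff_false, iff_false, not_and]
    exact fun hx hx' => h (eq_of_mem_interior 𝒯 hK hK' hx hx')
  have h2 : (hull K ∩ hull K' : Set (Pt d)) =ᵐ[volume] (interior (hull K) ∩ hull K' : Set (Pt d)) :=
    (interior_ae_hull K).symm.inter (ae_eq_refl _)
  rw [AEDisjoint, measure_congr h2, h1, measure_empty]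

/-- The scaled copies, to the smallest diameter `r`, of the elements at a vertex are disjoint and
lie in one ball of radius `r`. -/
theorem card_star_mul_le (hd : 1 ≤ d) {ρ : ℝ} (hρ : 0 < ρ) (hf : ∀ K ∈ 𝒯.cells, Fat ρ K)
    (z : Pt d) : ((𝒯.star z).card : ℝ) * ρ ^ d ≤ 1 := by
  rcases (𝒯.star z).eq_empty_or_nonempty with h0 | hne
  · simp [h0]
  obtain ⟨K₀, hK₀, hmin⟩ := Finset.exists_min_image (𝒯.star z) (fun K => Metric.diam (hull K)) hne
  set r := Metric.diam (hull K₀) with hr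
  have hr0 : 0 < r := diam_hull_pos (𝒯.isSimplex (mem_star.1 hK₀).1) hd
  set t : Finset (Pt d) → Set (Pt d) := fun K =>
    AffineMap.homothety z (r / Metric.diam (hull K)) '' hull K with ht
  have hpos : ∀ K ∈ 𝒯.star z, 0 < Metric.diam (hull K) := fun K hK =>
    diam_hull_pos (𝒯.isSimplex (mem_star.1 hK).1) hd
  have hz : ∀ K ∈ 𝒯.star z, z ∈ hull K := fun K hK => subset_hull K (mem_star.1 hK).2
  have hsub : ∀ K ∈ 𝒯.star z, t K ⊆ hull K := fun K hK =>
    homothety_subset (hz K hK) (by have := hpos K hK; positivity)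
      ((div_le_one (hpos K hK)).2 (hmin K hK))
  have hball : (⋃ K ∈ 𝒯.star z, t K) ⊆ Metric.closedBall z r := by
    refine Set.iUnion₂_subset fun K hK => ?_
    have := homothety_subset_closedBall (hz K hK) (t := r / Metric.diam (hull K))
      (by have := hpos K hK; positivity)
    rwa [div_mul_cancel₀ _ (hpos K hK).ne'] at this
  have hmeas : ∀ K ∈ 𝒯.star z, NullMeasurableSet (t K) volume := fun K hK =>
    ((isCompact_hull K).image
      (AffineMap.continuous_of_finiteDimensional _)).measurableSet.nullMeasurableSet
  have hsum : ∑ K ∈ 𝒯.star z, volume.real (t K) = volume.real (⋃ K ∈ 𝒯.star z, t K) := by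
    simp only [Measure.real]
    rw [measure_biUnion_finset₀ _ hmeas, ENNReal.toReal_sum]
    · intro K hK
      exact (measure_lt_top_of_subset (hsub K hK) (volume_hull_ne_top K)).ne
    · intro K hK K' hK' hne'
      exact (aedisjoint_hull (mem_star.1 hK).1 (mem_star.1 hK').1 hne').mono 
        (hsub K hK) (hsub K' hK')
  have h1 : ∑ K ∈ 𝒯.star z, volume.real (t K) ≤ r ^ d * ballVol d := by
    rw [hsum, ← volume_closedBall z hr0.le]
    exact measureReal_mono hball (isCompact_closedBall z r).measure_lt_top.ne
  have h2 : ∀ K ∈ 𝒯.star z, ρ ^ d * (r ^ d * ballVol d) ≤ volume.real (t K) := by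
    intro K hK
    have hK' := hpos K hK
    rw [ht]
    simp only
    rw [volume_homothety z (by positivity)]
    have := le_volume_hull hρ.le (hf K (mem_star.1 hK).1)
    calc ρ ^ d * (r ^ d * ballVol d)
        = (r / Metric.diam (hull K)) ^ d * ((ρ * Metric.diam (hull K)) ^ d * ballVol d) := by
          rw [div_pow, mul_pow]; field_simp
      _ ≤ _ := by gcongr
  have h3 := Finset.sum_le_sum h2
  rw [Finset.sum_const, nsmul_eq_mul] at h3
  have hb : 0 < r ^ d * ballVol d := mul_pos (pow_pos hr0 d) ballVol_pos
  have h4 : ((𝒯.star z).card : ℝ) * ρ ^ d * (r ^ d * ballVol d) ≤ 1 * (r ^ d * ballVol d) := by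
    linarith
  exact le_of_mul_le_mul_right h4 hb

theorem card_nbrs_mul_le (hd : 1 ≤ d) {ρ : ℝ} (hρ : 0 < ρ) (hf : ∀ K ∈ 𝒯.cells, Fat ρ K)
    (hK : K ∈ 𝒯.cells) : ((𝒯.nbrs K).card : ℝ) * ρ ^ d ≤ d + 1 := by
  have h1 : 𝒯.nbrs K ⊆ K.biUnion fun z => 𝒯.star z := by
    intro K' hK'
    obtain ⟨h, z, hz⟩ := mem_nbrs.1 hK'
    exact Finset.mem_biUnion.2
      ⟨z, (Finset.mem_inter.1 hz).1, mem_star.2 ⟨h, (Finset.mem_inter.1 hz).2⟩⟩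
  have h2 : ((𝒯.nbrs K).card : ℝ) ≤ ∑ z ∈ K, ((𝒯.star z).card : ℝ) := by
    exact_mod_cast (Finset.card_le_card h1).trans Finset.card_biUnion_le
  calc ((𝒯.nbrs K).card : ℝ) * ρ ^ d ≤ (∑ z ∈ K, ((𝒯.star z).card : ℝ)) * ρ ^ d := by gcongr
    _ = ∑ z ∈ K, ((𝒯.star z).card : ℝ) * ρ ^ d := Finset.sum_mul ..
    _ ≤ ∑ z ∈ K, 1 := Finset.sum_le_sum fun z _ => card_star_mul_le hd hρ hf z
    _ = d + 1 := by rw [Finset.sum_const, hK.2]; simp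

/-- Around the centroid of a common face of two elements there is a ball contained in their
union. -/
theorem closedBall_subset_union (hd : 1 ≤ d) {ρ : ℝ} (hρ : 0 < ρ) (hf : ∀ K ∈ 𝒯.cells, Fat ρ K)
    (hK₁ : K₁ ∈ 𝒯.cells) (hK₂ : K₂ ∈ 𝒯.cells) (hcard : (K₁ ∩ K₂).card = d) {r : ℝ}
    (hr₁ : r ≤ 2 * ρ * Metric.diam (hull K₁) / d) (hr₂ : r ≤ 2 * ρ * Metric.diam (hull K₂) / d) :
    (K₁ ∩ K₂).centroid ℝ id ∈ hull (K₁ ∩ K₂) ∧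
    Metric.closedBall ((K₁ ∩ K₂).centroid ℝ id) r ⊆ hull K₁ ∪ hull K₂ := by
  set m := (K₁ ∩ K₂).centroid ℝ id with hm
  have hmem : m ∈ hull (K₁ ∩ K₂) :=
    Finset.centroid_mem_convexHull _ (Finset.card_pos.1 (by omega))
  refine ⟨hmem, fun y hy => ?_⟩
  have hd0 : (0 : ℝ) < d := by exact_mod_cast hd
  -- At the centroid the coordinates of the vertices of the face are `1 / d`, and they change by at
  -- most `‖y - m‖ / (2 ρ diam K)`. The same holds for the reflection of `y` at the centroid.
  have key : ∀ K ∈ 𝒯.cells, K₁ ∩ K₂ ⊆ K → r ≤ 2 * ρ * Metric.diam (hull K) / d →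
      ∀ v ∈ K₁ ∩ K₂, ∀ y', ‖y' - m‖ ≤ r → 0 ≤ coord K v y' := by
    intro K hK hs hr v hv y' hy'
    have hD := diam_hull_pos (𝒯.isSimplex hK) hd
    have h1 := abs_coord_sub_le (𝒯.isSimplex hK) hρ hd (hf K hK) v m y'
    have h2 := coord_centroid (𝒯.isSimplex hK) hs hv
    rw [← hm, hcard] at h2
    rw [h2, norm_sub_rev] at h1
    have h3 : ‖y' - m‖ / (2 * ρ * Metric.diam (hull K)) ≤ (d : ℝ)⁻¹ := by
      rw [div_le_iff₀ (by positivity)]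
      calc _ ≤ _ := hy'.trans hr
        _ = _ := by rw [div_eq_inv_mul]
    have := (abs_le.1 h1).2
    linarith
  have hy1 : ‖y - m‖ ≤ r := by rwa [← dist_eq_norm]
  have hy2 : ‖AffineMap.lineMap y m (2 : ℝ) - m‖ ≤ r := by
    have : AffineMap.lineMap y m (2 : ℝ) - m = -(y - m) := by
      rw [AffineMap.lineMap_apply_module]; module
    rw [this, norm_neg]; exact hy1
  exact mem_union_of_coord_nonneg 𝒯 hK₁ hK₂ hcard hmem
    (fun v hv => ⟨key K₁ hK₁ Finset.inter_subset_left hr₁ v hv _ hy1,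
      key K₁ hK₁ Finset.inter_subset_left hr₁ v hv _ hy2⟩)
    (fun v hv => ⟨key K₂ hK₂ Finset.inter_subset_right hr₂ v hv _ hy1,
      key K₂ hK₂ Finset.inter_subset_right hr₂ v hv _ hy2⟩)

theorem setIntegral_le_of_subset_union {f : Pt d → ℝ} (hf : ∀ x, 0 ≤ f x) {B : Set (Pt d)}
    (hB : B ⊆ hull K₁ ∪ hull K₂) (h₁ : IntegrableOn f (hull K₁) volume)
    (h₂ : IntegrableOn f (hull K₂) volume) :
    ∫ x in B, f x ≤ (∫ x in hull K₁, f x) + ∫ x in hull K₂, f x := by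
  rw [← integral_add_measure h₁ h₂]
  refine integral_mono_measure ((Measure.restrict_mono hB le_rfl).trans
    (Measure.restrict_union_le _ _)) (Filter.Eventually.of_forall hf) (Integrable.add_measure h₁ h₂)

/-- Passage from an element to one with a common face: the intermediate domain is a ball around
the centroid of the face, and both elements contain a scaled copy of themselves in that ball. -/
theorem massOn_le_of_adjacent (hd : 1 ≤ d) {ρ : ℝ} (hρ : 0 < ρ) (hρ1 : ρ ≤ 1 / 2)
    (hf : ∀ K ∈ 𝒯.cells, Fat ρ K) (hK₁ : K₁ ∈ 𝒯.cells) (hK₂ : K₂ ∈ 𝒯.cells)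
    (hcard : (K₁ ∩ K₂).card = d) {Λ : ℝ} (hΛ : 1 ≤ Λ)
    (hD : Metric.diam (hull K₂) ≤ Λ * Metric.diam (hull K₁))
    {L : ℝ≥0} {w : Pt d → ℝ} (hw : LipschitzWith L w) :
    (2 * ρ / (d * Λ)) ^ d * ρ ^ d * massOn K₂ w ≤ 4 * massOn K₁ w +
      2 ^ (d + 5) * Metric.diam (hull K₂) ^ 2 * (energyOn K₁ w + energyOn K₂ w) := by
  set D₁ := Metric.diam (hull K₁)
  set D₂ := Metric.diam (hull K₂)
  have hD₁ : 0 < D₁ := diam_hull_pos (𝒯.isSimplex hK₁) hd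
  have hD₂ : 0 < D₂ := diam_hull_pos (𝒯.isSimplex hK₂) hd
  have hd0 : (0 : ℝ) < d := by exact_mod_cast hd
  have hd1 : (1 : ℝ) ≤ d := by exact_mod_cast hd
  have hΛ0 : 0 < Λ := by linarith
  set r := 2 * ρ * min D₁ D₂ / d with hr
  clear_value r
  have hmin : 0 < min D₁ D₂ := lt_min hD₁ hD₂
  have hr0 : 0 < r := by rw [hr]; positivity
  have hr₁ : r ≤ 2 * ρ * D₁ / d := by rw [hr]; gcongr; exact min_le_left _ _
  have hr₂ : r ≤ 2 * ρ * D₂ / d := by rw [hr]; gcongr; exact min_le_right _ _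
  have hle : ∀ D : ℝ, 0 < D → 2 * ρ * D / d ≤ D := by
    intro D hD'
    rw [div_le_iff₀ hd0]
    nlinarith [mul_le_mul_of_nonneg_left hd1 hD'.le, mul_le_mul_of_nonneg_right hρ1 hD'.le]
  have hrD₁ : r ≤ D₁ := hr₁.trans (hle _ hD₁)
  have hrD₂ : r ≤ D₂ := hr₂.trans (hle _ hD₂)
  obtain ⟨hm, hB⟩ := closedBall_subset_union hd hρ hf hK₁ hK₂ hcard hr₁ hr₂
  set m := (K₁ ∩ K₂).centroid ℝ id
  set B := Metric.closedBall m r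
  have hm₁ : m ∈ hull K₁ := hull_mono Finset.inter_subset_left hm
  have hm₂ : m ∈ hull K₂ := hull_mono Finset.inter_subset_right hm
  set E₁ := AffineMap.homothety m (r / D₁) '' hull K₁
  set E₂ := AffineMap.homothety m (r / D₂) '' hull K₂
  have hE₁ : E₁ ⊆ hull K₁ := homothety_subset hm₁ (by positivity) ((div_le_one hD₁).2 hrD₁)
  have hE₂ : E₂ ⊆ hull K₂ := homothety_subset hm₂ (by positivity) ((div_le_one hD₂).2 hrD₂)
  have hE₁B : E₁ ⊆ B := by
    have := homothety_subset_closedBall hm₁ (t := r / D₁) (by positivity)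
    rwa [div_mul_cancel₀ _ hD₁.ne'] at this
  have hE₂B : E₂ ⊆ B := by
    have := homothety_subset_closedBall hm₂ (t := r / D₂) (by positivity)
    rwa [div_mul_cancel₀ _ hD₂.ne'] at this
  have hvE₁ : ρ ^ d * volume.real B ≤ volume.real E₁ := by
    rw [volume_homothety m (by positivity), volume_closedBall m hr0.le]
    have := le_volume_hull hρ.le (hf K₁ hK₁)
    calc ρ ^ d * (r ^ d * ballVol d) = (r / D₁) ^ d * ((ρ * D₁) ^ d * ballVol d) := by
          rw [div_pow, mul_pow]; field_simp
      _ ≤ _ := by gcongr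
  have hvE₂ : volume.real E₂ = (r / D₂) ^ d * volume.real (hull K₂) :=
    volume_homothety m (by positivity) _
  have hBpos : 0 < volume.real B := by
    rw [volume_closedBall m hr0.le]; exact mul_pos (pow_pos hr0 d) ballVol_pos
  have hBb : Bornology.IsBounded B := Metric.isBounded_closedBall
  have hiB := integrableOn_sq hw.continuous hBb
  have hi₁ := integrableOn_sq hw.continuous (isCompact_hull K₁).isBounded
  have hi₂ := integrableOn_sq hw.continuous (isCompact_hull K₂).isBounded
  have hg₁ := integrableOn_gradient_sq hw (volume_hull_ne_top K₁)
  have hg₂ := integrableOn_gradient_sq hw (volume_hull_ne_top K₂)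
  have p1 := poincare_subset hw (convex_closedBall m r) measurableSet_closedBall hE₁B (D := 2 * r)
    hBb (fun x hx y hy => by
      rw [← dist_eq_norm]
      have h1 := Metric.mem_closedBall.1 hx
      have h2 := Metric.mem_closedBall.1 hy
      linarith [dist_triangle_right x y m])
  have p2 := poincare_subset hw (convex_hull K₂) (measurableSet_hull K₂) hE₂ (D := D₂)
    (isCompact_hull K₂).isBounded (fun x hx y hy => dist_le_diam hx hy)
  have hGB : ∫ x in B, ‖gradient w x‖ ^ 2 ≤ energyOn K₁ w + energyOn K₂ w :=
    setIntegral_le_of_subset_union (fun _ => by positivity) hB hg₁ hg₂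
  have hwE₁ : ∫ x in E₁, (w x) ^ 2 ≤ massOn K₁ w :=
    setIntegral_mono_set hi₁ (Filter.Eventually.of_forall fun _ => by positivity) hE₁.eventuallyLE
  have hwE₂ : ∫ x in E₂, (w x) ^ 2 ≤ ∫ x in B, (w x) ^ 2 :=
    setIntegral_mono_set hiB (Filter.Eventually.of_forall fun _ => by positivity) hE₂B.eventuallyLE
  set MB := ∫ x in B, (w x) ^ 2 with hMB
  have hMB0 : 0 ≤ MB := integral_nonneg fun _ => by positivity
  set G := energyOn K₁ w + energyOn K₂ w
  have hG0 : 0 ≤ G := add_nonneg (energyOn_nonneg _ _) (energyOn_nonneg _ _)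
  -- the step from `K₁` to the ball, and the one from the ball to `K₂`
  have s1 : ρ ^ d * MB ≤ 2 * massOn K₁ w + 2 ^ (d + 3) * D₂ ^ 2 * G := by
    have h1 : volume.real B * (ρ ^ d * MB) ≤
        volume.real B * (2 * massOn K₁ w + 2 ^ (d + 3) * D₂ ^ 2 * G) := by
      calc volume.real B * (ρ ^ d * MB) = ρ ^ d * volume.real B * MB := by ring
        _ ≤ volume.real E₁ * MB := by gcongr
        _ ≤ _ := p1
        _ ≤ 2 * volume.real B * massOn K₁ w + 2 ^ (d + 1) * (2 * D₂) ^ 2 * volume.real B * G := by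
            gcongr
        _ = _ := by ring
    exact le_of_mul_le_mul_left h1 hBpos
  have hvK₂ := volume_hull_pos (𝒯.isSimplex hK₂)
  have s2 : (r / D₂) ^ d * massOn K₂ w ≤ 2 * MB + 2 ^ (d + 1) * D₂ ^ 2 * G := by
    have h1 : volume.real (hull K₂) * ((r / D₂) ^ d * massOn K₂ w) ≤
        volume.real (hull K₂) * (2 * MB + 2 ^ (d + 1) * D₂ ^ 2 * G) := by
      calc volume.real (hull K₂) * ((r / D₂) ^ d * massOn K₂ w)
          = volume.real E₂ * massOn K₂ w := by rw [hvE₂]; ring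
        _ ≤ _ := p2
        _ ≤ 2 * volume.real (hull K₂) * MB + 2 ^ (d + 1) * D₂ ^ 2 * volume.real (hull K₂) * G := by
            gcongr
            exact le_add_of_nonneg_left (energyOn_nonneg _ _)
        _ = _ := by ring
    exact le_of_mul_le_mul_left h1 hvK₂
  have hq : 2 * ρ / (d * Λ) ≤ r / D₂ := by
    rw [hr, div_le_div_iff₀ (by positivity) hD₂]
    have : D₂ ≤ min D₁ D₂ * Λ := by
      rcases min_cases D₁ D₂ with ⟨h, -⟩ | ⟨h, -⟩ <;> rw [h]
      · linarith
      · exact le_mul_of_one_le_right hD₂.le hΛ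
    calc 2 * ρ * D₂ ≤ 2 * ρ * (min D₁ D₂ * Λ) := by gcongr
      _ = _ := by field_simp
  have hρd : ρ ^ d ≤ 1 := pow_le_one₀ hρ.le (by linarith)
  have hX : 0 ≤ D₂ ^ 2 * G := by positivity
  calc (2 * ρ / (d * Λ)) ^ d * ρ ^ d * massOn K₂ w
      ≤ (r / D₂) ^ d * ρ ^ d * massOn K₂ w := by
        have := massOn_nonneg K₂ w
        gcongr
    _ = ρ ^ d * ((r / D₂) ^ d * massOn K₂ w) := by ring
    _ ≤ ρ ^ d * (2 * MB + 2 ^ (d + 1) * D₂ ^ 2 * G) := by gcongr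
    _ = 2 * (ρ ^ d * MB) + ρ ^ d * (2 ^ (d + 1) * (D₂ ^ 2 * G)) := by ring
    _ ≤ 2 * (2 * massOn K₁ w + 2 ^ (d + 3) * D₂ ^ 2 * G) + 1 * (2 ^ (d + 1) * (D₂ ^ 2 * G)) := by
        gcongr
    _ ≤ 4 * massOn K₁ w + 2 ^ (d + 5) * D₂ ^ 2 * G := by
        have : (0 : ℝ) ≤ 2 ^ d * (D₂ ^ 2 * G) := by positivity
        rw [pow_succ (2 : ℝ) (d + 4), pow_succ (2 : ℝ) (d + 3), pow_succ (2 : ℝ) (d + 2),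
          pow_succ (2 : ℝ) (d + 1), pow_succ (2 : ℝ) d]
        nlinarith [this]

end Triangulation

end LOD

namespace LOD

open scoped InnerProductSpace NNReal ENNReal Topology

variable {d : ℕ} {Ω : Set (Pt d)}

namespace Triangulation

variable {𝒯 : Triangulation Ω} {K K' K₁ K₂ : Finset (Pt d)}

theorem faceAdj_symm {z : Pt d} (h : 𝒯.FaceAdj z K₁ K₂) : 𝒯.FaceAdj z K₂ K₁ := by
  obtain ⟨h1, h2, h3, h4, h5⟩ := h
  exact ⟨h2, h1, h4, h3, by rwa [Finset.inter_comm]⟩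

/-- For `d ≥ 2`, elements with a common face share an edge and so have comparable diameters. -/
theorem diam_le_of_adjacent (hd : 2 ≤ d) {ρ : ℝ} (hρ : 0 < ρ) (hf : ∀ K ∈ 𝒯.cells, Fat ρ K)
    (hK₁ : K₁ ∈ 𝒯.cells) (hcard : (K₁ ∩ K₂).card = d) :
    2 * ρ * Metric.diam (hull K₁) ≤ Metric.diam (hull K₂) := by
  obtain ⟨a, ha, b, hb, hab⟩ := Finset.one_lt_card.1 (show 1 < (K₁ ∩ K₂).card by omega)
  rw [Finset.mem_inter] at ha hb
  have hS := 𝒯.isSimplex hK₁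
  have hD := diam_hull_pos hS (by omega)
  have h1 := abs_coord_sub_le hS hρ (by omega) (hf K₁ hK₁) a a b
  rw [coord_self hS ha.1, coord_of_ne hS hb.1 hab, sub_zero, abs_one, le_div_iff₀ (by positivity),
    one_mul] at h1
  exact h1.trans (dist_le_diam (subset_hull _ ha.2) (subset_hull _ hb.2))

/-- If `w` is orthogonal to the hat function of `z` and close to a constant on the elements around
`z`, then the constant is small. -/
theorem massOn_le_of_star (hΩ : IsBoundedDomain Ω) (hd : 1 ≤ d) {ρ : ℝ} (hρ : 0 < ρ)
    (hf : ∀ K ∈ 𝒯.cells, Fat ρ K) {z : Pt d} (hz : z ∈ Ω) (hK : K ∈ 𝒯.star z)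
    (hK' : K' ∈ 𝒯.star z) (hD : Metric.diam (hull K) ≤ Metric.diam (hull K')) {w : Pt d → ℝ}
    (hw : Continuous w) (hφ : ∫ x in Ω, w x * 𝒯.hat z x = 0) {c B : ℝ}
    (hB : ∀ K ∈ 𝒯.star z, massOn K (fun x => w x - c) ≤ B) :
    massOn K w ≤ (2 + 2 * 4 ^ (d + 1) / (ρ ^ d * ρ ^ d)) * B := by
  have hzn : z ∈ 𝒯.nodes := ⟨𝒯.vertex_of_mem_cell (mem_star.1 hK).1 (mem_star.1 hK).2, hz⟩
  have hφP := (hat_spec 𝒯 hΩ hzn).1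
  have hφc : Continuous (𝒯.hat z) := hφP.1
  have hφ0 := hat_nonneg 𝒯 hΩ hzn
  have hint : ∀ f : Pt d → ℝ, Continuous f → IntegrableOn f Ω volume := fun f hf' =>
    integrable_of_continuous hΩ hf'
  have hintK : ∀ (f : Pt d → ℝ) K, Continuous f → IntegrableOn f (hull K) volume := fun f K hf' =>
    hf'.continuousOn.integrableOn_compact (isCompact_hull K)
  have hB0 : 0 ≤ B := (massOn_nonneg _ _).trans (hB K hK)
  -- By orthogonality, `∫ (w - c)² φ = ∫ w² φ + c² ∫ φ` for the hat function `φ`.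
  have h1 : c ^ 2 * ∫ x in Ω, 𝒯.hat z x ≤ ∫ x in Ω, (w x - c) ^ 2 * 𝒯.hat z x := by
    have e : ∫ x in Ω, (w x - c) ^ 2 * 𝒯.hat z x = (∫ x in Ω, (w x) ^ 2 * 𝒯.hat z x) -
        2 * c * (∫ x in Ω, w x * 𝒯.hat z x) + c ^ 2 * ∫ x in Ω, 𝒯.hat z x := by
      rw [← integral_const_mul, ← integral_const_mul, ← integral_sub, ← integral_add]
      · exact integral_congr_ae (Filter.Eventually.of_forall fun x => by ring)
      · exact (hint _ (by fun_prop)).sub (hint _ (by fun_prop))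
      · exact hint _ (by fun_prop)
      · exact hint _ (by fun_prop)
      · exact hint _ (by fun_prop)
    rw [e, hφ]
    have : 0 ≤ ∫ x in Ω, (w x) ^ 2 * 𝒯.hat z x :=
      integral_nonneg fun x => mul_nonneg (sq_nonneg _) (hφ0 x)
    linarith
  have h2 : ∫ x in Ω, (w x - c) ^ 2 * 𝒯.hat z x ≤ (𝒯.star z).card * B := by
    rw [setIntegral_domain 𝒯 hΩ (fun K _ => hintK _ K (by fun_prop))]
    have : ∀ K ∈ 𝒯.cellSet, ∫ x in hull K, (w x - c) ^ 2 * 𝒯.hat z x ≤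
        if z ∈ K then B else 0 := by
      intro K hK
      have hKc := (mem_cellSet 𝒯).1 hK
      split_ifs with h
      · refine le_trans ?_ (hB K (mem_star.2 ⟨hKc, h⟩))
        refine setIntegral_mono_on (hintK _ K (by fun_prop)) (hintK _ K (by fun_prop))
          (measurableSet_hull K) fun x hx => ?_
        rw [hat_eq_coord 𝒯 hΩ hzn hKc hx]
        exact mul_le_of_le_one_right (sq_nonneg _) (coord_le_one (𝒯.isSimplex hKc) hx)
      · refine (setIntegral_congr_fun (measurableSet_hull K) (g := fun _ => 0)
            fun x hx => ?_).le.trans (by simp)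
        simp only
        rw [hat_eq_coord 𝒯 hΩ hzn hKc hx, coord_of_notMem h, mul_zero]
    refine (Finset.sum_le_sum this).trans ?_
    rw [← Finset.sum_filter, Finset.sum_const, nsmul_eq_mul]
    rfl
  have hK'c := (mem_star.1 hK').1
  -- `∫ φ` is bounded below by `∫ φ²` over the larger element `K'`.
  have h3 : volume.real (hull K') ≤ 4 ^ (d + 1) * ∫ x in Ω, 𝒯.hat z x := by
    have h := vertex_sq_le (coord K' z) (mem_star.1 hK').2
    rw [coord_self (𝒯.isSimplex hK'c) (mem_star.1 hK').2, one_pow, one_mul] at h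
    refine h.trans ?_
    gcongr
    rw [setIntegral_domain 𝒯 hΩ (fun K _ => hintK _ K hφc)]
    refine le_trans ?_ (Finset.single_le_sum (f := fun K => ∫ x in hull K, 𝒯.hat z x)
      (fun K _ => integral_nonneg hφ0) ((mem_cellSet 𝒯).2 hK'c))
    refine setIntegral_mono_on (hintK _ K' ((continuous_affine _).pow 2)) (hintK _ K' hφc)
      (measurableSet_hull K') fun x hx => ?_
    rw [hat_eq_coord 𝒯 hΩ hzn hK'c hx]
    have := coord_nonneg (𝒯.isSimplex hK'c) (y := z) hx
    nlinarith [coord_le_one (𝒯.isSimplex hK'c) (y := z) hx]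
  have hρd : 0 < ρ ^ d := pow_pos hρ d
  have hN : ((𝒯.star z).card : ℝ) ≤ 1 / ρ ^ d := by
    rw [le_div_iff₀ hρd]; exact card_star_mul_le hd hρ hf z
  have hvol : ρ ^ d * volume.real (hull K) ≤ volume.real (hull K') := by
    have a1 := volume_hull_le K
    have a2 := le_volume_hull hρ.le (hf K' hK'c)
    have hb := ballVol_pos (d := d)
    calc ρ ^ d * volume.real (hull K) ≤ ρ ^ d * (Metric.diam (hull K') ^ d * ballVol d) := by
          gcongr
          refine a1.trans ?_
          gcongr
      _ = (ρ * Metric.diam (hull K')) ^ d * ballVol d := by rw [mul_pow]; ring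
      _ ≤ _ := a2
  have h4 : c ^ 2 * (ρ ^ d * ρ ^ d) * volume.real (hull K) ≤ 4 ^ (d + 1) * B := by
    calc c ^ 2 * (ρ ^ d * ρ ^ d) * volume.real (hull K)
        = ρ ^ d * (c ^ 2 * (ρ ^ d * volume.real (hull K))) := by ring
      _ ≤ ρ ^ d * (c ^ 2 * (4 ^ (d + 1) * ∫ x in Ω, 𝒯.hat z x)) := by
          exact mul_le_mul_of_nonneg_left
            (mul_le_mul_of_nonneg_left (hvol.trans h3) (sq_nonneg c)) hρd.le
      _ = ρ ^ d * 4 ^ (d + 1) * (c ^ 2 * ∫ x in Ω, 𝒯.hat z x) := by ring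
      _ ≤ ρ ^ d * 4 ^ (d + 1) * (1 / ρ ^ d * B) := by
          refine mul_le_mul_of_nonneg_left ?_ (by positivity)
          exact h1.trans (h2.trans (by gcongr))
      _ = 4 ^ (d + 1) * B := by field_simp
  have h5 : massOn K w ≤ 2 * massOn K (fun x => w x - c) + 2 * c ^ 2 * volume.real (hull K) := by
    have : 2 * c ^ 2 * volume.real (hull K) = ∫ x in hull K, 2 * c ^ 2 := by
      rw [setIntegral_const, smul_eq_mul]; ring
    rw [massOn, massOn, ← integral_const_mul, this, ← integral_add (hintK _ K (by fun_prop))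
      (hintK _ K (by fun_prop))]
    refine setIntegral_mono_on (hintK _ K (by fun_prop)) ((hintK _ K (by fun_prop)).add
      (hintK _ K (by fun_prop))) (measurableSet_hull K) fun x _ => ?_
    nlinarith [sq_nonneg (w x - 2 * c)]
  have h6 : c ^ 2 * volume.real (hull K) ≤ 4 ^ (d + 1) / (ρ ^ d * ρ ^ d) * B := by
    rw [div_mul_eq_mul_div, le_div_iff₀ (by positivity)]
    linarith
  calc massOn K w ≤ 2 * B + 2 * (4 ^ (d + 1) / (ρ ^ d * ρ ^ d) * B) := by
        have := hB K hK
        linarith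
    _ = _ := by ring

/-- The chain of elements around a vertex, in dimension at least two, where the diameters of
adjacent elements are comparable. -/
theorem exists_massOn_chain (hd : 2 ≤ d) {ρ : ℝ} (hρ : 0 < ρ) (hρ1 : ρ ≤ 1 / 2) :
    ∃ C : ℝ, 1 ≤ C ∧ ∀ {Ω : Set (Pt d)} (𝒯 : Triangulation Ω), (∀ K ∈ 𝒯.cells, Fat ρ K) →
    ∀ {z : Pt d} {K K' : Finset (Pt d)}, K ∈ 𝒯.cells → z ∈ K →
      Relation.ReflTransGen (𝒯.FaceAdj z) K K' →
    Metric.diam (hull K') ≤ C * Metric.diam (hull K) ∧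
    ∀ {L : ℝ≥0} {w : Pt d → ℝ}, LipschitzWith L w →
      massOn K' w ≤ C * (massOn K w +
        Metric.diam (hull K) ^ 2 * ∑ K'' ∈ 𝒯.star z, energyOn K'' w) := by
  -- `n` bounds the number of elements in the star and so the length of a chain without repetition.
  -- One step changes the diameter by a factor of at most `Λ`, and the quantity
  -- `‖w‖² / diam² + ∑ ‖∇w‖²` by a factor of at most `q`.
  set n := ⌈1 / ρ ^ d⌉₊
  set Λ := 1 / (2 * ρ) with hΛ
  have hΛ1 : 1 ≤ Λ := by rw [hΛ, le_div_iff₀ (by positivity)]; linarith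
  set s := (2 * ρ / (d * Λ)) ^ d * ρ ^ d with hs
  have hd0 : (0 : ℝ) < d := by exact_mod_cast (by omega : 0 < d)
  have hs0 : 0 < s := by positivity
  set q := 1 + (4 * Λ ^ 2 + 2 ^ (d + 5)) / s with hq
  have hq1 : 1 ≤ q := by rw [hq]; linarith [show 0 ≤ (4 * Λ ^ 2 + 2 ^ (d + 5)) / s by positivity]
  have hΛn : 1 ≤ Λ ^ n := one_le_pow₀ hΛ1
  have hqn : 1 ≤ q ^ n := one_le_pow₀ hq1
  refine ⟨(Λ ^ n) ^ 2 * q ^ n, one_le_mul_of_one_le_of_one_le (one_le_pow₀ hΛn) hqn, ?_⟩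
  intro Ω 𝒯 hf z K K' hK hz h
  have hcard : (𝒯.star z).card ≤ n := by
    have h1 := card_star_mul_le (𝒯 := 𝒯) (by omega) hρ hf z
    rw [← le_div_iff₀ (by positivity)] at h1
    exact_mod_cast h1.trans (Nat.le_ceil _)
  have hDK : 0 < Metric.diam (hull K) := diam_hull_pos (𝒯.isSimplex hK) (by omega)
  have hadj : ∀ a b, 𝒯.FaceAdj z a b → a ∈ 𝒯.star z ∧ b ∈ 𝒯.star z ∧
      Metric.diam (hull b) ≤ Λ * Metric.diam (hull a) := by
    intro a b hab
    obtain ⟨ha, hb, hza, hzb, hc⟩ := hab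
    refine ⟨mem_star.2 ⟨ha, hza⟩, mem_star.2 ⟨hb, hzb⟩, ?_⟩
    rw [hΛ, one_div, ← div_eq_inv_mul, le_div_iff₀ (by positivity), mul_comm]
    exact diam_le_of_adjacent hd hρ hf hb (by rwa [Finset.inter_comm])
  have hdiam := le_pow_mul_of_reflTransGen hΛ1 (fun K => Metric.diam (hull K))
    (fun K => Metric.diam_nonneg) n (𝒯.star z) hcard _ hadj h
  refine ⟨hdiam.trans ?_, ?_⟩
  · have e : Λ ^ n ≤ (Λ ^ n) ^ 2 * q ^ n := by
      nlinarith [mul_nonneg (sub_nonneg.2 hΛn) (sub_nonneg.2 hqn), mul_self_nonneg (Λ ^ n - 1),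
        mul_le_mul_of_nonneg_left hqn (sq_nonneg (Λ ^ n))]
    gcongr
  · intro L w hw
    set G := ∑ K'' ∈ 𝒯.star z, energyOn K'' w with hG
    have hG0 : 0 ≤ G := Finset.sum_nonneg fun _ _ => energyOn_nonneg _ _
    have hstep : ∀ a b, 𝒯.FaceAdj z a b → a ∈ 𝒯.star z ∧ b ∈ 𝒯.star z ∧
        massOn b w / Metric.diam (hull b) ^ 2 + G ≤
          q * (massOn a w / Metric.diam (hull a) ^ 2 + G) := by
      intro a b hab
      obtain ⟨ha', hb', hle⟩ := hadj a b hab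
      obtain ⟨ha, hb, hza, hzb, hc⟩ := hab
      refine ⟨ha', hb', ?_⟩
      have hDa : 0 < Metric.diam (hull a) := diam_hull_pos (𝒯.isSimplex ha) (by omega)
      have hDb : 0 < Metric.diam (hull b) := diam_hull_pos (𝒯.isSimplex hb) (by omega)
      have hle' : Metric.diam (hull a) ≤ Λ * Metric.diam (hull b) :=
        (hadj b a (faceAdj_symm ⟨ha, hb, hza, hzb, hc⟩)).2.2
      have h1 := massOn_le_of_adjacent (by omega) hρ hρ1 hf ha hb hc hΛ1 hle hw
      have hsum : energyOn a w + energyOn b w ≤ G := by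
        have hne : a ≠ b := by
          rintro rfl
          rw [Finset.inter_self, ha.2] at hc; omega
        rw [← Finset.sum_pair (f := fun K => energyOn K w) hne]
        exact Finset.sum_le_sum_of_subset_of_nonneg
          (Finset.insert_subset ha' (Finset.singleton_subset_iff.2 hb'))
          fun _ _ _ => energyOn_nonneg _ _
      have hMa := massOn_nonneg a w
      have h2 : massOn b w / Metric.diam (hull b) ^ 2 ≤
          (4 * Λ ^ 2 * (massOn a w / Metric.diam (hull a) ^ 2) + 2 ^ (d + 5) * G) / s := by
        rw [div_le_iff₀ (by positivity), div_mul_eq_mul_div, le_div_iff₀ hs0]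
        have h3 : massOn a w ≤ Λ ^ 2 * (massOn a w / Metric.diam (hull a) ^ 2) *
            Metric.diam (hull b) ^ 2 := by
          have : Metric.diam (hull a) ^ 2 ≤ (Λ * Metric.diam (hull b)) ^ 2 := by gcongr
          calc massOn a w = massOn a w / Metric.diam (hull a) ^ 2 * Metric.diam (hull a) ^ 2 := by
                field_simp
            _ ≤ massOn a w / Metric.diam (hull a) ^ 2 * (Λ * Metric.diam (hull b)) ^ 2 := by gcongr
            _ = _ := by ring
        have h4 : 2 ^ (d + 5) * Metric.diam (hull b) ^ 2 * (energyOn a w + energyOn b w) ≤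
            2 ^ (d + 5) * Metric.diam (hull b) ^ 2 * G := by gcongr
        nlinarith [h1, h3, h4]
      have h5 : (4 * Λ ^ 2 * (massOn a w / Metric.diam (hull a) ^ 2) + 2 ^ (d + 5) * G) / s ≤
          (4 * Λ ^ 2 + 2 ^ (d + 5)) / s * (massOn a w / Metric.diam (hull a) ^ 2 + G) := by
        rw [div_mul_eq_mul_div]
        gcongr
        have t1 : 0 ≤ 4 * Λ ^ 2 * G := by positivity
        have t2 : 0 ≤ 2 ^ (d + 5) * (massOn a w / Metric.diam (hull a) ^ 2) := by positivity
        nlinarith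
      have t3 : 0 ≤ massOn a w / Metric.diam (hull a) ^ 2 := by positivity
      rw [hq, add_mul, one_mul]
      linarith
    have hc := le_pow_mul_of_reflTransGen hq1
      (fun K => massOn K w / Metric.diam (hull K) ^ 2 + G)
      (fun K => add_nonneg (div_nonneg (massOn_nonneg _ _) (by positivity)) hG0)
      n (𝒯.star z) hcard _ hstep h
    have hK'c := (reach_mem 𝒯 hK hz h).1
    have hDK' : 0 < Metric.diam (hull K') := diam_hull_pos (𝒯.isSimplex hK'c) (by omega)
    have hMK := massOn_nonneg K w
    calc massOn K' w = Metric.diam (hull K') ^ 2 * (massOn K' w / Metric.diam (hull K') ^ 2) := by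
          field_simp
      _ ≤ (Λ ^ n * Metric.diam (hull K)) ^ 2 *
          (q ^ n * (massOn K w / Metric.diam (hull K) ^ 2 + G)) := by
          have : massOn K' w / Metric.diam (hull K') ^ 2 ≤
            q ^ n * (massOn K w / Metric.diam (hull K) ^ 2 + G) := by linarith
          have hnn := massOn_nonneg K' w
          gcongr
      _ = _ := by field_simp

/-- The element `K` satisfies a local Friedrichs inequality, at the scale `δ`, on its neighbours. -/
def LocalPoincare (𝒯 : Triangulation Ω) (C δ : ℝ) (K : Finset (Pt d)) (w : Pt d → ℝ) : Prop :=
  massOn K w ≤ C * δ ^ 2 * ∑ K' ∈ 𝒯.nbrs K, energyOn K' w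

theorem sum_star_le {z : Pt d} (hz : z ∈ K) (w : Pt d → ℝ) :
    ∑ K' ∈ 𝒯.star z, energyOn K' w ≤ ∑ K' ∈ 𝒯.nbrs K, energyOn K' w :=
  Finset.sum_le_sum_of_subset_of_nonneg (star_subset_nbrs hz) fun _ _ _ => energyOn_nonneg _ _

theorem energyOn_le_sum_star {z : Pt d} (hK : K ∈ 𝒯.star z) (w : Pt d → ℝ) :
    energyOn K w ≤ ∑ K' ∈ 𝒯.star z, energyOn K' w :=
  Finset.single_le_sum (f := fun K => energyOn K w) (fun _ _ => energyOn_nonneg _ _) hK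

theorem energyOn_sub_const (K : Finset (Pt d)) (w : Pt d → ℝ) (c : ℝ) :
    energyOn K (fun x => w x - c) = energyOn K w := by
  simp only [energyOn, gradient_sub_const']

/-- In dimension at least two every element has a local Friedrichs inequality at the scale of its
own diameter. -/
theorem exists_massOn_le_of_two_le (hd : 2 ≤ d) {ρ : ℝ} (hρ : 0 < ρ) (hρ1 : ρ ≤ 1 / 2) :
    ∃ C : ℝ, 0 < C ∧ ∀ {Ω : Set (Pt d)} (_ : IsBoundedDomain Ω) (𝒯 : Triangulation Ω),
      (∀ K ∈ 𝒯.cells, Fat ρ K) → ∀ {L : ℝ≥0} {w : Pt d → ℝ}, LipschitzWith L w →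
      (∀ x, x ∉ Ω → w x = 0) → (∀ z ∈ 𝒯.nodes, ∫ x in Ω, w x * 𝒯.hat z x = 0) →
      ∀ {K : Finset (Pt d)} {z : Pt d}, K ∈ 𝒯.cells → z ∈ K →
      massOn K w ≤ C * Metric.diam (hull K) ^ 2 * ∑ K' ∈ 𝒯.star z, energyOn K' w := by
  obtain ⟨C, hC1, hchain⟩ := exists_massOn_chain hd hρ hρ1
  have hd1 : 1 ≤ d := by omega
  set F : ℝ := 2 ^ (d + 1) * 4 * 2 ^ d with hF
  set Q : ℝ := 2 + 2 * 4 ^ (d + 1) / (ρ ^ d * ρ ^ d) with hQ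
  have hC0 : 0 < C := by linarith
  refine ⟨C * (F + 1) * C ^ 2 + Q * (C * (2 ^ d + 1)), by positivity, ?_⟩
  intro Ω hΩ 𝒯 hf L w hw hw0 hφ K z hK hz
  set G := ∑ K' ∈ 𝒯.star z, energyOn K' w with hG
  have hG0 : 0 ≤ G := Finset.sum_nonneg fun _ _ => energyOn_nonneg _ _
  have hKs : K ∈ 𝒯.star z := mem_star.2 ⟨hK, hz⟩
  have hDG : 0 ≤ Metric.diam (hull K) ^ 2 * G := by positivity
  -- Either a chain from `K` ends at a face on the boundary, where `w` vanishes, or the chains reach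
  -- all elements around `z` and the mean of `w` is controlled by orthogonality to the hat function.
  rcases exists_boundary_face_or_star 𝒯 hΩ hK hz with ⟨K₁, hr, a, ha, hza, hb⟩ | ⟨hzΩ, hall⟩
  · obtain ⟨hK₁, hz₁⟩ := reach_mem 𝒯 hK hz hr
    have hr' : Relation.ReflTransGen (𝒯.FaceAdj z) K₁ K :=
      haveI : Std.Symm (𝒯.FaceAdj z) := ⟨fun _ _ => faceAdj_symm⟩
      Relation.ReflTransGen.stdSymm.symm _ _ hr
    have h1 := friedrichs_face hd1 (𝒯.isSimplex hK₁) ha hw fun x hx =>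
      hw0 x (notMem_domain_of_boundary_face 𝒯 hΩ hK₁ ha hb hx)
    have h2 := (hchain 𝒯 hf hK₁ hz₁ hr').2 hw
    have h3 := (hchain 𝒯 hf hK hz hr).1
    have h4 : energyOn K₁ w ≤ G := energyOn_le_sum_star (mem_star.2 ⟨hK₁, hz₁⟩) w
    calc massOn K w ≤ C * (massOn K₁ w + Metric.diam (hull K₁) ^ 2 * G) := h2
      _ ≤ C * (F * Metric.diam (hull K₁) ^ 2 * G + Metric.diam (hull K₁) ^ 2 * G) := by
          have : massOn K₁ w ≤ F * Metric.diam (hull K₁) ^ 2 * G := h1.trans (by gcongr)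
          gcongr
      _ = C * (F + 1) * Metric.diam (hull K₁) ^ 2 * G := by ring
      _ ≤ C * (F + 1) * (C * Metric.diam (hull K)) ^ 2 * G := by
          have : (0:ℝ) ≤ Metric.diam (hull K₁) := Metric.diam_nonneg
          gcongr
      _ = C * (F + 1) * C ^ 2 * (Metric.diam (hull K) ^ 2 * G) := by ring
      _ ≤ (C * (F + 1) * C ^ 2 + Q * (C * (2 ^ d + 1))) * (Metric.diam (hull K) ^ 2 * G) := by
          gcongr
          exact le_add_of_nonneg_right (by positivity)
      _ = _ := by ring
  · obtain ⟨c, hc⟩ := poincare_const hw (convex_hull K) (measurableSet_hull K)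
      (isCompact_hull K).isBounded (fun x hx y hy => dist_le_diam hx hy)
      (volume_hull_pos (𝒯.isSimplex hK))
    have hwc : LipschitzWith L (fun x => w x - c) := by
      have := hw.sub (LipschitzWith.const c)
      rwa [add_zero] at this
    have hB : ∀ K' ∈ 𝒯.star z, massOn K' (fun x => w x - c) ≤
        C * ((2 ^ d + 1) * (Metric.diam (hull K) ^ 2 * G)) := by
      intro K' hK'
      have h := (hchain 𝒯 hf hK hz (hall K' (mem_star.1 hK').1 (mem_star.1 hK').2)).2 hwc
      simp only [energyOn_sub_const] at h
      refine h.trans ?_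
      have h4 : energyOn K w ≤ G := energyOn_le_sum_star hKs w
      have h5 : massOn K (fun x => w x - c) ≤ 2 ^ d * Metric.diam (hull K) ^ 2 * G :=
        hc.trans (by gcongr)
      have : massOn K (fun x => w x - c) + Metric.diam (hull K) ^ 2 * G ≤
        (2 ^ d + 1) * (Metric.diam (hull K) ^ 2 * G) := by linarith
      gcongr
    have h := massOn_le_of_star hΩ hd1 hρ hf hzΩ hKs hKs le_rfl hw.continuous
      (hφ z ⟨𝒯.vertex_of_mem_cell hK hz, hzΩ⟩) hB
    calc massOn K w ≤ _ := h
      _ = Q * (C * (2 ^ d + 1)) * (Metric.diam (hull K) ^ 2 * G) := by rw [hQ]; ring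
      _ ≤ (C * (F + 1) * C ^ 2 + Q * (C * (2 ^ d + 1))) * (Metric.diam (hull K) ^ 2 * G) := by
          gcongr
          exact le_add_of_nonneg_left (by positivity)
      _ = _ := by ring

/-- In dimension one the diameters of neighbours are not comparable, and the inequality holds at
the scale of the largest element at the vertex. -/
theorem exists_massOn_le_of_eq_one (hd : d = 1) {ρ : ℝ} (hρ : 0 < ρ) (hρ1 : ρ ≤ 1 / 2) :
    ∃ C : ℝ, 0 < C ∧ ∀ {Ω : Set (Pt d)} (_ : IsBoundedDomain Ω) (𝒯 : Triangulation Ω),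
      (∀ K ∈ 𝒯.cells, Fat ρ K) → ∀ {L : ℝ≥0} {w : Pt d → ℝ}, LipschitzWith L w →
      (∀ x, x ∉ Ω → w x = 0) → (∀ z ∈ 𝒯.nodes, ∫ x in Ω, w x * 𝒯.hat z x = 0) →
      ∀ {K : Finset (Pt d)} {z : Pt d} {δ : ℝ}, K ∈ 𝒯.cells → z ∈ K →
      (∀ K' ∈ 𝒯.star z, Metric.diam (hull K') ≤ δ) →
      massOn K w ≤ C * δ ^ 2 * ∑ K' ∈ 𝒯.star z, energyOn K' w := by
  have hd1 : 1 ≤ d := by omega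
  have hd0 : (0 : ℝ) < d := by exact_mod_cast (by omega : 0 < d)
  set F : ℝ := 2 ^ (d + 1) * 4 * 2 ^ d with hF
  set Q : ℝ := 2 + 2 * 4 ^ (d + 1) / (ρ ^ d * ρ ^ d) with hQ
  set s := (2 * ρ / (d * 1)) ^ d * ρ ^ d with hs
  have hs0 : 0 < s := by positivity
  set P : ℝ := 2 ^ d + (4 * 2 ^ d + 2 ^ (d + 5)) / s with hP
  refine ⟨F + Q * P, by positivity, ?_⟩
  intro Ω hΩ 𝒯 hf L w hw hw0 hφ K z δ hK hz hδ
  set G := ∑ K' ∈ 𝒯.star z, energyOn K' w with hG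
  have hG0 : 0 ≤ G := Finset.sum_nonneg fun _ _ => energyOn_nonneg _ _
  have hKs : K ∈ 𝒯.star z := mem_star.2 ⟨hK, hz⟩
  have hDG : 0 ≤ δ ^ 2 * G := by positivity
  rcases exists_boundary_face_or_star 𝒯 hΩ hK hz with ⟨K₁, hr, a, ha, hza, hb⟩ | ⟨hzΩ, hall⟩
  · obtain ⟨hK₁, hz₁⟩ := reach_mem 𝒯 hK hz hr
    have hKK : K = K₁ := by
      refine hb K hK fun x hx => ?_
      have h1 : (K₁.erase a).card = 1 := by rw [Finset.card_erase_of_mem ha, hK₁.2]; omega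
      obtain ⟨y, hy⟩ := Finset.card_eq_one.1 h1
      rw [hy, Finset.mem_singleton] at hx hza
      rw [hx, ← hza]; exact hz
    subst hKK
    have h1 := friedrichs_face hd1 (𝒯.isSimplex hK₁) ha hw fun x hx =>
      hw0 x (notMem_domain_of_boundary_face 𝒯 hΩ hK₁ ha hb hx)
    have h4 : energyOn K w ≤ G := energyOn_le_sum_star hKs w
    calc massOn K w ≤ F * δ ^ 2 * G := h1.trans (by
          have := hδ K hKs
          gcongr)
      _ = F * (δ ^ 2 * G) := by ring
      _ ≤ (F + Q * P) * (δ ^ 2 * G) := by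
          gcongr; exact le_add_of_nonneg_right (by positivity)
      _ = _ := by ring
  · -- Starting from the largest element avoids any comparison of diameters from below.
    obtain ⟨K₀, hK₀, hmax⟩ := Finset.exists_max_image (𝒯.star z) (fun K => Metric.diam (hull K))
      ⟨K, hKs⟩
    have hK₀c := (mem_star.1 hK₀).1
    obtain ⟨c, hc⟩ := poincare_const hw (convex_hull K₀) (measurableSet_hull K₀)
      (isCompact_hull K₀).isBounded (fun x hx y hy => dist_le_diam hx hy)
      (volume_hull_pos (𝒯.isSimplex hK₀c))
    have hwc : LipschitzWith L (fun x => w x - c) := by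
      have := hw.sub (LipschitzWith.const c)
      rwa [add_zero] at this
    have hM₀ : massOn K₀ (fun x => w x - c) ≤ 2 ^ d * (δ ^ 2 * G) := by
      refine hc.trans ?_
      rw [mul_assoc]
      have h4 : energyOn K₀ w ≤ G := energyOn_le_sum_star hK₀ w
      have := hδ K₀ hK₀
      gcongr
    have hB : ∀ K' ∈ 𝒯.star z, massOn K' (fun x => w x - c) ≤ P * (δ ^ 2 * G) := by
      intro K' hK'
      have hK'c := (mem_star.1 hK').1
      by_cases hne : K₀ = K'
      · subst hne
        refine hM₀.trans ?_
        gcongr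
        exact le_add_of_nonneg_right (by positivity)
      · have hcard : (K₀ ∩ K').card = d := by
          have h1 : 0 < (K₀ ∩ K').card :=
            Finset.card_pos.2 ⟨z, Finset.mem_inter.2 ⟨(mem_star.1 hK₀).2, (mem_star.1 hK').2⟩⟩
          have h2 : (K₀ ∩ K').card < K₀.card := by
            refine Finset.card_lt_card (Finset.ssubset_iff_subset_ne.2
              ⟨Finset.inter_subset_left, fun h => hne ?_⟩)
            exact Finset.eq_of_subset_of_card_le (Finset.inter_eq_left.1 h) (by rw [hK₀c.2, hK'c.2])
          rw [hK₀c.2] at h2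
          omega
        have h1 := massOn_le_of_adjacent hd1 hρ hρ1 hf hK₀c hK'c hcard le_rfl
          (by rw [one_mul]; exact hmax K' hK') hwc
        simp only [energyOn_sub_const] at h1
        have hsum : energyOn K₀ w + energyOn K' w ≤ G := by
          rw [← Finset.sum_pair (f := fun K => energyOn K w) hne]
          exact Finset.sum_le_sum_of_subset_of_nonneg
            (Finset.insert_subset hK₀ (Finset.singleton_subset_iff.2 hK'))
            fun _ _ _ => energyOn_nonneg _ _
        have h2 : 2 ^ (d + 5) * Metric.diam (hull K') ^ 2 * (energyOn K₀ w + energyOn K' w) ≤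
            2 ^ (d + 5) * δ ^ 2 * G := by
          have := hδ K' hK'
          have := add_nonneg (energyOn_nonneg K₀ w) (energyOn_nonneg K' w)
          gcongr
        have h3 : massOn K' (fun x => w x - c) ≤
            (4 * 2 ^ d + 2 ^ (d + 5)) * (δ ^ 2 * G) / s := by
          rw [le_div_iff₀ hs0]
          linarith
        refine h3.trans ?_
        rw [hP, add_mul (2 ^ d : ℝ), div_mul_eq_mul_div]
        exact le_add_of_nonneg_left (by positivity)
    have h := massOn_le_of_star hΩ hd1 hρ hf hzΩ hKs hK₀ (hmax K hKs) hw.continuous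
      (hφ z ⟨𝒯.vertex_of_mem_cell hK hz, hzΩ⟩) hB
    calc massOn K w ≤ _ := h
      _ = Q * P * (δ ^ 2 * G) := by rw [hQ]; ring
      _ ≤ (F + Q * P) * (δ ^ 2 * G) := by
          gcongr; exact le_add_of_nonneg_left (by positivity)
      _ = _ := by ring

/-- In dimension one at most two elements share a vertex. -/
theorem star_subset_pair (hd : d = 1) {z : Pt d} (hK : K ∈ 𝒯.star z) (hK' : K' ∈ 𝒯.star z)
    (hne : K ≠ K') {K₂ : Finset (Pt d)} (hK₂ : K₂ ∈ 𝒯.star z) : K₂ = K ∨ K₂ = K' := by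
  obtain ⟨hKc, hzK⟩ := mem_star.1 hK
  obtain ⟨hK'c, hzK'⟩ := mem_star.1 hK'
  obtain ⟨hK₂c, hzK₂⟩ := mem_star.1 hK₂
  have hzi : z ∈ K ∩ K' := Finset.mem_inter.2 ⟨hzK, hzK'⟩
  have hcard : (K ∩ K').card = d := by
    have h1 : 0 < (K ∩ K').card := Finset.card_pos.2 ⟨z, hzi⟩
    have h2 : (K ∩ K').card < K.card := by
      refine Finset.card_lt_card (Finset.ssubset_iff_subset_ne.2
        ⟨Finset.inter_subset_left, fun h => hne ?_⟩)
      exact Finset.eq_of_subset_of_card_le (Finset.inter_eq_left.1 h) (by rw [hKc.2, hK'c.2])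
    rw [hKc.2] at h2
    omega
  have hn : hull K ∪ hull K' ∈ 𝓝 z := by
    refine union_mem_nhds 𝒯 hKc hK'c hcard (subset_hull _ hzi) fun v hv => ?_
    obtain ⟨y, hy⟩ := Finset.card_eq_one.1 (hcard.trans hd)
    rw [hy, Finset.mem_singleton] at hv hzi
    rw [hv, ← hzi, coord_self (𝒯.isSimplex hKc) hzK]
    exact one_pos
  have hcl : z ∈ closure (interior (hull K₂)) := by
    rw [closure_interior_hull (𝒯.isSimplex hK₂c)]; exact subset_hull _ hzK₂
  obtain ⟨x, hx, hx'⟩ := mem_closure_iff_nhds.1 hcl _ hn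
  rcases hx with h | h
  · exact Or.inl (eq_of_mem_interior 𝒯 hK₂c hKc hx' h)
  · exact Or.inr (eq_of_mem_interior 𝒯 hK₂c hK'c hx' h)

/-- Local Friedrichs inequalities for functions that are orthogonal to the coarse space. -/
theorem exists_localPoincare (hd : 1 ≤ d) {ρ : ℝ} (hρ : 0 < ρ) (hρ1 : ρ ≤ 1 / 2) :
    ∃ C : ℝ, 0 < C ∧ ∀ {Ω : Set (Pt d)} (_ : IsBoundedDomain Ω) (𝒯 : Triangulation Ω),
      (∀ K ∈ 𝒯.cells, Fat ρ K) → ∀ {L : ℝ≥0} {w : Pt d → ℝ}, LipschitzWith L w →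
      (∀ x, x ∉ Ω → w x = 0) → (∀ z ∈ 𝒯.nodes, ∫ x in Ω, w x * 𝒯.hat z x = 0) →
      (∀ {K : Finset (Pt d)} {H : ℝ}, K ∈ 𝒯.cells → (∀ K' ∈ 𝒯.cells, Metric.diam (hull K') ≤ H) →
        LocalPoincare 𝒯 C H K w) ∧
      ∀ {K K' : Finset (Pt d)}, K ∈ 𝒯.cells → K' ∈ 𝒯.nbrs K → K ≠ K' →
        Metric.diam (hull K') ≤ Metric.diam (hull K) →
        LocalPoincare 𝒯 C (Metric.diam (hull K)) K w := by
  rcases hd.eq_or_lt with h1 | h2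
  · obtain ⟨C, hC, h⟩ := exists_massOn_le_of_eq_one h1.symm hρ hρ1
    refine ⟨C, hC, fun hΩ 𝒯 hf L w hw hw0 hφ => ⟨fun {K H} hK hH => ?_, ?_⟩⟩
    · obtain ⟨z, hz⟩ := (𝒯.isSimplex hK).nonempty
      refine (h hΩ 𝒯 hf hw hw0 hφ hK hz fun K' hK' => hH K' (mem_star.1 hK').1).trans ?_
      gcongr ?_ * ?_
      exact sum_star_le hz w
    · intro K K' hK hK' hne hle
      obtain ⟨hK'c, z, hzi⟩ := mem_nbrs.1 hK'
      obtain ⟨hz, hz'⟩ := Finset.mem_inter.1 hzi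
      refine (h hΩ 𝒯 hf hw hw0 hφ hK hz (δ := Metric.diam (hull K)) fun K₂ hK₂ => ?_).trans ?_
      · rcases star_subset_pair h1.symm (mem_star.2 ⟨hK, hz⟩) (mem_star.2 ⟨hK'c, hz'⟩) hne hK₂ with
          h | h <;> rw [h]
        exact hle
      · gcongr ?_ * ?_
        exact sum_star_le hz w
  · obtain ⟨C, hC, h⟩ := exists_massOn_le_of_two_le h2 hρ hρ1
    have key : ∀ {Ω : Set (Pt d)} (_ : IsBoundedDomain Ω) (𝒯 : Triangulation Ω),
      (∀ K ∈ 𝒯.cells, Fat ρ K) → ∀ {L : ℝ≥0} {w : Pt d → ℝ}, LipschitzWith L w →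
      (∀ x, x ∉ Ω → w x = 0) → (∀ z ∈ 𝒯.nodes, ∫ x in Ω, w x * 𝒯.hat z x = 0) →
      ∀ {K : Finset (Pt d)} {δ : ℝ}, K ∈ 𝒯.cells → Metric.diam (hull K) ≤ δ →
        LocalPoincare 𝒯 C δ K w := by
      intro Ω hΩ 𝒯 hf L w hw hw0 hφ K δ hK hδ
      obtain ⟨z, hz⟩ := (𝒯.isSimplex hK).nonempty
      refine (h hΩ 𝒯 hf hw hw0 hφ hK hz).trans ?_
      have : (0:ℝ) ≤ Metric.diam (hull K) := Metric.diam_nonneg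
      have h0 : 0 ≤ ∑ K' ∈ 𝒯.star z, energyOn K' w :=
        Finset.sum_nonneg fun _ _ => energyOn_nonneg _ _
      gcongr ?_ * ?_ ^ 2 * ?_
      exact sum_star_le hz w
    exact ⟨C, hC, fun hΩ 𝒯 hf L w hw hw0 hφ => ⟨fun hK hH => key hΩ 𝒯 hf hw hw0 hφ hK (hH _ hK),
      fun hK _ _ _ => key hΩ 𝒯 hf hw hw0 hφ hK le_rfl⟩⟩

end Triangulation

end LOD

namespace LOD

open scoped InnerProductSpace NNReal ENNReal Topology

variable {d : ℕ} {Ω : Set (Pt d)}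

/-! ### Nodal interpolation on the fine mesh -/

theorem gradient_eq_slope {K : Finset (Pt d)} {v : Pt d → ℝ} {g : Pt d →ᵃ[ℝ] ℝ}
    (h : Set.EqOn v g (hull K)) {x : Pt d} (hx : x ∈ interior (hull K)) :
    gradient v x = slope g := by
  have h1 : v =ᶠ[𝓝 x] g := by
    filter_upwards [mem_interior_iff_mem_nhds.1 hx] with y hy using h hy
  rw [gradient_congr h1]
  exact (hasGradientAt_affine g x).gradient

theorem energyOn_eq {K : Finset (Pt d)} {v : Pt d → ℝ} {g : Pt d →ᵃ[ℝ] ℝ}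
    (h : Set.EqOn v g (hull K)) : energyOn K v = ‖slope g‖ ^ 2 * volume.real (hull K) := by
  rw [energyOn, ← setIntegral_congr_set (interior_ae_hull K),
    setIntegral_congr_fun isOpen_interior.measurableSet (g := fun _ => ‖slope g‖ ^ 2)
      fun x hx => by simp only [gradient_eq_slope h hx], setIntegral_const, smul_eq_mul, mul_comm,
    measureReal_congr (interior_ae_hull K)]

namespace Triangulation

variable {𝒯 𝒯h : Triangulation Ω} {K K' : Finset (Pt d)}

open Classical in
variable (𝒯h) in
/-- The elements of the mesh that lie in the simplex `K`. -/
noncomputable def cellsIn (K : Finset (Pt d)) : Finset (Finset (Pt d)) :=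
  𝒯h.cellSet.filter fun K' => hull K' ⊆ hull K

theorem mem_cellsIn : K' ∈ 𝒯h.cellsIn K ↔ K' ∈ 𝒯h.cells ∧ hull K' ⊆ hull K := by
  classical
  rw [cellsIn, Finset.mem_filter, mem_cellSet]

/-- An element of the refinement that meets the interior of a coarse element lies in it. -/
theorem hull_subset_of_mem_interior (href : 𝒯h.IsRefinement 𝒯) (hK : K ∈ 𝒯.cells)
    (hK' : K' ∈ 𝒯h.cells) {x : Pt d} (hx : x ∈ interior (hull K)) (hx' : x ∈ hull K') :
    hull K' ⊆ hull K := by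
  obtain ⟨K₂, hK₂, h⟩ := href K' hK'
  rwa [eq_of_mem_interior 𝒯 hK hK₂ hx (h hx')]

theorem setIntegral_cellsIn (href : 𝒯h.IsRefinement 𝒯) (hK : K ∈ 𝒯.cells) {f : Pt d → ℝ}
    (hf : IntegrableOn f (hull K) volume) :
    ∫ x in hull K, f x = ∑ K' ∈ 𝒯h.cellsIn K, ∫ x in hull K', f x := by
  rw [← setIntegral_iUnion 𝒯h (fun K' hK' => (mem_cellsIn.1 hK').1)
    fun K' hK' => hf.mono_set (mem_cellsIn.1 hK').2]
  refine setIntegral_congr_set ?_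
  refine Filter.EventuallyLE.antisymm ?_ ?_
  · refine (interior_ae_hull K).symm.le.trans (LE.le.eventuallyLE fun x hx => ?_)
    obtain ⟨K', hK', hx'⟩ := exists_cell 𝒯h (hull_subset_closure 𝒯 hK (interior_subset hx))
    exact Set.mem_biUnion (mem_cellsIn.2 ⟨hK', hull_subset_of_mem_interior href hK hK' hx hx'⟩) hx'
  · exact LE.le.eventuallyLE (Set.iUnion₂_subset fun K' hK' => (mem_cellsIn.1 hK').2)

theorem exists_mem_cellsIn (href : 𝒯h.IsRefinement 𝒯) (hK : K ∈ 𝒯.cells) {x : Pt d}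
    (hx : x ∈ interior (hull K)) : ∃ K' ∈ 𝒯h.cellsIn K, x ∈ hull K' := by
  obtain ⟨K', hK', hx'⟩ := exists_cell 𝒯h (hull_subset_closure 𝒯 hK (interior_subset hx))
  exact ⟨K', mem_cellsIn.2 ⟨hK', hull_subset_of_mem_interior href hK hK' hx hx'⟩, hx'⟩

theorem energyOn_interp_le (hd : 1 ≤ d) {ρ : ℝ} (hρ : 0 < ρ) (hf : Fat ρ K) (hK : K ∈ 𝒯.cells)
    {c : Pt d → ℝ} {δ : ℝ}
    (hδ : ∀ y ∈ K, ∀ y' ∈ K, c y - c y' ≤ δ * Metric.diam (hull K)) :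
    energyOn K (𝒯.interp c) ≤ (δ / (2 * ρ)) ^ 2 * volume.real (hull K) := by
  obtain ⟨g, hg, hgv⟩ := exists_affine_interp 𝒯 c hK
  have hD := diam_hull_pos (𝒯.isSimplex hK) hd
  obtain ⟨p, hp⟩ := hf
  have h1 := norm_slope_le (by positivity) hp g (δ := δ * Metric.diam (hull K))
    fun y hy y' hy' => by rw [hgv y hy, hgv y' hy']; exact hδ y hy y' hy'
  rw [energyOn_eq hg]
  gcongr
  rw [le_div_iff₀ (by positivity)]
  have : ‖slope g‖ * (2 * ρ) * Metric.diam (hull K) ≤ δ * Metric.diam (hull K) := by linarith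
  exact le_of_mul_le_mul_right this hD

/-- Interpolation of the product of a finite element function with a Lipschitz function, on one
element. -/
theorem interp_mul_le (hd : 1 ≤ d) {ρ : ℝ} (hρ : 0 < ρ) (hf : Fat ρ K) (hK : K ∈ 𝒯.cells)
    {η φ : Pt d → ℝ} (hφ : φ ∈ 𝒯.P1) {M : ℝ} (hM : 0 ≤ M) (hη1 : ∀ x ∈ hull K, |η x| ≤ 1)
    (hηM : ∀ x ∈ hull K, ∀ y ∈ hull K, |η x - η y| ≤ M * ‖x - y‖) :
    energyOn K (𝒯.interp fun y => η y * φ y) ≤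
      1 / (2 * ρ ^ 2) * energyOn K φ + 4 ^ (d + 1) * M ^ 2 / (2 * ρ ^ 2) * massOn K φ ∧
    massOn K (𝒯.interp fun y => η y * φ y) ≤ 4 ^ (d + 1) * massOn K φ := by
  have hS := 𝒯.isSimplex hK
  obtain ⟨g, hg⟩ := hφ.2.2 K hK
  obtain ⟨y₀, hy₀, hmax⟩ := Finset.exists_max_image K (fun y => |φ y|) hS.nonempty
  have hD := diam_hull_pos hS hd
  set D := Metric.diam (hull K)
  set m := |φ y₀| with hm
  have hm0 : 0 ≤ m := abs_nonneg _
  have hmass : m ^ 2 * volume.real (hull K) ≤ 4 ^ (d + 1) * massOn K φ := by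
    have h := vertex_sq_le g hy₀
    rw [← hg (subset_hull K hy₀), ← sq_abs] at h
    refine h.trans (le_of_eq ?_)
    have : massOn K φ = ∫ x in hull K, (g x) ^ 2 :=
      setIntegral_congr_fun (measurableSet_hull K) fun x hx => by simp only [hg hx]
    rw [this]
  constructor
  · -- The product rule for differences of vertex values bounds the slope of the interpolant;
    -- `m` is the largest modulus of `φ` at a vertex.
    have h1 := energyOn_interp_le hd hρ hf hK (c := fun y => η y * φ y)
      (δ := ‖slope g‖ + M * m) fun y hy y' hy' => by
        have hyh := subset_hull K hy
        have hyh' := subset_hull K hy'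
        have e : η y * φ y - η y' * φ y' = η y * (φ y - φ y') + (η y - η y') * φ y' := by ring
        have a1 : |η y * (φ y - φ y')| ≤ ‖slope g‖ * D := by
          rw [abs_mul, hg hyh, hg hyh']
          calc |η y| * |g y - g y'| ≤ 1 * (‖slope g‖ * ‖y - y'‖) := by
                gcongr
                · exact hη1 y hyh
                · exact abs_affine_sub_le g y y'
            _ ≤ _ := by rw [one_mul]; gcongr; exact dist_le_diam hyh hyh'
        have a2 : |(η y - η y') * φ y'| ≤ M * m * D := by
          rw [abs_mul]
          calc |η y - η y'| * |φ y'| ≤ (M * ‖y - y'‖) * m := by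
                gcongr
                · exact hηM y hyh y' hyh'
                · exact hmax y' hy'
            _ ≤ (M * D) * m := by gcongr; exact dist_le_diam hyh hyh'
            _ = _ := by ring
        rw [e]
        linarith [le_abs_self (η y * (φ y - φ y')), le_abs_self ((η y - η y') * φ y')]
    refine h1.trans ?_
    rw [energyOn_eq hg]
    calc ((‖slope g‖ + M * m) / (2 * ρ)) ^ 2 * volume.real (hull K)
        ≤ ((2 * ‖slope g‖ ^ 2 + 2 * (M * m) ^ 2) / (2 * ρ) ^ 2) * volume.real (hull K) := by
          rw [div_pow]
          gcongr
          nlinarith [sq_nonneg (‖slope g‖ - M * m)]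
      _ = 1 / (2 * ρ ^ 2) * (‖slope g‖ ^ 2 * volume.real (hull K)) +
          M ^ 2 / (2 * ρ ^ 2) * (m ^ 2 * volume.real (hull K)) := by field_simp
      _ ≤ 1 / (2 * ρ ^ 2) * (‖slope g‖ ^ 2 * volume.real (hull K)) +
          M ^ 2 / (2 * ρ ^ 2) * (4 ^ (d + 1) * massOn K φ) := by gcongr
      _ = _ := by ring
  · refine le_trans ?_ hmass
    have hi : ∀ x ∈ hull K, (𝒯.interp (fun y => η y * φ y) x) ^ 2 ≤ m ^ 2 := by
      intro x hx
      rw [interp_eq 𝒯 _ hK hx]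
      refine sq_le_sq' ?_ ?_
      all_goals
        have h : |∑ y ∈ K, coord K y x * (η y * φ y)| ≤ m := by
          refine (Finset.abs_sum_le_sum_abs _ _).trans ?_
          calc ∑ y ∈ K, |coord K y x * (η y * φ y)| ≤ ∑ y ∈ K, coord K y x * m := by
                refine Finset.sum_le_sum fun y hy => ?_
                rw [abs_mul, abs_of_nonneg (coord_nonneg hS hx), abs_mul]
                have := coord_nonneg hS (y := y) hx
                gcongr
                calc |η y| * |φ y| ≤ 1 * m := by
                      gcongr
                      · exact hη1 y (subset_hull K hy)
                      · exact hmax y hy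
                  _ = m := one_mul m
            _ = m := by rw [← Finset.sum_mul, sum_coord hS, one_mul]
      · linarith [neg_abs_le (∑ y ∈ K, coord K y x * (η y * φ y))]
      · exact (le_abs_self _).trans h
    obtain ⟨g', hg', -⟩ := exists_affine_interp 𝒯 (fun y => η y * φ y) hK
    have hint : IntegrableOn (fun x => (𝒯.interp (fun y => η y * φ y) x) ^ 2) (hull K) volume := by
      refine IntegrableOn.congr_fun (f := fun x => (g' x) ^ 2) ?_
        (fun x hx => by simp only [hg' hx]) (measurableSet_hull K)
      exact ((continuous_affine g').pow 2).continuousOn.integrableOn_compact (isCompact_hull K)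
    calc massOn K (𝒯.interp fun y => η y * φ y) ≤ ∫ x in hull K, m ^ 2 :=
          setIntegral_mono_on hint (integrableOn_const (volume_hull_ne_top K))
            (measurableSet_hull K) hi
      _ = _ := by rw [setIntegral_const, smul_eq_mul, mul_comm]

end Triangulation

end LOD

namespace LOD

open scoped InnerProductSpace NNReal ENNReal Topology

variable {d : ℕ} {Ω : Set (Pt d)}

/-! ### Fine functions supported in one coarse element with prescribed moments -/

/-- A row stochastic matrix with diagonal entries at least `3/4` is invertible, and its transpose
has an inverse of norm at most two in `ℓ¹`. -/
theorem exists_sum_mul_eq {ι : Type*} [Fintype ι] [DecidableEq ι] (A : ι → ι → ℝ)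
    (hA : ∀ x y, 0 ≤ A x y) (hrow : ∀ x, ∑ y, A x y = 1) (hdiag : ∀ x, 3 / 4 ≤ A x x) (ℓ : ι → ℝ) :
    ∃ s : ι → ℝ, (∀ x, ∑ z, s z * A z x = ℓ x) ∧ ∑ z, |s z| ≤ 2 * ∑ x, |ℓ x| := by
  let T : (ι → ℝ) →ₗ[ℝ] (ι → ℝ) :=
    { toFun := fun s x => ∑ z, s z * A z x
      map_add' := fun s s' => by
        ext x; simp only [Pi.add_apply, add_mul, Finset.sum_add_distrib]
      map_smul' := fun c s => by
        ext x; simp only [Pi.smul_apply, smul_eq_mul, mul_assoc, Finset.mul_sum, RingHom.id_apply] }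
  have hT : ∀ s x, T s x = ∑ z, s z * A z x := fun _ _ => rfl
  have hbd : ∀ s : ι → ℝ, ∑ z, |s z| ≤ 2 * ∑ x, |T s x| := by
    intro s
    have h1 : ∀ x, 2 * (|s x| * A x x) - ∑ z, |s z| * A z x ≤ |T s x| := by
      intro x
      rw [hT, ← Finset.add_sum_erase Finset.univ (fun z => s z * A z x) (Finset.mem_univ x),
        ← Finset.add_sum_erase Finset.univ (fun z => |s z| * A z x) (Finset.mem_univ x)]
      have a1 : |∑ z ∈ Finset.univ.erase x, s z * A z x| ≤
          ∑ z ∈ Finset.univ.erase x, |s z| * A z x := by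
        refine (Finset.abs_sum_le_sum_abs _ _).trans (Finset.sum_le_sum fun z _ => ?_)
        rw [abs_mul, abs_of_nonneg (hA z x)]
      have a2 : |s x * A x x| = |s x| * A x x := by rw [abs_mul, abs_of_nonneg (hA x x)]
      have a3 := abs_sub_abs_le_abs_add (s x * A x x) (∑ z ∈ Finset.univ.erase x, s z * A z x)
      linarith
    have h2 := Finset.sum_le_sum fun x (_ : x ∈ Finset.univ) => h1 x
    rw [Finset.sum_sub_distrib, Finset.sum_comm, ← Finset.mul_sum] at h2
    simp only [← Finset.mul_sum, hrow, mul_one] at h2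
    have h3 : ∑ z, |s z| * (3 / 4) ≤ ∑ z, |s z| * A z z :=
      Finset.sum_le_sum fun z _ => mul_le_mul_of_nonneg_left (hdiag z) (abs_nonneg _)
    rw [← Finset.sum_mul] at h3
    linarith
  have hinj : Function.Injective T := by
    rw [← LinearMap.ker_eq_bot, LinearMap.ker_eq_bot']
    intro s hs
    have h := hbd s
    rw [hs] at h
    simp only [Pi.zero_apply, abs_zero, Finset.sum_const_zero, mul_zero] at h
    ext z
    have h1 := Finset.single_le_sum (f := fun z => |s z|) (fun z _ => abs_nonneg _)
      (Finset.mem_univ z)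
    exact abs_eq_zero.1 (le_antisymm (h1.trans h) (abs_nonneg _))
  obtain ⟨s, hs⟩ := LinearMap.injective_iff_surjective.1 hinj ℓ
  refine ⟨s, fun x => by rw [← hT, hs], ?_⟩
  have := hbd s
  rwa [hs] at this

/-- The tent of height `r / 2` at `c`, supported in the ball of radius `r / 2`. -/
noncomputable def tent (c : Pt d) (r : ℝ) (y : Pt d) : ℝ := max 0 (r / 2 - dist y c)

theorem tent_nonneg (c : Pt d) (r : ℝ) (y : Pt d) : 0 ≤ tent c r y := le_max_left _ _

theorem tent_sub_le (c : Pt d) (r : ℝ) (y y' : Pt d) : |tent c r y - tent c r y'| ≤ dist y y' := by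
  refine (abs_max_sub_max_le_max _ _ _ _).trans ?_
  rw [sub_self, abs_zero]
  refine max_le dist_nonneg ?_
  rw [sub_sub_sub_cancel_left, abs_sub_comm]
  exact abs_dist_sub_le y y' c

namespace Triangulation

variable {𝒯 𝒯h : Triangulation Ω} {K K' : Finset (Pt d)}

theorem interp_sum_mul (s : Finset (Pt d)) (t : Pt d → ℝ) (ψ : Pt d → Pt d → ℝ) (hK : K ∈ 𝒯.cells)
    {x : Pt d} (hx : x ∈ hull K) : 𝒯.interp (fun y => ∑ z ∈ s, t z * ψ z y) x =
      ∑ z ∈ s, t z * 𝒯.interp (ψ z) x := by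
  simp only [interp_eq 𝒯 _ hK hx, Finset.mul_sum]
  rw [Finset.sum_comm]
  exact Finset.sum_congr rfl fun _ _ => Finset.sum_congr rfl fun _ _ => by ring

/-- The fine interpolant of a tent in a coarse element. -/
theorem interp_tent (hΩ : IsBoundedDomain Ω) (href : 𝒯h.IsRefinement 𝒯) (hK : K ∈ 𝒯.cells)
    {c : Pt d} {r : ℝ} (hr : 0 < r) (hc : Metric.closedBall c r ⊆ hull K)
    (hfine : ∀ K' ∈ 𝒯h.cellsIn K, Metric.diam (hull K') ≤ r / 8) :
    (∀ v, tent c r v ≠ 0 → v ∈ interior (hull K)) ∧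
    𝒯h.interp (tent c r) ∈ 𝒯h.P1 ∧ (∀ y, 0 ≤ 𝒯h.interp (tent c r) y) ∧
    (∀ y, 𝒯h.interp (tent c r) y ≠ 0 → y ∈ Metric.closedBall c r) ∧
    r / 8 * ((r / 4) ^ d * ballVol d) ≤ ∫ y in hull K, 𝒯h.interp (tent c r) y := by
  have hint : ∀ v, tent c r v ≠ 0 → dist v c < r / 2 := by
    intro v hv
    by_contra h
    exact hv (max_eq_left (by linarith))
  have hin : Metric.ball c r ⊆ interior (hull K) :=
    interior_maximal (Metric.ball_subset_closedBall.trans hc) Metric.isOpen_ball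
  have hint' : ∀ v, tent c r v ≠ 0 → v ∈ interior (hull K) := fun v hv =>
    hin (Metric.mem_ball.2 (by linarith [hint v hv]))
  have hP : 𝒯h.interp (tent c r) ∈ 𝒯h.P1 := by
    refine interp_mem_P1 𝒯h hΩ fun y _ hy => ?_
    by_contra h
    exact hy (interior_hull_subset 𝒯 hΩ hK (hint' y h))
  refine ⟨hint', hP, fun y => ?_, fun y hy => ?_, ?_⟩
  · by_cases hy : y ∈ Ω
    · obtain ⟨K', hK', hy'⟩ := exists_cell 𝒯h (subset_closure hy)
      rw [interp_eq 𝒯h _ hK' hy']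
      exact Finset.sum_nonneg fun v _ =>
        mul_nonneg (coord_nonneg (𝒯h.isSimplex hK') hy') (tent_nonneg _ _ _)
    · rw [hP.2.1 y hy]
  · have hyΩ : y ∈ Ω := by
      by_contra h
      exact hy (hP.2.1 y h)
    obtain ⟨K', hK', hy'⟩ := exists_cell 𝒯h (subset_closure hyΩ)
    rw [interp_eq 𝒯h _ hK' hy'] at hy
    obtain ⟨v, hv, hne⟩ := Finset.exists_ne_zero_of_sum_ne_zero hy
    have hne' := right_ne_zero_of_mul hne
    have hsub := hull_subset_of_mem_interior href hK hK' (hint' v hne') (subset_hull K' hv)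
    have h1 := hfine K' (mem_cellsIn.2 ⟨hK', hsub⟩)
    have h2 := dist_le_diam hy' (subset_hull K' hv)
    rw [← dist_eq_norm] at h2
    rw [Metric.mem_closedBall]
    linarith [dist_triangle y v c, hint v hne']
  · have hi : IntegrableOn (𝒯h.interp (tent c r)) (hull K) volume :=
      hP.1.continuousOn.integrableOn_compact (isCompact_hull K)
    have hnn : ∀ y, 0 ≤ 𝒯h.interp (tent c r) y := by
      intro y
      by_cases hy : y ∈ Ω
      · obtain ⟨K', hK', hy'⟩ := exists_cell 𝒯h (subset_closure hy)
        rw [interp_eq 𝒯h _ hK' hy']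
        exact Finset.sum_nonneg fun v _ =>
          mul_nonneg (coord_nonneg (𝒯h.isSimplex hK') hy') (tent_nonneg _ _ _)
      · rw [hP.2.1 y hy]
    have hsub : Metric.closedBall c (r / 4) ⊆ hull K :=
      (Metric.closedBall_subset_closedBall (by linarith)).trans hc
    calc r / 8 * ((r / 4) ^ d * ballVol d) = ∫ _ in Metric.closedBall c (r / 4), r / 8 := by
          rw [setIntegral_const, smul_eq_mul, volume_closedBall c (by positivity), mul_comm]
      _ ≤ ∫ y in Metric.closedBall c (r / 4), 𝒯h.interp (tent c r) y := by
          -- A fine element that meets the ball of radius `r / 4` has diameter at most `r / 8`, so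
          -- the tent is at least `r / 2 - r / 4 - r / 8` at its vertices.
          refine setIntegral_mono_on (integrableOn_const
            (isCompact_closedBall c (r / 4)).measure_lt_top.ne) (hi.mono_set hsub)
            measurableSet_closedBall fun y hy => ?_
          rw [Metric.mem_closedBall] at hy
          obtain ⟨K', hK', hy'⟩ := exists_mem_cellsIn href hK
            (hin (Metric.mem_ball.2 (by linarith) : y ∈ Metric.ball c r))
          have hK'c := (mem_cellsIn.1 hK').1
          rw [interp_eq 𝒯h _ hK'c hy']
          have hS := 𝒯h.isSimplex hK'c
          calc r / 8 = ∑ v ∈ K', coord K' v y * (r / 8) := by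
                rw [← Finset.sum_mul, sum_coord hS, one_mul]
            _ ≤ _ := by
                refine Finset.sum_le_sum fun v hv =>
                  mul_le_mul_of_nonneg_left ?_ (coord_nonneg hS hy')
                refine le_max_of_le_right ?_
                have h1 := hfine K' hK'
                have h2 := dist_le_diam (subset_hull K' hv) hy'
                rw [← dist_eq_norm] at h2
                linarith [dist_triangle v y c]
      _ ≤ _ := setIntegral_mono_set hi (Filter.Eventually.of_forall hnn) hsub.eventuallyLE

/-- If the fine mesh is fine enough, then there are fine functions supported in a coarse element
with prescribed moments against the barycentric coordinates. They are combinations of interpolated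
tents, one near each vertex `x`, located where the coordinate of `x` is at least `3/4`. -/
theorem exists_bubble (hd : 1 ≤ d) {ρ : ℝ} (hρ : 0 < ρ) (hΩ : IsBoundedDomain Ω)
    (hf : ∀ K ∈ 𝒯.cells, Fat ρ K) (hfh : ∀ K ∈ 𝒯h.cells, Fat ρ K) (href : 𝒯h.IsRefinement 𝒯)
    (hfiner : 𝒯h.IsFiner 𝒯 (ρ / 32)) (hK : K ∈ 𝒯.cells) (ℓ : Pt d → ℝ) :
    ∃ b ∈ 𝒯h.P1, (∀ x, x ∉ hull K → b x = 0) ∧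
      (∀ x ∈ K, ∫ y in hull K, b y * coord K x y = ℓ x) ∧
      energyOn K b * (Metric.diam (hull K) ^ 2 * volume.real (hull K)) ≤
        (1 / (ρ * (ρ / 32 * (ρ / 16) ^ d))) ^ 2 * (∑ x ∈ K, |ℓ x|) ^ 2 := by
  have hS := 𝒯.isSimplex hK
  have hD := diam_hull_pos hS hd
  set D := Metric.diam (hull K) with hDdef
  set κ := ρ / 32 * (ρ / 16) ^ d with hκ
  have hκ0 : 0 < κ := by positivity
  have hvol := volume_hull_pos hS
  set vol := volume.real (hull K) with hvoldef
  obtain ⟨c, hc⟩ := hf K hK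
  rw [← hDdef] at hc
  set r := ρ * D / 4 with hr
  have hr0 : 0 < r := by positivity
  -- The ball around `p x` is the inscribed ball of `K`, contracted towards the vertex `x`.
  let p : Pt d → Pt d := fun x => AffineMap.homothety x (1 / 4 : ℝ) c
  have hp : ∀ x ∈ K, ∀ y ∈ Metric.closedBall (p x) r, y ∈ hull K ∧ 3 / 4 ≤ coord K x y := by
    intro x hx y hy
    have hy0 : AffineMap.homothety x (4 : ℝ) y ∈ Metric.closedBall c (ρ * D) := by
      rw [Metric.mem_closedBall, dist_eq_norm] at hy ⊢
      have e : AffineMap.homothety x (4 : ℝ) y - c = (4 : ℝ) • (y - p x) := by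
        simp only [p, AffineMap.homothety_apply, vsub_eq_sub, vadd_eq_add]
        module
      rw [e, norm_smul, Real.norm_of_nonneg (by norm_num)]
      linarith
    have hy1 := hc hy0
    have e : y = AffineMap.lineMap x (AffineMap.homothety x (4 : ℝ) y) (1 / 4 : ℝ) := by
      simp only [AffineMap.homothety_apply, AffineMap.lineMap_apply, vsub_eq_sub, vadd_eq_add]
      module
    have hv : ∀ v, coord K v y = 3 / 4 * coord K v x +
        1 / 4 * coord K v (AffineMap.homothety x (4 : ℝ) y) := by
      intro v
      conv_lhs => rw [e]
      rw [AffineMap.apply_lineMap, AffineMap.lineMap_apply_module, smul_eq_mul, smul_eq_mul]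
      norm_num
    refine ⟨(mem_hull_iff hS).2 fun v _ => ?_, ?_⟩
    · rw [hv]
      have h1 := coord_nonneg hS (y := v) (subset_hull K hx)
      have h2 := coord_nonneg hS (y := v) hy1
      linarith
    · rw [hv, coord_self hS hx]
      have h2 := coord_nonneg hS (y := x) hy1
      linarith
  have hfine : ∀ K' ∈ 𝒯h.cellsIn K, Metric.diam (hull K') ≤ r / 8 := by
    intro K' hK'
    refine (hfiner K hK K' (mem_cellsIn.1 hK').1 (mem_cellsIn.1 hK').2).trans (le_of_eq ?_)
    rw [hr]; ring
  let B : Pt d → Pt d → ℝ := fun x => 𝒯h.interp (tent (p x) r)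
  have hB := fun x (hx : x ∈ K) => interp_tent hΩ href hK hr0 (fun y hy => (hp x hx y hy).1) hfine
  let m : Pt d → ℝ := fun x => ∫ y in hull K, B x y
  have hm : ∀ x ∈ K, κ * (D * vol) ≤ m x := by
    intro x hx
    refine le_trans ?_ (hB x hx).2.2.2.2
    calc κ * (D * vol) ≤ κ * (D * (D ^ d * ballVol d)) := by
          gcongr; exact volume_hull_le K
      _ = r / 8 * ((r / 4) ^ d * ballVol d) := by
          rw [hκ, hr, show ρ * D / 4 / 4 = ρ / 16 * D by ring, mul_pow]; ring
  have hm0 : ∀ x ∈ K, 0 < m x := fun x hx => lt_of_lt_of_le (by positivity) (hm x hx)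
  have hBc : ∀ x ∈ K, Continuous (B x) := fun x hx => (hB x hx).2.1.1
  have hiB : ∀ x ∈ K, ∀ y, IntegrableOn (fun q => B x q * coord K y q) (hull K) volume :=
    fun x hx y => ((hBc x hx).mul (continuous_affine _)).continuousOn.integrableOn_compact
      (isCompact_hull K)
  -- The moments of the tents, each divided by the integral of the tent, form a row stochastic
  -- matrix because the coordinates add up to one.
  obtain ⟨s, hs, hsb⟩ := exists_sum_mul_eq (ι := K)
    (fun x y => (∫ q in hull K, B x q * coord K y q) / m x)
    (fun x y => div_nonneg (setIntegral_nonneg (measurableSet_hull K) fun q hq =>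
      mul_nonneg ((hB x x.2).2.2.1 q) (coord_nonneg hS hq)) (hm0 x x.2).le)
    (fun x => by
      rw [← Finset.sum_div, div_eq_one_iff_eq (hm0 x x.2).ne', ← integral_finsetSum
        (f := fun (y : K) q => B x q * coord K y q) _ fun y _ => hiB x x.2 y]
      refine setIntegral_congr_fun (measurableSet_hull K) fun q _ => ?_
      rw [← Finset.mul_sum, Finset.sum_coe_sort K (fun y => coord K y q), sum_coord hS, mul_one])
    (fun x => by
      rw [le_div_iff₀ (hm0 x x.2), ← integral_const_mul]
      refine setIntegral_mono_on (((hBc x x.2).continuousOn.integrableOn_compact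
        (isCompact_hull K)).const_mul _) (hiB x x.2 x) (measurableSet_hull K) fun q _ => ?_
      by_cases h : B x q = 0
      · simp only [h]; simp
      · have := (hp x x.2 q ((hB x x.2).2.2.2.1 q h)).2
        have h0 := (hB x x.2).2.2.1 q
        rw [mul_comm]
        exact mul_le_mul_of_nonneg_left this h0)
    (fun x => ℓ x)
  classical
  let t : Pt d → ℝ := fun x => if h : x ∈ K then s ⟨x, h⟩ / m x else 0
  have ht : ∀ x : K, t x = s x / m x := fun x => by simp only [t, x.2, dif_pos]
  set δ := ∑ x ∈ K, |t x| with hδ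
  have hδle : δ ≤ 2 * (∑ x ∈ K, |ℓ x|) / (κ * (D * vol)) := by
    rw [le_div_iff₀ (by positivity), hδ, Finset.sum_mul]
    calc ∑ x ∈ K, |t x| * (κ * (D * vol)) = ∑ x : K, |t x| * (κ * (D * vol)) :=
          (Finset.sum_coe_sort K fun x => |t x| * (κ * (D * vol))).symm
      _ ≤ ∑ x : K, |s x| := by
          refine Finset.sum_le_sum fun x _ => ?_
          rw [ht, abs_div, abs_of_pos (hm0 x x.2), div_mul_eq_mul_div, div_le_iff₀ (hm0 x x.2)]
          exact mul_le_mul_of_nonneg_left (hm x x.2) (abs_nonneg _)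
      _ ≤ 2 * ∑ x : K, |ℓ x| := hsb
      _ = _ := by rw [Finset.sum_coe_sort K fun x => |ℓ x|]
  let Ψ : Pt d → ℝ := fun y => ∑ z ∈ K, t z * tent (p z) r y
  have hΨ : ∀ y, Ψ y ≠ 0 → y ∈ interior (hull K) := by
    intro y hy
    obtain ⟨z, hz, hne⟩ := Finset.exists_ne_zero_of_sum_ne_zero hy
    exact (hB z hz).1 y (right_ne_zero_of_mul hne)
  have hbP : 𝒯h.interp Ψ ∈ 𝒯h.P1 := by
    refine interp_mem_P1 𝒯h hΩ fun y _ hy => ?_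
    by_contra h
    exact hy (interior_hull_subset 𝒯 hΩ hK (hΨ y h))
  have hbB : ∀ y ∈ closure Ω, 𝒯h.interp Ψ y = ∑ z ∈ K, t z * B z y := by
    intro y hy
    obtain ⟨K', hK', hy'⟩ := exists_cell 𝒯h hy
    exact interp_sum_mul K t _ hK' hy'
  refine ⟨𝒯h.interp Ψ, hbP, fun y hy => ?_, fun x hx => ?_, ?_⟩
  · by_cases hyΩ : y ∈ Ω
    · rw [hbB y (subset_closure hyΩ)]
      refine Finset.sum_eq_zero fun z hz => ?_
      have : B z y = 0 := by
        by_contra h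
        exact hy (hp z hz y ((hB z hz).2.2.2.1 y h)).1
      rw [this, mul_zero]
    · exact hbP.2.1 y hyΩ
  · have e : ∫ y in hull K, 𝒯h.interp Ψ y * coord K x y =
        ∑ z ∈ K, t z * ∫ y in hull K, B z y * coord K x y := by
      rw [setIntegral_congr_fun (measurableSet_hull K)
        (g := fun y => ∑ z ∈ K, t z * (B z y * coord K x y)) fun y hy => by
          simp only [hbB y (hull_subset_closure 𝒯 hK hy), Finset.sum_mul, mul_assoc],
        integral_finsetSum _ fun z hz => (hiB z hz x).const_mul _]
      simp only [integral_const_mul]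
    rw [e, ← Finset.sum_coe_sort K fun z => t z * ∫ y in hull K, B z y * coord K x y, ← hs ⟨x, hx⟩]
    refine Finset.sum_congr rfl fun z _ => ?_
    rw [ht]; ring
  · have hδ0 : 0 ≤ δ := Finset.sum_nonneg fun _ _ => abs_nonneg _
    obtain ⟨L, hL⟩ := exists_lipschitz 𝒯h hΩ hbP
    have h1 : energyOn K (𝒯h.interp Ψ) ≤ (δ / (2 * ρ)) ^ 2 * vol := by
      have hv : vol = ∑ K' ∈ 𝒯h.cellsIn K, volume.real (hull K') := by
        have := setIntegral_cellsIn href hK (f := fun _ => (1 : ℝ))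
          (integrableOn_const (volume_hull_ne_top K))
        simpa only [setIntegral_const, smul_eq_mul, mul_one] using this
      rw [energyOn, setIntegral_cellsIn href hK
          (integrableOn_gradient_sq hL (volume_hull_ne_top K)), hv, Finset.mul_sum]
      refine Finset.sum_le_sum fun K' hK' => ?_
      have hK'c := (mem_cellsIn.1 hK').1
      refine energyOn_interp_le hd hρ (hfh K' hK'c) hK'c fun y hy y' hy' => ?_
      have hyy : dist y y' ≤ Metric.diam (hull K') := by
        rw [dist_eq_norm]; exact dist_le_diam (subset_hull K' hy) (subset_hull K' hy')
      calc Ψ y - Ψ y' = ∑ z ∈ K, t z * (tent (p z) r y - tent (p z) r y') := by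
            simp only [Ψ, ← Finset.sum_sub_distrib, mul_sub]
        _ ≤ ∑ z ∈ K, |t z| * Metric.diam (hull K') := by
            refine Finset.sum_le_sum fun z _ => (le_abs_self _).trans ?_
            rw [abs_mul]
            exact mul_le_mul_of_nonneg_left ((tent_sub_le _ _ _ _).trans hyy) (abs_nonneg _)
        _ = _ := by rw [hδ, Finset.sum_mul]
    calc energyOn K (𝒯h.interp Ψ) * (D ^ 2 * vol) ≤ (δ / (2 * ρ)) ^ 2 * vol * (D ^ 2 * vol) := by
          gcongr
      _ = δ ^ 2 * (D * vol / (2 * ρ)) ^ 2 := by ring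
      _ ≤ (2 * (∑ x ∈ K, |ℓ x|) / (κ * (D * vol))) ^ 2 * (D * vol / (2 * ρ)) ^ 2 := by gcongr
      _ = _ := by field_simp

end Triangulation

end LOD

namespace LOD

open scoped InnerProductSpace NNReal ENNReal Topology

variable {d : ℕ} {Ω : Set (Pt d)}

/-! ### Cutoff inside the fine scale space -/

theorem gradient_sub_ae {L L' : ℝ≥0} {u v : Pt d → ℝ} (hu : LipschitzWith L u)
    (hv : LipschitzWith L' v) :
    ∀ᵐ x ∂(volume : Measure (Pt d)),
      gradient (fun y => u y - v y) x = gradient u x - gradient v x := by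
  filter_upwards [hu.ae_differentiableAt, hv.ae_differentiableAt] with x h1 h2
  rw [gradient, gradient, gradient, fderiv_fun_sub h1 h2, map_sub]

theorem gradient_add_ae {L L' : ℝ≥0} {u v : Pt d → ℝ} (hu : LipschitzWith L u)
    (hv : LipschitzWith L' v) :
    ∀ᵐ x ∂(volume : Measure (Pt d)),
      gradient (fun y => u y + v y) x = gradient u x + gradient v x := by
  filter_upwards [hu.ae_differentiableAt, hv.ae_differentiableAt] with x h1 h2
  rw [gradient, gradient, gradient, fderiv_fun_add h1 h2, map_add]

theorem energyOn_sub_le {K : Finset (Pt d)} {L L' : ℝ≥0} {u v : Pt d → ℝ} (hu : LipschitzWith L u)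
    (hv : LipschitzWith L' v) :
    energyOn K (fun y => u y - v y) ≤ 2 * energyOn K u + 2 * energyOn K v := by
  have hiu := integrableOn_gradient_sq hu (volume_hull_ne_top K)
  have hiv := integrableOn_gradient_sq hv (volume_hull_ne_top K)
  rw [energyOn, energyOn, energyOn, ← integral_const_mul, ← integral_const_mul,
    ← integral_add (hiu.const_mul 2) (hiv.const_mul 2)]
  refine integral_mono_ae (integrableOn_gradient_sq (hu.sub hv) (volume_hull_ne_top K))
    ((hiu.const_mul 2).add (hiv.const_mul 2)) ?_
  filter_upwards [ae_restrict_of_ae (gradient_sub_ae hu hv)] with x hx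
  rw [hx]
  have := parallelogram_law_with_norm ℝ (gradient u x) (gradient v x)
  nlinarith [sq_nonneg ‖gradient u x + gradient v x‖]

theorem eqOn_hull_of_interior {K : Finset (Pt d)} (hK : IsSimplex K) {u v : Pt d → ℝ}
    (hu : Continuous u) (hv : Continuous v) (h : Set.EqOn u v (interior (hull K))) :
    Set.EqOn u v (hull K) := by
  rw [← closure_interior_hull hK]
  exact h.closure hu hv

theorem energyOn_congr {K : Finset (Pt d)} {u v : Pt d → ℝ} (h : Set.EqOn u v (hull K)) :
    energyOn K u = energyOn K v := by
  rw [energyOn, energyOn, ← setIntegral_congr_set (interior_ae_hull K),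
    ← setIntegral_congr_set (interior_ae_hull K)]
  refine setIntegral_congr_fun isOpen_interior.measurableSet fun x hx => ?_
  have : u =ᶠ[𝓝 x] v := by
    filter_upwards [mem_interior_iff_mem_nhds.1 hx] with y hy using h hy
  simp only [gradient_congr this]

/-- The Cauchy–Schwarz inequality against the constant one. -/
theorem sq_setIntegral_le {K : Finset (Pt d)} (hK : IsSimplex K) {f : Pt d → ℝ}
    (hf : Continuous f) :
    (∫ x in hull K, f x) ^ 2 ≤ volume.real (hull K) * ∫ x in hull K, (f x) ^ 2 := by
  have hV := volume_hull_pos hK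
  set V := volume.real (hull K)
  set I := ∫ x in hull K, f x with hI
  have hi : ∀ g : Pt d → ℝ, Continuous g → IntegrableOn g (hull K) volume := fun g hg =>
    hg.continuousOn.integrableOn_compact (isCompact_hull K)
  have h : ∫ x in hull K, (V * f x - I) ^ 2 =
      V ^ 2 * (∫ x in hull K, (f x) ^ 2) - 2 * V * I * I + I ^ 2 * V := by
    have e : ∫ x in hull K, (V * f x - I) ^ 2 =
        ∫ x in hull K, (V ^ 2 * (f x) ^ 2 - 2 * V * I * f x + I ^ 2) :=
      integral_congr_ae (Filter.Eventually.of_forall fun x => by ring)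
    rw [e, integral_add (hi _ (by fun_prop)) (hi _ (by fun_prop)),
      integral_sub (hi _ (by fun_prop)) (hi _ (by fun_prop)), integral_const_mul,
      integral_const_mul, setIntegral_const, smul_eq_mul, ← hI, mul_comm (V) (I ^ 2)]
  have h0 : 0 ≤ ∫ x in hull K, (V * f x - I) ^ 2 := integral_nonneg fun _ => sq_nonneg _
  rw [h] at h0
  have : V * I ^ 2 ≤ V * (V * ∫ x in hull K, (f x) ^ 2) := by nlinarith
  exact le_of_mul_le_mul_left this hV

namespace Triangulation

variable {𝒯 𝒯h : Triangulation Ω} {K K' : Finset (Pt d)}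

theorem energyOn_cellsIn (hΩ : IsBoundedDomain Ω) (href : 𝒯h.IsRefinement 𝒯) (hK : K ∈ 𝒯.cells)
    {v : Pt d → ℝ} (hv : v ∈ 𝒯h.P1) : energyOn K v = ∑ K' ∈ 𝒯h.cellsIn K, energyOn K' v := by
  obtain ⟨L, hL⟩ := exists_lipschitz 𝒯h hΩ hv
  exact setIntegral_cellsIn href hK (integrableOn_gradient_sq hL (volume_hull_ne_top K))

theorem massOn_cellsIn (href : 𝒯h.IsRefinement 𝒯) (hK : K ∈ 𝒯.cells)
    {v : Pt d → ℝ} (hv : Continuous v) : massOn K v = ∑ K' ∈ 𝒯h.cellsIn K, massOn K' v :=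
  setIntegral_cellsIn href hK (integrableOn_sq hv (isCompact_hull K).isBounded)

/-- Where the factor is constant, the interpolant of the product is a multiple of the finite
element function. -/
theorem interp_mul_const (href : 𝒯h.IsRefinement 𝒯) (hK : K ∈ 𝒯.cells) {η φ : Pt d → ℝ}
    (hφ : φ ∈ 𝒯h.P1) (hu : Continuous (𝒯h.interp fun y => η y * φ y)) {e : ℝ}
    (he : ∀ x ∈ hull K, η x = e) :
    Set.EqOn (𝒯h.interp fun y => η y * φ y) (fun x => e * φ x) (hull K) := by
  refine eqOn_hull_of_interior (𝒯.isSimplex hK) hu (continuous_const.mul hφ.1) fun x hx => ?_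
  obtain ⟨K', hK', hx'⟩ := exists_mem_cellsIn href hK hx
  obtain ⟨hK'c, hsub⟩ := mem_cellsIn.1 hK'
  rw [interp_eq 𝒯h _ hK'c hx', eq_sum_of_mem_P1 𝒯h hφ hK'c hx', Finset.mul_sum]
  refine Finset.sum_congr rfl fun v hv => ?_
  rw [he v (hsub (subset_hull K' hv))]; ring

theorem abs_interp_sub_le (hd : 1 ≤ d) {ρ : ℝ} (hρ : 0 < ρ) (hf : Fat ρ K) (hK : K ∈ 𝒯.cells)
    {χ : Pt d → ℝ} (hχ : ∀ x, |χ x| ≤ 1) {x y : Pt d} (hx : x ∈ hull K) (hy : y ∈ hull K) :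
    |𝒯.interp χ x - 𝒯.interp χ y| ≤ (d + 1) / (2 * ρ) / Metric.diam (hull K) * ‖x - y‖ := by
  rw [interp_eq 𝒯 _ hK hx, interp_eq 𝒯 _ hK hy, ← Finset.sum_sub_distrib]
  refine (Finset.abs_sum_le_sum_abs _ _).trans ?_
  calc ∑ v ∈ K, |coord K v x * χ v - coord K v y * χ v|
      ≤ ∑ v ∈ K, ‖x - y‖ / (2 * ρ * Metric.diam (hull K)) := by
        refine Finset.sum_le_sum fun v _ => ?_
        rw [← sub_mul, abs_mul]
        exact (mul_le_of_le_one_right (abs_nonneg _) (hχ v)).trans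
          (abs_coord_sub_le (𝒯.isSimplex hK) hρ hd hf v x y)
    _ = _ := by
        rw [Finset.sum_const, hK.2, nsmul_eq_mul]
        push_cast
        field_simp

theorem abs_interp_le_one (hK : K ∈ 𝒯.cells)
    {χ : Pt d → ℝ} (hχ : ∀ x, |χ x| ≤ 1) {x : Pt d} (hx : x ∈ hull K) : |𝒯.interp χ x| ≤ 1 := by
  rw [interp_eq 𝒯 _ hK hx]
  refine (Finset.abs_sum_le_sum_abs _ _).trans ?_
  rw [← sum_coord (𝒯.isSimplex hK) x]
  refine Finset.sum_le_sum fun v _ => ?_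
  have := coord_nonneg (𝒯.isSimplex hK) (y := v) hx
  rw [abs_mul, abs_of_nonneg this]
  exact mul_le_of_le_one_right this (hχ v)

/-- Cutoff inside the fine scale space. The function `φ` is multiplied by a coarse nodal cutoff,
which is zero at the vertices in `Z` and one at the others, and interpolated; the moments against
the coarse hat functions, which only change on elements with vertices of both kinds, are restored
by bubbles. -/
theorem exists_cutoff_of_set (hd : 1 ≤ d) {ρ : ℝ} (hρ : 0 < ρ) {C₁ : ℝ} (hC₁ : 0 ≤ C₁) :
    ∃ C : ℝ, 0 < C ∧ ∀ {Ω : Set (Pt d)} (_ : IsBoundedDomain Ω) {𝒯 𝒯h : Triangulation Ω},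
      (∀ K ∈ 𝒯.cells, Fat ρ K) → (∀ K ∈ 𝒯h.cells, Fat ρ K) → 𝒯h.IsRefinement 𝒯 →
      𝒯h.IsFiner 𝒯 (ρ / 32) → ∀ {φ : Pt d → ℝ}, φ ∈ fineSpace 𝒯 𝒯h → ∀ Z : Set (Pt d),
      (∀ K ∈ 𝒯.cells, (∃ x ∈ K, x ∈ Z) → (∃ x ∈ K, x ∉ Z) →
        LocalPoincare 𝒯 C₁ (Metric.diam (hull K)) K φ) →
      ∃ z ∈ fineSpace 𝒯 𝒯h, (∀ K ∈ 𝒯.cells, (∀ x ∈ K, x ∈ Z) → Set.EqOn z 0 (hull K)) ∧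
        (∀ K ∈ 𝒯.cells, (∀ x ∈ K, x ∉ Z) → Set.EqOn z φ (hull K)) ∧
        ∀ K ∈ 𝒯.cells, (∃ x ∈ K, x ∈ Z) → (∃ x ∈ K, x ∉ Z) →
          energyOn K z ≤ C * ∑ K' ∈ 𝒯.nbrs K, energyOn K' φ := by
  classical
  set Cb := (1 / (ρ * (ρ / 32 * (ρ / 16) ^ d))) ^ 2 with hCb
  set Cu := 4 ^ (d + 1) * ((d + 1) / (2 * ρ)) ^ 2 / (2 * ρ ^ 2) with hCu
  set Cℓ : ℝ := 2 * (4 ^ (d + 1) + 1) with hCℓ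
  refine ⟨2 * (1 / (2 * ρ ^ 2) + Cu * C₁) + 2 * (Cb * (d + 1) ^ 2 * Cℓ * C₁), by positivity, ?_⟩
  intro Ω hΩ 𝒯 𝒯h hf hfh href hfiner φ hφ Z hmix
  have hφP := hφ.1
  let χ : Pt d → ℝ := fun y => if y ∈ Z then 0 else 1
  have hχ1 : ∀ x, |χ x| ≤ 1 := fun x => by simp only [χ]; split_ifs <;> simp
  let η := 𝒯.interp χ
  set u := 𝒯h.interp (fun y => η y * φ y) with hu
  have huP : u ∈ 𝒯h.P1 := by
    refine interp_mem_P1 𝒯h hΩ fun y _ hy => ?_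
    rw [hφP.2.1 y hy, mul_zero]
  have hconst : ∀ K ∈ 𝒯.cells, ∀ e : ℝ, (∀ x ∈ K, χ x = e) →
      Set.EqOn u (fun x => e * φ x) (hull K) := by
    intro K hK e he
    refine interp_mul_const href hK hφP huP.1 fun x hx => ?_
    simp only [η]
    rw [interp_eq 𝒯 _ hK hx, Finset.sum_congr rfl fun v hv => by rw [he v hv], ← Finset.sum_mul,
      sum_coord (𝒯.isSimplex hK), one_mul]
  -- On an element with vertices of one kind, `u` is `0` or `φ`; only the other elements need a
  -- correction. The defect `ℓ K x` compares with the moments of the product of `φ` and the nodal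
  -- value `χ x`.
  let mixed := 𝒯.cellSet.filter fun K => (∃ x ∈ K, x ∈ Z) ∧ ∃ x ∈ K, x ∉ Z
  have hmixed : ∀ K, K ∈ mixed ↔ K ∈ 𝒯.cells ∧ (∃ x ∈ K, x ∈ Z) ∧ ∃ x ∈ K, x ∉ Z := fun K => by
    simp only [mixed, Finset.mem_filter, mem_cellSet]
  let ℓ : Finset (Pt d) → Pt d → ℝ := fun K x => ∫ y in hull K, (u y - χ x * φ y) * coord K x y
  have hbub := fun K : 𝒯.cells => exists_bubble hd hρ hΩ hf hfh href hfiner K.2 (ℓ K)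
  choose b hbP hb0 hbm hbe using hbub
  let B : Finset (Pt d) → Pt d → ℝ := fun K => if h : K ∈ 𝒯.cells then b ⟨K, h⟩ else 0
  have hB : ∀ K (hK : K ∈ 𝒯.cells), B K = b ⟨K, hK⟩ := fun K hK => by simp only [B, dif_pos hK]
  have hBP : ∀ K ∈ 𝒯.cells, B K ∈ 𝒯h.P1 := fun K hK => by rw [hB K hK]; exact hbP _
  have hBother : ∀ K ∈ 𝒯.cells, ∀ K' ∈ 𝒯.cells, K' ≠ K → Set.EqOn (B K') 0 (hull K) := by
    intro K hK K' hK' hne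
    refine eqOn_hull_of_interior (𝒯.isSimplex hK) (hBP K' hK').1 continuous_const fun x hx => ?_
    rw [hB K' hK']
    exact hb0 ⟨K', hK'⟩ x fun h => hne (eq_of_mem_interior 𝒯 hK hK' hx h).symm
  set z : Pt d → ℝ := u - ∑ K ∈ mixed, B K with hz
  have hzP : z ∈ 𝒯h.P1 :=
    𝒯h.P1Sub.sub_mem huP (𝒯h.P1Sub.sum_mem fun K hK => hBP K ((hmixed K).1 hK).1)
  have hzm : ∀ K ∈ mixed, Set.EqOn z (fun x => u x - B K x) (hull K) := by
    intro K hK x hx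
    have hKc := ((hmixed K).1 hK).1
    simp only [hz, Pi.sub_apply, Finset.sum_apply]
    rw [Finset.sum_eq_single_of_mem K hK fun K' hK' hne =>
      hBother K hKc K' ((hmixed K').1 hK').1 hne hx]
  have hzn : ∀ K ∈ 𝒯.cells, K ∉ mixed → Set.EqOn z u (hull K) := by
    intro K hKc hK x hx
    simp only [hz, Pi.sub_apply, Finset.sum_apply]
    rw [Finset.sum_eq_zero fun K' hK' => hBother K hKc K' ((hmixed K').1 hK').1
      (fun h => hK (h ▸ hK')) hx, sub_zero]
  have hcomp : ∀ K (f : Pt d → ℝ), Continuous f → IntegrableOn f (hull K) volume := fun K f hf' =>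
    hf'.continuousOn.integrableOn_compact (isCompact_hull K)
  have hmul : ∀ K (f g : Pt d → ℝ), Continuous f → Continuous g →
      IntegrableOn (fun y => f y * g y) (hull K) volume := fun K f g hf' hg' =>
    hcomp K _ (hf'.mul hg')
  have hcoord : ∀ (K : Finset (Pt d)) (x : Pt d), Continuous fun y => coord K x y :=
    fun K x => continuous_affine _
  have hφc := hφP.1
  have huc := huP.1
  refine ⟨z, ⟨hzP, (clement_eq_zero_iff 𝒯 hΩ z).2 fun x hx => ?_⟩, fun K hK hKZ x hx => ?_,
    fun K hK hKZ x hx => ?_, fun K hK h1 h2 => ?_⟩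
  · have hhat := (hat_spec 𝒯 hΩ hx).1.1
    have hloc : ∀ (v : Pt d → ℝ) (_ : Continuous v), ∫ y in Ω, v y * 𝒯.hat x y =
        ∑ K ∈ 𝒯.cellSet, ∫ y in hull K, v y * coord K x y := by
      intro v hv
      rw [setIntegral_domain 𝒯 hΩ fun K _ => hmul K _ _ hv hhat]
      refine Finset.sum_congr rfl fun K hK => setIntegral_congr_fun (measurableSet_hull K)
        fun y hy => ?_
      rw [hat_eq_coord 𝒯 hΩ hx ((mem_cellSet 𝒯).1 hK) hy]
    have hφx := (clement_eq_zero_iff 𝒯 hΩ φ).1 hφ.2 x hx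
    rw [hloc φ hφc] at hφx
    rw [hloc z hzP.1]
    -- After the correction the moments for the vertex `x` are multiplied by the same number `χ x`
    -- on all elements, so that their sum still vanishes.
    have key : ∀ K ∈ 𝒯.cellSet, ∫ y in hull K, z y * coord K x y =
        χ x * ∫ y in hull K, φ y * coord K x y := by
      intro K hK
      rw [mem_cellSet] at hK
      by_cases hxK : x ∈ K
      · by_cases hm : K ∈ mixed
        · have h1 : ∫ y in hull K, z y * coord K x y =
              (∫ y in hull K, u y * coord K x y) - ∫ y in hull K, B K y * coord K x y := by
            rw [← integral_sub (hmul K _ _ huc (hcoord K x))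
              (hmul K _ _ (hBP K hK).1 (hcoord K x))]
            refine setIntegral_congr_fun (measurableSet_hull K) fun y hy => ?_
            simp only [hzm K hm hy, sub_mul]
          have h2 : ∫ y in hull K, B K y * coord K x y = ℓ K x := by
            rw [hB K hK]; exact hbm ⟨K, hK⟩ x hxK
          have h3 : ℓ K x = (∫ y in hull K, u y * coord K x y) -
              χ x * ∫ y in hull K, φ y * coord K x y := by
            rw [← integral_const_mul, ← integral_sub (hmul K _ _ huc (hcoord K x))
              ((hmul K _ _ hφc (hcoord K x)).const_mul _)]
            refine setIntegral_congr_fun (measurableSet_hull K) fun y _ => ?_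
            ring
          rw [h1, h2, h3]; ring
        · have hall : ∀ y ∈ K, χ y = χ x := by
            intro y hy
            have : y ∈ Z ↔ x ∈ Z := by
              by_contra hne
              refine hm ((hmixed K).2 ⟨hK, ?_⟩)
              by_cases hyZ : y ∈ Z
              · exact ⟨⟨y, hy, hyZ⟩, x, hxK, fun h => hne ⟨fun _ => h, fun _ => hyZ⟩⟩
              · refine ⟨⟨x, hxK, ?_⟩, y, hy, hyZ⟩
                by_contra h
                exact hne ⟨fun h' => absurd h' hyZ, fun h' => absurd h' h⟩
            simp only [χ, this]
          rw [← integral_const_mul]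
          refine setIntegral_congr_fun (measurableSet_hull K) fun y hy => ?_
          simp only [hzn K hK hm hy, hconst K hK _ hall hy]; ring
      · simp only [coord_of_notMem hxK, mul_zero, integral_zero]
    rw [Finset.sum_congr rfl key, ← Finset.mul_sum, hφx, mul_zero]
  · have hm : K ∉ mixed := fun h => by
      obtain ⟨-, -, y, hy, hyZ⟩ := (hmixed K).1 h
      exact hyZ (hKZ y hy)
    rw [hzn K hK hm hx, hconst K hK 0 (fun y hy => if_pos (hKZ y hy)) hx]; simp
  · have hm : K ∉ mixed := fun h => by
      obtain ⟨-, ⟨y, hy, hyZ⟩, -⟩ := (hmixed K).1 h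
      exact hKZ y hy hyZ
    rw [hzn K hK hm hx, hconst K hK 1 (fun y hy => if_neg (hKZ y hy)) hx]; simp
  · have hm : K ∈ mixed := (hmixed K).2 ⟨hK, h1, h2⟩
    have hS := 𝒯.isSimplex hK
    have hD := diam_hull_pos hS hd
    have hloc := hmix K hK h1 h2
    set D := Metric.diam (hull K) with hDdef
    set E := ∑ K' ∈ 𝒯.nbrs K, energyOn K' φ with hE
    have hφE : energyOn K φ ≤ E :=
      Finset.single_le_sum (f := fun K' => energyOn K' φ) (fun _ _ => energyOn_nonneg _ _)
        (mem_nbrs_self hK)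
    rw [LocalPoincare, ← hE] at hloc
    obtain ⟨L, hL⟩ := exists_lipschitz 𝒯h hΩ huP
    obtain ⟨L', hL'⟩ := exists_lipschitz 𝒯h hΩ (hBP K hK)
    have hprod : ∀ K' ∈ 𝒯h.cellsIn K, _ := fun K' hK' =>
      interp_mul_le (η := η) (M := (d + 1) / (2 * ρ) / D) hd hρ (hfh K' (mem_cellsIn.1 hK').1)
        (mem_cellsIn.1 hK').1 hφP (by positivity)
        (fun x hx => abs_interp_le_one hK hχ1 ((mem_cellsIn.1 hK').2 hx))
        (fun x hx y hy => abs_interp_sub_le hd hρ (hf K hK) hK hχ1 ((mem_cellsIn.1 hK').2 hx)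
          ((mem_cellsIn.1 hK').2 hy))
    have hu1 : energyOn K u ≤ 1 / (2 * ρ ^ 2) * energyOn K φ + Cu / D ^ 2 * massOn K φ := by
      rw [energyOn_cellsIn hΩ href hK huP, energyOn_cellsIn hΩ href hK hφP,
        massOn_cellsIn href hK hφc, Finset.mul_sum, Finset.mul_sum, ← Finset.sum_add_distrib]
      refine Finset.sum_le_sum fun K' hK' => (hprod K' hK').1.trans (le_of_eq ?_)
      rw [hCu, div_pow _ D]; field_simp
    have hu2 : massOn K u ≤ 4 ^ (d + 1) * massOn K φ := by
      rw [massOn_cellsIn href hK huc, massOn_cellsIn href hK hφc, Finset.mul_sum]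
      exact Finset.sum_le_sum fun K' hK' => (hprod K' hK').2
    have hV := volume_hull_pos hS
    set V := volume.real (hull K) with hVdef
    have hMφ := massOn_nonneg K φ
    have hℓ : ∀ x ∈ K, (ℓ K x) ^ 2 ≤ V * (Cℓ * massOn K φ) := by
      intro x hx
      refine (sq_setIntegral_le hS (f := fun y => (u y - χ x * φ y) * coord K x y)
        ((huc.sub (continuous_const.mul hφc)).mul (hcoord K x))).trans ?_
      refine mul_le_mul_of_nonneg_left ?_ hV.le
      calc ∫ y in hull K, ((u y - χ x * φ y) * coord K x y) ^ 2
          ≤ ∫ y in hull K, (2 * (u y) ^ 2 + 2 * (φ y) ^ 2) := by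
            have := hcoord K x
            refine setIntegral_mono_on (hcomp K _ (by fun_prop)) (hcomp K _ (by fun_prop))
              (measurableSet_hull K) fun y hy => ?_
            have c0 := coord_nonneg hS (y := x) hy
            have c1 := coord_le_one hS (y := x) hy
            have hχ2 : χ x ^ 2 ≤ 1 := by
              rw [← sq_abs]; exact pow_le_one₀ (abs_nonneg _) (hχ1 x)
            calc ((u y - χ x * φ y) * coord K x y) ^ 2
                = (u y - χ x * φ y) ^ 2 * (coord K x y) ^ 2 := by ring
              _ ≤ (u y - χ x * φ y) ^ 2 * 1 := by
                  gcongr; exact pow_le_one₀ c0 c1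
              _ ≤ 2 * (u y) ^ 2 + 2 * (χ x ^ 2 * (φ y) ^ 2) := by
                  nlinarith [sq_nonneg (u y + χ x * φ y)]
              _ ≤ 2 * (u y) ^ 2 + 2 * (1 * (φ y) ^ 2) := by gcongr
              _ = _ := by ring
        _ = 2 * massOn K u + 2 * massOn K φ := by
            rw [integral_add (hcomp K _ (by fun_prop)) (hcomp K _ (by fun_prop)),
              integral_const_mul, integral_const_mul]
        _ ≤ Cℓ * massOn K φ := by rw [hCℓ]; linarith
    have hsum : (∑ x ∈ K, |ℓ K x|) ^ 2 ≤ (d + 1) ^ 2 * (V * (Cℓ * massOn K φ)) := by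
      refine (sq_sum_le_card_mul_sum_sq (s := K)).trans ?_
      calc (K.card : ℝ) * ∑ x ∈ K, |ℓ K x| ^ 2
          ≤ (K.card : ℝ) * ∑ x ∈ K, V * (Cℓ * massOn K φ) := by
            gcongr with x hx
            rw [sq_abs]; exact hℓ x hx
        _ = _ := by rw [Finset.sum_const, hK.2, nsmul_eq_mul]; push_cast; ring
    -- The defects are bounded by the mass of `φ` on `K`, and so is the energy of the bubble, with
    -- a factor `1 / D ^ 2` that the local inequality on `K` absorbs.
    have hb1 : energyOn K (B K) ≤ Cb * (d + 1) ^ 2 * Cℓ / D ^ 2 * massOn K φ := by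
      have h := hbe ⟨K, hK⟩
      rw [← hB K hK, ← hDdef, ← hVdef, ← hCb] at h
      have h' : energyOn K (B K) * (D ^ 2 * V) ≤
          Cb * (d + 1) ^ 2 * Cℓ / D ^ 2 * massOn K φ * (D ^ 2 * V) := by
        refine h.trans ((mul_le_mul_of_nonneg_left hsum (by positivity)).trans (le_of_eq ?_))
        field_simp
      exact le_of_mul_le_mul_right h' (by positivity)
    have hm2 : massOn K φ / D ^ 2 ≤ C₁ * E := by
      rw [div_le_iff₀ (by positivity)]; linarith
    have hCu0 : 0 ≤ Cu := by positivity
    calc energyOn K z = energyOn K fun x => u x - B K x := energyOn_congr (hzm K hm)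
      _ ≤ 2 * energyOn K u + 2 * energyOn K (B K) := energyOn_sub_le hL hL'
      _ ≤ 2 * (1 / (2 * ρ ^ 2) * energyOn K φ + Cu / D ^ 2 * massOn K φ) +
          2 * (Cb * (d + 1) ^ 2 * Cℓ / D ^ 2 * massOn K φ) := by gcongr
      _ = 2 * (1 / (2 * ρ ^ 2) * energyOn K φ + Cu * (massOn K φ / D ^ 2)) +
          2 * (Cb * (d + 1) ^ 2 * Cℓ * (massOn K φ / D ^ 2)) := by ring
      _ ≤ 2 * (1 / (2 * ρ ^ 2) * E + Cu * (C₁ * E)) +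
          2 * (Cb * (d + 1) ^ 2 * Cℓ * (C₁ * E)) := by gcongr
      _ = _ := by ring

end Triangulation

end LOD

namespace LOD

open scoped InnerProductSpace NNReal ENNReal Topology

variable {d : ℕ} {Ω : Set (Pt d)}

namespace Triangulation

variable {𝒯 𝒯h : Triangulation Ω} {K K' : Finset (Pt d)}

/-! ### Layers of elements -/

variable (𝒯) in
/-- The elements reached from `K` in at most `m` steps to a neighbour. -/
noncomputable def layer : ℕ → Finset (Pt d) → Finset (Finset (Pt d))
  | 0, K => {K}
  | m + 1, K => (layer m K).biUnion 𝒯.nbrs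

theorem mem_layer_succ {m : ℕ} :
    K' ∈ 𝒯.layer (m + 1) K ↔ ∃ K₂ ∈ 𝒯.layer m K, K' ∈ 𝒯.nbrs K₂ := by
  rw [layer, Finset.mem_biUnion]

theorem layer_subset_cellSet (hK : K ∈ 𝒯.cells) (m : ℕ) : 𝒯.layer m K ⊆ 𝒯.cellSet := by
  intro K' h
  rw [mem_cellSet]
  cases m with
  | zero => rw [layer, Finset.mem_singleton] at h; rwa [h]
  | succ m =>
    obtain ⟨K₂, -, h⟩ := mem_layer_succ.1 h
    exact (mem_nbrs.1 h).1

theorem layer_subset_succ (hK : K ∈ 𝒯.cells) (m : ℕ) : 𝒯.layer m K ⊆ 𝒯.layer (m + 1) K :=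
  fun K' h => mem_layer_succ.2
    ⟨K', h, mem_nbrs_self ((mem_cellSet 𝒯).1 (layer_subset_cellSet hK m h))⟩

theorem layer_mono (hK : K ∈ 𝒯.cells) {m n : ℕ} (h : m ≤ n) : 𝒯.layer m K ⊆ 𝒯.layer n K := by
  induction n, h using Nat.le_induction with
  | base => exact subset_rfl
  | succ n _ ih => exact ih.trans (layer_subset_succ hK n)

theorem self_mem_layer (hK : K ∈ 𝒯.cells) (m : ℕ) : K ∈ 𝒯.layer m K :=
  layer_mono hK (Nat.zero_le m) (by rw [layer, Finset.mem_singleton])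

theorem mem_layer_succ_of_nbrs {m : ℕ} : ∀ {K K₂ K' : Finset (Pt d)}, K₂ ∈ 𝒯.nbrs K →
    K' ∈ 𝒯.layer m K₂ → K' ∈ 𝒯.layer (m + 1) K := by
  induction m with
  | zero =>
    intro K K₂ K' h h'
    rw [layer, Finset.mem_singleton] at h'
    exact mem_layer_succ.2 ⟨K, by rw [layer, Finset.mem_singleton], h' ▸ h⟩
  | succ m ih =>
    intro K K₂ K' h h'
    obtain ⟨K₃, h3, h4⟩ := mem_layer_succ.1 h'
    exact mem_layer_succ.2 ⟨K₃, ih h h3, h4⟩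

theorem mem_layer_comm {m : ℕ} : ∀ {K K' : Finset (Pt d)}, K ∈ 𝒯.cells → K' ∈ 𝒯.layer m K →
    K ∈ 𝒯.layer m K' := by
  induction m with
  | zero =>
    intro K K' _ h
    rw [layer, Finset.mem_singleton] at h ⊢
    exact h.symm
  | succ m ih =>
    intro K K' hK h
    obtain ⟨K₂, h2, h3⟩ := mem_layer_succ.1 h
    exact mem_layer_succ_of_nbrs
      (mem_nbrs_comm ((mem_cellSet 𝒯).1 (layer_subset_cellSet hK m h2)) h3) (ih hK h2)

theorem patch_eq (hK : K ∈ 𝒯.cells) (m : ℕ) : 𝒯.patch m K = ⋃ K' ∈ 𝒯.layer m K, hull K' := by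
  induction m with
  | zero => simp [patch, layer]
  | succ m ih =>
    have : ∀ K', (K' ∈ 𝒯.cells ∧ (hull K' ∩ 𝒯.patch m K).Nonempty) ↔ K' ∈ 𝒯.layer (m + 1) K := by
      intro K'
      rw [mem_layer_succ, ih]
      constructor
      · rintro ⟨hK', x, hx, hx'⟩
        obtain ⟨K₂, hK₂, hx₂⟩ := Set.mem_iUnion₂.1 hx'
        have hK₂c := (mem_cellSet 𝒯).1 (layer_subset_cellSet hK m hK₂)
        refine ⟨K₂, hK₂, mem_nbrs.2 ⟨hK', ?_⟩⟩
        by_contra hne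
        rw [Finset.not_nonempty_iff_eq_empty] at hne
        have := mem_hull_inter 𝒯 hK₂c hK' hx₂ hx
        simp [hne, hull] at this
      · rintro ⟨K₂, hK₂, h⟩
        obtain ⟨hK', x, hx⟩ := mem_nbrs.1 h
        obtain ⟨hx₂, hx'⟩ := Finset.mem_inter.1 hx
        exact ⟨hK', x, subset_hull _ hx', Set.mem_biUnion hK₂ (subset_hull _ hx₂)⟩
    simp only [patch, Set.mem_ofPred_eq, this]

theorem card_layer_le {ν : ℝ} (hν : 𝒯.PatchGrowth ν) (hK : K ∈ 𝒯.cells) {m : ℕ} (hm : 1 ≤ m) :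
    ((𝒯.layer m K).card : ℝ) ≤ ν * (m : ℝ) ^ d := by
  refine le_trans ?_ (hν K hK m hm)
  rw [← Set.ncard_coe_finset]
  refine Nat.cast_le.2 (Set.ncard_le_ncard (fun K' h => ?_) (𝒯.finite_cells.subset fun _ h => h.1))
  refine ⟨(mem_cellSet 𝒯).1 (layer_subset_cellSet hK m h), ?_⟩
  rw [patch_eq hK]
  exact Set.subset_biUnion_of_mem (u := fun K => hull K) (Finset.mem_coe.1 h)

/-- The functions with support in a patch are those that vanish on the other elements. -/
theorem tsupport_subset_patch_iff (hK : K ∈ 𝒯.cells) (m : ℕ) {w : Pt d → ℝ} (hw : Continuous w)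
    (hw0 : ∀ x, x ∉ Ω → w x = 0) : tsupport w ⊆ 𝒯.patch m K ↔
      ∀ K' ∈ 𝒯.cells, K' ∉ 𝒯.layer m K → Set.EqOn w 0 (hull K') := by
  rw [patch_eq hK]
  constructor
  · intro h K' hK' hn
    refine eqOn_hull_of_interior (𝒯.isSimplex hK') hw continuous_const fun x hx => ?_
    by_contra hne
    obtain ⟨K₂, hK₂, hx₂⟩ := Set.mem_iUnion₂.1 (h (subset_tsupport w hne))
    have := eq_of_mem_interior 𝒯 hK' ((mem_cellSet 𝒯).1 (layer_subset_cellSet hK m hK₂)) hx hx₂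
    exact hn (this ▸ hK₂)
  · intro h
    refine closure_minimal (fun x hx => ?_)
      ((𝒯.layer m K).finite_toSet.isClosed_biUnion fun K' _ => isClosed_hull K')
    have hxΩ : x ∈ Ω := by
      by_contra hn
      exact hx (hw0 x hn)
    obtain ⟨K', hK', hx'⟩ := exists_cell 𝒯 (subset_closure hxΩ)
    by_contra hn
    exact hx (h K' hK' (fun hl => hn (Set.mem_biUnion hl hx')) hx')

theorem fineSpace_props (hΩ : IsBoundedDomain Ω) {w : Pt d → ℝ} (hw : w ∈ fineSpace 𝒯 𝒯h) :
    (∃ L : ℝ≥0, LipschitzWith L w) ∧ (∀ x, x ∉ Ω → w x = 0) ∧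
      ∀ z ∈ 𝒯.nodes, ∫ x in Ω, w x * 𝒯.hat z x = 0 :=
  ⟨exists_lipschitz 𝒯h hΩ hw.1, hw.1.2.1, (clement_eq_zero_iff 𝒯 hΩ w).1 hw.2⟩

/-- Cutoff around an element. Elements without a local Friedrichs inequality at the scale of their
own diameter are pairwise disjoint; the cutoff is kept constant on those near its support. -/
theorem exists_cutoff (hd : 1 ≤ d) {ρ : ℝ} (hρ : 0 < ρ) (hρ1 : ρ ≤ 1 / 2) :
    ∃ C : ℝ, 0 < C ∧ ∀ {Ω : Set (Pt d)} (_ : IsBoundedDomain Ω) {𝒯 𝒯h : Triangulation Ω},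
      (∀ K ∈ 𝒯.cells, Fat ρ K) → (∀ K ∈ 𝒯h.cells, Fat ρ K) → 𝒯h.IsRefinement 𝒯 →
      𝒯h.IsFiner 𝒯 (ρ / 32) → ∀ {φ : Pt d → ℝ}, φ ∈ fineSpace 𝒯 𝒯h →
      ∀ {K₀ : Finset (Pt d)}, K₀ ∈ 𝒯.cells → ∀ m : ℕ,
      ∃ z ∈ fineSpace 𝒯 𝒯h, (∀ K ∈ 𝒯.layer m K₀, Set.EqOn z 0 (hull K)) ∧
        (∀ K ∈ 𝒯.cells, K ∉ 𝒯.layer (m + 2) K₀ → Set.EqOn z φ (hull K)) ∧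
        ∀ K ∈ 𝒯.cells, energyOn K z ≤ C * ∑ K' ∈ 𝒯.nbrs K, energyOn K' φ := by
  obtain ⟨C₁, hC₁, hP⟩ := exists_localPoincare hd hρ hρ1
  obtain ⟨C, hC, hcut⟩ := exists_cutoff_of_set hd hρ hC₁.le
  refine ⟨C + 1, by linarith, ?_⟩
  intro Ω hΩ 𝒯 𝒯h hf hfh href hfiner φ hφ K₀ hK₀ m
  -- Elements with a local inequality at the scale of their own diameter; of two neighbours, the
  -- one with the larger diameter is of this kind.
  let Good : Finset (Pt d) → Prop := fun K =>
    ∀ w ∈ fineSpace 𝒯 𝒯h, LocalPoincare 𝒯 C₁ (Metric.diam (hull K)) K w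
  have hgood : ∀ K ∈ 𝒯.cells, ∀ K' ∈ 𝒯.nbrs K, K ≠ K' → Good K ∨ Good K' := by
    intro K hK K' hK' hne
    rcases le_total (Metric.diam (hull K')) (Metric.diam (hull K)) with h | h
    · left
      intro w hw
      obtain ⟨⟨L, hL⟩, h0, h1⟩ := fineSpace_props hΩ hw
      exact (hP hΩ 𝒯 hf hL h0 h1).2 hK hK' hne h
    · right
      intro w hw
      obtain ⟨⟨L, hL⟩, h0, h1⟩ := fineSpace_props hΩ hw
      exact (hP hΩ 𝒯 hf hL h0 h1).2 (mem_nbrs.1 hK').1 (mem_nbrs_comm hK hK') hne.symm h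
  -- The cutoff is zero at the vertices of the layer `m`, and also at those of the other elements
  -- of the layer `m + 1` that are not good. Thus no such element has vertices of both kinds.
  let Z : Set (Pt d) := {x | ∃ K ∈ 𝒯.layer (m + 1) K₀, x ∈ K ∧ (K ∈ 𝒯.layer m K₀ ∨ ¬ Good K)}
  have hlc : ∀ n, ∀ K ∈ 𝒯.layer n K₀, K ∈ 𝒯.cells := fun n K h =>
    (mem_cellSet 𝒯).1 (layer_subset_cellSet hK₀ n h)
  have hmix : ∀ K ∈ 𝒯.cells, (∃ x ∈ K, x ∈ Z) → (∃ x ∈ K, x ∉ Z) → Good K := by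
    rintro K hK ⟨x, hx, K₁, hK₁, hx₁, h⟩ ⟨y, hy, hyZ⟩
    by_contra hbad
    have hnb : K ∈ 𝒯.nbrs K₁ := mem_nbrs.2 ⟨hK, x, Finset.mem_inter.2 ⟨hx₁, hx⟩⟩
    rcases h with h | h
    · exact hyZ ⟨K, mem_layer_succ.2 ⟨K₁, h, hnb⟩, hy, Or.inr hbad⟩
    · by_cases hne : K₁ = K
      · subst hne
        exact hyZ ⟨K₁, hK₁, hy, Or.inr h⟩
      · exact (hgood K₁ (hlc _ _ hK₁) K hnb hne).elim h hbad
  obtain ⟨z, hz, h1, h2, h3⟩ := hcut hΩ hf hfh href hfiner hφ Z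
    fun K hK ha hb => hmix K hK ha hb φ hφ
  refine ⟨z, hz, fun K hK => h1 K (hlc _ _ hK) fun x hx =>
    ⟨K, layer_subset_succ hK₀ m hK, hx, Or.inl hK⟩, fun K hK hn => h2 K hK fun x hx hxZ => ?_,
    fun K hK => ?_⟩
  · obtain ⟨K₁, hK₁, hx₁, -⟩ := hxZ
    exact hn (mem_layer_succ.2 ⟨K₁, hK₁, mem_nbrs.2 ⟨hK, x, Finset.mem_inter.2 ⟨hx₁, hx⟩⟩⟩)
  · have hE0 : 0 ≤ ∑ K' ∈ 𝒯.nbrs K, energyOn K' φ :=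
      Finset.sum_nonneg fun _ _ => energyOn_nonneg _ _
    have hφE : energyOn K φ ≤ ∑ K' ∈ 𝒯.nbrs K, energyOn K' φ :=
      Finset.single_le_sum (f := fun K' => energyOn K' φ) (fun _ _ => energyOn_nonneg _ _)
        (mem_nbrs_self hK)
    rw [add_mul, one_mul]
    by_cases ha : ∃ x ∈ K, x ∈ Z
    · by_cases hb : ∃ x ∈ K, x ∉ Z
      · linarith [h3 K hK ha hb]
      · push Not at hb
        have h0 : energyOn K z = 0 := by
          rw [energyOn_congr (h1 K hK hb), energyOn]
          have : ∀ x, gradient (0 : Pt d → ℝ) x = 0 := fun x =>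
            gradient_eq_zero Filter.EventuallyEq.rfl
          simp only [this, norm_zero]; simp
        rw [h0]; positivity
    · push Not at ha
      rw [energyOn_congr (h2 K hK ha)]
      have : 0 ≤ C * ∑ K' ∈ 𝒯.nbrs K, energyOn K' φ := by positivity
      linarith

end Triangulation

end LOD

namespace LOD

open scoped InnerProductSpace NNReal ENNReal Topology

variable {d : ℕ} {Ω : Set (Pt d)}

namespace Triangulation

variable {𝒯 : Triangulation Ω}

/-! ### Exponential decay of correctors -/

/-- Symmetric positive semidefinite forms, one for each element, with a cutoff at each layer around
each element. The spaces `S m K` play the role of the functions that vanish outside the layer `m`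
around `K`. -/
structure HasCutoff (𝒯 : Triangulation Ω) {V : Type*} [AddCommGroup V] [Module ℝ V]
    (a : Finset (Pt d) → V →ₗ[ℝ] V →ₗ[ℝ] ℝ) (S : ℕ → Finset (Pt d) → Submodule ℝ V)
    (C n : ℝ) : Prop where
  symm : ∀ K x y, a K x y = a K y x
  nonneg : ∀ K x, 0 ≤ a K x x
  vanish : ∀ m, ∀ K ∈ 𝒯.cells, ∀ w ∈ S m K, ∀ K' ∈ 𝒯.cells, K' ∉ 𝒯.layer m K → a K' w w = 0
  cutoff : ∀ K ∈ 𝒯.cells, ∀ m φ, ∃ z, (∀ K' ∈ 𝒯.layer m K, a K' z z = 0) ∧ φ - z ∈ S (m + 2) K ∧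
    ∀ K' ∈ 𝒯.cells, a K' z z ≤ C * ∑ K₂ ∈ 𝒯.nbrs K', a K₂ φ φ
  const_nonneg : 0 ≤ C
  bound_nonneg : 0 ≤ n
  card_nbrs : ∀ K ∈ 𝒯.cells, ((𝒯.nbrs K).card : ℝ) ≤ n

/-- In a sum over neighbourhoods each element is counted at most `n` times, since being a neighbour
is a symmetric relation. -/
theorem sum_nbrs_le {n : ℝ} (hn : ∀ K ∈ 𝒯.cells, ((𝒯.nbrs K).card : ℝ) ≤ n)
    {g : Finset (Pt d) → ℝ} (hg : ∀ K, 0 ≤ g K) {F G : Finset (Finset (Pt d))}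
    (hF : F ⊆ 𝒯.cellSet) (hG : G ⊆ 𝒯.cellSet) (hFG : ∀ K ∈ F, 𝒯.nbrs K ⊆ G) :
    ∑ K ∈ F, ∑ K' ∈ 𝒯.nbrs K, g K' ≤ n * ∑ K ∈ G, g K := by
  classical
  calc ∑ K ∈ F, ∑ K' ∈ 𝒯.nbrs K, g K' ≤ ∑ K' ∈ G, ∑ K ∈ 𝒯.nbrs K', g K' := by
        rw [Finset.sum_sigma', Finset.sum_sigma']
        refine (Finset.sum_le_sum_of_subset_of_nonneg
          (t := (G.sigma fun K' => 𝒯.nbrs K').map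
            ⟨fun x => (⟨x.2, x.1⟩ : (_ : Finset (Pt d)) × Finset (Pt d)), fun x y h => by
              cases x; cases y; simp_all⟩) ?_ fun x _ _ => hg _).trans ?_
        · rintro ⟨K, K'⟩ h
          rw [Finset.mem_sigma] at h
          rw [Finset.mem_map]
          exact ⟨⟨K', K⟩, Finset.mem_sigma.2 ⟨hFG K h.1 h.2,
            mem_nbrs_comm ((mem_cellSet 𝒯).1 (hF h.1)) h.2⟩, rfl⟩
        · rw [Finset.sum_map]; rfl
    _ ≤ ∑ K' ∈ G, n * g K' := by
        refine Finset.sum_le_sum fun K' hK' => ?_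
        rw [Finset.sum_const, nsmul_eq_mul]
        exact mul_le_mul_of_nonneg_right (hn K' ((mem_cellSet 𝒯).1 (hG hK'))) (hg K')
    _ = _ := (Finset.mul_sum ..).symm

section

variable {V : Type*} [AddCommGroup V] [Module ℝ V] {a : Finset (Pt d) → V →ₗ[ℝ] V →ₗ[ℝ] ℝ}
  {S : ℕ → Finset (Pt d) → Submodule ℝ V} {C n : ℝ}

variable (𝒯) in
/-- The sum of the forms over all elements. -/
noncomputable def total (a : Finset (Pt d) → V →ₗ[ℝ] V →ₗ[ℝ] ℝ) : V →ₗ[ℝ] V →ₗ[ℝ] ℝ :=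
  ∑ K ∈ 𝒯.cellSet, a K

theorem total_apply (x y : V) : 𝒯.total a x y = ∑ K ∈ 𝒯.cellSet, a K x y := by
  simp only [total, LinearMap.sum_apply]

variable (𝒯) in
/-- The energy of `p` outside the layer `m` around `K₀`. -/
noncomputable def tail (a : Finset (Pt d) → V →ₗ[ℝ] V →ₗ[ℝ] ℝ) (K₀ : Finset (Pt d)) (p : V)
    (m : ℕ) : ℝ := ∑ K ∈ 𝒯.cellSet \ 𝒯.layer m K₀, a K p p

namespace HasCutoff

theorem total_symm (h : 𝒯.HasCutoff a S C n) (x y : V) : 𝒯.total a x y = 𝒯.total a y x := by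
  simp only [total_apply, h.symm _ x y]

theorem total_nonneg (h : 𝒯.HasCutoff a S C n) (x : V) : 0 ≤ 𝒯.total a x x := by
  rw [total_apply]; exact Finset.sum_nonneg fun K _ => h.nonneg K x

theorem eq_zero_left (h : 𝒯.HasCutoff a S C n) {K : Finset (Pt d)} {x : V} (hx : a K x x = 0)
    (y : V) : a K x y = 0 := by
  have := bilin_cauchy_schwarz (a K) (h.symm K) (h.nonneg K) x y
  rw [hx, Real.sqrt_zero, zero_mul] at this
  exact abs_eq_zero.1 (le_antisymm this (abs_nonneg _))

theorem eq_zero_right (h : 𝒯.HasCutoff a S C n) {K : Finset (Pt d)} {x : V} (hx : a K x x = 0)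
    (y : V) : a K y x = 0 := by
  rw [h.symm]; exact h.eq_zero_left hx y

theorem tail_le_tail (h : 𝒯.HasCutoff a S C n) {K₀ : Finset (Pt d)} (hK₀ : K₀ ∈ 𝒯.cells) (p : V)
    {m m' : ℕ} (hm : m ≤ m') : 𝒯.tail a K₀ p m' ≤ 𝒯.tail a K₀ p m :=
  Finset.sum_le_sum_of_subset_of_nonneg (Finset.sdiff_subset_sdiff subset_rfl (layer_mono hK₀ hm))
    fun K _ _ => h.nonneg K p

theorem tail_le_total (h : 𝒯.HasCutoff a S C n) (K₀ : Finset (Pt d)) (p : V) (m : ℕ) :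
    𝒯.tail a K₀ p m ≤ 𝒯.total a p p := by
  rw [total_apply]
  exact Finset.sum_le_sum_of_subset_of_nonneg Finset.sdiff_subset fun K _ _ => h.nonneg K p

theorem tail_sub_tail {K₀ : Finset (Pt d)} (hK₀ : K₀ ∈ 𝒯.cells) (p : V) {m m' : ℕ} (hm : m ≤ m') :
    ∑ K ∈ 𝒯.layer m' K₀ \ 𝒯.layer m K₀, a K p p = 𝒯.tail a K₀ p m - 𝒯.tail a K₀ p m' := by
  have h1 := Finset.sum_sdiff (f := fun K => a K p p) (layer_mono hK₀ hm)
  have h2 := Finset.sum_sdiff (f := fun K => a K p p) (layer_subset_cellSet hK₀ m)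
  have h3 := Finset.sum_sdiff (f := fun K => a K p p) (layer_subset_cellSet hK₀ m')
  simp only [tail]
  linarith

/-- A corrector is orthogonal to its cutoff, which agrees with it far from `K₀`; so the energy far
away is controlled by the energy in a few layers. -/
theorem decay_step (h : 𝒯.HasCutoff a S C n) {K₀ : Finset (Pt d)} (hK₀ : K₀ ∈ 𝒯.cells) {p : V}
    (hp : ∀ w, a K₀ w w = 0 → 𝒯.total a p w = 0) (j : ℕ) :
    (2 + C * n) * 𝒯.tail a K₀ p (j + 4) ≤ (1 + C * n) * 𝒯.tail a K₀ p j := by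
  obtain ⟨z, hz0, hzS, hzE⟩ := h.cutoff K₀ hK₀ (j + 1) p
  have hz1 : ∀ K ∈ 𝒯.cells, K ∉ 𝒯.layer (j + 3) K₀ → a K p z = a K p p := by
    intro K hK hn
    have := h.eq_zero_right (h.vanish _ K₀ hK₀ _ hzS K hK hn) p
    rw [map_sub, sub_eq_zero] at this
    exact this.symm
  have hL : ∀ m, 𝒯.layer m K₀ ⊆ 𝒯.cellSet := layer_subset_cellSet hK₀
  -- The transition layers: the cutoff `z` vanishes inside, and agrees with `p` outside.
  set R := 𝒯.layer (j + 3) K₀ \ 𝒯.layer (j + 1) K₀ with hR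
  have hRc : R ⊆ 𝒯.cellSet := Finset.sdiff_subset.trans (hL _)
  have h0 : 𝒯.tail a K₀ p (j + 3) + ∑ K ∈ R, a K p z = 0 := by
    have e := hp z (hz0 K₀ (self_mem_layer hK₀ _))
    rw [total_apply, ← Finset.sum_sdiff (hL (j + 3)),
      ← Finset.sum_sdiff (s₁ := 𝒯.layer (j + 1) K₀) (s₂ := 𝒯.layer (j + 3) K₀)
        (layer_mono hK₀ (by omega)),
      Finset.sum_eq_zero (s := 𝒯.layer (j + 1) K₀) fun K hK => h.eq_zero_right (hz0 K hK) p,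
      add_zero] at e
    rw [← e, tail]
    congr 1
    refine Finset.sum_congr rfl fun K hK => ?_
    rw [Finset.mem_sdiff, mem_cellSet] at hK
    exact (hz1 K hK.1 hK.2).symm
  have h1 : ∀ K, -a K p z ≤ 1 / 2 * (a K p p + a K z z) := by
    intro K
    have := h.nonneg K (p + z)
    simp only [map_add, LinearMap.add_apply] at this
    rw [h.symm K z p] at this
    linarith
  set G := 𝒯.layer (j + 4) K₀ \ 𝒯.layer j K₀ with hG
  have hGsum : ∑ K ∈ G, a K p p = 𝒯.tail a K₀ p j - 𝒯.tail a K₀ p (j + 4) :=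
    tail_sub_tail hK₀ p (by omega)
  have hRG : R ⊆ G :=
    Finset.sdiff_subset_sdiff (layer_mono hK₀ (by omega)) (layer_mono hK₀ (by omega))
  have h2 : ∑ K ∈ R, a K p p ≤ ∑ K ∈ G, a K p p :=
    Finset.sum_le_sum_of_subset_of_nonneg hRG fun K _ _ => h.nonneg K p
  have h3 : ∑ K ∈ R, a K z z ≤ C * (n * ∑ K ∈ G, a K p p) := by
    calc ∑ K ∈ R, a K z z ≤ ∑ K ∈ R, C * ∑ K' ∈ 𝒯.nbrs K, a K' p p :=
          Finset.sum_le_sum fun K hK => hzE K ((mem_cellSet 𝒯).1 (hRc hK))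
      _ = C * ∑ K ∈ R, ∑ K' ∈ 𝒯.nbrs K, a K' p p := (Finset.mul_sum ..).symm
      _ ≤ _ := by
          refine mul_le_mul_of_nonneg_left (sum_nbrs_le h.card_nbrs (fun K => h.nonneg K p) hRc
            (Finset.sdiff_subset.trans (hL _)) fun K hK K' hK' => ?_) h.const_nonneg
          rw [hR, Finset.mem_sdiff] at hK
          refine Finset.mem_sdiff.2 ⟨mem_layer_succ.2 ⟨K, hK.1, hK'⟩, fun hn => hK.2 ?_⟩
          exact mem_layer_succ.2 ⟨K', hn,
            mem_nbrs_comm ((mem_cellSet 𝒯).1 (hL _ hK.1)) hK'⟩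
  have h4 : -∑ K ∈ R, a K p z ≤ 1 / 2 * (∑ K ∈ R, a K p p + ∑ K ∈ R, a K z z) := by
    rw [← Finset.sum_neg_distrib, ← Finset.sum_add_distrib, Finset.mul_sum]
    exact Finset.sum_le_sum fun K _ => h1 K
  have h5 := h.tail_le_tail hK₀ p (show j + 3 ≤ j + 4 by omega)
  have h6 := h.tail_le_tail hK₀ p (show j ≤ j + 4 by omega)
  have hCn := mul_nonneg h.const_nonneg h.bound_nonneg
  have h7 := mul_nonneg hCn (sub_nonneg.2 h6)
  rw [hGsum] at h2 h3
  nlinarith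

theorem tail_le (h : 𝒯.HasCutoff a S C n) {K₀ : Finset (Pt d)} (hK₀ : K₀ ∈ 𝒯.cells) {p : V}
    (hp : ∀ w, a K₀ w w = 0 → 𝒯.total a p w = 0) (j : ℕ) :
    𝒯.tail a K₀ p j ≤ ((1 + C * n) / (2 + C * n)) ^ (j / 4) * 𝒯.total a p p := by
  have hCn := mul_nonneg h.const_nonneg h.bound_nonneg
  set θ := (1 + C * n) / (2 + C * n) with hθ
  have hθ0 : 0 ≤ θ := by positivity
  have key : ∀ i : ℕ, 𝒯.tail a K₀ p (4 * i) ≤ θ ^ i * 𝒯.total a p p := by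
    intro i
    induction i with
    | zero => rw [pow_zero, one_mul]; exact h.tail_le_total K₀ p _
    | succ i ih =>
      have h1 := h.decay_step hK₀ hp (4 * i)
      have h2 : 𝒯.tail a K₀ p (4 * i + 4) ≤ θ * 𝒯.tail a K₀ p (4 * i) := by
        rw [hθ, div_mul_eq_mul_div, le_div_iff₀ (by positivity)]; linarith
      calc 𝒯.tail a K₀ p (4 * (i + 1)) ≤ θ * 𝒯.tail a K₀ p (4 * i) := h2
        _ ≤ θ * (θ ^ i * 𝒯.total a p p) := by gcongr
        _ = _ := by ring
  exact (h.tail_le_tail hK₀ p (Nat.mul_div_le j 4)).trans (key _)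

theorem total_le_of_functional (h : 𝒯.HasCutoff a S C n) {K₀ : Finset (Pt d)}
    (hK₀ : K₀ ∈ 𝒯.cells) {p : V} {c : ℝ} (hc : 0 ≤ c)
    (hp : (𝒯.total a p p) ^ 2 ≤ c * a K₀ p p) : 𝒯.total a p p ≤ c := by
  have h1 : a K₀ p p ≤ 𝒯.total a p p := by
    rw [total_apply]
    exact Finset.single_le_sum (f := fun K => a K p p) (fun K _ => h.nonneg K p)
      ((mem_cellSet 𝒯).2 hK₀)
  rcases (h.total_nonneg p).eq_or_lt with h0 | h0
  · rw [← h0]; exact hc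
  · have : 𝒯.total a p p * 𝒯.total a p p ≤ c * 𝒯.total a p p := by
      rw [← sq]; exact hp.trans (mul_le_mul_of_nonneg_left h1 hc)
    exact le_of_mul_le_mul_right this h0

/-- The localization error of one corrector. -/
theorem localization_error_le (h : 𝒯.HasCutoff a S C n) {K₀ : Finset (Pt d)} (hK₀ : K₀ ∈ 𝒯.cells)
    {μ : ℝ} (hμ0 : 0 < μ) (hμ1 : μ ≤ 1) (hμ : μ ^ 8 = (1 + C * n) / (2 + C * n))
    {ℓ : V → ℝ} {c : ℝ} (hc : 0 ≤ c) (hℓ : ∀ w, (ℓ w) ^ 2 ≤ c * a K₀ w w) {k : ℕ} {p q : V}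
    (hp : ∀ w, 𝒯.total a p w = ℓ w) (hq : q ∈ S k K₀)
    (hqℓ : ∀ w ∈ S k K₀, 𝒯.total a q w = ℓ w) :
    𝒯.total a (p - q) (p - q) ≤ (1 + C * n) / μ ^ 12 * μ ^ (2 * k) * c := by
  have hCn := mul_nonneg h.const_nonneg h.bound_nonneg
  have hp0 : ∀ w, a K₀ w w = 0 → 𝒯.total a p w = 0 := by
    intro w hw
    have := hℓ w
    rw [hw, mul_zero] at this
    rw [hp, pow_eq_zero_iff two_ne_zero |>.1 (le_antisymm this (sq_nonneg _))]
  have hpp : 𝒯.total a p p ≤ c := h.total_le_of_functional hK₀ hc (by rw [hp]; exact hℓ p)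
  -- Céa's lemma: the localized corrector is the best approximation of `p`.
  have hbest : ∀ w ∈ S k K₀, 𝒯.total a (p - q) (p - q) ≤ 𝒯.total a (p - w) (p - w) := by
    intro w hw
    have h1 : 𝒯.total a (p - q) (q - w) = 0 := by
      have hm := (S k K₀).sub_mem hq hw
      rw [map_sub (𝒯.total a) p q, LinearMap.sub_apply, hp, hqℓ _ hm, sub_self]
    have e : p - w = (p - q) + (q - w) := by abel
    have h2 := h.total_nonneg (q - w)
    rw [e]
    generalize hx : p - q = x at h1 ⊢
    generalize hy : q - w = y at h1 h2 ⊢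
    simp only [map_add, LinearMap.add_apply]
    rw [h.total_symm y x, h1]
    linarith
  have hk : 𝒯.total a (p - q) (p - q) ≤ (1 + C * n) * ((μ ^ 8) ^ ((k - 3) / 4) * c) := by
    rcases le_or_gt k 2 with hk | hk
    · have h1 := hbest 0 (S k K₀).zero_mem
      rw [sub_zero] at h1
      rw [show (k - 3) / 4 = 0 by omega, pow_zero, one_mul]
      nlinarith [mul_nonneg hCn hc]
    · obtain ⟨j, rfl⟩ : ∃ j, k = j + 3 := ⟨k - 3, by omega⟩
      obtain ⟨z, hz0, hzS, hzE⟩ := h.cutoff K₀ hK₀ (j + 1) p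
      have h1 := hbest (p - z) hzS
      rw [sub_sub_cancel] at h1
      have hL : ∀ m, 𝒯.layer m K₀ ⊆ 𝒯.cellSet := layer_subset_cellSet hK₀
      have h2 : 𝒯.total a z z ≤ C * (n * 𝒯.tail a K₀ p j) := by
        rw [total_apply, ← Finset.sum_sdiff (hL (j + 1)),
          Finset.sum_eq_zero (s := 𝒯.layer (j + 1) K₀) hz0, add_zero]
        calc ∑ K ∈ 𝒯.cellSet \ 𝒯.layer (j + 1) K₀, a K z z
            ≤ ∑ K ∈ 𝒯.cellSet \ 𝒯.layer (j + 1) K₀, C * ∑ K' ∈ 𝒯.nbrs K, a K' p p :=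
              Finset.sum_le_sum fun K hK =>
                hzE K ((mem_cellSet 𝒯).1 (Finset.sdiff_subset hK))
          _ = C * ∑ K ∈ 𝒯.cellSet \ 𝒯.layer (j + 1) K₀, ∑ K' ∈ 𝒯.nbrs K, a K' p p :=
              (Finset.mul_sum ..).symm
          _ ≤ _ := by
              refine mul_le_mul_of_nonneg_left (sum_nbrs_le h.card_nbrs (fun K => h.nonneg K p)
                Finset.sdiff_subset Finset.sdiff_subset fun K hK K' hK' => ?_) h.const_nonneg
              rw [Finset.mem_sdiff] at hK ⊢
              refine ⟨(mem_cellSet 𝒯).2 (mem_nbrs.1 hK').1, fun hn => hK.2 ?_⟩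
              exact mem_layer_succ.2 ⟨K', hn, mem_nbrs_comm ((mem_cellSet 𝒯).1 hK.1) hK'⟩
      have h3 := h.tail_le hK₀ hp0 j
      rw [← hμ] at h3
      rw [show j + 3 - 3 = j by omega]
      have h4 : 𝒯.tail a K₀ p j ≤ (μ ^ 8) ^ (j / 4) * c := h3.trans (by gcongr)
      have h5 : 0 ≤ (μ ^ 8) ^ (j / 4) * c := by positivity
      calc 𝒯.total a (p - q) (p - q) ≤ C * (n * 𝒯.tail a K₀ p j) := h1.trans h2
        _ = C * n * 𝒯.tail a K₀ p j := by ring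
        _ ≤ C * n * ((μ ^ 8) ^ (j / 4) * c) := by gcongr
        _ ≤ _ := by linarith
  refine hk.trans ?_
  -- The truncated division loses at most six of the `k` layers, each of which counts twice in
  -- the exponent.
  have hpow : (μ ^ 8) ^ ((k - 3) / 4) ≤ μ ^ (2 * k) / μ ^ 12 := by
    rw [le_div_iff₀ (by positivity), ← pow_mul, ← pow_add]
    exact pow_le_pow_of_le_one hμ0.le hμ1 (by omega)
  calc (1 + C * n) * ((μ ^ 8) ^ ((k - 3) / 4) * c)
      ≤ (1 + C * n) * (μ ^ (2 * k) / μ ^ 12 * c) := by gcongr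
    _ = _ := by ring

/-- The localization error of all correctors together. Only boundedly many layers of the
neighbourhoods overlap, which gives the factor `k ^ d` in place of the number of elements. -/
theorem sum_localization_error_le (h : 𝒯.HasCutoff a S C n) {ν : ℝ} (hν : 𝒯.PatchGrowth ν)
    {μ : ℝ} (hμ0 : 0 < μ) (hμ1 : μ ≤ 1) (hμ : μ ^ 8 = (1 + C * n) / (2 + C * n))
    {ℓ : Finset (Pt d) → V → ℝ} {c : Finset (Pt d) → ℝ} (hc : ∀ K, 0 ≤ c K)
    (hℓ : ∀ K ∈ 𝒯.cells, ∀ w, (ℓ K w) ^ 2 ≤ c K * a K w w) {k : ℕ} (hk : 1 ≤ k)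
    {p q : Finset (Pt d) → V}
    (hp : ∀ K ∈ 𝒯.cells, ∀ w, 𝒯.total a (p K) w = ℓ K w) (hq : ∀ K ∈ 𝒯.cells, q K ∈ S k K)
    (hqℓ : ∀ K ∈ 𝒯.cells, ∀ w ∈ S k K, 𝒯.total a (q K) w = ℓ K w) :
    𝒯.total a (∑ K ∈ 𝒯.cellSet, (p K - q K)) (∑ K ∈ 𝒯.cellSet, (p K - q K)) ≤
      2 * (1 + C * n) ^ 2 / μ ^ 12 * 4 ^ d * ν * (k : ℝ) ^ d * μ ^ (2 * k) *
        ∑ K ∈ 𝒯.cellSet, c K := by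
  have hCn := mul_nonneg h.const_nonneg h.bound_nonneg
  set e := ∑ K ∈ 𝒯.cellSet, (p K - q K) with he
  set X := (1 + C * n) / μ ^ 12 * μ ^ (2 * k) with hX
  have hX0 : 0 ≤ X := by positivity
  set y : Finset (Pt d) → ℝ := fun K =>
    2 * (1 + C * n) * ∑ K' ∈ 𝒯.layer (k + 3) K, a K' e e with hy
  have hy0 : ∀ K, 0 ≤ y K := fun K =>
    mul_nonneg (by positivity) (Finset.sum_nonneg fun K' _ => h.nonneg K' e)
  have hterm : ∀ K ∈ 𝒯.cellSet, 𝒯.total a (p K - q K) e ≤ √(X * c K) * √(y K) := by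
    intro K hK
    have hKc := (mem_cellSet 𝒯).1 hK
    obtain ⟨z, hz0, hzS, hzE⟩ := h.cutoff K hKc k e
    have hL : ∀ m, 𝒯.layer m K ⊆ 𝒯.cellSet := layer_subset_cellSet hKc
    -- The cutoff of `e` lives away from `K`, where the right-hand side `ℓ K` vanishes, and outside
    -- the patch that carries `q K`.
    have hz : 𝒯.total a (p K - q K) z = 0 := by
      have h1 : 𝒯.total a (p K) z = 0 := by
        rw [hp K hKc]
        have := hℓ K hKc z
        rw [hz0 K (self_mem_layer hKc k), mul_zero] at this
        exact pow_eq_zero_iff two_ne_zero |>.1 (le_antisymm this (sq_nonneg _))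
      have h2 : 𝒯.total a (q K) z = 0 := by
        rw [total_apply]
        refine Finset.sum_eq_zero fun K' hK' => ?_
        by_cases hl : K' ∈ 𝒯.layer k K
        · exact h.eq_zero_right (hz0 K' hl) _
        · exact h.eq_zero_left (h.vanish k K hKc _ (hq K hKc) K' ((mem_cellSet 𝒯).1 hK') hl) _
      rw [map_sub (𝒯.total a) (p K) (q K), LinearMap.sub_apply, h1, h2, sub_zero]
    have h1 : 𝒯.total a (p K - q K) e = 𝒯.total a (p K - q K) (e - z) := by
      rw [map_sub _ e z, hz, sub_zero]
    have h2 := h.localization_error_le hKc hμ0 hμ1 hμ (hc K) (hℓ K hKc) (hp K hKc) (hq K hKc)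
      (hqℓ K hKc)
    have h3 : 𝒯.total a (e - z) (e - z) ≤ y K := by
      rw [total_apply, ← Finset.sum_sdiff (hL (k + 2)), Finset.sum_eq_zero
        (s := 𝒯.cellSet \ 𝒯.layer (k + 2) K) fun K' hK' => h.vanish _ K hKc _ hzS K'
          ((mem_cellSet 𝒯).1 (Finset.mem_sdiff.1 hK').1) (Finset.mem_sdiff.1 hK').2, zero_add]
      have a1 : ∀ K' ∈ 𝒯.layer (k + 2) K, a K' (e - z) (e - z) ≤ 2 * a K' e e + 2 * a K' z z := by
        intro K' _
        have := h.nonneg K' (e + z)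
        simp only [map_add, LinearMap.add_apply] at this
        simp only [map_sub, LinearMap.sub_apply]
        linarith
      have a2 : ∑ K' ∈ 𝒯.layer (k + 2) K, a K' e e ≤ ∑ K' ∈ 𝒯.layer (k + 3) K, a K' e e :=
        Finset.sum_le_sum_of_subset_of_nonneg (layer_mono hKc (by omega)) fun K' _ _ =>
          h.nonneg K' e
      have a3 : ∑ K' ∈ 𝒯.layer (k + 2) K, a K' z z ≤
          C * (n * ∑ K' ∈ 𝒯.layer (k + 3) K, a K' e e) := by
        calc ∑ K' ∈ 𝒯.layer (k + 2) K, a K' z z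
            ≤ ∑ K' ∈ 𝒯.layer (k + 2) K, C * ∑ K₂ ∈ 𝒯.nbrs K', a K₂ e e :=
              Finset.sum_le_sum fun K' hK' => hzE K' ((mem_cellSet 𝒯).1 (hL _ hK'))
          _ = C * ∑ K' ∈ 𝒯.layer (k + 2) K, ∑ K₂ ∈ 𝒯.nbrs K', a K₂ e e :=
              (Finset.mul_sum ..).symm
          _ ≤ _ := mul_le_mul_of_nonneg_left (sum_nbrs_le h.card_nbrs (fun K => h.nonneg K e)
              (hL _) (hL _) fun K' hK' K₂ hK₂ => mem_layer_succ.2 ⟨K', hK', hK₂⟩) h.const_nonneg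
      calc ∑ K' ∈ 𝒯.layer (k + 2) K, a K' (e - z) (e - z)
          ≤ ∑ K' ∈ 𝒯.layer (k + 2) K, (2 * a K' e e + 2 * a K' z z) := Finset.sum_le_sum a1
        _ = 2 * ∑ K' ∈ 𝒯.layer (k + 2) K, a K' e e + 2 * ∑ K' ∈ 𝒯.layer (k + 2) K, a K' z z := by
            rw [Finset.sum_add_distrib, Finset.mul_sum, Finset.mul_sum]
        _ ≤ y K := by rw [hy]; linarith
    rw [h1]
    refine (le_abs_self _).trans ((bilin_cauchy_schwarz (𝒯.total a) h.total_symm h.total_nonneg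
      _ _).trans ?_)
    gcongr
  set W := 𝒯.total a e e with hW
  have hW0 : 0 ≤ W := h.total_nonneg e
  have hsumy : ∑ K ∈ 𝒯.cellSet, y K ≤ 2 * (1 + C * n) * (ν * (4 * k : ℝ) ^ d * W) := by
    rw [hy, ← Finset.mul_sum]
    refine mul_le_mul_of_nonneg_left ?_ (by positivity)
    have hcomm : ∑ K ∈ 𝒯.cellSet, ∑ K' ∈ 𝒯.layer (k + 3) K, a K' e e =
        ∑ K' ∈ 𝒯.cellSet, ∑ K ∈ 𝒯.layer (k + 3) K', a K' e e := by
      refine Finset.sum_comm' fun K K' => ⟨fun ⟨h1, h2⟩ => ?_, fun ⟨h1, h2⟩ => ?_⟩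
      · have h1' := (mem_cellSet 𝒯).1 h1
        exact ⟨mem_layer_comm h1' h2, layer_subset_cellSet h1' _ h2⟩
      · have h2' := (mem_cellSet 𝒯).1 h2
        exact ⟨layer_subset_cellSet h2' _ h1, mem_layer_comm h2' h1⟩
    rw [hcomm, hW, total_apply, Finset.mul_sum]
    refine Finset.sum_le_sum fun K' hK' => ?_
    rw [Finset.sum_const, nsmul_eq_mul]
    refine mul_le_mul_of_nonneg_right ?_ (h.nonneg K' e)
    have hK'c := (mem_cellSet 𝒯).1 hK'
    have hg := card_layer_le hν hK'c (m := k + 3) (by omega)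
    have hν0 : 0 ≤ ν := by
      have h1 := card_layer_le hν hK'c (m := 1) le_rfl
      rw [Nat.cast_one, one_pow, mul_one] at h1
      exact (Nat.cast_nonneg _).trans h1
    refine hg.trans ?_
    gcongr
    -- the base is `k + 3 ≤ 4 * k`
    have : (1 : ℝ) ≤ k := by exact_mod_cast hk
    push_cast
    linarith
  have hmain : W ^ 2 ≤ (X * ∑ K ∈ 𝒯.cellSet, c K) *
      (2 * (1 + C * n) * (ν * (4 * k : ℝ) ^ d * W)) := by
    have h1 : W ≤ ∑ K ∈ 𝒯.cellSet, √(X * c K) * √(y K) := by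
      have : W = ∑ K ∈ 𝒯.cellSet, 𝒯.total a (p K - q K) e := by
        conv_lhs => rw [hW]; enter [1]; rw [he, map_sum]
        rw [LinearMap.sum_apply]
      rw [this]
      exact Finset.sum_le_sum hterm
    have h2 := Real.sum_sqrt_mul_sqrt_le 𝒯.cellSet (f := fun K => X * c K) (g := y)
      (fun K => mul_nonneg hX0 (hc K)) hy0
    have hs1 : 0 ≤ ∑ K ∈ 𝒯.cellSet, X * c K :=
      Finset.sum_nonneg fun K _ => mul_nonneg hX0 (hc K)
    have hs2 : 0 ≤ ∑ K ∈ 𝒯.cellSet, y K := Finset.sum_nonneg fun K _ => hy0 K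
    calc W ^ 2 ≤ (√(∑ K ∈ 𝒯.cellSet, X * c K) * √(∑ K ∈ 𝒯.cellSet, y K)) ^ 2 := by
          gcongr; exact h1.trans h2
      _ = (∑ K ∈ 𝒯.cellSet, X * c K) * ∑ K ∈ 𝒯.cellSet, y K := by
          rw [mul_pow, Real.sq_sqrt hs1, Real.sq_sqrt hs2]
      _ ≤ _ := by
          rw [← Finset.mul_sum] at hs1 ⊢
          exact mul_le_mul_of_nonneg_left hsumy hs1
  rcases hW0.eq_or_lt with h0 | h0
  · rw [← h0]
    rcases 𝒯.cellSet.eq_empty_or_nonempty with hE | ⟨K, hK⟩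
    · rw [hE]; simp
    · have h1 := card_layer_le hν ((mem_cellSet 𝒯).1 hK) (m := 1) le_rfl
      rw [Nat.cast_one, one_pow, mul_one] at h1
      have hν0 : 0 ≤ ν := (Nat.cast_nonneg _).trans h1
      have : 0 ≤ ∑ K ∈ 𝒯.cellSet, c K := Finset.sum_nonneg fun K _ => hc K
      positivity
  · have : W * W ≤ (2 * (1 + C * n) ^ 2 / μ ^ 12 * 4 ^ d * ν * (k : ℝ) ^ d * μ ^ (2 * k) *
        ∑ K ∈ 𝒯.cellSet, c K) * W := by
      rw [← sq]
      refine hmain.trans (le_of_eq ?_)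
      rw [hX, mul_pow]; ring
    exact le_of_mul_le_mul_right this h0

end HasCutoff

end

end Triangulation

end LOD

namespace LOD

open scoped InnerProductSpace NNReal ENNReal Topology

variable {d : ℕ} {Ω : Set (Pt d)}

/-! ### The bilinear forms on the fine finite element space -/

/-- `B p · q`, in the order of summation of `form`. -/
def coefForm (B : Matrix (Fin d) (Fin d) ℝ) (p q : Pt d) : ℝ := ∑ i, ∑ j, B i j * p j * q i

theorem form_eq (A : Pt d → Matrix (Fin d) (Fin d) ℝ) (ω : Set (Pt d)) (u v : Pt d → ℝ) :
    form A ω u v = ∫ x in ω, coefForm (A x) (gradient u x) (gradient v x) := rfl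

theorem coefForm_add_left (B : Matrix (Fin d) (Fin d) ℝ) (p p' q : Pt d) :
    coefForm B (p + p') q = coefForm B p q + coefForm B p' q := by
  simp only [coefForm, PiLp.add_apply, ← Finset.sum_add_distrib]
  exact Finset.sum_congr rfl fun _ _ => Finset.sum_congr rfl fun _ _ => by ring

theorem coefForm_smul_left (B : Matrix (Fin d) (Fin d) ℝ) (c : ℝ) (p q : Pt d) :
    coefForm B (c • p) q = c * coefForm B p q := by
  simp only [coefForm, PiLp.smul_apply, smul_eq_mul, Finset.mul_sum]
  exact Finset.sum_congr rfl fun _ _ => Finset.sum_congr rfl fun _ _ => by ring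

theorem coefForm_add_right (B : Matrix (Fin d) (Fin d) ℝ) (p q q' : Pt d) :
    coefForm B p (q + q') = coefForm B p q + coefForm B p q' := by
  simp only [coefForm, PiLp.add_apply, ← Finset.sum_add_distrib]
  exact Finset.sum_congr rfl fun _ _ => Finset.sum_congr rfl fun _ _ => by ring

theorem coefForm_smul_right (B : Matrix (Fin d) (Fin d) ℝ) (c : ℝ) (p q : Pt d) :
    coefForm B p (c • q) = c * coefForm B p q := by
  simp only [coefForm, PiLp.smul_apply, smul_eq_mul, Finset.mul_sum]
  exact Finset.sum_congr rfl fun _ _ => Finset.sum_congr rfl fun _ _ => by ring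

theorem coefForm_comm {B : Matrix (Fin d) (Fin d) ℝ} (hB : B.IsSymm) (p q : Pt d) :
    coefForm B p q = coefForm B q p := by
  simp only [coefForm]
  rw [Finset.sum_comm]
  refine Finset.sum_congr rfl fun i _ => Finset.sum_congr rfl fun j _ => ?_
  rw [hB.apply i j]; ring

theorem coefForm_self (B : Matrix (Fin d) (Fin d) ℝ) (p : Pt d) :
    coefForm B p p = B.mulVec p ⬝ᵥ p := by
  simp only [coefForm, dotProduct, Matrix.mulVec, Finset.sum_mul]

theorem ae_coefForm {A : Pt d → Matrix (Fin d) (Fin d) ℝ} {α β : ℝ} (hA : IsCoefficient Ω A α β) :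
    ∀ᵐ x ∂(volume.restrict Ω), (∀ p q, coefForm (A x) p q = coefForm (A x) q p) ∧
      ∀ p, α * ‖p‖ ^ 2 ≤ coefForm (A x) p p ∧ coefForm (A x) p p ≤ β * ‖p‖ ^ 2 := by
  filter_upwards [hA.2] with x hx
  refine ⟨coefForm_comm hx.1, fun p => ?_⟩
  have e : (‖p‖ ^ 2 : ℝ) = p.ofLp ⬝ᵥ p.ofLp := by
    rw [EuclideanSpace.real_norm_sq_eq]
    simp only [dotProduct, sq]
  rw [coefForm_self, e]
  exact hx.2 p

theorem abs_coefForm_le {B : Matrix (Fin d) (Fin d) ℝ} {α β : ℝ} (hα : 0 ≤ α)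
    (hs : ∀ p q, coefForm B p q = coefForm B q p)
    (hB : ∀ p, α * ‖p‖ ^ 2 ≤ coefForm B p p ∧ coefForm B p p ≤ β * ‖p‖ ^ 2) (p q : Pt d) :
    |coefForm B p q| ≤ |β| * (‖p‖ + ‖q‖) ^ 2 := by
  have h1 := hB (p + q)
  have h2 := hB (p - q)
  have e1 : coefForm B (p + q) (p + q) =
      coefForm B p p + 2 * coefForm B p q + coefForm B q q := by
    simp only [coefForm_add_left, coefForm_add_right]
    rw [hs q p]; ring
  have e2 : coefForm B (p - q) (p - q) =
      coefForm B p p - 2 * coefForm B p q + coefForm B q q := by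
    rw [sub_eq_add_neg, ← neg_one_smul ℝ q]
    simp only [coefForm_add_left, coefForm_add_right, coefForm_smul_left, coefForm_smul_right]
    rw [hs q p]; ring
  have n1 : ‖p + q‖ ^ 2 ≤ (‖p‖ + ‖q‖) ^ 2 := by gcongr; exact norm_add_le p q
  have n2 : ‖p - q‖ ^ 2 ≤ (‖p‖ + ‖q‖) ^ 2 := by gcongr; exact norm_sub_le p q
  have b1 : coefForm B (p + q) (p + q) ≤ |β| * (‖p‖ + ‖q‖) ^ 2 :=
    h1.2.trans (by gcongr; exact le_abs_self β)
  have b2 : coefForm B (p - q) (p - q) ≤ |β| * (‖p‖ + ‖q‖) ^ 2 :=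
    h2.2.trans (by gcongr; exact le_abs_self β)
  have c1 : 0 ≤ coefForm B (p + q) (p + q) := le_trans (by positivity) h1.1
  have c2 : 0 ≤ coefForm B (p - q) (p - q) := le_trans (by positivity) h2.1
  have : 0 ≤ |β| * (‖p‖ + ‖q‖) ^ 2 := by positivity
  rw [abs_le]
  constructor <;> linarith

theorem integrableOn_coefForm (hΩ : IsBoundedDomain Ω) {A : Pt d → Matrix (Fin d) (Fin d) ℝ}
    {α β : ℝ} (hα : 0 ≤ α) (hA : IsCoefficient Ω A α β) {L L' : ℝ≥0} {u v : Pt d → ℝ}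
    (hu : LipschitzWith L u) (hv : LipschitzWith L' v) :
    IntegrableOn (fun x => coefForm (A x) (gradient u x) (gradient v x)) Ω volume := by
  have hm : ∀ (w : Pt d → ℝ) (j : Fin d), Measurable fun x => gradient w x j := fun w j =>
    (EuclideanSpace.proj (𝕜 := ℝ) j).continuous.measurable.comp (measurable_gradient' w)
  have : IsFiniteMeasure ((volume : Measure (Pt d)).restrict Ω) :=
    ⟨by rw [Measure.restrict_apply_univ]; exact hΩ.isBounded.measure_lt_top⟩
  refine Integrable.of_bound (C := |β| * (L + L') ^ 2) ?_ ?_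
  · refine AEMeasurable.aestronglyMeasurable ?_
    simp only [coefForm]
    refine Finset.aemeasurable_fun_sum _ fun i _ => Finset.aemeasurable_fun_sum _ fun j _ => ?_
    exact ((hA.1 i j).mul (hm u j).aemeasurable).mul (hm v i).aemeasurable
  · filter_upwards [ae_coefForm hA] with x hx
    rw [Real.norm_eq_abs]
    refine (abs_coefForm_le hα hx.1 hx.2 _ _).trans ?_
    gcongr
    · exact norm_gradient_le hu x
    · exact norm_gradient_le hv x

theorem gradient_smul_ae {L : ℝ≥0} {u : Pt d → ℝ} (hu : LipschitzWith L u) (c : ℝ) :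
    ∀ᵐ x ∂(volume : Measure (Pt d)), gradient (fun y => c * u y) x = c • gradient u x := by
  filter_upwards [hu.ae_differentiableAt] with x h1
  rw [gradient, gradient, fderiv_const_mul h1, map_smulₛₗ]
  simp

namespace Triangulation

variable {𝒯 𝒯h : Triangulation Ω} {K K' : Finset (Pt d)}

/-- The form `∫_{ω ∩ Ω} A ∇u · ∇v` on the finite element space. -/
noncomputable def formLin (𝒯h : Triangulation Ω) (hΩ : IsBoundedDomain Ω)
    {A : Pt d → Matrix (Fin d) (Fin d) ℝ} {α β : ℝ} (hα : 0 ≤ α) (hA : IsCoefficient Ω A α β)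
    (ω : Set (Pt d)) : 𝒯h.P1Sub →ₗ[ℝ] 𝒯h.P1Sub →ₗ[ℝ] ℝ :=
  have hi : ∀ u v : 𝒯h.P1Sub, IntegrableOn
      (fun x => coefForm (A x) (gradient (u : Pt d → ℝ) x) (gradient (v : Pt d → ℝ) x))
      (ω ∩ Ω) volume := fun u v =>
    ((exists_lipschitz 𝒯h hΩ u.2).elim fun _ hu => (exists_lipschitz 𝒯h hΩ v.2).elim fun _ hv =>
      integrableOn_coefForm hΩ hα hA hu hv).mono_set Set.inter_subset_right
  LinearMap.mk₂ ℝ (fun u v => form A (ω ∩ Ω) u v)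
    (fun u u' v => by
      obtain ⟨L, hu⟩ := exists_lipschitz 𝒯h hΩ u.2
      obtain ⟨L', hu'⟩ := exists_lipschitz 𝒯h hΩ u'.2
      rw [form_eq, form_eq, form_eq, ← integral_add (hi u v) (hi u' v)]
      refine integral_congr_ae ?_
      filter_upwards [ae_restrict_of_ae (gradient_add_ae hu hu')] with x hx
      rw [← coefForm_add_left, ← hx]; rfl)
    (fun c u v => by
      obtain ⟨L, hu⟩ := exists_lipschitz 𝒯h hΩ u.2
      rw [form_eq, form_eq, smul_eq_mul, ← integral_const_mul]
      refine integral_congr_ae ?_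
      filter_upwards [ae_restrict_of_ae (gradient_smul_ae hu c)] with x hx
      rw [← coefForm_smul_left, ← hx]; rfl)
    (fun v u u' => by
      obtain ⟨L, hu⟩ := exists_lipschitz 𝒯h hΩ u.2
      obtain ⟨L', hu'⟩ := exists_lipschitz 𝒯h hΩ u'.2
      rw [form_eq, form_eq, form_eq, ← integral_add (hi v u) (hi v u')]
      refine integral_congr_ae ?_
      filter_upwards [ae_restrict_of_ae (gradient_add_ae hu hu')] with x hx
      rw [← coefForm_add_right, ← hx]; rfl)
    (fun c v u => by
      obtain ⟨L, hu⟩ := exists_lipschitz 𝒯h hΩ u.2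
      rw [form_eq, form_eq, smul_eq_mul, ← integral_const_mul]
      refine integral_congr_ae ?_
      filter_upwards [ae_restrict_of_ae (gradient_smul_ae hu c)] with x hx
      rw [← coefForm_smul_right, ← hx]; rfl)

theorem hull_ae_le (hΩ : IsBoundedDomain Ω) (hK : K ∈ 𝒯.cells) :
    (hull K ∩ Ω : Set (Pt d)) =ᵐ[volume] hull K := by
  refine Filter.EventuallyLE.antisymm (LE.le.eventuallyLE Set.inter_subset_left) ?_
  exact (interior_ae_hull K).symm.le.trans (LE.le.eventuallyLE fun x hx =>
    ⟨interior_subset hx, interior_hull_subset 𝒯 hΩ hK hx⟩)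

theorem integrableOn_gradient_sq_P1 (hΩ : IsBoundedDomain Ω) (u : 𝒯h.P1Sub)
    {ω : Set (Pt d)} (hω : volume ω ≠ ⊤) :
    IntegrableOn (fun x => ‖gradient (u : Pt d → ℝ) x‖ ^ 2) ω volume := by
  obtain ⟨L, hu⟩ := exists_lipschitz 𝒯h hΩ u.2
  exact integrableOn_gradient_sq hu hω

section

variable (hΩ : IsBoundedDomain Ω) {A : Pt d → Matrix (Fin d) (Fin d) ℝ} {α β : ℝ} (hα : 0 ≤ α)
  (hA : IsCoefficient Ω A α β)

theorem formLin_apply (ω : Set (Pt d)) (u v : 𝒯h.P1Sub) :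
    𝒯h.formLin hΩ hα hA ω u v = form A (ω ∩ Ω) u v := rfl

theorem formLin_domain (u v : 𝒯h.P1Sub) : 𝒯h.formLin hΩ hα hA Ω u v = form A Ω u v := by
  rw [formLin_apply, Set.inter_self]

theorem formLin_hull (hK : K ∈ 𝒯.cells) (u v : 𝒯h.P1Sub) :
    𝒯h.formLin hΩ hα hA (hull K) u v = form A (hull K) u v := by
  rw [formLin_apply, form_eq, form_eq, setIntegral_congr_set (hull_ae_le hΩ hK)]

theorem formLin_symm (ω : Set (Pt d)) (u v : 𝒯h.P1Sub) :
    𝒯h.formLin hΩ hα hA ω u v = 𝒯h.formLin hΩ hα hA ω v u := by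
  rw [formLin_apply, formLin_apply, form_eq, form_eq]
  refine integral_congr_ae ?_
  filter_upwards [ae_restrict_of_ae_restrict_of_subset Set.inter_subset_right (ae_coefForm hA)]
    with x hx using hx.1 _ _

theorem formLin_bounds (ω : Set (Pt d)) (u : 𝒯h.P1Sub) :
    α * ∫ x in ω ∩ Ω, ‖gradient (u : Pt d → ℝ) x‖ ^ 2 ≤ 𝒯h.formLin hΩ hα hA ω u u ∧
    𝒯h.formLin hΩ hα hA ω u u ≤ β * ∫ x in ω ∩ Ω, ‖gradient (u : Pt d → ℝ) x‖ ^ 2 := by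
  obtain ⟨L, hu⟩ := exists_lipschitz 𝒯h hΩ u.2
  have hi := (integrableOn_coefForm hΩ hα hA hu hu).mono_set (Set.inter_subset_right (s := ω))
  have hg := (integrableOn_gradient_sq_P1 hΩ u hΩ.isBounded.measure_lt_top.ne).mono_set
    (Set.inter_subset_right (s := ω))
  have hae := ae_restrict_of_ae_restrict_of_subset (Set.inter_subset_right (s := ω)) (ae_coefForm
      hA)
  rw [formLin_apply, form_eq, ← integral_const_mul, ← integral_const_mul]
  constructor
  · refine integral_mono_ae (hg.const_mul α) hi ?_
    filter_upwards [hae] with x hx using (hx.2 _).1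
  · refine integral_mono_ae hi (hg.const_mul β) ?_
    filter_upwards [hae] with x hx using (hx.2 _).2

theorem formLin_nonneg (ω : Set (Pt d)) (u : 𝒯h.P1Sub) : 0 ≤ 𝒯h.formLin hΩ hα hA ω u u :=
  le_trans (mul_nonneg hα (integral_nonneg fun _ => by positivity))
    (formLin_bounds hΩ hα hA ω u).1

theorem formLin_hull_bounds (hK : K ∈ 𝒯.cells) (u : 𝒯h.P1Sub) :
    α * energyOn K u ≤ 𝒯h.formLin hΩ hα hA (hull K) u u ∧
    𝒯h.formLin hΩ hα hA (hull K) u u ≤ β * energyOn K u := by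
  have h := formLin_bounds hΩ hα hA (hull K) u
  rwa [setIntegral_congr_set (hull_ae_le hΩ hK)] at h

theorem sum_formLin (u v : 𝒯h.P1Sub) :
    ∑ K ∈ 𝒯.cellSet, 𝒯h.formLin hΩ hα hA (hull K) u v = 𝒯h.formLin hΩ hα hA Ω u v := by
  obtain ⟨L, hu⟩ := exists_lipschitz 𝒯h hΩ u.2
  obtain ⟨L', hv⟩ := exists_lipschitz 𝒯h hΩ v.2
  rw [formLin_domain, form_eq, setIntegral_domain 𝒯 hΩ]
  · exact Finset.sum_congr rfl fun K hK => formLin_hull hΩ hα hA ((mem_cellSet 𝒯).1 hK) u v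
  · intro K hK
    have hi := (integrableOn_coefForm hΩ hα hA hu hv).mono_set
      (Set.inter_subset_right (s := hull K))
    exact hi.congr_set_ae (hull_ae_le hΩ ((mem_cellSet 𝒯).1 hK)).symm

theorem form_union {S : Finset (Finset (Pt d))} (hS : S ⊆ 𝒯.cellSet) (u v : 𝒯h.P1Sub) :
    form A (⋃ K ∈ S, hull K) u v = ∑ K ∈ S, 𝒯h.formLin hΩ hα hA (hull K) u v := by
  obtain ⟨L, hu⟩ := exists_lipschitz 𝒯h hΩ u.2
  obtain ⟨L', hv⟩ := exists_lipschitz 𝒯h hΩ v.2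
  rw [form_eq, setIntegral_iUnion 𝒯 fun K hK => (mem_cellSet 𝒯).1 (hS hK)]
  · exact Finset.sum_congr rfl fun K hK =>
      (formLin_hull hΩ hα hA ((mem_cellSet 𝒯).1 (hS hK)) u v).symm
  · intro K hK
    have hi := (integrableOn_coefForm hΩ hα hA hu hv).mono_set
      (Set.inter_subset_right (s := hull K))
    exact hi.congr_set_ae (hull_ae_le hΩ ((mem_cellSet 𝒯).1 (hS hK))).symm

end

/-! ### The `L²` inner product on the fine finite element space -/

theorem memLp_of_mem_P1 (hΩ : IsBoundedDomain Ω) {v : Pt d → ℝ} (hv : v ∈ 𝒯h.P1) :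
    MemLp v 2 (volume.restrict Ω) :=
  (hv.1.memLp_of_hasCompactSupport (hasCompactSupport_of_mem_P1 𝒯h hΩ hv)).restrict _

/-- The finite element space as a subspace of `L²(Ω)`. -/
noncomputable def toL2 (𝒯h : Triangulation Ω) (hΩ : IsBoundedDomain Ω) :
    𝒯h.P1Sub →ₗ[ℝ] Lp ℝ 2 ((volume : Measure (Pt d)).restrict Ω) where
  toFun v := (memLp_of_mem_P1 hΩ v.2).toLp v
  map_add' _ _ := rfl
  map_smul' _ _ := rfl

theorem inner_toL2 (hΩ : IsBoundedDomain Ω) (x : Lp ℝ 2 ((volume : Measure (Pt d)).restrict Ω))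
    (v : 𝒯h.P1Sub) : ⟪x, 𝒯h.toL2 hΩ v⟫_ℝ = ∫ y in Ω, x y * (v : Pt d → ℝ) y := by
  rw [L2.inner_def]
  refine integral_congr_ae ?_
  filter_upwards [(memLp_of_mem_P1 hΩ v.2).coeFn_toLp] with y hy
  have : (𝒯h.toL2 hΩ v) y = (v : Pt d → ℝ) y := hy
  rw [this]
  simp [mul_comm]

theorem inner_toL2_toL2 (hΩ : IsBoundedDomain Ω) (u v : 𝒯h.P1Sub) :
    ⟪𝒯h.toL2 hΩ u, 𝒯h.toL2 hΩ v⟫_ℝ = ∫ y in Ω, (u : Pt d → ℝ) y * (v : Pt d → ℝ) y := by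
  rw [inner_toL2]
  refine integral_congr_ae ?_
  filter_upwards [(memLp_of_mem_P1 hΩ u.2).coeFn_toLp] with y hy
  have : (𝒯h.toL2 hΩ u) y = (u : Pt d → ℝ) y := hy
  rw [this]

theorem norm_toL2 (hΩ : IsBoundedDomain Ω) (u : 𝒯h.P1Sub) :
    ‖𝒯h.toL2 hΩ u‖ = l2norm Ω (u : Pt d → ℝ) := by
  rw [norm_eq_sqrt_real_inner, inner_toL2_toL2, l2norm]
  simp only [sq]

theorem toL2_injective (hΩ : IsBoundedDomain Ω) {u : 𝒯h.P1Sub} (h : 𝒯h.toL2 hΩ u = 0) : u = 0 := by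
  have h0 : (u : Pt d → ℝ) =ᵐ[volume.restrict Ω] 0 := by
    have h1 := (memLp_of_mem_P1 hΩ u.2).coeFn_toLp
    have h2 : (𝒯h.toL2 hΩ u : Pt d → ℝ) =ᵐ[volume.restrict Ω] 0 := by
      rw [h]; exact Lp.coeFn_zero _ _ _
    exact h1.symm.trans h2
  have h1 : Set.EqOn (u : Pt d → ℝ) 0 Ω :=
    Measure.eqOn_open_of_ae_eq h0 hΩ.isOpen u.2.1.continuousOn continuousOn_const
  ext x
  by_cases hx : x ∈ Ω
  · exact h1 hx
  · exact u.2.2.1 x hx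

end Triangulation

end LOD

namespace LOD

open scoped InnerProductSpace NNReal ENNReal Topology

variable {d : ℕ} {Ω : Set (Pt d)}

namespace Triangulation

variable {𝒯 𝒯h : Triangulation Ω} {K K' : Finset (Pt d)}

/-! ### Correctors and the multiscale space -/

/-- The fine scale space as a subspace of the fine finite element space. -/
noncomputable def fineSub (𝒯 𝒯h : Triangulation Ω) (hΩ : IsBoundedDomain Ω) :
    Submodule ℝ 𝒯h.P1Sub where
  carrier := {v | ∀ w ∈ 𝒯.P1, ∫ y in Ω, (v : Pt d → ℝ) y * w y = 0}
  add_mem' {u v} hu hv w hw := by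
    have e : ∀ y, ((u + v : 𝒯h.P1Sub) : Pt d → ℝ) y * w y =
        (u : Pt d → ℝ) y * w y + (v : Pt d → ℝ) y * w y := fun y => add_mul _ _ _
    simp only [e]
    have h1 : IntegrableOn (fun y => (u : Pt d → ℝ) y * w y) Ω volume :=
      integrable_of_continuous hΩ (u.2.1.mul hw.1)
    have h2 : IntegrableOn (fun y => (v : Pt d → ℝ) y * w y) Ω volume :=
      integrable_of_continuous hΩ (v.2.1.mul hw.1)
    rw [integral_add h1 h2, hu w hw, hv w hw, add_zero]
  zero_mem' w _ := by
    have e : ∀ y, ((0 : 𝒯h.P1Sub) : Pt d → ℝ) y * w y = 0 := fun y => zero_mul _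
    simp only [e, integral_zero]
  smul_mem' c u hu w hw := by
    have e : ∀ y, ((c • u : 𝒯h.P1Sub) : Pt d → ℝ) y * w y = c * ((u : Pt d → ℝ) y * w y) :=
      fun y => mul_assoc _ _ _
    simp only [e]
    rw [integral_const_mul, hu w hw, mul_zero]

theorem mem_fineSub (hΩ : IsBoundedDomain Ω) {v : 𝒯h.P1Sub} :
    v ∈ fineSub 𝒯 𝒯h hΩ ↔ (v : Pt d → ℝ) ∈ fineSpace 𝒯 𝒯h := by
  rw [mem_fineSpace_iff 𝒯 hΩ 𝒯h]
  exact ⟨fun h => ⟨v.2, h⟩, fun h => h.2⟩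

/-- The fine scale functions that vanish outside the layer `m` around `K`. -/
noncomputable def layerSub (𝒯 𝒯h : Triangulation Ω) (hΩ : IsBoundedDomain Ω) (m : ℕ)
    (K : Finset (Pt d)) : Submodule ℝ (fineSub 𝒯 𝒯h hΩ) where
  carrier := {v | ∀ K' ∈ 𝒯.cells, K' ∉ 𝒯.layer m K →
    Set.EqOn ((v : 𝒯h.P1Sub) : Pt d → ℝ) 0 (hull K')}
  add_mem' {u v} hu hv K' hK' hn x hx := by
    have h1 := hu K' hK' hn hx
    have h2 := hv K' hK' hn hx
    change ((u : 𝒯h.P1Sub) : Pt d → ℝ) x + ((v : 𝒯h.P1Sub) : Pt d → ℝ) x = 0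
    rw [h1, h2]; simp
  zero_mem' K' _ _ x _ := rfl
  smul_mem' c u hu K' hK' hn x hx := by
    have h1 := hu K' hK' hn hx
    change c * ((u : 𝒯h.P1Sub) : Pt d → ℝ) x = 0
    rw [h1]; simp

/-- The coarse space as a subspace of the fine finite element space. -/
noncomputable def coarseSub (𝒯 𝒯h : Triangulation Ω) : Submodule ℝ 𝒯h.P1Sub :=
  𝒯.P1Sub.comap 𝒯h.P1Sub.subtype

theorem mem_fineSpaceOn_iff (hΩ : IsBoundedDomain Ω) (hK : K ∈ 𝒯.cells) (k : ℕ)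
    {w : Pt d → ℝ} : w ∈ fineSpaceOn 𝒯 𝒯h k K ↔
      ∃ v ∈ layerSub 𝒯 𝒯h hΩ k K, ((v : 𝒯h.P1Sub) : Pt d → ℝ) = w := by
  constructor
  · rintro ⟨h1, h2⟩
    refine ⟨⟨⟨w, h1.1⟩, (mem_fineSub hΩ).2 h1⟩, ?_, rfl⟩
    exact (tsupport_subset_patch_iff hK k h1.1.1 h1.1.2.1).1 h2
  · rintro ⟨v, hv, rfl⟩
    have h1 := (mem_fineSub hΩ).1 v.2
    exact ⟨h1, (tsupport_subset_patch_iff hK k h1.1.1 h1.1.2.1).2 hv⟩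

section

variable (hΩ : IsBoundedDomain Ω) {A : Pt d → Matrix (Fin d) (Fin d) ℝ} {α β : ℝ} (hα : 0 ≤ α)
  (hA : IsCoefficient Ω A α β)

/-- The form of the element `K` on the fine scale space. -/
noncomputable def fineForm (𝒯 𝒯h : Triangulation Ω) (K : Finset (Pt d)) :
    fineSub 𝒯 𝒯h hΩ →ₗ[ℝ] fineSub 𝒯 𝒯h hΩ →ₗ[ℝ] ℝ :=
  (𝒯h.formLin hΩ hα hA (hull K)).compl₁₂ (fineSub 𝒯 𝒯h hΩ).subtype (fineSub 𝒯 𝒯h hΩ).subtype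

theorem total_fineForm (u v : fineSub 𝒯 𝒯h hΩ) :
    𝒯.total (fineForm hΩ hα hA 𝒯 𝒯h) u v = 𝒯h.formLin hΩ hα hA Ω u v := by
  rw [total_apply, ← sum_formLin (𝒯 := 𝒯) hΩ hα hA]
  rfl

theorem energyOn_eq_zero {w : Pt d → ℝ} (h : Set.EqOn w 0 (hull K)) : energyOn K w = 0 := by
  rw [energyOn_congr h, energyOn]
  have : ∀ x, gradient (0 : Pt d → ℝ) x = 0 := fun x => gradient_eq_zero Filter.EventuallyEq.rfl
  simp only [this, norm_zero]; simp

theorem formLin_eq_zero (hK : K ∈ 𝒯.cells) {u : 𝒯h.P1Sub}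
    (h : Set.EqOn (u : Pt d → ℝ) 0 (hull K)) (v : 𝒯h.P1Sub) :
    𝒯h.formLin hΩ hα hA (hull K) u v = 0 := by
  have h0 : 𝒯h.formLin hΩ hα hA (hull K) u u = 0 := by
    refine le_antisymm ?_ (formLin_nonneg hΩ hα hA _ u)
    have := (formLin_hull_bounds hΩ hα hA hK u).2
    rwa [energyOn_eq_zero h, mul_zero] at this
  have := bilin_cauchy_schwarz _ (formLin_symm hΩ hα hA (hull K)) (formLin_nonneg hΩ hα hA _) u v
  rw [h0, Real.sqrt_zero, zero_mul] at this
  exact abs_eq_zero.1 (le_antisymm this (abs_nonneg _))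

/-- Friedrichs' inequality for finite element functions, in terms of the energy. -/
theorem sq_norm_toL2_le (hd : 1 ≤ d) {D : ℝ} (hD : Metric.diam Ω ≤ D) (u : 𝒯h.P1Sub) :
    α * ‖𝒯h.toL2 hΩ u‖ ^ 2 ≤ 4 * D ^ 2 * 𝒯h.formLin hΩ hα hA Ω u u := by
  obtain ⟨L, hL⟩ := exists_lipschitz 𝒯h hΩ u.2
  have h1 := friedrichs hd hΩ.isOpen.measurableSet hΩ.isBounded hD hL u.2.2.1
  have h2 := (formLin_bounds hΩ hα hA Ω u).1
  rw [Set.inter_self] at h2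
  rw [norm_toL2, l2norm, Real.sq_sqrt (integral_nonneg fun _ => sq_nonneg _)]
  calc α * ∫ x in Ω, (u : Pt d → ℝ) x ^ 2
      ≤ α * (4 * D ^ 2 * ∫ x in Ω, ‖gradient (u : Pt d → ℝ) x‖ ^ 2) := by gcongr
    _ = 4 * D ^ 2 * (α * ∫ x in Ω, ‖gradient (u : Pt d → ℝ) x‖ ^ 2) := by ring
    _ ≤ _ := by gcongr

end

theorem eq_zero_of_formLin (hd : 1 ≤ d) (hΩ : IsBoundedDomain Ω)
    {A : Pt d → Matrix (Fin d) (Fin d) ℝ} {α β : ℝ} (hα : 0 < α) (hA : IsCoefficient Ω A α β)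
    {u : 𝒯h.P1Sub} (h : 𝒯h.formLin hΩ hα.le hA Ω u u = 0) : u = 0 := by
  have h1 := sq_norm_toL2_le hΩ hα.le hA hd le_rfl u
  rw [h, mul_zero] at h1
  refine toL2_injective hΩ (norm_eq_zero.1 ?_)
  have h2 : ‖𝒯h.toL2 hΩ u‖ ^ 2 ≤ 0 := by
    by_contra hn
    push Not at hn
    nlinarith [mul_pos hα hn]
  exact pow_eq_zero_iff two_ne_zero |>.1 (le_antisymm h2 (sq_nonneg _))

/-- The forms of the elements admit the cutoff of `exists_cutoff`. Passing from the gradient to the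
forms multiplies its constant by the contrast. -/
theorem exists_hasCutoff (hd : 1 ≤ d) {ρ : ℝ} (hρ : 0 < ρ) (hρ1 : ρ ≤ 1 / 2) {κ : ℝ}
    (hκ : 0 ≤ κ) : ∃ C n : ℝ, 0 ≤ C ∧ 0 ≤ n ∧
    ∀ {Ω : Set (Pt d)} (hΩ : IsBoundedDomain Ω) {𝒯 𝒯h : Triangulation Ω},
      (∀ K ∈ 𝒯.cells, Fat ρ K) → (∀ K ∈ 𝒯h.cells, Fat ρ K) → 𝒯h.IsRefinement 𝒯 →
      𝒯h.IsFiner 𝒯 (ρ / 32) → ∀ {A : Pt d → Matrix (Fin d) (Fin d) ℝ} {α β : ℝ} (hα : 0 < α)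
      (_ : β ≤ κ * α) (hA : IsCoefficient Ω A α β),
      𝒯.HasCutoff (V := fineSub 𝒯 𝒯h hΩ) (fineForm hΩ hα.le hA 𝒯 𝒯h)
        (layerSub 𝒯 𝒯h hΩ) C n := by
  obtain ⟨C, hC, hcut⟩ := exists_cutoff hd hρ hρ1
  have hn0 : (0 : ℝ) ≤ (d + 1) / ρ ^ d := by positivity
  refine ⟨κ * C, (d + 1) / ρ ^ d, by positivity, hn0, ?_⟩
  intro Ω hΩ 𝒯 𝒯h hf hfh href hfiner A α β hα hβ hA
  refine ⟨fun K x y => formLin_symm hΩ hα.le hA _ _ _, fun K x => formLin_nonneg hΩ hα.le hA _ _,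
    fun m K _ w hw K' hK' hn => formLin_eq_zero hΩ hα.le hA hK' (hw K' hK' hn) _,
    fun K hK m φ => ?_, by positivity, hn0, fun K hK => ?_⟩
  · obtain ⟨z, hz, h1, h2, h3⟩ := hcut hΩ hf hfh href hfiner ((mem_fineSub hΩ).1 φ.2) hK m
    refine ⟨⟨⟨z, hz.1⟩, (mem_fineSub hΩ).2 hz⟩, fun K' hK' => ?_, fun K' hK' hn x hx => ?_,
      fun K' hK' => ?_⟩
    · exact formLin_eq_zero hΩ hα.le hA
        ((mem_cellSet 𝒯).1 (layer_subset_cellSet hK m hK')) (h1 K' hK') _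
    · change ((φ : 𝒯h.P1Sub) : Pt d → ℝ) x - z x = 0
      rw [h2 K' hK' hn hx, sub_self]
    · have b0 : 0 ≤ ∑ K₂ ∈ 𝒯.nbrs K', energyOn K₂ ((φ : 𝒯h.P1Sub) : Pt d → ℝ) :=
        Finset.sum_nonneg fun _ _ => energyOn_nonneg _ _
      have e0 := energyOn_nonneg K' z
      calc 𝒯h.formLin hΩ hα.le hA (hull K') ⟨z, hz.1⟩ ⟨z, hz.1⟩ ≤ β * energyOn K' z :=
            (formLin_hull_bounds hΩ hα.le hA hK' ⟨z, hz.1⟩).2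
        _ ≤ (κ * α) * energyOn K' z := by gcongr
        _ ≤ (κ * α) * (C * ∑ K₂ ∈ 𝒯.nbrs K', energyOn K₂ ((φ : 𝒯h.P1Sub) : Pt d → ℝ)) := by
            gcongr; exact h3 K' hK'
        _ = κ * C * ∑ K₂ ∈ 𝒯.nbrs K', α * energyOn K₂ ((φ : 𝒯h.P1Sub) : Pt d → ℝ) := by
            rw [← Finset.mul_sum]; ring
        _ ≤ _ := by
            refine mul_le_mul_of_nonneg_left (Finset.sum_le_sum fun K₂ hK₂ => ?_) (by positivity)
            exact (formLin_hull_bounds hΩ hα.le hA (mem_nbrs.1 hK₂).1 (φ : 𝒯h.P1Sub)).1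
  · rw [le_div_iff₀ (by positivity)]
    exact card_nbrs_mul_le hd hρ hf hK

/-- Existence of the localized correctors, and the error committed by localization. -/
theorem exists_correctors (hd : 1 ≤ d) {ρ : ℝ} (hρ : 0 < ρ) (hρ1 : ρ ≤ 1 / 2) {κ : ℝ}
    (hκ : 0 ≤ κ) : ∃ μ C : ℝ, 0 < μ ∧ μ < 1 ∧ 0 ≤ C ∧
    ∀ {Ω : Set (Pt d)} (hΩ : IsBoundedDomain Ω) {𝒯 𝒯h : Triangulation Ω},
      (∀ K ∈ 𝒯.cells, Fat ρ K) → (∀ K ∈ 𝒯h.cells, Fat ρ K) → 𝒯h.IsRefinement 𝒯 →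
      𝒯h.IsFiner 𝒯 (ρ / 32) → ∀ {A : Pt d → Matrix (Fin d) (Fin d) ℝ} {α β : ℝ} (hα : 0 < α)
      (_ : β ≤ κ * α) (hA : IsCoefficient Ω A α β) {ν : ℝ} (_ : 𝒯.PatchGrowth ν) {k : ℕ}
      (_ : 1 ≤ k), ∃ Q : Finset (Pt d) → 𝒯h.P1Sub →ₗ[ℝ] fineSub 𝒯 𝒯h hΩ,
        (∀ K ∈ 𝒯.cells, ∀ v, Q K v ∈ layerSub 𝒯 𝒯h hΩ k K ∧ ∀ w ∈ layerSub 𝒯 𝒯h hΩ k K,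
          𝒯h.formLin hΩ hα.le hA Ω (Q K v) w = 𝒯h.formLin hΩ hα.le hA (hull K) v w) ∧
        ∀ v, ∃ p : fineSub 𝒯 𝒯h hΩ,
          (∀ w : fineSub 𝒯 𝒯h hΩ, 𝒯h.formLin hΩ hα.le hA Ω p w = 𝒯h.formLin hΩ hα.le hA Ω v w) ∧
          ∀ e : 𝒯h.P1Sub, e = ↑(p - ∑ K ∈ 𝒯.cellSet, Q K v) → 𝒯h.formLin hΩ hα.le hA Ω e e ≤
            C * ν * (k : ℝ) ^ d * μ ^ (2 * k) * 𝒯h.formLin hΩ hα.le hA Ω v v := by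
  obtain ⟨C, n, hC, hn, hcut⟩ := exists_hasCutoff hd hρ hρ1 hκ
  have hCn := mul_nonneg hC hn
  set θ := (1 + C * n) / (2 + C * n) with hθ
  have hθ0 : 0 < θ := by positivity
  have hθ1 : θ < 1 := by rw [hθ, div_lt_one (by positivity)]; linarith
  -- Four layers reduce the energy by the factor `θ`, so one layer reduces the energy norm by its
  -- eighth root.
  have hμ0 : 0 < θ ^ (1 / 8 : ℝ) := Real.rpow_pos_of_pos hθ0 _
  have hμ1 : θ ^ (1 / 8 : ℝ) < 1 := Real.rpow_lt_one hθ0.le hθ1 (by norm_num)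
  have hμ8 : (θ ^ (1 / 8 : ℝ)) ^ 8 = θ := by
    rw [← Real.rpow_natCast, ← Real.rpow_mul hθ0.le]; norm_num
  set μ := θ ^ (1 / 8 : ℝ) with hμ
  refine ⟨μ, 2 * (1 + C * n) ^ 2 / μ ^ 12 * 4 ^ d, hμ0, hμ1, by positivity, ?_⟩
  intro Ω hΩ 𝒯 𝒯h hf hfh href hfiner A α β hα hβ hA ν hν k hk
  have h := hcut hΩ hf hfh href hfiner hα hβ hA
  have hpd : ∀ S : Submodule ℝ (fineSub 𝒯 𝒯h hΩ), ∀ x ∈ S,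
      𝒯.total (fineForm hΩ hα.le hA 𝒯 𝒯h) x x = 0 → x = 0 := by
    intro S x _ hx
    rw [total_fineForm] at hx
    exact Subtype.ext (eq_zero_of_formLin hd hΩ hα hA hx)
  have hP := fun K => exists_galerkin (E := fineSub 𝒯 𝒯h hΩ) (X := 𝒯h.P1Sub)
    (𝒯.total (fineForm hΩ hα.le hA 𝒯 𝒯h)) ⊤ (hpd ⊤)
    ((𝒯h.formLin hΩ hα.le hA (hull K)).compl₂ (fineSub 𝒯 𝒯h hΩ).subtype)
  have hQ := fun K => exists_galerkin (E := fineSub 𝒯 𝒯h hΩ) (X := 𝒯h.P1Sub)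
    (𝒯.total (fineForm hΩ hα.le hA 𝒯 𝒯h)) (layerSub 𝒯 𝒯h hΩ k K) (hpd _)
    ((𝒯h.formLin hΩ hα.le hA (hull K)).compl₂ (fineSub 𝒯 𝒯h hΩ).subtype)
  choose P hP using hP
  choose Q hQ using hQ
  refine ⟨Q, fun K _ v => ⟨(hQ K v).1, fun w hw => ?_⟩, fun v => ?_⟩
  · rw [← total_fineForm (𝒯 := 𝒯)]; exact (hQ K v).2 w hw
  · refine ⟨∑ K ∈ 𝒯.cellSet, P K v, fun w => ?_, fun e he => ?_⟩
    · rw [← total_fineForm (𝒯 := 𝒯), map_sum, LinearMap.sum_apply,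
        ← sum_formLin (𝒯 := 𝒯) hΩ hα.le hA]
      exact Finset.sum_congr rfl fun K _ => (hP K v).2 w trivial
    · have h1 := h.sum_localization_error_le hν hμ0 hμ1.le hμ8
        (ℓ := fun K w => 𝒯h.formLin hΩ hα.le hA (hull K) v w)
        (c := fun K => 𝒯h.formLin hΩ hα.le hA (hull K) v v)
        (fun K => formLin_nonneg hΩ hα.le hA _ _) (fun K _ w => by
          have h2 := bilin_cauchy_schwarz _ (formLin_symm hΩ hα.le hA (hull K))
            (formLin_nonneg hΩ hα.le hA _) v (w : 𝒯h.P1Sub)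
          rw [← sq_abs]
          refine (pow_le_pow_left₀ (abs_nonneg _) h2 2).trans (le_of_eq ?_)
          rw [mul_pow, Real.sq_sqrt (formLin_nonneg hΩ hα.le hA _ _),
            Real.sq_sqrt (formLin_nonneg hΩ hα.le hA _ _)]
          rfl) hk (p := fun K => P K v) (q := fun K => Q K v)
        (fun K _ w => (hP K v).2 w trivial) (fun K _ => (hQ K v).1) (fun K _ => (hQ K v).2)
      rw [total_fineForm, sum_formLin] at h1
      have h2 : ∑ K ∈ 𝒯.cellSet, (P K v - Q K v) =
          ∑ K ∈ 𝒯.cellSet, P K v - ∑ K ∈ 𝒯.cellSet, Q K v :=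
        Finset.sum_sub_distrib (G := fineSub 𝒯 𝒯h hΩ) _ _
      rw [h2] at h1
      rw [he]
      exact h1

/-- The localized multiscale space in terms of linear localized correctors. -/
theorem mem_msSpace_iff (hd : 1 ≤ d) (hΩ : IsBoundedDomain Ω) (href : 𝒯h.IsRefinement 𝒯)
    {A : Pt d → Matrix (Fin d) (Fin d) ℝ} {α β : ℝ} (hα : 0 < α) (hA : IsCoefficient Ω A α β)
    {k : ℕ} {Q : Finset (Pt d) → 𝒯h.P1Sub →ₗ[ℝ] fineSub 𝒯 𝒯h hΩ}
    (hQ : ∀ K ∈ 𝒯.cells, ∀ v, Q K v ∈ layerSub 𝒯 𝒯h hΩ k K ∧ ∀ w ∈ layerSub 𝒯 𝒯h hΩ k K,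
      𝒯h.formLin hΩ hα.le hA Ω (Q K v) w = 𝒯h.formLin hΩ hα.le hA (hull K) v w)
    {u : Pt d → ℝ} : u ∈ msSpace 𝒯 𝒯h A k ↔
      ∃ v ∈ coarseSub 𝒯 𝒯h, u = ↑(v - ∑ K ∈ 𝒯.cellSet, (Q K v : 𝒯h.P1Sub)) := by
  have hpatch : ∀ K ∈ 𝒯.cells, ∀ q ∈ layerSub 𝒯 𝒯h hΩ k K, ∀ w : 𝒯h.P1Sub,
      form A (𝒯.patch k K) ((q : 𝒯h.P1Sub) : Pt d → ℝ) w = 𝒯h.formLin hΩ hα.le hA Ω q w := by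
    intro K hK q hq w
    rw [patch_eq hK, form_union hΩ hα.le hA (layer_subset_cellSet hK k),
      ← sum_formLin (𝒯 := 𝒯) hΩ hα.le hA]
    refine Finset.sum_subset (layer_subset_cellSet hK k) fun K' hK' hn => ?_
    exact formLin_eq_zero hΩ hα.le hA ((mem_cellSet 𝒯).1 hK') (hq K' ((mem_cellSet 𝒯).1 hK') hn) w
  -- Correctors are unique because the form is definite.
  have hcor : ∀ K ∈ 𝒯.cells, ∀ (v : 𝒯h.P1Sub) (q : Pt d → ℝ),
      IsCorrector 𝒯 𝒯h A k K v q ↔ q = ((Q K v : 𝒯h.P1Sub) : Pt d → ℝ) := by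
    intro K hK v q
    constructor
    · rintro ⟨hq, h⟩
      obtain ⟨q', hq', rfl⟩ := (mem_fineSpaceOn_iff hΩ hK k).1 hq
      have hm : q' - Q K v ∈ layerSub 𝒯 𝒯h hΩ k K :=
        Submodule.sub_mem (M := fineSub 𝒯 𝒯h hΩ) _ hq' (hQ K hK v).1
      have e1 := h _ ((mem_fineSpaceOn_iff hΩ hK k).2 ⟨_, hm, rfl⟩)
      rw [hpatch K hK q' hq', ← formLin_hull hΩ hα.le hA hK, ← (hQ K hK v).2 _ hm] at e1
      have e2 : 𝒯h.formLin hΩ hα.le hA Ω ((q' - Q K v : fineSub 𝒯 𝒯h hΩ) : 𝒯h.P1Sub)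
          ((q' - Q K v : fineSub 𝒯 𝒯h hΩ) : 𝒯h.P1Sub) = 0 := by
        rw [Submodule.coe_sub, map_sub (𝒯h.formLin hΩ hα.le hA Ω) (q' : 𝒯h.P1Sub) (Q K v),
          LinearMap.sub_apply, sub_eq_zero]
        exact e1
      have e3 := eq_zero_of_formLin hd hΩ hα hA e2
      rw [Submodule.coe_sub, sub_eq_zero] at e3
      rw [e3]
    · rintro rfl
      refine ⟨(mem_fineSpaceOn_iff hΩ hK k).2 ⟨_, (hQ K hK v).1, rfl⟩, fun w hw => ?_⟩
      obtain ⟨w', hw', rfl⟩ := (mem_fineSpaceOn_iff hΩ hK k).1 hw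
      rw [hpatch K hK _ (hQ K hK v).1, ← formLin_hull hΩ hα.le hA hK]
      exact (hQ K hK v).2 w' hw'
  have hsum : ∀ (v : 𝒯h.P1Sub) (q : Finset (Pt d) → Pt d → ℝ),
      (∀ K ∈ 𝒯.cells, q K = ((Q K v : 𝒯h.P1Sub) : Pt d → ℝ)) →
      (fun x => (v : Pt d → ℝ) x - ∑ᶠ K ∈ 𝒯.cells, q K x) =
        ↑(v - ∑ K ∈ 𝒯.cellSet, (Q K v : 𝒯h.P1Sub)) := by
    intro v q hq
    funext x
    rw [finsum_mem_eq_finite_toFinset_sum _ 𝒯.finite_cells]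
    rw [Submodule.coe_sub, Submodule.coe_sum, Pi.sub_apply, Finset.sum_apply]
    congr 1
    exact Finset.sum_congr rfl fun K hK => by rw [hq K ((mem_cellSet 𝒯).1 hK)]
  constructor
  · rintro ⟨v, hv, q, hq, rfl⟩
    have hvh := P1_subset_of_refinement 𝒯 href hv
    exact ⟨⟨v, hvh⟩, hv, hsum ⟨v, hvh⟩ q fun K hK => (hcor K hK ⟨v, hvh⟩ _).1 (hq K hK)⟩
  · rintro ⟨v, hv, rfl⟩
    refine ⟨v, hv, fun K => ((Q K v : 𝒯h.P1Sub) : Pt d → ℝ), fun K hK => (hcor K hK v _).2 rfl, ?_⟩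
    exact (hsum v _ fun K _ => rfl).symm

end Triangulation

end LOD

namespace LOD

open scoped InnerProductSpace NNReal ENNReal Topology

variable {d : ℕ} {Ω : Set (Pt d)}

/-! ### Approximation by the multiscale space -/

theorem Fat.mono {ρ ρ' : ℝ} (h : ρ ≤ ρ') {K : Finset (Pt d)} (hK : Fat ρ' K) : Fat ρ K := by
  obtain ⟨c, hc⟩ := hK
  refine ⟨c, (Metric.closedBall_subset_closedBall ?_).trans hc⟩
  gcongr

namespace Triangulation

variable {𝒯 𝒯h : Triangulation Ω} {K K' : Finset (Pt d)}

theorem diam_le_meshSize (hK : K ∈ 𝒯.cells) : Metric.diam (hull K) ≤ 𝒯.meshSize :=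
  le_csSup (𝒯.finite_cells.image _).bddAbove ⟨K, hK, rfl⟩

theorem meshSize_nonneg (𝒯 : Triangulation Ω) : 0 ≤ 𝒯.meshSize :=
  Real.sSup_nonneg (by rintro _ ⟨K, _, rfl⟩; exact Metric.diam_nonneg)

/-- Fine scale functions are small in `L²`: the local Poincaré inequalities summed over the mesh. -/
theorem exists_sq_norm_fine_le (hd : 1 ≤ d) {ρ : ℝ} (hρ : 0 < ρ) (hρ1 : ρ ≤ 1 / 2) :
    ∃ C : ℝ, 0 ≤ C ∧ ∀ {Ω : Set (Pt d)} (hΩ : IsBoundedDomain Ω) {𝒯 𝒯h : Triangulation Ω},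
      (∀ K ∈ 𝒯.cells, Fat ρ K) → ∀ {A : Pt d → Matrix (Fin d) (Fin d) ℝ} {α β : ℝ} (hα : 0 ≤ α)
      (hA : IsCoefficient Ω A α β) (x : fineSub 𝒯 𝒯h hΩ),
      α * ‖𝒯h.toL2 hΩ x‖ ^ 2 ≤ C * 𝒯.meshSize ^ 2 * 𝒯h.formLin hΩ hα hA Ω x x := by
  obtain ⟨C, hC, hP⟩ := exists_localPoincare hd hρ hρ1
  refine ⟨C * ((d + 1) / ρ ^ d), by positivity, ?_⟩
  intro Ω hΩ 𝒯 𝒯h hf A α β hα hA x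
  obtain ⟨⟨L, hL⟩, h0, h1⟩ := fineSpace_props hΩ ((mem_fineSub hΩ).1 x.2)
  obtain ⟨hloc, -⟩ := hP hΩ 𝒯 hf hL h0 h1
  have hcard : ∀ K ∈ 𝒯.cells, ((𝒯.nbrs K).card : ℝ) ≤ (d + 1) / ρ ^ d := fun K hK => by
    rw [le_div_iff₀ (by positivity)]
    exact card_nbrs_mul_le hd hρ hf hK
  have hsum := sum_nbrs_le hcard (fun K => energyOn_nonneg K ((x : 𝒯h.P1Sub) : Pt d → ℝ))
    (Finset.Subset.refl 𝒯.cellSet) (Finset.Subset.refl _)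
    fun K hK K' hK' => (mem_cellSet 𝒯).2 (mem_nbrs.1 hK').1
  have hm : ‖𝒯h.toL2 hΩ x‖ ^ 2 = ∑ K ∈ 𝒯.cellSet, massOn K ((x : 𝒯h.P1Sub) : Pt d → ℝ) := by
    rw [norm_toL2, l2norm, Real.sq_sqrt (integral_nonneg fun _ => sq_nonneg _),
      setIntegral_domain 𝒯 hΩ]
    intro K hK
    exact ((hL.continuous.pow 2).continuousOn.integrableOn_compact (isCompact_hull K))
  have hE : α * ∑ K ∈ 𝒯.cellSet, energyOn K ((x : 𝒯h.P1Sub) : Pt d → ℝ) ≤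
      𝒯h.formLin hΩ hα hA Ω x x := by
    rw [← sum_formLin (𝒯 := 𝒯) hΩ hα hA, Finset.mul_sum]
    exact Finset.sum_le_sum fun K hK =>
      (formLin_hull_bounds hΩ hα hA ((mem_cellSet 𝒯).1 hK) (x : 𝒯h.P1Sub)).1
  calc α * ‖𝒯h.toL2 hΩ x‖ ^ 2
      ≤ α * ∑ K ∈ 𝒯.cellSet, C * 𝒯.meshSize ^ 2 *
          ∑ K' ∈ 𝒯.nbrs K, energyOn K' ((x : 𝒯h.P1Sub) : Pt d → ℝ) := by
        rw [hm]
        refine mul_le_mul_of_nonneg_left (Finset.sum_le_sum fun K hK => ?_) hα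
        exact hloc ((mem_cellSet 𝒯).1 hK) fun K' hK' => diam_le_meshSize hK'
    _ ≤ α * (C * 𝒯.meshSize ^ 2 * ((d + 1) / ρ ^ d *
          ∑ K ∈ 𝒯.cellSet, energyOn K ((x : 𝒯h.P1Sub) : Pt d → ℝ))) := by
        rw [← Finset.mul_sum]
        gcongr
    _ = C * ((d + 1) / ρ ^ d) * 𝒯.meshSize ^ 2 *
          (α * ∑ K ∈ 𝒯.cellSet, energyOn K ((x : 𝒯h.P1Sub) : Pt d → ℝ)) := by ring
    _ ≤ _ := by gcongr

/-- Energy estimate: if the energy `q` of a solution with `L²` norm `s` is at most `n * s`, and the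
form is coercive, then `q` is bounded by the data `n`. -/
theorem mul_le_of_coercive {q s n α c : ℝ} (hα : 0 < α) (hc : 0 ≤ c) (hq : 0 ≤ q)
    (h1 : q ≤ n * s) (h2 : α * s ^ 2 ≤ c * q) : α * q ≤ c * n ^ 2 := by
  rcases hq.eq_or_lt with h | h
  · rw [← h, mul_zero]; positivity
  · have h3 : q ^ 2 ≤ n ^ 2 * s ^ 2 := by rw [← mul_pow]; gcongr
    have h4 : α * q * q ≤ c * n ^ 2 * q := by
      calc α * q * q = α * q ^ 2 := by ring
        _ ≤ α * (n ^ 2 * s ^ 2) := by gcongr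
        _ = n ^ 2 * (α * s ^ 2) := by ring
        _ ≤ n ^ 2 * (c * q) := by gcongr
        _ = _ := by ring
    exact le_of_mul_le_mul_right h4 h

theorem sq_gradNorm (v : Pt d → ℝ) : gradNorm Ω v ^ 2 = ∫ x in Ω, ‖gradient v x‖ ^ 2 :=
  Real.sq_sqrt (integral_nonneg fun _ => by positivity)

/-- An `H¹`-stable projection is stable in the energy norm, up to the contrast. -/
theorem formLin_le_of_projStable (hΩ : IsBoundedDomain Ω) {A : Pt d → Matrix (Fin d) (Fin d) ℝ}
    {α β κ cP : ℝ} (hα : 0 ≤ α) (hκ : 0 ≤ κ) (hβ : β ≤ κ * α) (hA : IsCoefficient Ω A α β)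
    (hP : ProjStable 𝒯 𝒯h cP) {u p : 𝒯h.P1Sub} (hp : IsL2Proj Ω 𝒯.P1 u p) :
    𝒯h.formLin hΩ hα hA Ω p p ≤ κ * cP ^ 2 * 𝒯h.formLin hΩ hα hA Ω u u := by
  have h1 := (formLin_bounds hΩ hα hA Ω p).2
  have h2 := (formLin_bounds hΩ hα hA Ω u).1
  rw [Set.inter_self, ← sq_gradNorm] at h1 h2
  have h3 : gradNorm Ω (p : Pt d → ℝ) ^ 2 ≤ (cP * gradNorm Ω (u : Pt d → ℝ)) ^ 2 :=
    pow_le_pow_left₀ (Real.sqrt_nonneg _) (hP u u.2 p hp) 2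
  calc 𝒯h.formLin hΩ hα hA Ω p p ≤ β * gradNorm Ω (p : Pt d → ℝ) ^ 2 := h1
    _ ≤ (κ * α) * (cP * gradNorm Ω (u : Pt d → ℝ)) ^ 2 := by gcongr
    _ = κ * cP ^ 2 * (α * gradNorm Ω (u : Pt d → ℝ) ^ 2) := by ring
    _ ≤ _ := by gcongr

/-- The multiscale space approximates the solution of an elliptic problem with an `L²` right-hand
side. The fine scale part of the error is small in `L²` and tested with the right-hand side only;
the other part is due to the localization. -/
theorem exists_multiscale_approximation (hd : 1 ≤ d) {ρ : ℝ} (hρ : 0 < ρ) (hρ1 : ρ ≤ 1 / 2)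
    {κ : ℝ} (hκ : 0 ≤ κ) : ∃ μ C : ℝ, 0 < μ ∧ μ < 1 ∧ 0 ≤ C ∧
    ∀ {Ω : Set (Pt d)} (hΩ : IsBoundedDomain Ω) {𝒯 𝒯h : Triangulation Ω},
      (∀ K ∈ 𝒯.cells, Fat ρ K) → (∀ K ∈ 𝒯h.cells, Fat ρ K) → 𝒯h.IsRefinement 𝒯 →
      𝒯h.IsFiner 𝒯 (ρ / 32) → ∀ {cP : ℝ}, ProjStable 𝒯 𝒯h cP →
      ∀ {A : Pt d → Matrix (Fin d) (Fin d) ℝ} {α β : ℝ} (hα : 0 < α)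
      (_ : β ≤ κ * α) (hA : IsCoefficient Ω A α β) {ν : ℝ} (_ : 0 ≤ ν) (_ : 𝒯.PatchGrowth ν) {D : ℝ}
      (_ : Metric.diam Ω ≤ D) {k : ℕ} (_ : 1 ≤ k), ∃ S : Submodule ℝ 𝒯h.P1Sub,
        (∀ u, u ∈ msSpace 𝒯 𝒯h A k ↔ ∃ v ∈ S, u = ↑v) ∧
        ∀ u g : 𝒯h.P1Sub, (∀ v, 𝒯h.formLin hΩ hα.le hA Ω u v = ⟪𝒯h.toL2 hΩ g, 𝒯h.toL2 hΩ v⟫_ℝ) →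
          ∃ w ∈ S, α * 𝒯h.formLin hΩ hα.le hA Ω (u - w) (u - w) ≤
            C * (1 + ν * cP ^ 2 * D ^ 2) *
              (𝒯.meshSize + (k : ℝ) ^ ((d : ℝ) / 2) * μ ^ k) ^ 2 * ‖𝒯h.toL2 hΩ g‖ ^ 2 := by
  obtain ⟨μ, C₂, hμ0, hμ1, hC₂, hcor⟩ := exists_correctors hd hρ hρ1 hκ
  obtain ⟨C₁, hC₁, hfine⟩ := exists_sq_norm_fine_le hd hρ hρ1
  refine ⟨μ, 2 * C₁ + 8 * C₂ * κ, hμ0, hμ1, by positivity, ?_⟩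
  intro Ω hΩ 𝒯 𝒯h hf hfh href hfiner cP hP A α β hα hβ hA ν hν0 hν D hD k hk
  obtain ⟨Q, hQ, hpe⟩ := hcor hΩ hf hfh href hfiner hα hβ hA hν hk
  set a := 𝒯h.formLin hΩ hα.le hA Ω with ha
  have as := formLin_symm (𝒯h := 𝒯h) hΩ hα.le hA Ω
  have ap := formLin_nonneg (𝒯h := 𝒯h) hΩ hα.le hA Ω
  let q : 𝒯h.P1Sub →ₗ[ℝ] 𝒯h.P1Sub :=
    LinearMap.id - ∑ K ∈ 𝒯.cellSet, (fineSub 𝒯 𝒯h hΩ).subtype ∘ₗ Q K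
  have hq : ∀ v, q v = v - ∑ K ∈ 𝒯.cellSet, (Q K v : 𝒯h.P1Sub) := by
    intro v
    simp only [q, LinearMap.sub_apply, LinearMap.id_apply, LinearMap.sum_apply,
      LinearMap.comp_apply, Submodule.subtype_apply]
  refine ⟨(coarseSub 𝒯 𝒯h).map q, fun u => ?_, fun u g hug => ?_⟩
  · rw [mem_msSpace_iff hd hΩ href hα hA hQ]
    constructor
    · rintro ⟨v, hv, rfl⟩
      exact ⟨q v, Submodule.mem_map_of_mem hv, by rw [hq]⟩
    · rintro ⟨_, ⟨v, hv, rfl⟩, rfl⟩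
      exact ⟨v, hv, by rw [hq]⟩
  -- the `L²` projection of `u` onto the coarse space
  obtain ⟨P, hPr⟩ := exists_galerkin
    ((innerₗ (Lp ℝ 2 ((volume : Measure (Pt d)).restrict Ω))).compl₁₂ (𝒯h.toL2 hΩ) (𝒯h.toL2 hΩ))
    (coarseSub 𝒯 𝒯h) (fun x _ hx => toL2_injective hΩ (inner_self_eq_zero.1 hx))
    ((innerₗ (Lp ℝ 2 ((volume : Measure (Pt d)).restrict Ω))).compl₁₂ (𝒯h.toL2 hΩ) (𝒯h.toL2 hΩ))
  obtain ⟨hu₀, hu₀'⟩ := hPr u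
  set u₀ := P u
  have horth : ∀ w ∈ 𝒯.P1, ∫ y in Ω, ((u : Pt d → ℝ) y - (u₀ : Pt d → ℝ) y) * w y = 0 := by
    intro w hw
    have hwh := P1_subset_of_refinement 𝒯 href hw
    have h1 : ⟪𝒯h.toL2 hΩ u₀, 𝒯h.toL2 hΩ ⟨w, hwh⟩⟫_ℝ = ⟪𝒯h.toL2 hΩ u, 𝒯h.toL2 hΩ ⟨w, hwh⟩⟫_ℝ :=
      hu₀' ⟨w, hwh⟩ hw
    have h2 := inner_toL2_toL2 hΩ (u - u₀) ⟨w, hwh⟩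
    rw [map_sub, inner_sub_left, h1, sub_self] at h2
    exact h2.symm
  have hfs : u - u₀ ∈ fineSub 𝒯 𝒯h hΩ := horth
  -- The ideal corrector `p` of `u₀`, and its localization error `e`. The error `u - q u₀` is
  -- `x - e` where `x` lies in the fine scale space.
  obtain ⟨p, hp, hpe⟩ := hpe u₀
  set e : 𝒯h.P1Sub := ↑(p - ∑ K ∈ 𝒯.cellSet, Q K u₀) with he
  have h2 := hpe e he
  have hxe : u - q u₀ = (u - u₀ + (p : 𝒯h.P1Sub)) - e := by
    rw [hq, he, Submodule.coe_sub, Submodule.coe_sum]; abel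
  let x : fineSub 𝒯 𝒯h hΩ := ⟨u - u₀, hfs⟩ + p
  have hx : (x : 𝒯h.P1Sub) = u - u₀ + (p : 𝒯h.P1Sub) := rfl
  -- The fine scale part `x` solves the elliptic problem with the right-hand side `g`, tested with
  -- fine scale functions.
  have hax : ∀ w : fineSub 𝒯 𝒯h hΩ, a x w = ⟪𝒯h.toL2 hΩ g, 𝒯h.toL2 hΩ w⟫_ℝ := by
    intro w
    rw [hx, map_add a (u - u₀) (p : 𝒯h.P1Sub), map_sub a u u₀, LinearMap.add_apply,
      LinearMap.sub_apply, hp w, sub_add_cancel, hug]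
  have b1 : α * a x x ≤ C₁ * 𝒯.meshSize ^ 2 * ‖𝒯h.toL2 hΩ g‖ ^ 2 := by
    refine mul_le_of_coercive hα (by positivity) (ap x) ?_ (hfine hΩ hf hα.le hA x)
    rw [hax x]
    exact real_inner_le_norm _ _
  have b2 : α * a u u ≤ 4 * D ^ 2 * ‖𝒯h.toL2 hΩ g‖ ^ 2 := by
    refine mul_le_of_coercive hα (by positivity) (ap u) ?_ (sq_norm_toL2_le hΩ hα.le hA hd hD u)
    rw [hug u]
    exact real_inner_le_norm _ _
  have b3 : a u₀ u₀ ≤ κ * cP ^ 2 * a u u :=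
    formLin_le_of_projStable hΩ hα.le hκ hβ hA hP ⟨hu₀, horth⟩
  set G := ‖𝒯h.toL2 hΩ g‖ ^ 2
  set M := 𝒯.meshSize
  have hM : 0 ≤ M := meshSize_nonneg 𝒯
  set r := (k : ℝ) ^ ((d : ℝ) / 2) * μ ^ k with hr
  have hr0 : 0 ≤ r := by positivity
  have hr2 : (k : ℝ) ^ d * μ ^ (2 * k) = r ^ 2 := by
    rw [hr, mul_pow, ← Real.rpow_natCast ((k : ℝ) ^ ((d : ℝ) / 2)), ← Real.rpow_mul (by positivity),
      ← pow_mul, mul_comm k 2]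
    norm_num
  have b4 : α * a e e ≤ 4 * C₂ * κ * (ν * cP ^ 2 * D ^ 2) * r ^ 2 * G := by
    calc α * a e e ≤ α * (C₂ * ν * (k : ℝ) ^ d * μ ^ (2 * k) * (κ * cP ^ 2 * a u u)) := by
          refine mul_le_mul_of_nonneg_left (h2.trans ?_) hα.le
          gcongr
      _ = C₂ * ν * r ^ 2 * (κ * cP ^ 2) * (α * a u u) := by rw [← hr2]; ring
      _ ≤ C₂ * ν * r ^ 2 * (κ * cP ^ 2) * (4 * D ^ 2 * G) := by gcongr
      _ = _ := by ring
  have b5 : a (u - q u₀) (u - q u₀) ≤ 2 * a x x + 2 * a e e := by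
    have h3 := ap ((x : 𝒯h.P1Sub) + e)
    have h4 := as x e
    rw [hxe, ← hx]
    simp only [map_add, map_sub, LinearMap.add_apply, LinearMap.sub_apply] at h3 ⊢
    linarith
  refine ⟨q u₀, Submodule.mem_map_of_mem hu₀, ?_⟩
  have hG : 0 ≤ G := by positivity
  have hz : 0 ≤ ν * cP ^ 2 * D ^ 2 := by positivity
  have c1 : M ^ 2 ≤ (M + r) ^ 2 := by gcongr; linarith
  have c2 : r ^ 2 ≤ (M + r) ^ 2 := by gcongr; linarith
  calc α * a (u - q u₀) (u - q u₀) ≤ 2 * (α * a x x) + 2 * (α * a e e) := by nlinarith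
    _ ≤ 2 * (C₁ * M ^ 2 * G) + 2 * (4 * C₂ * κ * (ν * cP ^ 2 * D ^ 2) * r ^ 2 * G) := by gcongr
    _ ≤ 2 * (C₁ * (M + r) ^ 2 * G) +
          2 * (4 * C₂ * κ * (ν * cP ^ 2 * D ^ 2) * (M + r) ^ 2 * G) := by gcongr
    _ ≤ 2 * (C₁ * (M + r) ^ 2 * G) * (1 + ν * cP ^ 2 * D ^ 2) +
          2 * (4 * C₂ * κ * (1 + ν * cP ^ 2 * D ^ 2) * (M + r) ^ 2 * G) := by
        refine add_le_add ?_ ?_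
        · refine le_mul_of_one_le_right (by positivity) (by linarith)
        · gcongr; linarith
    _ = _ := by ring

end Triangulation

/-! ### Backward Euler in function spaces -/

/-- The abstract error bound for functions identified, through an injective map, with elements
of an ambient inner product space that contains the source terms. -/
theorem norm_galerkin_backwardEuler_sub_le_of_injective {E L : Type*} [AddCommGroup E] [Module ℝ E]
    [FiniteDimensional ℝ E] [NormedAddCommGroup L] [InnerProductSpace ℝ L] (ι : E →ₗ[ℝ] L)
    (hι : Function.Injective ι) (a : E →ₗ[ℝ] E →ₗ[ℝ] ℝ)
    (hs : ∀ x y, a x y = a y x) (hp : ∀ x, 0 ≤ a x x) (hd : ∀ x, a x x = 0 → x = 0)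
    (S : Submodule ℝ E) {ε τ : ℝ} (hε : 0 ≤ ε) (hτ : 0 < τ)
    (happ : ∀ u g : E, (∀ v, a u v = ⟪ι g, ι v⟫_ℝ) →
      ∃ w ∈ S, a (u - w) (u - w) ≤ (ε * ‖ι g‖) ^ 2)
    (U V : ℕ → E) (f : ℕ → L) (N : ℕ)
    (hU : ∀ n < N, ∀ v, ⟪ι (U (n + 1) - U n), ι v⟫_ℝ / τ + a (U (n + 1)) v = ⟪f n, ι v⟫_ℝ)
    (hVS : ∀ n < N, V (n + 1) ∈ S)
    (hV : ∀ n < N, ∀ v ∈ S,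
      ⟪ι (V (n + 1) - V n), ι v⟫_ℝ / τ + a (V (n + 1)) v = ⟪f n, ι v⟫_ℝ)
    (hV0 : ∀ v ∈ S, ⟪ι (U 0 - V 0), ι v⟫_ℝ = 0)
    (m : ℕ) (hm : m < N) {M₀ M₁ : ℝ} (hM₁0 : 0 ≤ M₁) (hM₀ : ‖f 0‖ ≤ M₀)
    (hM₁ : ∀ j < m, ‖f (j + 1) - f j‖ ≤ τ * M₁) :
    ‖ι (U (m + 1) - V (m + 1))‖ ≤ ε ^ 2 * (1 + Real.log (m + 1)) *
      (2 * (((m : ℝ) + 1) * τ)⁻¹ * ‖ι (U 0)‖ + 3 * M₀ + 3 * (m * τ) * M₁) := by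
  -- All data are transported to the range of `ι`, and the sources projected onto it orthogonally;
  -- this does not change their inner products with the test functions.
  let R : Submodule ℝ L := LinearMap.range ι
  let j : E ≃ₗ[ℝ] R := LinearEquiv.ofInjective ι hι
  have hj : ∀ x, ((j x : R) : L) = ι x := fun x => rfl
  have hjs : ∀ y : R, ι (j.symm y) = y := fun y => by rw [← hj, j.apply_symm_apply]
  have : FiniteDimensional ℝ R := LinearMap.finiteDimensional_range ι
  let pr : L →L[ℝ] R := R.orthogonalProjectionOnto
  have hpr : ∀ x (v : R), ⟪pr x, v⟫_ℝ = ⟪x, (v : L)⟫_ℝ := fun x v =>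
    Submodule.inner_orthogonalProjectionOnto_eq_of_mem_right v x
  have hprn : ∀ x, ‖pr x‖ ≤ ‖x‖ := fun x => R.norm_orthogonalProjectionOnto_apply_le x
  let a' : R →ₗ[ℝ] R →ₗ[ℝ] ℝ := a.compl₁₂ j.symm.toLinearMap j.symm.toLinearMap
  have ha' : ∀ x y, a' x y = a (j.symm x) (j.symm y) := fun x y => rfl
  have key := norm_galerkin_backwardEuler_sub_le a' (fun x y => hs _ _) (fun x => hp _)
    (fun x hx => by simpa using hd _ hx) (S.map j.toLinearMap) hε hτ
    (fun u g hug => by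
      obtain ⟨w, hw, h⟩ := happ (j.symm u) (j.symm g) fun v => by
        have := hug (j v)
        rw [ha', j.symm_apply_apply] at this
        rw [this, hjs]; rfl
      refine ⟨j w, Submodule.mem_map_of_mem hw, ?_⟩
      rw [ha', map_sub, j.symm_apply_apply]
      rw [hjs] at h
      exact h)
    (fun n => j (U n)) (fun n => j (V n)) (fun n => pr (f n)) N
    (fun n hn v => by
      have := hU n hn (j.symm v)
      rw [hjs] at this
      rw [hpr, ← this, ha', j.symm_apply_apply, ← map_sub]; rfl)
    (fun n hn => Submodule.mem_map_of_mem (hVS n hn))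
    (fun n hn v hv => by
      obtain ⟨v, hv, rfl⟩ := hv
      have := hV n hn v hv
      rw [hpr]
      change _ = ⟪f n, ι v⟫_ℝ
      rw [← this, ha', j.symm_apply_apply, ← map_sub]
      change _ + a _ (j.symm (j v)) = _
      rw [j.symm_apply_apply]; rfl)
    (fun v hv => by
      obtain ⟨v, hv, rfl⟩ := hv
      rw [← map_sub]
      exact hV0 v hv)
    m hm hM₁0 ((hprn _).trans hM₀)
    (fun i hi => by rw [← map_sub]; exact (hprn _).trans (hM₁ i hi))
  rw [← map_sub] at key
  exact key

/-! ### The source term -/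

section Source

variable {T : ℝ} {f f' : ℝ → Lp ℝ 2 ((volume : Measure (Pt d)).restrict Ω)}

theorem linftyNorm_nonneg (T : ℝ) (f : ℝ → Lp ℝ 2 ((volume : Measure (Pt d)).restrict Ω)) :
    0 ≤ linftyNorm T f := ENNReal.toReal_nonneg

theorem ae_norm_le_linftyNorm (hf : MemLp f ⊤ (volume.restrict (Set.Icc 0 T))) :
    ∀ᵐ t ∂(volume.restrict (Set.Icc 0 T)), ‖f t‖ ≤ linftyNorm T f := by
  have h := hf.2
  rw [eLpNorm_exponent_top] at h
  filter_upwards [enorm_ae_le_eLpNormEssSup f (volume.restrict (Set.Icc 0 T))] with t ht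
  rw [linftyNorm, eLpNorm_exponent_top, ← toReal_enorm]
  exact ENNReal.toReal_mono h.ne ht

theorem IsSource.norm_sub_le (hf : IsSource T f f') {s t : ℝ} (hs : 0 ≤ s) (hst : s ≤ t)
    (ht : t ≤ T) : ‖f t - f s‖ ≤ (t - s) * linftyNorm T f' := by
  have hint : IntegrableOn f' (Set.Icc 0 T) volume := hf.2.1.integrable le_top
  have hi : ∀ r, 0 ≤ r → r ≤ T → IntervalIntegrable f' volume 0 r := fun r h0 hr => by
    rw [intervalIntegrable_iff_integrableOn_Ioc_of_le h0]
    exact hint.mono_set fun x hx => ⟨hx.1.le, hx.2.trans hr⟩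
  rw [hf.2.2 t ⟨hs.trans hst, ht⟩, hf.2.2 s ⟨hs, hst.trans ht⟩, add_sub_add_left_eq_sub,
    intervalIntegral.integral_interval_sub_left (hi t (hs.trans hst) ht) (hi s hs (hst.trans ht))]
  have h1 : ∀ᵐ r ∂volume, r ∈ Set.uIoc s t → ‖f' r‖ ≤ linftyNorm T f' := by
    have h2 := ae_norm_le_linftyNorm hf.2.1
    rw [ae_restrict_iff' measurableSet_Icc] at h2
    filter_upwards [h2] with r hr hrs
    rw [Set.uIoc_of_le hst] at hrs
    exact hr ⟨hs.trans hrs.1.le, hrs.2.trans ht⟩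
  refine (intervalIntegral.norm_integral_le_of_norm_le_const_ae h1).trans (le_of_eq ?_)
  rw [abs_of_nonneg (by linarith), mul_comm]

/-- The essential bound of `f` holds at some time, and `f` is Lipschitz continuous in time. -/
theorem IsSource.norm_le (hf : IsSource T f f') (hT : 0 < T) {t : ℝ} (ht0 : 0 ≤ t) (ht : t ≤ T) :
    ‖f t‖ ≤ linftyNorm T f + T * linftyNorm T f' := by
  have : NeZero ((volume : Measure ℝ).restrict (Set.Icc 0 T)) := ⟨by
    rw [Ne, Measure.restrict_eq_zero, Real.volume_Icc, sub_zero, ENNReal.ofReal_eq_zero, not_le]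
    exact hT⟩
  obtain ⟨s, hs, hs0, hsT⟩ := ((ae_norm_le_linftyNorm hf.1).and
    (ae_restrict_mem measurableSet_Icc)).exists
  have h0 := linftyNorm_nonneg T f'
  have h1 : ‖f t - f s‖ ≤ T * linftyNorm T f' := by
    rcases le_total s t with h | h
    · exact (hf.norm_sub_le hs0 h ht).trans (by gcongr; linarith)
    · rw [norm_sub_rev]
      exact (hf.norm_sub_le ht0 h hsT).trans (by gcongr; linarith)
  calc ‖f t‖ = ‖f s + (f t - f s)‖ := by rw [add_sub_cancel]
    _ ≤ ‖f s‖ + ‖f t - f s‖ := norm_add_le _ _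
    _ ≤ _ := add_le_add hs h1

end Source

end LOD

namespace LOD

open scoped InnerProductSpace NNReal ENNReal Topology

variable {d : ℕ} {Ω : Set (Pt d)}

/-! ### The error of the multiscale method -/

theorem Triangulation.ShapeRegular.fat {𝒯 : Triangulation Ω} (hd : 1 ≤ d) {γ : ℝ} (hγ : 0 < γ)
    (h : 𝒯.ShapeRegular γ) : ∀ K ∈ 𝒯.cells, Fat (min (γ / 4) (1 / 2)) K := fun K hK =>
  (fat_of_shapeRatio (𝒯.isSimplex hK) hd hγ (h K hK)).mono (min_le_left _ _)

/-- The backward Euler relation in terms of the inner product of `L²` and the linear forms on the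
fine finite element space. -/
theorem IsBackwardEuler.eq_linear (hΩ : IsBoundedDomain Ω) {𝒯h : Triangulation Ω}
    {A : Pt d → Matrix (Fin d) (Fin d) ℝ} {α β : ℝ} (hα : 0 ≤ α) (hA : IsCoefficient Ω A α β)
    {S : Set (Pt d → ℝ)} {τ : ℝ} {N : ℕ}
    {f : ℝ → Lp ℝ 2 ((volume : Measure (Pt d)).restrict Ω)} {U : ℕ → Pt d → ℝ}
    (h : IsBackwardEuler A S τ N f U) {V : ℕ → 𝒯h.P1Sub} (hV : ∀ n ≤ N, U n = V n) {n : ℕ}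
    (hn : n < N) {v : 𝒯h.P1Sub} (hv : (v : Pt d → ℝ) ∈ S) :
    ⟪𝒯h.toL2 hΩ (V (n + 1) - V n), 𝒯h.toL2 hΩ v⟫_ℝ / τ +
      𝒯h.formLin hΩ hα hA Ω (V (n + 1)) v = ⟪f ((n + 1) * τ), 𝒯h.toL2 hΩ v⟫_ℝ := by
  have h1 := (h (n + 1) (Nat.le_add_left 1 n) hn).2 v hv
  rw [Nat.add_sub_cancel, hV (n + 1) hn, hV n hn.le] at h1
  rw [Triangulation.inner_toL2_toL2, Triangulation.inner_toL2, Triangulation.formLin_domain,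
    ← integral_div]
  push_cast at h1
  rw [← h1]
  congr 2
  funext x
  change ((V (n + 1) : Pt d → ℝ) x - (V n : Pt d → ℝ) x) * (v : Pt d → ℝ) x / τ = _
  ring

end LOD

theorem theorem4p1 (d : ℕ) (hd1 : 1 ≤ d) (hd3 : d ≤ 3) (γ : ℝ) (hγ : 0 < γ) :
    ∃ c₀ : ℝ, 0 < c₀ ∧
    ∀ κ cP : ℝ, ∃ μ : ℝ, 0 < μ ∧ μ < 1 ∧
    ∀ α β ν T D : ℝ, 0 < α → β ≤ κ * α → 0 < T →
    ∃ C : ℝ, 0 < C ∧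
    ∀ (Ω : Set (LOD.Pt d)), LOD.IsBoundedDomain Ω → Metric.diam Ω ≤ D →
    ∀ (𝒯H 𝒯h : LOD.Triangulation Ω),
      𝒯H.ShapeRegular γ → 𝒯h.ShapeRegular γ → 𝒯h.IsRefinement 𝒯H → 𝒯h.IsFiner 𝒯H c₀ →
      LOD.ProjStable 𝒯H 𝒯h cP → 𝒯H.PatchGrowth ν →
    ∀ (A : LOD.Pt d → Matrix (Fin d) (Fin d) ℝ), LOD.IsCoefficient Ω A α β →
    ∀ (f f' : ℝ → Lp ℝ 2 ((volume : Measure (LOD.Pt d)).restrict Ω)), LOD.IsSource T f f' →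
    ∀ (N : ℕ), 1 ≤ N → ∀ (τ : ℝ), τ = T / N →
    ∀ (k : ℕ), 1 ≤ k →
    ∀ (U Ums : ℕ → LOD.Pt d → ℝ),
      U 0 ∈ 𝒯h.P1 → LOD.IsBackwardEuler A 𝒯h.P1 τ N f U →
      LOD.IsL2Proj Ω (LOD.msSpace 𝒯H 𝒯h A k) (U 0) (Ums 0) →
      LOD.IsBackwardEuler A (LOD.msSpace 𝒯H 𝒯h A k) τ N f Ums →
    ∀ (n : ℕ), 1 ≤ n → n ≤ N →
      LOD.l2norm Ω (fun x => Ums n x - U n x) ≤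
        C * (1 + Real.log (n * τ / τ)) *
          (𝒯H.meshSize + (k : ℝ) ^ ((d : ℝ) / 2) * μ ^ k) ^ 2 *
          ((n * τ)⁻¹ * LOD.l2norm Ω (U 0) + LOD.linftyNorm T f + LOD.linftyNorm T f') := by
  obtain ⟨ρ, hρdef⟩ : ∃ ρ, ρ = min (γ / 4) (1 / 2) := ⟨_, rfl⟩
  have hρ : 0 < ρ := by rw [hρdef]; positivity
  have hρ1 : ρ ≤ 1 / 2 := by rw [hρdef]; exact min_le_right _ _
  refine ⟨ρ / 32, by positivity, fun κ cP => ?_⟩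
  obtain ⟨μ, C, hμ0, hμ1, hC, happ⟩ :=
    LOD.Triangulation.exists_multiscale_approximation hd1 hρ hρ1 (le_max_right κ 0)
  refine ⟨μ, hμ0, hμ1, fun α β ν T D hα hβ hT => ?_⟩
  -- `B` is the constant in the approximation property of the multiscale space
  obtain ⟨B, hB⟩ : ∃ B, B = C * (1 + max ν 0 * cP ^ 2 * D ^ 2) / α := ⟨_, rfl⟩
  have hB0 : 0 ≤ B := by rw [hB]; positivity
  -- The summand `1` keeps the constant positive when `B = 0`.
  refine ⟨B * (3 + 6 * T) + 1, by positivity, ?_⟩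
  intro Ω hΩ hD 𝒯 𝒯h hreg hregh href hfiner hP hν A hA f f' hf N hN τ hτ k hk U W hU0 hU hW0 hW n
    hn hnN
  have hf1 := hreg.fat hd1 hγ
  have hf2 := hregh.fat hd1 hγ
  rw [← hρdef] at hf1 hf2
  have hν' : 𝒯.PatchGrowth (max ν 0) := fun K hK m hm =>
    (hν K hK m hm).trans (by gcongr; exact le_max_left _ _)
  obtain ⟨S, hS, happ⟩ := happ hΩ hf1 hf2 href hfiner hP hα
    (hβ.trans (by gcongr; exact le_max_left _ _)) hA (le_max_right ν 0) hν' hD hk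
  have hN0 : (0 : ℝ) < N := by exact_mod_cast hN
  have hτ0 : 0 < τ := by rw [hτ]; positivity
  have hNτ : N * τ = T := by rw [hτ]; field_simp
  have hle : ∀ j : ℕ, j ≤ N → (j : ℝ) * τ ≤ T := fun j hj => by
    rw [← hNτ]; gcongr
  -- the iterates as elements of the finite element space
  obtain ⟨V, hV⟩ : ∃ V : ℕ → 𝒯h.P1Sub, ∀ j ≤ N, U j = V j := by
    have : ∀ j, ∃ v : 𝒯h.P1Sub, j ≤ N → U j = v := fun j => by
      by_cases hj : j ≤ N
      · rcases j.eq_zero_or_pos with rfl | h0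
        · exact ⟨⟨_, hU0⟩, fun _ => rfl⟩
        · exact ⟨⟨_, (hU j h0 hj).1⟩, fun _ => rfl⟩
      · exact ⟨0, fun h => absurd h hj⟩
    choose V hV using this
    exact ⟨V, hV⟩
  obtain ⟨Z, hZS, hZ⟩ : ∃ Z : ℕ → 𝒯h.P1Sub, (∀ j, Z j ∈ S) ∧ ∀ j ≤ N, W j = Z j := by
    have : ∀ j, ∃ v : 𝒯h.P1Sub, v ∈ S ∧ (j ≤ N → W j = v) := fun j => by
      by_cases hj : j ≤ N
      · have h1 : W j ∈ LOD.msSpace 𝒯 𝒯h A k := by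
          rcases j.eq_zero_or_pos with rfl | h0
          · exact hW0.1
          · exact (hW j h0 hj).1
        obtain ⟨v, hv, h⟩ := (hS _).1 h1
        exact ⟨v, hv, fun _ => h⟩
      · exact ⟨0, S.zero_mem, fun h => absurd h hj⟩
    choose Z hZS hZ using this
    exact ⟨Z, hZS, hZ⟩
  have hmem : ∀ v ∈ S, (v : LOD.Pt d → ℝ) ∈ LOD.msSpace 𝒯 𝒯h A k := fun v hv =>
    (hS _).2 ⟨v, hv, rfl⟩
  obtain ⟨m, rfl⟩ : ∃ m, n = m + 1 := ⟨n - 1, by omega⟩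
  obtain ⟨r, hr⟩ : ∃ r, r = 𝒯.meshSize + (k : ℝ) ^ ((d : ℝ) / 2) * μ ^ k := ⟨_, rfl⟩
  rw [← hr] at happ ⊢
  have hr0 : 0 ≤ r := by
    rw [hr]
    exact add_nonneg (LOD.Triangulation.meshSize_nonneg 𝒯) (by positivity)
  have hF := LOD.linftyNorm_nonneg T f
  have hF' := LOD.linftyNorm_nonneg T f'
  have hε2 : (Real.sqrt B * r) ^ 2 = B * r ^ 2 := by rw [mul_pow, Real.sq_sqrt hB0]
  have key := LOD.norm_galerkin_backwardEuler_sub_le_of_injective (𝒯h.toL2 hΩ)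
    ((injective_iff_map_eq_zero _).2 fun _ => LOD.Triangulation.toL2_injective hΩ)
    (𝒯h.formLin hΩ hα.le hA Ω) (LOD.Triangulation.formLin_symm hΩ hα.le hA Ω)
    (LOD.Triangulation.formLin_nonneg hΩ hα.le hA Ω)
    (fun _ => LOD.Triangulation.eq_zero_of_formLin hd1 hΩ hα hA) S
    (ε := Real.sqrt B * r) (by positivity) hτ0
    (fun u g hug => by
      obtain ⟨w, hw, h⟩ := happ u g hug
      refine ⟨w, hw, ?_⟩
      rw [mul_pow, hε2, hB, div_mul_eq_mul_div, div_mul_eq_mul_div, le_div_iff₀ hα, mul_comm]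
      exact h)
    V Z (fun j => f ((j + 1) * τ)) N
    (fun j hj v => hU.eq_linear hΩ hα.le hA hV hj v.2)
    (fun j _ => hZS _)
    (fun j hj v hv => hW.eq_linear hΩ hα.le hA hZ hj (hmem v hv))
    (fun v hv => by
      rw [LOD.Triangulation.inner_toL2_toL2]
      have h := hW0.2 v (hmem v hv)
      rw [hV 0 N.zero_le, hZ 0 N.zero_le] at h
      exact h)
    m hnN hF' (M₀ := LOD.linftyNorm T f + T * LOD.linftyNorm T f')
    (by
      refine hf.norm_le hT (by positivity) ?_
      simpa using hle 1 hN)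
    (fun j hj => by
      have h1 : ((j + 1 : ℕ) + 1 : ℝ) * τ ≤ T := by
        simpa using hle (j + 1 + 1) (by omega)
      refine (hf.norm_sub_le (by positivity) ?_ h1).trans (le_of_eq ?_)
      · push_cast; gcongr; linarith
      · push_cast; ring)
  have e1 : ‖𝒯h.toL2 hΩ (V (m + 1) - Z (m + 1))‖ =
      LOD.l2norm Ω (fun x => W (m + 1) x - U (m + 1) x) := by
    rw [map_sub, norm_sub_rev, ← map_sub, LOD.Triangulation.norm_toL2, hV _ hnN, hZ _ hnN]
    rfl
  have e2 : ‖𝒯h.toL2 hΩ (V 0)‖ = LOD.l2norm Ω (U 0) := by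
    rw [LOD.Triangulation.norm_toL2, hV 0 N.zero_le]
  rw [e1, e2, hε2] at key
  have hlog : 0 ≤ Real.log ((m : ℝ) + 1) := Real.log_nonneg (by linarith [m.cast_nonneg (α := ℝ)])
  have hmτ : m * τ ≤ T := hle m (by omega)
  push_cast
  rw [mul_div_assoc, div_self hτ0.ne', mul_one]
  have hX : 0 ≤ (((m : ℝ) + 1) * τ)⁻¹ * LOD.l2norm Ω (U 0) :=
    mul_nonneg (by positivity) (Real.sqrt_nonneg _)
  generalize LOD.linftyNorm T f = F at *
  generalize LOD.linftyNorm T f' = F' at *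
  refine key.trans ?_
  calc B * r ^ 2 * (1 + Real.log (m + 1)) *
        (2 * (((m : ℝ) + 1) * τ)⁻¹ * LOD.l2norm Ω (U 0) + 3 * (F + T * F') + 3 * (m * τ) * F')
      ≤ B * r ^ 2 * (1 + Real.log (m + 1)) *
        ((3 + 6 * T) * ((((m : ℝ) + 1) * τ)⁻¹ * LOD.l2norm Ω (U 0) + F + F')) := by
        refine mul_le_mul_of_nonneg_left ?_ (by positivity)
        have h1 : m * τ * F' ≤ T * F' := by gcongr
        have h2 := mul_nonneg hT.le hX
        have h3 := mul_nonneg hT.le hF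
        linarith
    _ = (B * (3 + 6 * T)) * ((1 + Real.log (m + 1)) * r ^ 2 *
        ((((m : ℝ) + 1) * τ)⁻¹ * LOD.l2norm Ω (U 0) + F + F')) := by ring
    _ ≤ (B * (3 + 6 * T) + 1) * ((1 + Real.log (m + 1)) * r ^ 2 *
        ((((m : ℝ) + 1) * τ)⁻¹ * LOD.l2norm Ω (U 0) + F + F')) := by
        refine mul_le_mul_of_nonneg_right (by linarith) (by positivity)
    _ = _ := by ring
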